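/- **Conventions.** All categories are $\mathbb C$-linear. A *ribbon category* is a monoidal category $(\mathcal C,\otimes,I)$ with $\dim\mathrm{End}(I)=1$, a natural braiding $c_{V,W}:V\otimes W\to W\otimes V$ (both hexagon identities), a duality $b_V:I\to V\otimes V^*$, $d_V:V^*\otimes V\to I$ (both zigzag identities) and a natural twist $\theta_V$, with $\theta_{V\otimes W}=c_{W,V}c_{V,W}(\theta_V\otimes\theta_W)$ and $(\theta_V\otimes\mathrm{id})b_V=(\mathrm{id}\otimes\theta_{V^*})b_V$. Put $\mathrm{tr}_q(f)=d_Vc_{V,V^*}(\theta_Vf\otimes\mathrm{id})b_V$ for $f\in\mathrm{End}(V)$. A morphism $f:V\to W$ is *negligible* if $\mathrm{tr}_q(fg)=0$ for all $g:W\to V$. The *purified* category $\overline{\mathcal C}$ has the same objects, and its morphisms are those of $\mathcal C$ modulo the negligible ones. A $\mathbb C$-linear monoidal functor $F$ *preserves the ribbon structures* if (up to its monoidal structure isomorphisms) $F(c_{V,W})=c_{F(V),F(W)}$, $F(\theta_V)=\theta_{F(V)}$, and for each $V$ there is an isomorphism $u:F(V^*)\to F(V)^*$ with $F(b_V)=(\mathrm{id}\otimes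 u^{-1})b_{F(V)}$ and $F(d_V)=d_{F(V)}(u\otimes\mathrm{id})$. A nonzero complex number is *generic* if it is not a root of unity. **Turaev's category.** Let $a\in\mathbb C^\times$. $E_{k,l}$ is the complex vector space spanned by planar isotopy classes of tangle diagrams in $\mathbb R\times[0,1]$ with $k$ bottom and $l$ top end points, modulo: a circle is $-(a^2+a^{-2})$ times its removal, and a positive crossing is $a$ times two vertical strands plus $a^{-1}$ times a cap below a cup. The Temperley–Lieb category $\mathcal S(a)$ has objects $0,1,2,\dots$ and morphisms $k\to l$ the elements of $E_{k,l}$, with vertical composition and horizontal juxtaposition as tensor product; $c_{n,m}$ is the positive crossing of $n$ strands with $m$ strands, $n^*=n$, $b_n$ and $d_n$ are $n$ nested cups and caps, and $\theta_n$ is $(-1)^n$ times the (positive) curl of $n$ parallel strands. The Jones–Wenzl idempotent $f_n\in E_{n,n}$ is the unique element such that $f_n-1$ is a noncommutative polynomial without constant term in the standard elements $e_1,\dots,e_{n-1}$ and $e_if_n=f_ne_i=0$ for all $i$. Let $J=\{1,2,\dots\}$ if $a$ is generic and $J=\{1,\dots,r-2\}$ if $a$ is a primitive $4r$-th root of unity,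 $r\ge3$. The objects of $\mathcal V(a)$ are the finite sequences $s=(n_1,\dots,n_m)$ in $J$; with $|s|=\sum n_i$ and $f_s=f_{n_1}\otimes\cdots\otimes f_{n_m}$, $\mathrm{Hom}(s,t)=f_tE_{|s|,|t|}f_s$. The tensor product is concatenation, $s^*$ is the reversed sequence, and $c,\theta,b,d$ are obtained from those of $\mathcal S(a)$ by composing with the idempotents $f_s$ on both sides. **Modules.** Let $q=a^2\neq\pm1$, and use $a$ as the square root of $q$. $U_q(sl_2)$ is generated by $K^{\pm1},X,Y$ with $KXK^{-1}=q^2X$, $KYK^{-1}=q^{-2}Y$, $XY-YX=\frac{K-K^{-1}}{q-q^{-1}}$, and $\Delta X=1\otimes X+X\otimes K$, $\Delta Y=K^{-1}\otimes Y+Y\otimes1$, $\Delta K=K\otimes K$, $\varepsilon(X)=\varepsilon(Y)=0$, $\varepsilon(K)=1$. Write $[k]=\frac{q^k-q^{-k}}{q-q^{-1}}$. Let $\tilde J=J\cup\{0\}$. For $n\in\tilde J$ let $V_n$ be the simple module with basis $v_0,\dots,v_n$ and $Kv_i=q^{n-2i}v_i$, $Yv_i=v_{i+1}$, $Xv_i=[i][n-i+1]v_{i-1}$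 (with $v_{-1}=v_{n+1}=0$). $\mathcal R(q)$ is the full subcategory of the category of finite-dimensional modules on the iterated tensor products of the $V_n$, $n\in\tilde J$, including the trivial module. On the $V_n$, the braiding is the flip composed with $v_i\otimes v_j\mapsto a^{(n-2i)(m-2j)}v_i\otimes v_j$ and $\sum_{l=0}^{n}\frac{(q-q^{-1})^lq^{l(l-1)/2}}{[l]!}X^l\otimes Y^l$; the twist is $a^{n(n+2)}$; $V_n$ is identified with its dual, with $d(v_i\otimes v_{n-i})=(-1)^iq^{-i(n-i+1)}$ (other values $0$) and $b(1)=\sum_i(-1)^{n-i}q^{(n-i)(i+1)}v_i\otimes v_{n-i}$. These are extended to tensor products by the hexagon identities, by $\theta_{V\otimes W}=c_{W,V}c_{V,W}(\theta_V\otimes\theta_W)$, and by $(V\otimes W)^*=W^*\otimes V^*$ with nested $b,d$. **Theorem.** Let $a\in\mathbb C^\times$ and $q=a^2$. 1. If $a$ and $q$ are generic, then $\mathcal V(a)$ and $\mathcal R(q)$, with the structures above, are ribbon categories, and there is a $\mathbb C$-linear monoidal equivalence of categories $\mathcal F:\mathcal V(a)\to\mathcal R(q)$ which preserves the ribbon structures.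 2. If, for some $r\ge3$, $a$ is a primitive $4r$-th root of unity and $q$ is a primitive $2r$-th root of unity, then the negligible morphisms of $\mathcal V(a)$ and of $\mathcal R(q)$ form linear subspaces stable under composition and tensor product with arbitrary morphisms, the purified categories $\overline{\mathcal V}(a)$ and $\overline{\mathcal R}(q)$, with the induced structures, are ribbon categories, and there is a $\mathbb C$-linear monoidal equivalence of categories $\overline{\mathcal F}:\overline{\mathcal V}(a)\to\overline{\mathcal R}(q)$ which preserves the ribbon structures. -/

import Mathlib

open CategoryTheory MonoidalCategory

noncomputable section

/-! ### Tangle diagrams in a strip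

A diagram of type `(k, l)` consists of immersed arcs and circles in `ℝ × [0, 1]`, with `k` end points
on the bottom line, `l` end points on the top line, and an over/under information at each double
point. In general position with respect to the height such a diagram is a composite of juxtapositions of
vertical strands, cups, caps and crossings, and two such composites are isotopic in the strip if
and only if they are related by the moves of the pivotal calculus: the axioms of a strict monoidal
category (changes of the heights of distant pieces), the two zigzag moves, and the rotation of a
crossing. No Reidemeister move is imposed. -/


/-- Diagrams with `k` inputs and `l` outputs, as words in the elementary diagrams. `comp D D'` is `D'`
placed on top of `D`, and `tensor D D'` is `D` placed to the left of `D'`. The two crossings `pos`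
and `neg` differ by the choice of the over-strand. -/
inductive Diagram : ℕ → ℕ → Type
  | id (n : ℕ) : Diagram n n
  | comp {k l m : ℕ} (D : Diagram k l) (D' : Diagram l m) : Diagram k m
  | tensor {k l k' l' : ℕ} (D : Diagram k l) (D' : Diagram k' l') : Diagram (k + k') (l + l')
  | cup : Diagram 0 2
  | cap : Diagram 2 0
  | pos : Diagram 2 2
  | neg : Diagram 2 2

namespace Diagram

/-- Transport along equalities of the numbers of end points. -/
def cast {k l k' l' : ℕ} (hk : k = k') (hl : l = l') (D : Diagram k l) : Diagram k' l' :=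
  hl ▸ hk ▸ D

/-- Planar isotopy, respecting the crossings. -/
inductive Isotopic : ∀ {k l : ℕ}, Diagram k l → Diagram k l → Prop
  | refl {k l : ℕ} (D : Diagram k l) : Isotopic D D
  | symm {k l : ℕ} {D D' : Diagram k l} : Isotopic D D' → Isotopic D' D
  | trans {k l : ℕ} {D D' D'' : Diagram k l} : Isotopic D D' → Isotopic D' D'' → Isotopic D D''
  | comp_congr {k l m : ℕ} {D₁ D₁' : Diagram k l} {D₂ D₂' : Diagram l m} :
      Isotopic D₁ D₁' → Isotopic D₂ D₂' → Isotopic (D₁.comp D₂) (D₁'.comp D₂')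
  | tensor_congr {k l k' l' : ℕ} {D₁ D₁' : Diagram k l} {D₂ D₂' : Diagram k' l'} :
      Isotopic D₁ D₁' → Isotopic D₂ D₂' → Isotopic (D₁.tensor D₂) (D₁'.tensor D₂')
  | id_comp {k l : ℕ} (D : Diagram k l) : Isotopic ((id k).comp D) D
  | comp_id {k l : ℕ} (D : Diagram k l) : Isotopic (D.comp (id l)) D
  | comp_assoc {k l m n : ℕ} (D₁ : Diagram k l) (D₂ : Diagram l m) (D₃ : Diagram m n) :
      Isotopic ((D₁.comp D₂).comp D₃) (D₁.comp (D₂.comp D₃))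
  | id_tensor_id (m n : ℕ) : Isotopic ((id m).tensor (id n)) (id (m + n))
  | interchange {k l m k' l' m' : ℕ} (D₁ : Diagram k l) (D₂ : Diagram l m)
      (D₁' : Diagram k' l') (D₂' : Diagram l' m') :
      Isotopic ((D₁.comp D₂).tensor (D₁'.comp D₂')) ((D₁.tensor D₁').comp (D₂.tensor D₂'))
  | tensor_assoc {k l k' l' k'' l'' : ℕ} (D : Diagram k l) (D' : Diagram k' l')
      (D'' : Diagram k'' l'') :
      Isotopic (((D.tensor D').tensor D'').cast (Nat.add_assoc k k' k'') (Nat.add_assoc l l' l''))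
        (D.tensor (D'.tensor D''))
  | empty_tensor {k l : ℕ} (D : Diagram k l) :
      Isotopic (((id 0).tensor D).cast (Nat.zero_add k) (Nat.zero_add l)) D
  | tensor_empty {k l : ℕ} (D : Diagram k l) :
      Isotopic ((D.tensor (id 0)).cast (Nat.add_zero k) (Nat.add_zero l)) D
  | zigzag_left : Isotopic (((id 1).tensor cup).comp (cap.tensor (id 1))) (id 1)
  | zigzag_right : Isotopic ((cup.tensor (id 1)).comp ((id 1).tensor cap)) (id 1)
  | rotate_pos : Isotopic
      ((((id 2).tensor cup).comp (((id 1).tensor pos).tensor (id 1))).comp (cap.tensor (id 2))) neg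
  | rotate_neg : Isotopic
      ((((id 2).tensor cup).comp (((id 1).tensor neg).tensor (id 1))).comp (cap.tensor (id 2))) pos

instance isotopySetoid (k l : ℕ) : Setoid (Diagram k l) where
  r := Isotopic
  iseqv := ⟨.refl, .symm, .trans⟩

end Diagram

/-- Isotopy classes of diagrams. -/
def Tangle (k l : ℕ) : Type := Quotient (Diagram.isotopySetoid k l)

namespace Tangle

open Diagram (Isotopic)

/-- The isotopy class of a diagram. -/
def mk {k l : ℕ} (D : Diagram k l) : Tangle k l := Quotient.mk _ D

def id (n : ℕ) : Tangle n n := mk (.id n)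

def comp {k l m : ℕ} : Tangle k l → Tangle l m → Tangle k m :=
  Quotient.map₂ Diagram.comp fun _ _ h _ _ h' => Isotopic.comp_congr h h'

def tensor {k l k' l' : ℕ} : Tangle k l → Tangle k' l' → Tangle (k + k') (l + l') :=
  Quotient.map₂ Diagram.tensor fun _ _ h _ _ h' => Isotopic.tensor_congr h h'

/-- The vertical strands, when `m = n`. -/
def eqId {m n : ℕ} (h : m = n) : Tangle m n := mk ((Diagram.id m).cast rfl h)

theorem id_comp {k l : ℕ} (x : Tangle k l) : (id k).comp x = x := by
  induction x using Quotient.ind; exact Quotient.sound (Isotopic.id_comp _)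

theorem comp_id {k l : ℕ} (x : Tangle k l) : x.comp (id l) = x := by
  induction x using Quotient.ind; exact Quotient.sound (Isotopic.comp_id _)

theorem comp_assoc {k l m n : ℕ} (x : Tangle k l) (y : Tangle l m) (z : Tangle m n) :
    (x.comp y).comp z = x.comp (y.comp z) := by
  induction x using Quotient.ind; induction y using Quotient.ind; induction z using Quotient.ind
  exact Quotient.sound (Isotopic.comp_assoc _ _ _)

theorem id_tensor_id (m n : ℕ) : (id m).tensor (id n) = id (m + n) :=
  Quotient.sound (Isotopic.id_tensor_id m n)

theorem interchange {k l m k' l' m' : ℕ} (x : Tangle k l) (y : Tangle l m) (x' : Tangle k' l')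
    (y' : Tangle l' m') : (x.comp y).tensor (x'.comp y') = (x.tensor x').comp (y.tensor y') := by
  induction x using Quotient.ind; induction y using Quotient.ind
  induction x' using Quotient.ind; induction y' using Quotient.ind
  exact Quotient.sound (Isotopic.interchange _ _ _ _)

theorem mk_cast {k l k' l' : ℕ} (hk : k = k') (hl : l = l') (D : Diagram k l) :
    (mk D).comp (eqId hl) = (eqId hk).comp (mk (D.cast hk hl)) := by
  subst hk hl; exact (comp_id _).trans (id_comp _).symm

theorem tensor_assoc {k l k' l' k'' l'' : ℕ} (x : Tangle k l) (y : Tangle k' l')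
    (z : Tangle k'' l'') : ((x.tensor y).tensor z).comp (eqId (Nat.add_assoc l l' l'')) =
      (eqId (Nat.add_assoc k k' k'')).comp (x.tensor (y.tensor z)) := by
  induction x using Quotient.ind; induction y using Quotient.ind; induction z using Quotient.ind
  refine (mk_cast _ _ _).trans (congrArg _ (Quotient.sound (Isotopic.tensor_assoc _ _ _)))

theorem empty_tensor {k l : ℕ} (x : Tangle k l) : ((id 0).tensor x).comp (eqId (Nat.zero_add l)) =
    (eqId (Nat.zero_add k)).comp x := by
  induction x using Quotient.ind
  refine (mk_cast _ _ _).trans (congrArg _ (Quotient.sound (Isotopic.empty_tensor _)))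

theorem tensor_empty {k l : ℕ} (x : Tangle k l) : (x.tensor (id 0)).comp (eqId (Nat.add_zero l)) =
    (eqId (Nat.add_zero k)).comp x := by
  induction x using Quotient.ind
  refine (mk_cast _ _ _).trans (congrArg _ (Quotient.sound (Isotopic.tensor_empty _)))

theorem eqId_comp_eqId {k l m : ℕ} (h : k = l) (h' : l = m) :
    (eqId h).comp (eqId h') = eqId (h.trans h') := by
  subst h h'; exact id_comp _

theorem eqId_tensor_eqId {k l k' l' : ℕ} (h : k = l) (h' : k' = l') :
    (eqId h).tensor (eqId h') = eqId (congrArg₂ (· + ·) h h') := by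
  subst h h'; exact id_tensor_id _ _

end Tangle

/-- The local relations on linear combinations of diagrams: a circle is `-(a² + a⁻²)` times the empty
diagram, and a positive crossing is `a` times two vertical strands plus `a⁻¹` times a cap followed by a
cup. They may be applied inside any diagram. -/
inductive SkeinRel (a : ℂ) : ∀ {k l : ℕ}, (Tangle k l →₀ ℂ) → Prop
  | circle : SkeinRel a (Finsupp.single (Tangle.mk (Diagram.cup.comp .cap)) 1 +
      (a ^ 2 + a⁻¹ ^ 2) • Finsupp.single (Tangle.id 0) 1)
  | kauffman : SkeinRel a (Finsupp.single (Tangle.mk .pos) 1 - a • Finsupp.single (Tangle.id 2) 1 -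
      a⁻¹ • Finsupp.single (Tangle.mk (Diagram.cap.comp .cup)) 1)
  | comp_left {k l m : ℕ} (D : Tangle k l) {x : Tangle l m →₀ ℂ} :
      SkeinRel a x → SkeinRel a (x.mapDomain fun D' => D.comp D')
  | comp_right {k l m : ℕ} {x : Tangle k l →₀ ℂ} (D : Tangle l m) :
      SkeinRel a x → SkeinRel a (x.mapDomain fun D' => D'.comp D)
  | tensor_left {k l k' l' : ℕ} (D : Tangle k l) {x : Tangle k' l' →₀ ℂ} :
      SkeinRel a x → SkeinRel a (x.mapDomain fun D' => D.tensor D')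
  | tensor_right {k l k' l' : ℕ} {x : Tangle k l →₀ ℂ} (D : Tangle k' l') :
      SkeinRel a x → SkeinRel a (x.mapDomain fun D' => D'.tensor D)

/-- The span of the relations. -/
def skein (a : ℂ) (k l : ℕ) : Submodule ℂ (Tangle k l →₀ ℂ) := Submodule.span ℂ {x | SkeinRel a x}

/-- The space `E_{k,l}` of diagrams modulo the skein relations. -/
abbrev SkeinModule (a : ℂ) (k l : ℕ) : Type := (Tangle k l →₀ ℂ) ⧸ skein a k l

namespace SkeinModule

variable {a : ℂ}

/-- The class of a diagram. -/
def mk {k l : ℕ} (D : Tangle k l) : SkeinModule a k l := (skein a k l).mkQ (Finsupp.single D 1)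

theorem hom_ext {k l : ℕ} {M : Type*} [AddCommGroup M] [Module ℂ M]
    {f g : SkeinModule a k l →ₗ[ℂ] M} (h : ∀ D, f (mk D) = g (mk D)) : f = g := by
  refine Submodule.linearMap_qext _ (Finsupp.lhom_ext' fun D => LinearMap.ext_ring (h D))

/-- Descent of a biadditive operation. -/
def bilin {k l k' l' k'' l'' : ℕ} (op : Tangle k l → Tangle k' l' → Tangle k'' l'')
    (h₁ : ∀ x, SkeinRel a x → ∀ D, SkeinRel a (x.mapDomain fun D' => op D' D))
    (h₂ : ∀ x, SkeinRel a x → ∀ D, SkeinRel a (x.mapDomain fun D' => op D D')) :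
    SkeinModule a k l →ₗ[ℂ] SkeinModule a k' l' →ₗ[ℂ] SkeinModule a k'' l'' :=
  ((skein a k' l').liftQ
    ((skein a k l).liftQ
      ((Finsupp.lift _ ℂ _ fun D => Finsupp.lmapDomain ℂ ℂ (op D)).compr₂
        (skein a k'' l'').mkQ)
      (Submodule.span_le.2 fun x hx => by
        refine Finsupp.lhom_ext' fun D => LinearMap.ext_ring ?_
        refine (Submodule.Quotient.mk_eq_zero _).2 ?_
        have : _ ∈ skein a k'' l'' := Submodule.subset_span (h₁ x hx D)
        convert this using 1
        simp [Finsupp.mapDomain, Finsupp.sum])).flip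
    (Submodule.span_le.2 fun x hx => by
      refine hom_ext fun D => ?_
      refine (Submodule.Quotient.mk_eq_zero _).2 ?_
      have : _ ∈ skein a k'' l'' := Submodule.subset_span (h₂ x hx D)
      convert this using 1
      simp)).flip

theorem bilin_mk {k l k' l' k'' l'' : ℕ} {op : Tangle k l → Tangle k' l' → Tangle k'' l''}
    (h₁ h₂) (D D') : bilin (a := a) op h₁ h₂ (mk D) (mk D') = mk (op D D') := by
  change (skein _ _ _).mkQ (((Finsupp.lift _ ℂ _ fun D => Finsupp.lmapDomain ℂ ℂ (op D))
    (Finsupp.single D 1)) (Finsupp.single D' 1)) = _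
  simp [mk]

/-- Composition of linear combinations of diagrams. -/
def comp {k l m : ℕ} : SkeinModule a k l →ₗ[ℂ] SkeinModule a l m →ₗ[ℂ] SkeinModule a k m :=
  bilin Tangle.comp (fun _ h D => h.comp_right D) (fun _ h D => h.comp_left D)

/-- Juxtaposition of linear combinations of diagrams. -/
def tensor {k l k' l' : ℕ} :
    SkeinModule a k l →ₗ[ℂ] SkeinModule a k' l' →ₗ[ℂ] SkeinModule a (k + k') (l + l') :=
  bilin Tangle.tensor (fun _ h D => h.tensor_right D) (fun _ h D => h.tensor_left D)

theorem comp_mk {k l m : ℕ} (D : Tangle k l) (D' : Tangle l m) :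
    comp (mk D) (mk D') = mk (a := a) (D.comp D') := bilin_mk _ _ _ _

theorem tensor_mk {k l k' l' : ℕ} (D : Tangle k l) (D' : Tangle k' l') :
    tensor (mk D) (mk D') = mk (a := a) (D.tensor D') := bilin_mk _ _ _ _

@[elab_as_elim]
theorem induction {k l : ℕ} {P : SkeinModule a k l → Prop} (x : SkeinModule a k l)
    (zero : P 0) (mk : ∀ D, P (mk D)) (add : ∀ x y, P x → P y → P (x + y))
    (smul : ∀ (c : ℂ) x, P x → P (c • x)) : P x := by
  obtain ⟨x, rfl⟩ := (skein a k l).mkQ_surjective x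
  induction x using Finsupp.induction_linear with
  | zero => simpa using zero
  | add x y hx hy => simpa using add _ _ hx hy
  | single D c =>
    have := smul c _ (mk D)
    rwa [SkeinModule.mk, ← map_smul, Finsupp.smul_single_one] at this

end SkeinModule

/-- The Temperley-Lieb category: its objects are the natural numbers, the morphisms from `k` to `l`
are the elements of `E_{k,l}`. -/
@[ext]
structure TL (a : ℂ) where
  strands : ℕ

namespace TL

open SkeinModule

variable {a : ℂ}

instance : Category (TL a) where
  Hom m n := SkeinModule a m.strands n.strands
  id n := SkeinModule.mk (Tangle.id n.strands)
  comp f g := SkeinModule.comp f g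
  id_comp {m n} f := LinearMap.congr_fun (f := SkeinModule.comp (SkeinModule.mk (Tangle.id _)))
    (g := LinearMap.id)
    (hom_ext fun D => by rw [comp_mk, Tangle.id_comp, LinearMap.id_apply]) f
  comp_id {m n} f := LinearMap.congr_fun
    (f := SkeinModule.comp.flip (SkeinModule.mk (Tangle.id _))) (g := LinearMap.id)
    (hom_ext fun D => by rw [LinearMap.flip_apply, comp_mk, Tangle.comp_id, LinearMap.id_apply]) f
  assoc {m n p s} f g h := by
    induction f using SkeinModule.induction with
    | zero => simp only [map_zero, LinearMap.zero_apply]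
    | add x y hx hy => simp only [map_add, LinearMap.add_apply, hx, hy]
    | smul c x hx => simp only [map_smul, LinearMap.smul_apply, hx]
    | mk D =>
    induction g using SkeinModule.induction with
    | zero => simp only [map_zero, LinearMap.zero_apply]
    | add x y hx hy => simp only [map_add, LinearMap.add_apply, hx, hy]
    | smul c x hx => simp only [map_smul, LinearMap.smul_apply, hx]
    | mk D' =>
    induction h using SkeinModule.induction with
    | zero => simp only [map_zero]
    | add x y hx hy => simp only [map_add, hx, hy]
    | smul c x hx => simp only [map_smul, hx]
    | mk D'' => simp only [comp_mk, Tangle.comp_assoc]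

instance : Preadditive (TL a) where
  homGroup m n := inferInstanceAs (AddCommGroup (SkeinModule a m.strands n.strands))
  add_comp k l m f f' g :=
    LinearMap.map_add₂ (SkeinModule.comp (a := a) (k := k.1) (l := l.1) (m := m.1)) f f' g
  comp_add k l m f g g' :=
    (SkeinModule.comp (a := a) (k := k.1) (l := l.1) (m := m.1) f).map_add g g'

instance : Linear ℂ (TL a) where
  homModule m n := inferInstanceAs (Module ℂ (SkeinModule a m.strands n.strands))
  smul_comp k l m c f g :=
    LinearMap.map_smul₂ (SkeinModule.comp (a := a) (k := k.1) (l := l.1) (m := m.1)) c f g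
  comp_smul k l m f c g :=
    (SkeinModule.comp (a := a) (k := k.1) (l := l.1) (m := m.1) f).map_smul c g

/-- The class of a diagram. -/
def diagram {m n : TL a} (D : Tangle m.strands n.strands) : m ⟶ n := SkeinModule.mk D

/-- The tensor product of morphisms, by juxtaposition. -/
def tensorMap {m n m' n' : TL a} (f : m ⟶ n) (g : m' ⟶ n') :
    (⟨m.strands + m'.strands⟩ : TL a) ⟶ ⟨n.strands + n'.strands⟩ :=
  SkeinModule.tensor (a := a) f g

@[elab_as_elim]
theorem induction {m n : TL a} {P : (m ⟶ n) → Prop} (x : m ⟶ n)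
    (zero : P 0) (diagram : ∀ D, P (diagram D)) (add : ∀ x y, P x → P y → P (x + y))
    (smul : ∀ (c : ℂ) x, P x → P (c • x)) : P x :=
  SkeinModule.induction (P := P) x zero diagram add smul

theorem diagram_comp {m n p : TL a} (D : Tangle m.strands n.strands)
    (D' : Tangle n.strands p.strands) :
    (diagram D : m ⟶ n) ≫ (diagram D' : n ⟶ p) = diagram (D.comp D') := comp_mk _ _

theorem diagram_tensor {m n m' n' : TL a} (D : Tangle m.strands n.strands)
    (D' : Tangle m'.strands n'.strands) :
    tensorMap (diagram D : m ⟶ n) (diagram D' : m' ⟶ n') = diagram (D.tensor D') := tensor_mk _ _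

theorem diagram_id (n : TL a) : 𝟙 n = diagram (Tangle.id n.strands) := rfl

section
variable {m n m' n' : TL a}
theorem tensorMap_add (f : m ⟶ n) (g g' : m' ⟶ n') :
    tensorMap f (g + g') = tensorMap f g + tensorMap f g' := map_add (SkeinModule.tensor _) _ _
theorem add_tensorMap (f f' : m ⟶ n) (g : m' ⟶ n') :
    tensorMap (f + f') g = tensorMap f g + tensorMap f' g := LinearMap.map_add₂ SkeinModule.tensor _ _ _
theorem tensorMap_smul (c : ℂ) (f : m ⟶ n) (g : m' ⟶ n') :
    tensorMap f (c • g) = c • tensorMap f g := map_smul (SkeinModule.tensor _) _ _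
theorem smul_tensorMap (c : ℂ) (f : m ⟶ n) (g : m' ⟶ n') :
    tensorMap (c • f) g = c • tensorMap f g := LinearMap.map_smul₂ SkeinModule.tensor _ _ _
theorem tensorMap_zero (f : m ⟶ n) : tensorMap f (0 : m' ⟶ n') = 0 :=
  map_zero (SkeinModule.tensor _)
theorem zero_tensorMap (g : m' ⟶ n') : tensorMap (0 : m ⟶ n) g = 0 :=
  LinearMap.map_zero₂ SkeinModule.tensor _
end

/-- The isomorphism between objects with the same number of strands. -/
def eqIso {m n : TL a} (h : m.strands = n.strands) : m ≅ n where
  hom := diagram (Tangle.eqId h)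
  inv := diagram (Tangle.eqId h.symm)
  hom_inv_id := (diagram_comp _ _).trans (congrArg _ (Tangle.eqId_comp_eqId _ _))
  inv_hom_id := (diagram_comp _ _).trans (congrArg _ (Tangle.eqId_comp_eqId _ _))

theorem eqIso_comp_eqIso {m n p : TL a} (h : m.strands = n.strands) (h' : n.strands = p.strands) :
    (eqIso h).hom ≫ (eqIso h').hom = (eqIso (h.trans h')).hom :=
  (diagram_comp _ _).trans (congrArg _ (Tangle.eqId_comp_eqId _ _))

theorem tensorMap_id (m n : TL a) : tensorMap (𝟙 m) (𝟙 n) = 𝟙 _ :=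
  (diagram_tensor _ _).trans (congrArg diagram (Tangle.id_tensor_id _ _))

theorem id_eq_eqIso (m : TL a) : 𝟙 m = (eqIso rfl).hom := rfl

theorem eqIso_tensor_eqIso {m n m' n' : TL a} (h : m.strands = n.strands)
    (h' : m'.strands = n'.strands) : tensorMap (eqIso h).hom (eqIso h').hom =
      (eqIso (congrArg₂ (· + ·) h h')).hom :=
  (diagram_tensor _ _).trans (congrArg _ (Tangle.eqId_tensor_eqId _ _))

theorem tensorMap_comp {m n p m' n' p' : TL a} (f : m ⟶ n) (g : n ⟶ p) (f' : m' ⟶ n')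
    (g' : n' ⟶ p') : tensorMap (f ≫ g) (f' ≫ g') = tensorMap f f' ≫ tensorMap g g' := by
  induction f using induction with
  | zero => simp [zero_tensorMap]
  | add x y hx hy => simp [add_tensorMap, hx, hy]
  | smul c x hx => simp [smul_tensorMap, hx]
  | diagram D =>
  induction g using induction with
  | zero => simp [zero_tensorMap]
  | add x y hx hy => simp [add_tensorMap, hx, hy]
  | smul c x hx => simp [smul_tensorMap, hx]
  | diagram D₂ =>
  induction f' using induction with
  | zero => simp [tensorMap_zero]
  | add x y hx hy => simp [tensorMap_add, hx, hy]
  | smul c x hx => simp [tensorMap_smul, hx]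
  | diagram D₃ =>
  induction g' using induction with
  | zero => simp [tensorMap_zero]
  | add x y hx hy => simp [tensorMap_add, hx, hy]
  | smul c x hx => simp [tensorMap_smul, hx]
  | diagram D₄ => simp only [diagram_comp, diagram_tensor, Tangle.interchange]

theorem tensorMap_assoc {m n m' n' m'' n'' : TL a} (f : m ⟶ n) (g : m' ⟶ n') (h : m'' ⟶ n'') :
    tensorMap (tensorMap f g) h ≫ (eqIso (Nat.add_assoc _ _ _)).hom =
      (eqIso (Nat.add_assoc _ _ _)).hom ≫ tensorMap f (tensorMap g h) := by
  induction f using induction with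
  | zero => simp [zero_tensorMap]
  | add x y hx hy => simp [add_tensorMap, hx, hy]
  | smul c x hx => simp [smul_tensorMap, hx]
  | diagram D =>
  induction g using induction with
  | zero => simp [zero_tensorMap, tensorMap_zero]
  | add x y hx hy => simp [add_tensorMap, tensorMap_add, hx, hy]
  | smul c x hx => simp [smul_tensorMap, tensorMap_smul, hx]
  | diagram D₂ =>
  induction h using induction with
  | zero => simp [tensorMap_zero]
  | add x y hx hy => simp [tensorMap_add, hx, hy]
  | smul c x hx => simp [tensorMap_smul, hx]
  | diagram D₃ =>
    simp only [diagram_tensor, eqIso]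
    exact (diagram_comp _ _).trans ((congrArg _ (Tangle.tensor_assoc _ _ _)).trans
      (diagram_comp _ _).symm)

theorem empty_tensorMap {m n : TL a} (f : m ⟶ n) :
    tensorMap (𝟙 (⟨0⟩ : TL a)) f ≫ (eqIso (Nat.zero_add _)).hom =
      (eqIso (Nat.zero_add _)).hom ≫ f := by
  induction f using induction with
  | zero => simp [tensorMap_zero]
  | add x y hx hy => simp [tensorMap_add, hx, hy]
  | smul c x hx => simp [tensorMap_smul, hx]
  | diagram D =>
    rw [diagram_id, diagram_tensor, eqIso, eqIso]
    exact (diagram_comp _ _).trans ((congrArg _ (Tangle.empty_tensor _)).trans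
      (diagram_comp _ _).symm)

theorem tensorMap_empty {m n : TL a} (f : m ⟶ n) :
    tensorMap f (𝟙 (⟨0⟩ : TL a)) ≫ (eqIso (Nat.add_zero _)).hom =
      (eqIso (Nat.add_zero _)).hom ≫ f := by
  induction f using induction with
  | zero => simp [zero_tensorMap]
  | add x y hx hy => simp [add_tensorMap, hx, hy]
  | smul c x hx => simp [smul_tensorMap, hx]
  | diagram D =>
    rw [diagram_id, diagram_tensor, eqIso, eqIso]
    exact (diagram_comp _ _).trans ((congrArg _ (Tangle.tensor_empty _)).trans
      (diagram_comp _ _).symm)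

instance : MonoidalCategory (TL a) where
  tensorObj m n := ⟨m.strands + n.strands⟩
  tensorUnit := ⟨0⟩
  tensorHom f g := tensorMap f g
  whiskerLeft m _ _ g := tensorMap (𝟙 m) g
  whiskerRight f n := tensorMap f (𝟙 n)
  associator _ _ _ := eqIso (Nat.add_assoc _ _ _)
  leftUnitor _ := eqIso (Nat.zero_add _)
  rightUnitor _ := eqIso (Nat.add_zero _)
  tensorHom_def f g := by rw [← tensorMap_comp, Category.id_comp, Category.comp_id]
  id_tensorHom_id m n := tensorMap_id m n
  tensorHom_comp_tensorHom f g f' g' := (tensorMap_comp f f' g g').symm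
  whiskerLeft_id m n := tensorMap_id m n
  id_whiskerRight m n := tensorMap_id m n
  associator_naturality f g h := tensorMap_assoc f g h
  leftUnitor_naturality f := empty_tensorMap f
  rightUnitor_naturality f := tensorMap_empty f
  pentagon m n p s := by simp only [id_eq_eqIso, eqIso_tensor_eqIso, eqIso_comp_eqIso]
  triangle m n := by simp only [id_eq_eqIso, eqIso_tensor_eqIso, eqIso_comp_eqIso]

instance : MonoidalPreadditive (TL a) where
  whiskerLeft_zero := tensorMap_zero _
  zero_whiskerRight := zero_tensorMap _
  whiskerLeft_add := tensorMap_add _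
  add_whiskerRight f g := add_tensorMap f g _

instance : MonoidalLinear ℂ (TL a) where
  whiskerLeft_smul _ _ _ c f := tensorMap_smul c _ f
  smul_whiskerRight c _ _ f _ := smul_tensorMap c f _

end TL

/-! ### The Karoubi envelope of a linear monoidal category -/

namespace KaroubiMonoidal

open Idempotents

variable {C : Type*} [Category C]

instance linear [Preadditive C] [Linear ℂ C] : Linear ℂ (Karoubi C) where
  homModule P Q :=
    { smul := fun c f => ⟨c • f.f, by simp⟩
      one_smul := fun f => Karoubi.hom_ext _ _ (one_smul ℂ f.f)
      mul_smul := fun c d f => Karoubi.hom_ext _ _ (mul_smul c d f.f)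
      smul_zero := fun c => Karoubi.hom_ext _ _ (smul_zero c)
      smul_add := fun c f g => Karoubi.hom_ext _ _ (smul_add c f.f g.f)
      add_smul := fun c d f => Karoubi.hom_ext _ _ (add_smul c d f.f)
      zero_smul := fun f => Karoubi.hom_ext _ _ (zero_smul ℂ f.f) }
  smul_comp _ _ _ c f g := Karoubi.hom_ext _ _ (Linear.smul_comp _ _ _ c f.f g.f)
  comp_smul _ _ _ f c g := Karoubi.hom_ext _ _ (Linear.comp_smul _ _ _ f.f c g.f)

theorem smul_f [Preadditive C] [Linear ℂ C] {P Q : Karoubi C} (c : ℂ) (f : P ⟶ Q) :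
    (c • f).f = c • f.f := rfl

variable [MonoidalCategory C]

/-- The tensor product of two direct factors. -/
def tensorObj (P Q : Karoubi C) : Karoubi C :=
  ⟨P.X ⊗ Q.X, P.p ⊗ₘ Q.p, by rw [tensorHom_comp_tensorHom, P.idem, Q.idem]⟩

/-- The tensor product of two morphisms of direct factors. -/
def tensorHom {P Q P' Q' : Karoubi C} (f : P ⟶ Q) (f' : P' ⟶ Q') :
    tensorObj P P' ⟶ tensorObj Q Q' :=
  ⟨f.f ⊗ₘ f'.f, by simp [tensorObj]⟩

/-- An isomorphism compatible with idempotents restricts to the direct factors. -/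
def isoMk {P Q : Karoubi C} (e : P.X ≅ Q.X) (h : P.p ≫ e.hom = e.hom ≫ Q.p) : P ≅ Q where
  hom := ⟨e.hom ≫ Q.p, by rw [← h, Category.assoc, ← h, P.idem_assoc, P.idem_assoc]⟩
  inv := ⟨e.inv ≫ P.p, by
    have h' : Q.p ≫ e.inv = e.inv ≫ P.p := by rw [Iso.comp_inv_eq, Category.assoc, h]; simp
    rw [Category.assoc, P.idem, ← h', Q.idem_assoc]⟩
  hom_inv_id := by
    ext
    simp [← reassoc_of% h]
  inv_hom_id := by
    ext
    simp [reassoc_of% h]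

/-- The morphism of direct factors cut out of a morphism of the ambient objects. -/
def hat {P Q : Karoubi C} (g : P.X ⟶ Q.X) : P ⟶ Q := ⟨P.p ≫ g ≫ Q.p, by simp⟩

theorem comp_tensor {X Y Z X' Y' : C} (f : X ⟶ Y) (g : Y ⟶ Z) (h : X' ⟶ Y') :
    (f ≫ g) ⊗ₘ h = f ▷ X' ≫ (g ⊗ₘ h) := by simp [MonoidalCategory.tensorHom_def]

theorem tensor_comp {X Y Z X' Y' : C} (f : X ⟶ Y) (g : Y ⟶ Z) (h : X' ⟶ Y') :
    h ⊗ₘ (f ≫ g) = X' ◁ f ≫ (h ⊗ₘ g) := by simp [MonoidalCategory.tensorHom_def, whisker_exchange_assoc]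

instance monoidal : MonoidalCategory (Karoubi C) where
  tensorObj := tensorObj
  tensorUnit := (toKaroubi C).obj (𝟙_ C)
  tensorHom := tensorHom
  whiskerLeft P _ _ f := tensorHom (𝟙 P) f
  whiskerRight f Q := tensorHom f (𝟙 Q)
  associator P Q R := isoMk (P := tensorObj (tensorObj P Q) R) (Q := tensorObj P (tensorObj Q R))
    (α_ P.X Q.X R.X) (associator_naturality P.p Q.p R.p)
  leftUnitor P := isoMk (P := tensorObj ((toKaroubi C).obj (𝟙_ C)) P) (λ_ P.X) (by
    simp [tensorObj])
  rightUnitor P := isoMk (P := tensorObj P ((toKaroubi C).obj (𝟙_ C))) (ρ_ P.X) (by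
    simp [tensorObj])
  tensorHom_def {X₁ Y₁ X₂ Y₂} f g := by
    ext
    refine Eq.trans ?_ (MonoidalCategory.tensorHom_comp_tensorHom f.f X₂.p Y₁.p g.f).symm
    change f.f ⊗ₘ g.f = (f.f ≫ Y₁.p) ⊗ₘ (X₂.p ≫ g.f)
    rw [Karoubi.comp_p, Karoubi.p_comp]
  id_tensorHom_id P Q := by ext; simp [tensorHom, tensorObj]
  tensorHom_comp_tensorHom f g f' g' := by
    ext
    exact MonoidalCategory.tensorHom_comp_tensorHom f.f g.f f'.f g'.f
  whiskerLeft_id m n := by ext; simp [tensorHom, tensorObj]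
  id_whiskerRight m n := by ext; simp [tensorHom, tensorObj]
  associator_naturality f g h := by
    ext; simp [tensorHom, isoMk, tensorObj]
  leftUnitor_naturality f := by
    ext; simp [tensorHom, isoMk, tensorObj]
  rightUnitor_naturality f := by
    ext; simp [tensorHom, isoMk, tensorObj]
  pentagon m n p s := by
    ext
    have h₁ : (m.p ⊗ₘ ((n.p ⊗ₘ p.p) ⊗ₘ s.p)) ≫ m.X ◁ (α_ n.X p.X s.X).hom =
        m.X ◁ (α_ n.X p.X s.X).hom ≫ (m.p ⊗ₘ (n.p ⊗ₘ (p.p ⊗ₘ s.p))) := by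
      simp [MonoidalCategory.tensorHom_def]
    simp only [Karoubi.comp_f, tensorHom, isoMk, tensorObj, Karoubi.id_f, comp_tensor, tensor_comp,
      Category.assoc, associator_naturality_assoc]
    simp only [reassoc_of% h₁,
      MonoidalCategory.tensorHom_comp_tensorHom, Karoubi.idem]
    rw [pentagon_assoc]
  triangle m n := by
    ext
    have h₁ : (m.p ⊗ₘ (𝟙 (𝟙_ C) ⊗ₘ n.p)) ≫ m.X ◁ (λ_ n.X).hom =
        m.X ◁ (λ_ n.X).hom ≫ (m.p ⊗ₘ n.p) := by
      simp only [← id_tensorHom m.X, MonoidalCategory.tensorHom_comp_tensorHom]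
      simp
    simp only [Karoubi.comp_f, tensorHom, isoMk, tensorObj, Karoubi.id_f, comp_tensor, tensor_comp,
      Category.assoc, toKaroubi_obj_X, toKaroubi_obj_p]
    rw [reassoc_of% h₁, MonoidalCategory.tensorHom_comp_tensorHom, Karoubi.idem, Karoubi.idem,
      triangle_assoc]

instance monoidalPreadditive [Preadditive C] [MonoidalPreadditive C] :
    MonoidalPreadditive (Karoubi C) where
  whiskerLeft_zero := Karoubi.hom_ext _ _ (MonoidalPreadditive.tensor_zero _)
  zero_whiskerRight := Karoubi.hom_ext _ _ (MonoidalPreadditive.zero_tensor _)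
  whiskerLeft_add _ _ := Karoubi.hom_ext _ _ (MonoidalPreadditive.tensor_add _ _ _)
  add_whiskerRight _ _ := Karoubi.hom_ext _ _ (MonoidalPreadditive.add_tensor _ _ _)

instance monoidalLinear [Preadditive C] [MonoidalPreadditive C] [Linear ℂ C]
    [MonoidalLinear ℂ C] : MonoidalLinear ℂ (Karoubi C) where
  whiskerLeft_smul X _ _ c f := Karoubi.hom_ext _ _ (by
    change X.p ⊗ₘ (c • f.f) = c • (X.p ⊗ₘ f.f)
    simp [MonoidalCategory.tensorHom_def])
  smul_whiskerRight c _ _ f X := Karoubi.hom_ext _ _ (by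
    change (c • f.f) ⊗ₘ X.p = c • (f.f ⊗ₘ X.p)
    simp [MonoidalCategory.tensorHom_def])

end KaroubiMonoidal

/-! ### Ribbon structures -/

section Ribbon

variable {C : Type*} [Category C] [MonoidalCategory C]

/-- The data of a braiding `c`, a duality `(*, b, d)` and a twist `θ` on a monoidal category, without
any law. `coev X` is `b_X` and `ev X` is `d_X`. -/
structure RibbonData (C : Type*) [Category C] [MonoidalCategory C] where
  braiding (X Y : C) : X ⊗ Y ⟶ Y ⊗ X
  dual : C → C
  coev (X : C) : 𝟙_ C ⟶ X ⊗ dual X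
  ev (X : C) : dual X ⊗ X ⟶ 𝟙_ C
  twist (X : C) : X ⟶ X

namespace RibbonData

/-- The laws of a ribbon category, together with the condition that the endomorphisms of the unit object
form a vector space of dimension `1`. -/
structure IsRibbon [Preadditive C] [Linear ℂ C] (D : RibbonData C) : Prop where
  finrank_end_unit : Module.finrank ℂ (𝟙_ C ⟶ 𝟙_ C) = 1
  isIso_braiding (X Y : C) : IsIso (D.braiding X Y)
  braiding_naturality {X X' Y Y' : C} (f : X ⟶ X') (g : Y ⟶ Y') :
    (f ⊗ₘ g) ≫ D.braiding X' Y' = D.braiding X Y ≫ (g ⊗ₘ f)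
  braiding_tensor_left (X Y Z : C) : D.braiding (X ⊗ Y) Z =
    (α_ X Y Z).hom ≫ X ◁ D.braiding Y Z ≫ (α_ X Z Y).inv ≫ D.braiding X Z ▷ Y ≫ (α_ Z X Y).hom
  braiding_tensor_right (X Y Z : C) : D.braiding X (Y ⊗ Z) =
    (α_ X Y Z).inv ≫ D.braiding X Y ▷ Z ≫ (α_ Y X Z).hom ≫ Y ◁ D.braiding X Z ≫ (α_ Y Z X).inv
  coev_ev (X : C) : D.coev X ▷ X ≫ (α_ X (D.dual X) X).hom ≫ X ◁ D.ev X =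
    (λ_ X).hom ≫ (ρ_ X).inv
  ev_coev (X : C) : D.dual X ◁ D.coev X ≫ (α_ (D.dual X) X (D.dual X)).inv ≫ D.ev X ▷ D.dual X =
    (ρ_ (D.dual X)).hom ≫ (λ_ (D.dual X)).inv
  isIso_twist (X : C) : IsIso (D.twist X)
  twist_naturality {X Y : C} (f : X ⟶ Y) : f ≫ D.twist Y = D.twist X ≫ f
  twist_tensor (X Y : C) :
    D.twist (X ⊗ Y) = (D.twist X ⊗ₘ D.twist Y) ≫ D.braiding X Y ≫ D.braiding Y X
  twist_dual (X : C) : D.coev X ≫ D.twist X ▷ D.dual X = D.coev X ≫ X ◁ D.twist (D.dual X)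

/-- The quantum trace `d_X c_{X,X*} (θ_X f ⊗ id) b_X`. -/
def trace (D : RibbonData C) {X : C} (f : X ⟶ X) : 𝟙_ C ⟶ 𝟙_ C :=
  D.coev X ≫ (f ≫ D.twist X) ▷ D.dual X ≫ D.braiding X (D.dual X) ≫ D.ev X

/-- A morphism `f : X ⟶ Y` is negligible if `tr_q(f g) = 0` for all `g : Y ⟶ X`. -/
def Negligible [Preadditive C] (D : RibbonData C) {X Y : C} (f : X ⟶ Y) : Prop :=
  ∀ g : Y ⟶ X, D.trace (g ≫ f) = 0

/-- The monoidal functor `F` preserves the ribbon structures: it sends the braidings and the twists to the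
braidings and the twists, and the duality morphisms to the duality morphisms up to isomorphisms
`F(X*) ≅ F(X)*`. -/
structure IsPreservedBy {C' : Type*} [Category C'] [MonoidalCategory C'] (D : RibbonData C)
    (D' : RibbonData C') (F : C ⥤ C') [F.Monoidal] : Prop where
  map_braiding (X Y : C) : Functor.LaxMonoidal.μ F X Y ≫ F.map (D.braiding X Y) =
    D'.braiding (F.obj X) (F.obj Y) ≫ Functor.LaxMonoidal.μ F Y X
  map_twist (X : C) : F.map (D.twist X) = D'.twist (F.obj X)
  map_dual (X : C) : ∃ u : F.obj (D.dual X) ≅ D'.dual (F.obj X),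
    Functor.LaxMonoidal.ε F ≫ F.map (D.coev X) =
      D'.coev (F.obj X) ≫ F.obj X ◁ u.inv ≫ Functor.LaxMonoidal.μ F X (D.dual X) ∧
    Functor.LaxMonoidal.μ F (D.dual X) X ≫ F.map (D.ev X) =
      u.hom ▷ F.obj X ≫ D'.ev (F.obj X) ≫ Functor.LaxMonoidal.ε F

end RibbonData

variable [Preadditive C] [Linear ℂ C]

/-- The statement that the negligible morphisms form linear subspaces which are stable under composition
and under tensor product with arbitrary morphisms. The subspaces are determined by `mem_iff`. -/
structure NegligibleIdeal (D : RibbonData C) where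
  toSubmodule (X Y : C) : Submodule ℂ (X ⟶ Y)
  mem_iff {X Y : C} (f : X ⟶ Y) : f ∈ toSubmodule X Y ↔ D.Negligible f
  comp_left {X Y Z : C} (f : X ⟶ Y) {g : Y ⟶ Z} : g ∈ toSubmodule Y Z → f ≫ g ∈ toSubmodule X Z
  comp_right {X Y Z : C} {f : X ⟶ Y} (g : Y ⟶ Z) : f ∈ toSubmodule X Y → f ≫ g ∈ toSubmodule X Z
  whiskerLeft (X : C) {Y Z : C} {f : Y ⟶ Z} : f ∈ toSubmodule Y Z →
    X ◁ f ∈ toSubmodule (X ⊗ Y) (X ⊗ Z)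
  whiskerRight {X Y : C} {f : X ⟶ Y} (Z : C) : f ∈ toSubmodule X Y →
    f ▷ Z ∈ toSubmodule (X ⊗ Z) (Y ⊗ Z)

/-- The purified category: it has the same objects, and its morphisms are the morphisms of the given
category modulo the negligible ones. -/
structure Purified {D : RibbonData C} (N : NegligibleIdeal D) where
  of : C

namespace Purified

variable {D : RibbonData C} (N : NegligibleIdeal D)

/-- Composition of classes of morphisms. -/
def comp (X Y Z : C) : (X ⟶ Y) ⧸ N.toSubmodule X Y →ₗ[ℂ]
    (Y ⟶ Z) ⧸ N.toSubmodule Y Z →ₗ[ℂ] (X ⟶ Z) ⧸ N.toSubmodule X Z :=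
  ((N.toSubmodule Y Z).liftQ
    ((N.toSubmodule X Y).liftQ ((Linear.comp X Y Z).compr₂ (N.toSubmodule X Z).mkQ)
      (fun f hf => by
        refine LinearMap.ext fun g => ?_
        exact (Submodule.Quotient.mk_eq_zero _).2 (N.comp_right g hf))).flip
    (fun g hg => by
      refine Submodule.linearMap_qext _ (LinearMap.ext fun f => ?_)
      exact (Submodule.Quotient.mk_eq_zero _).2 (N.comp_left f hg))).flip

instance : Category (Purified N) where
  Hom X Y := (X.of ⟶ Y.of) ⧸ N.toSubmodule X.of Y.of
  id X := Submodule.Quotient.mk (𝟙 X.of)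
  comp f g := comp N _ _ _ f g
  id_comp f := by
    obtain ⟨f, rfl⟩ := Submodule.Quotient.mk_surjective _ f
    exact congrArg Submodule.Quotient.mk (Category.id_comp f)
  comp_id f := by
    obtain ⟨f, rfl⟩ := Submodule.Quotient.mk_surjective _ f
    exact congrArg Submodule.Quotient.mk (Category.comp_id f)
  assoc f g h := by
    obtain ⟨f, rfl⟩ := Submodule.Quotient.mk_surjective _ f
    obtain ⟨g, rfl⟩ := Submodule.Quotient.mk_surjective _ g
    obtain ⟨h, rfl⟩ := Submodule.Quotient.mk_surjective _ h
    exact congrArg Submodule.Quotient.mk (Category.assoc f g h)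

instance : Preadditive (Purified N) where
  homGroup X Y := inferInstanceAs (AddCommGroup ((X.of ⟶ Y.of) ⧸ N.toSubmodule X.of Y.of))
  add_comp X Y Z f f' g := LinearMap.map_add₂ (comp N X.of Y.of Z.of) f f' g
  comp_add X Y Z f g g' := (comp N X.of Y.of Z.of f).map_add g g'

instance : Linear ℂ (Purified N) where
  homModule X Y := inferInstanceAs (Module ℂ ((X.of ⟶ Y.of) ⧸ N.toSubmodule X.of Y.of))
  smul_comp X Y Z c f g := LinearMap.map_smul₂ (comp N X.of Y.of Z.of) c f g
  comp_smul X Y Z f c g := (comp N X.of Y.of Z.of f).map_smul c g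

/-- The quotient functor. -/
def proj : C ⥤ Purified N where
  obj X := ⟨X⟩
  map f := Submodule.Quotient.mk f

theorem proj_map_surjective {X Y : Purified N} (f : X ⟶ Y) :
    ∃ g : X.of ⟶ Y.of, (proj N).map g = f :=
  Submodule.Quotient.mk_surjective _ f

variable [MonoidalPreadditive C] [MonoidalLinear ℂ C]

/-- Tensor product with an object on the left. -/
def tensorLeftMap (X Y Z : C) : (Y ⟶ Z) ⧸ N.toSubmodule Y Z →ₗ[ℂ]
    (X ⊗ Y ⟶ X ⊗ Z) ⧸ N.toSubmodule (X ⊗ Y) (X ⊗ Z) :=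
  (N.toSubmodule Y Z).mapQ _ ((tensorLeft X).mapLinearMap ℂ) fun _ h => N.whiskerLeft X h

/-- Tensor product with an object on the right. -/
def tensorRightMap (X Y Z : C) : (X ⟶ Y) ⧸ N.toSubmodule X Y →ₗ[ℂ]
    (X ⊗ Z ⟶ Y ⊗ Z) ⧸ N.toSubmodule (X ⊗ Z) (Y ⊗ Z) :=
  (N.toSubmodule X Y).mapQ _ ((tensorRight Z).mapLinearMap ℂ) fun _ h => N.whiskerRight Z h

instance : MonoidalCategoryStruct (Purified N) where
  tensorObj X Y := ⟨X.of ⊗ Y.of⟩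
  tensorUnit := ⟨𝟙_ C⟩
  whiskerLeft X Y Z f := tensorLeftMap N X.of Y.of Z.of f
  whiskerRight {X Y} f Z := tensorRightMap N X.of Y.of Z.of f
  associator X Y Z := (proj N).mapIso (α_ X.of Y.of Z.of)
  leftUnitor X := (proj N).mapIso (λ_ X.of)
  rightUnitor X := (proj N).mapIso (ρ_ X.of)

theorem proj_whiskerLeft (X : Purified N) {Y Z : Purified N} (f : Y.of ⟶ Z.of) :
    X ◁ ((proj N).map f : Y ⟶ Z) = (proj N).map (X.of ◁ f) := rfl

theorem proj_whiskerRight {X Y : Purified N} (f : X.of ⟶ Y.of) (Z : Purified N) :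
    ((proj N).map f : X ⟶ Y) ▷ Z = (proj N).map (f ▷ Z.of) := rfl

theorem proj_tensorHom {X Y X' Y' : Purified N} (f : X.of ⟶ Y.of) (g : X'.of ⟶ Y'.of) :
    (((proj N).map f : X ⟶ Y) ⊗ₘ ((proj N).map g : X' ⟶ Y')) = (proj N).map (f ⊗ₘ g) :=
  congrArg (proj N).map (MonoidalCategory.tensorHom_def f g).symm

instance : MonoidalCategory (Purified N) where
  tensorHom_def _ _ := rfl
  id_tensorHom_id X Y := congrArg (proj N).map
    ((MonoidalCategory.tensorHom_def _ _).symm.trans (id_tensorHom_id X.of Y.of))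
  tensorHom_comp_tensorHom f g f' g' := by
    obtain ⟨f, rfl⟩ := proj_map_surjective N f
    obtain ⟨g, rfl⟩ := proj_map_surjective N g
    obtain ⟨f', rfl⟩ := proj_map_surjective N f'
    obtain ⟨g', rfl⟩ := proj_map_surjective N g'
    exact (congrArg₂ (· ≫ ·) (proj_tensorHom N f g) (proj_tensorHom N f' g')).trans
      ((congrArg (proj N).map (MonoidalCategory.tensorHom_comp_tensorHom f g f' g')).trans
        (proj_tensorHom N (f ≫ f') (g ≫ g')).symm)
  whiskerLeft_id X Y := congrArg (proj N).map (whiskerLeft_id X.of Y.of)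
  id_whiskerRight X Y := congrArg (proj N).map (id_whiskerRight X.of Y.of)
  associator_naturality f g h := by
    obtain ⟨f, rfl⟩ := proj_map_surjective N f
    obtain ⟨g, rfl⟩ := proj_map_surjective N g
    obtain ⟨h, rfl⟩ := proj_map_surjective N h
    refine congrArg (proj N).map ?_
    change ((f ▷ _ ≫ _ ◁ g) ▷ _ ≫ _ ◁ h) ≫ (α_ _ _ _).hom =
      (α_ _ _ _).hom ≫ (f ▷ _ ≫ _ ◁ (g ▷ _ ≫ _ ◁ h))
    simp only [← MonoidalCategory.tensorHom_def, associator_naturality]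
  leftUnitor_naturality f := by
    obtain ⟨f, rfl⟩ := proj_map_surjective N f
    exact congrArg (proj N).map (leftUnitor_naturality f)
  rightUnitor_naturality f := by
    obtain ⟨f, rfl⟩ := proj_map_surjective N f
    exact congrArg (proj N).map (rightUnitor_naturality f)
  pentagon W X Y Z := congrArg (proj N).map (pentagon W.of X.of Y.of Z.of)
  triangle X Y := congrArg (proj N).map (triangle X.of Y.of)

/-- The induced data on the purified category. -/
def ribbonData : RibbonData (Purified N) where
  braiding X Y := (proj N).map (D.braiding X.of Y.of)
  dual X := ⟨D.dual X.of⟩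
  coev X := (proj N).map (D.coev X.of)
  ev X := (proj N).map (D.ev X.of)
  twist X := (proj N).map (D.twist X.of)

end Purified

end Ribbon

/-! ### Jones-Wenzl idempotents and Turaev's category -/

namespace TL

open Idempotents

variable (a : ℂ)

/-- The cup. -/
def cup : 𝟙_ (TL a) ⟶ (⟨1⟩ ⊗ ⟨1⟩ : TL a) := diagram (n := ⟨2⟩) (Tangle.mk .cup)

/-- The cap. -/
def cap : (⟨1⟩ ⊗ ⟨1⟩ : TL a) ⟶ 𝟙_ (TL a) := diagram (m := ⟨2⟩) (Tangle.mk .cap)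

/-- The positive crossing, equal to `a` times the identity plus `a⁻¹` times `cap ≫ cup`. -/
def crossing : (⟨1⟩ ⊗ ⟨1⟩ : TL a) ⟶ ⟨1⟩ ⊗ ⟨1⟩ := diagram (m := ⟨2⟩) (n := ⟨2⟩) (Tangle.mk .pos)

/-- The elements `e_1, …, e_{n-1}` of the algebra `E_n`: a cap followed by a cup on two neighbouring
strands, and `i` and `j` vertical strands on the two sides. -/
def hooks (n : ℕ) : Set (End (⟨n⟩ : TL a)) :=
  {e | ∃ (i j : ℕ) (h : n = (i + (1 + 1)) + j),
    e = (eqIso h).hom ≫ ((⟨i⟩ ◁ (cap a ≫ cup a)) ▷ ⟨j⟩) ≫ (eqIso h.symm).hom}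

/-- The characterization of the Jones-Wenzl idempotent `f`: `f - 1` is a noncommutative polynomial
without constant term in the `e_i`, and `e_i f = f e_i = 0` for all `i`. -/
structure IsJonesWenzl {n : ℕ} (f : End (⟨n⟩ : TL a)) : Prop where
  sub_one_mem : f - 1 ∈ NonUnitalAlgebra.adjoin ℂ (hooks a n)
  hook_mul : ∀ e ∈ hooks a n, e * f = 0
  mul_hook : ∀ e ∈ hooks a n, f * e = 0

open Classical in
/-- The Jones-Wenzl idempotent, where it exists (it is then unique). -/
def jonesWenzl (n : ℕ) : End (⟨n⟩ : TL a) :=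
  if h : ∃ f : End (⟨n⟩ : TL a), IsJonesWenzl a f then h.choose else 0

variable {a} in
theorem IsJonesWenzl.mul_self {n : ℕ} {f : End (⟨n⟩ : TL a)} (hf : IsJonesWenzl a f) :
    f * f = f := by
  have key : ∀ x ∈ NonUnitalAlgebra.adjoin ℂ (hooks a n), f * x = 0 := fun x hx => by
    induction hx using NonUnitalAlgebra.adjoin_induction with
    | mem x hx => exact hf.mul_hook x hx
    | add x y _ _ hx hy => rw [mul_add, hx, hy, add_zero]
    | zero => exact mul_zero f
    | mul x y _ _ hx _ => rw [← mul_assoc, hx, zero_mul]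
    | smul c x _ hx => rw [mul_smul_comm, hx, smul_zero]
  have := key _ hf.sub_one_mem
  rwa [mul_sub, mul_one, sub_eq_zero] at this

theorem jonesWenzl_idem (n : ℕ) : jonesWenzl a n ≫ jonesWenzl a n = jonesWenzl a n := by
  unfold jonesWenzl
  split_ifs with h
  · exact h.choose_spec.mul_self
  · exact Limits.zero_comp

/-- One strand crossing `m` strands. -/
def braidOne : (m : ℕ) → ((⟨1⟩ ⊗ ⟨m⟩ : TL a) ⟶ ⟨m⟩ ⊗ ⟨1⟩)
  | 0 => (ρ_ (⟨1⟩ : TL a)).hom ≫ (λ_ (⟨1⟩ : TL a)).inv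
  | m + 1 => (α_ (⟨1⟩ : TL a) ⟨m⟩ ⟨1⟩).inv ≫ braidOne m ▷ ⟨1⟩ ≫ (α_ (⟨m⟩ : TL a) ⟨1⟩ ⟨1⟩).hom ≫
      ⟨m⟩ ◁ crossing a ≫ (α_ (⟨m⟩ : TL a) ⟨1⟩ ⟨1⟩).inv

/-- The braiding `c_{n,m}`: `n` strands crossing `m` strands. -/
def braid : (n m : ℕ) → ((⟨n⟩ ⊗ ⟨m⟩ : TL a) ⟶ ⟨m⟩ ⊗ ⟨n⟩)
  | 0, m => (λ_ (⟨m⟩ : TL a)).hom ≫ (ρ_ (⟨m⟩ : TL a)).inv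
  | n + 1, m => (α_ (⟨n⟩ : TL a) ⟨1⟩ ⟨m⟩).hom ≫ ⟨n⟩ ◁ braidOne a m ≫
      (α_ (⟨n⟩ : TL a) ⟨m⟩ ⟨1⟩).inv ≫ braid n m ▷ ⟨1⟩ ≫ (α_ (⟨m⟩ : TL a) ⟨n⟩ ⟨1⟩).hom

/-- `n` nested cups. -/
def coev : (n : ℕ) → (𝟙_ (TL a) ⟶ ⟨n⟩ ⊗ ⟨n⟩)
  | 0 => (λ_ (𝟙_ (TL a))).inv
  | n + 1 => coev n ≫ ⟨n⟩ ◁ ((λ_ (⟨n⟩ : TL a)).inv ≫ cup a ▷ ⟨n⟩) ≫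
      (eqIso (by change n + (1 + 1 + n) = n + 1 + (n + 1); omega)).hom

/-- `n` nested caps. -/
def ev : (n : ℕ) → ((⟨n⟩ ⊗ ⟨n⟩ : TL a) ⟶ 𝟙_ (TL a))
  | 0 => (λ_ (𝟙_ (TL a))).hom
  | n + 1 => (eqIso (by change n + 1 + (n + 1) = n + (1 + 1 + n); omega)).hom ≫
      ⟨n⟩ ◁ (cap a ▷ ⟨n⟩ ≫ (λ_ (⟨n⟩ : TL a)).hom) ≫ ev n

/-- The twist: `(-1)^n` times the curl of `n` parallel strands. -/
def twist (n : ℕ) : (⟨n⟩ : TL a) ⟶ ⟨n⟩ :=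
  (-1 : ℂ) ^ n • ((ρ_ (⟨n⟩ : TL a)).inv ≫ ⟨n⟩ ◁ coev a n ≫ (α_ (⟨n⟩ : TL a) ⟨n⟩ ⟨n⟩).inv ≫
    braid a n n ▷ ⟨n⟩ ≫ (α_ (⟨n⟩ : TL a) ⟨n⟩ ⟨n⟩).hom ≫ ⟨n⟩ ◁ ev a n ≫ (ρ_ (⟨n⟩ : TL a)).hom)

end TL

namespace Turaev

open Idempotents

/-- The set of colours: all `n ≥ 1` if `a` is not a root of unity, and `{1, …, r - 2}` if `a` is a
primitive `4r`-th root of unity. -/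
def J (a : ℂ) : Set ℕ := {n | 1 ≤ n ∧ ∀ r : ℕ, 0 < r → a ^ (4 * r) = 1 → n + 2 ≤ r}

variable (a : ℂ)

/-- The direct factor of the object `|s| = n_1 + ⋯ + n_m` of the Temperley-Lieb category given by the
idempotent `f_s = f_{n_1} ⊗ ⋯ ⊗ f_{n_m}`, for `s = (n_1, …, n_m)`. -/
def seqObj : List (J a) → Karoubi (TL a)
  | [] => 𝟙_ (Karoubi (TL a))
  | n :: s => (⟨⟨n⟩, TL.jonesWenzl a n, TL.jonesWenzl_idem a n⟩ : Karoubi (TL a)) ⊗ seqObj s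

theorem seqObj_strands (s : List (J a)) :
    (seqObj a s).X.strands = (s.map Subtype.val).sum := by
  induction s with
  | nil => rfl
  | cons n s ih => rw [List.map_cons, List.sum_cons, ← ih]; rfl

theorem seqObj_reverse_strands (s : List (J a)) :
    (seqObj a s).X.strands = (seqObj a s.reverse).X.strands := by
  rw [seqObj_strands, seqObj_strands, List.map_reverse, List.sum_reverse]

/-- `f_s ⊗ f_t = f_{st}`, up to the associativity of the addition of natural numbers. -/
def seqIso : (s t : List (J a)) → (seqObj a s ⊗ seqObj a t ≅ seqObj a (s ++ t))
  | [], t => λ_ (seqObj a t)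
  | _ :: s, t => α_ _ (seqObj a s) (seqObj a t) ≪≫ whiskerLeftIso _ (seqIso s t)

end Turaev

/-- Turaev's category: its objects are the finite sequences of elements of `J(a)`, and the morphisms from
`s` to `t` are the morphisms `f_t g f_s` of the Temperley-Lieb category. -/
abbrev TuraevCat (a : ℂ) : Type :=
  InducedCategory (Idempotents.Karoubi (TL a)) (Turaev.seqObj a)

namespace Turaev

open Idempotents

variable (a : ℂ)

/-- The tensor product of objects is the concatenation of sequences. -/
instance monoidalStruct : MonoidalCategoryStruct (TuraevCat a) where
  tensorObj (s t : List (J a)) := s ++ t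
  tensorUnit := ([] : List (J a))
  whiskerLeft s t t' f := InducedCategory.homMk
    ((seqIso a s t).inv ≫ seqObj a s ◁ f.hom ≫ (seqIso a s t').hom)
  whiskerRight {s s'} f t := InducedCategory.homMk
    ((seqIso a s t).inv ≫ f.hom ▷ seqObj a t ≫ (seqIso a s' t).hom)
  tensorHom {s s' t t'} f g := InducedCategory.homMk
    ((seqIso a s t).inv ≫ (f.hom ⊗ₘ g.hom) ≫ (seqIso a s' t').hom)
  associator (s t u : List (J a)) := InducedCategory.isoMk
    ((seqIso a (s ++ t) u).symm ≪≫ whiskerRightIso (seqIso a s t).symm _ ≪≫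
      α_ (seqObj a s) (seqObj a t) (seqObj a u) ≪≫ whiskerLeftIso _ (seqIso a t u) ≪≫
      seqIso a s (t ++ u))
  leftUnitor (s : List (J a)) := InducedCategory.isoMk
    ((seqIso a [] s).symm ≪≫ λ_ (seqObj a s))
  rightUnitor (s : List (J a)) := InducedCategory.isoMk
    ((seqIso a s []).symm ≪≫ ρ_ (seqObj a s))

theorem comp_id_tensor_id_comp {C : Type*} [Category C] [MonoidalCategory C] {A X Y Z : C}
    (f : A ⟶ X ⊗ Y) (g : X ⊗ Y ⟶ Z) : f ≫ g = (f ≫ (𝟙 X ⊗ₘ 𝟙 Y)) ≫ g := by simp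

/-- The tensor product is induced by the one of the Temperley-Lieb category. -/
def inducingData : Monoidal.InducingFunctorData
    (inducedFunctor (seqObj a) : TuraevCat a ⥤ Karoubi (TL a)) where
  μIso := seqIso a
  εIso := Iso.refl _
  whiskerLeft_eq _ _ _ _ := rfl
  whiskerRight_eq _ _ := rfl
  tensorHom_eq _ _ := rfl
  associator_eq s t u := by
    simp only [Iso.trans_hom, Iso.symm_hom, tensorIso_hom, Iso.refl_hom, tensorHom_id,
      id_tensorHom, Category.assoc]
    rfl
  leftUnitor_eq s := comp_id_tensor_id_comp _ _
  rightUnitor_eq s := comp_id_tensor_id_comp _ _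

instance monoidal : MonoidalCategory (TuraevCat a) :=
  Monoidal.induced (inducedFunctor (seqObj a)) (inducingData a)

instance functorMonoidal :
    (inducedFunctor (seqObj a) : TuraevCat a ⥤ Karoubi (TL a)).Monoidal :=
  Monoidal.fromInducedMonoidal (inducedFunctor (seqObj a)) (inducingData a)

instance monoidalPreadditive : MonoidalPreadditive (TuraevCat a) :=
  monoidalPreadditive_of_faithful (inducedFunctor (seqObj a))

instance monoidalLinear : MonoidalLinear ℂ (TuraevCat a) :=
  MonoidalLinear.ofFaithful ℂ (inducedFunctor (seqObj a))

/-- The ribbon structure of Turaev's category: the structure morphisms are cut out by the idempotents `f_s`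
from those of the Temperley-Lieb category, and `s*` is the reversed sequence. -/
def ribbonData : RibbonData (TuraevCat a) where
  braiding s t := InducedCategory.homMk ((seqIso a s t).inv ≫
    KaroubiMonoidal.hat (P := seqObj a s ⊗ seqObj a t) (Q := seqObj a t ⊗ seqObj a s)
      (TL.braid a (seqObj a s).X.strands (seqObj a t).X.strands) ≫ (seqIso a t s).hom)
  dual s := List.reverse s
  coev s := InducedCategory.homMk (
    KaroubiMonoidal.hat (P := 𝟙_ (Karoubi (TL a)))
      (Q := seqObj a s ⊗ seqObj a (List.reverse s))
      (TL.coev a (seqObj a s).X.strands ≫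
        (seqObj a s).X ◁ (TL.eqIso (seqObj_reverse_strands a s)).hom) ≫
      (seqIso a s (List.reverse s)).hom)
  ev s := InducedCategory.homMk ((seqIso a (List.reverse s) s).inv ≫
    KaroubiMonoidal.hat (P := seqObj a (List.reverse s) ⊗ seqObj a s)
      (Q := 𝟙_ (Karoubi (TL a)))
      ((TL.eqIso (seqObj_reverse_strands a s).symm).hom ▷ (seqObj a s).X ≫
        TL.ev a (seqObj a s).X.strands))
  twist s := InducedCategory.homMk
    (KaroubiMonoidal.hat (P := seqObj a s) (Q := seqObj a s) (TL.twist a (seqObj a s).X.strands))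

end Turaev


/-! ### The quantized enveloping algebra -/

/-- The generators `K`, `K⁻¹`, `X`, `Y`. -/
inductive UqGen
  | K
  | Kinv
  | X
  | Y

open FreeAlgebra in
/-- The defining relations of `U_q(sl_2)`. -/
inductive UqRel (q : ℂˣ) : FreeAlgebra ℂ UqGen → FreeAlgebra ℂ UqGen → Prop
  | K_Kinv : UqRel q (ι ℂ .K * ι ℂ .Kinv) 1
  | Kinv_K : UqRel q (ι ℂ .Kinv * ι ℂ .K) 1
  | K_X : UqRel q (ι ℂ .K * ι ℂ .X * ι ℂ .Kinv) ((q : ℂ) ^ 2 • ι ℂ .X)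
  | K_Y : UqRel q (ι ℂ .K * ι ℂ .Y * ι ℂ .Kinv) ((q : ℂ)⁻¹ ^ 2 • ι ℂ .Y)
  | X_Y : UqRel q (ι ℂ .X * ι ℂ .Y - ι ℂ .Y * ι ℂ .X)
      (((q : ℂ) - (q : ℂ)⁻¹)⁻¹ • (ι ℂ .K - ι ℂ .Kinv))

/-- The algebra `U_q(sl_2)`. -/
abbrev Uq (q : ℂˣ) : Type := RingQuot (UqRel q)

section

open scoped TensorProduct

namespace Uq

variable (q : ℂˣ)

/-- The generators, as elements of the algebra. -/
def gen (g : UqGen) : Uq q := RingQuot.mkAlgHom ℂ (UqRel q) (FreeAlgebra.ι ℂ g)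

def K : Uq q := gen q .K

def Kinv : Uq q := gen q .Kinv

def X : Uq q := gen q .X

def Y : Uq q := gen q .Y

theorem K_mul_Kinv : K q * Kinv q = 1 := by
  simpa [K, Kinv, gen] using RingQuot.mkAlgHom_rel ℂ (UqRel.K_Kinv (q := q))

theorem Kinv_mul_K : Kinv q * K q = 1 := by
  simpa [K, Kinv, gen] using RingQuot.mkAlgHom_rel ℂ (UqRel.Kinv_K (q := q))

theorem K_mul_X_mul_Kinv : K q * X q * Kinv q = (q : ℂ) ^ 2 • X q := by
  simpa [K, X, Kinv, gen] using RingQuot.mkAlgHom_rel ℂ (UqRel.K_X (q := q))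

theorem K_mul_Y_mul_Kinv : K q * Y q * Kinv q = (q : ℂ)⁻¹ ^ 2 • Y q := by
  simpa [K, Y, Kinv, gen] using RingQuot.mkAlgHom_rel ℂ (UqRel.K_Y (q := q))

theorem X_mul_Y_sub : X q * Y q - Y q * X q =
    ((q : ℂ) - (q : ℂ)⁻¹)⁻¹ • (K q - Kinv q) := by
  simpa [K, Kinv, X, Y, gen] using RingQuot.mkAlgHom_rel ℂ (UqRel.X_Y (q := q))

variable {q} {A : Type*} [Ring A] [Algebra ℂ A]

/-- The algebra morphism given by the images of the generators. -/
def lift (k k' x y : A) (h₁ : k * k' = 1) (h₂ : k' * k = 1) (h₃ : k * x * k' = (q : ℂ) ^ 2 • x)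
    (h₄ : k * y * k' = (q : ℂ)⁻¹ ^ 2 • y)
    (h₅ : x * y - y * x = ((q : ℂ) - (q : ℂ)⁻¹)⁻¹ • (k - k')) : Uq q →ₐ[ℂ] A :=
  RingQuot.liftAlgHom ℂ ⟨FreeAlgebra.lift ℂ fun g => match g with
    | .K => k
    | .Kinv => k'
    | .X => x
    | .Y => y, fun u v h => by
      cases h <;> simp [h₁, h₂, h₃, h₄, h₅]⟩

section lift
variable {k k' x y : A} {h₁ : k * k' = 1} {h₂ : k' * k = 1} {h₃ : k * x * k' = (q : ℂ) ^ 2 • x}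
    {h₄ : k * y * k' = (q : ℂ)⁻¹ ^ 2 • y}
    {h₅ : x * y - y * x = ((q : ℂ) - (q : ℂ)⁻¹)⁻¹ • (k - k')}

theorem lift_K : lift k k' x y h₁ h₂ h₃ h₄ h₅ (K q) = k := by simp [lift, K, gen]
theorem lift_Kinv : lift k k' x y h₁ h₂ h₃ h₄ h₅ (Kinv q) = k' := by simp [lift, Kinv, gen]
theorem lift_X : lift k k' x y h₁ h₂ h₃ h₄ h₅ (X q) = x := by simp [lift, X, gen]
theorem lift_Y : lift k k' x y h₁ h₂ h₃ h₄ h₅ (Y q) = y := by simp [lift, Y, gen]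
end lift

theorem induction {P : Uq q → Prop} (u : Uq q) (algebraMap : ∀ c : ℂ, P (algebraMap ℂ _ c))
    (K : P (K q)) (Kinv : P (Kinv q)) (X : P (X q)) (Y : P (Y q))
    (mul : ∀ u v, P u → P v → P (u * v)) (add : ∀ u v, P u → P v → P (u + v)) : P u := by
  obtain ⟨u, rfl⟩ := RingQuot.mkAlgHom_surjective ℂ (UqRel q) u
  induction u using FreeAlgebra.induction with
  | grade0 c => simpa using algebraMap c
  | grade1 g => cases g <;> assumption
  | mul u v hu hv => simpa using mul _ _ hu hv
  | add u v hu hv => simpa using add _ _ hu hv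

variable (q)

theorem K_mul_X : K q * X q = (q : ℂ) ^ 2 • (X q * K q) := by
  rw [← smul_mul_assoc, ← K_mul_X_mul_Kinv, mul_assoc _ _ (K q), Kinv_mul_K, mul_one]

theorem K_mul_Y : K q * Y q = (q : ℂ)⁻¹ ^ 2 • (Y q * K q) := by
  rw [← smul_mul_assoc, ← K_mul_Y_mul_Kinv, mul_assoc _ _ (K q), Kinv_mul_K, mul_one]

theorem X_mul_Kinv : X q * Kinv q = (q : ℂ) ^ 2 • (Kinv q * X q) := by
  rw [← mul_smul_comm, ← K_mul_X_mul_Kinv, mul_assoc (K q), ← mul_assoc, Kinv_mul_K, one_mul]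

theorem Kinv_mul_X : Kinv q * X q = (q : ℂ)⁻¹ ^ 2 • (X q * Kinv q) := by
  rw [X_mul_Kinv, smul_smul, ← mul_pow, inv_mul_cancel₀ q.ne_zero, one_pow, one_smul]

theorem Y_mul_Kinv : Y q * Kinv q = (q : ℂ)⁻¹ ^ 2 • (Kinv q * Y q) := by
  rw [← mul_smul_comm, ← K_mul_Y_mul_Kinv, mul_assoc (K q), ← mul_assoc, Kinv_mul_K, one_mul]

theorem Kinv_mul_Y : Kinv q * Y q = (q : ℂ) ^ 2 • (Y q * Kinv q) := by
  rw [Y_mul_Kinv, smul_smul, ← mul_pow, mul_inv_cancel₀ q.ne_zero, one_pow, one_smul]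

/-- The comultiplication. -/
def comul : Uq q →ₐ[ℂ] Uq q ⊗[ℂ] Uq q :=
  lift (K q ⊗ₜ[ℂ] K q) (Kinv q ⊗ₜ[ℂ] Kinv q) (1 ⊗ₜ[ℂ] X q + X q ⊗ₜ[ℂ] K q)
    (Kinv q ⊗ₜ[ℂ] Y q + Y q ⊗ₜ[ℂ] 1)
    (by rw [Algebra.TensorProduct.tmul_mul_tmul, K_mul_Kinv, Algebra.TensorProduct.one_def])
    (by rw [Algebra.TensorProduct.tmul_mul_tmul, Kinv_mul_K, Algebra.TensorProduct.one_def])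
    (by simp only [mul_add, add_mul, Algebra.TensorProduct.tmul_mul_tmul, mul_one, K_mul_Kinv,
          K_mul_X_mul_Kinv, TensorProduct.tmul_smul, TensorProduct.smul_tmul', smul_add,
          mul_assoc (K q) (K q), mul_one])
    (by simp only [mul_add, add_mul, Algebra.TensorProduct.tmul_mul_tmul, mul_one, K_mul_Kinv,
          K_mul_Y_mul_Kinv, TensorProduct.tmul_smul, TensorProduct.smul_tmul', smul_add, one_mul])
    (by
      have h : ((q : ℂ) - (q : ℂ)⁻¹)⁻¹ • (K q ⊗ₜ[ℂ] K q - Kinv q ⊗ₜ Kinv q) =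
          Kinv q ⊗ₜ (X q * Y q - Y q * X q) + (X q * Y q - Y q * X q) ⊗ₜ K q := by
        rw [X_mul_Y_sub, TensorProduct.tmul_smul, ← TensorProduct.smul_tmul', ← smul_add,
          TensorProduct.tmul_sub, TensorProduct.sub_tmul]
        congr 1; abel
      have h' : (X q * Kinv q) ⊗ₜ[ℂ] (K q * Y q) = (Kinv q * X q) ⊗ₜ (Y q * K q) := by
        rw [X_mul_Kinv, K_mul_Y, TensorProduct.smul_tmul_smul, ← mul_pow,
          mul_inv_cancel₀ q.ne_zero, one_pow, one_smul]
      rw [h]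
      simp only [mul_add, add_mul, Algebra.TensorProduct.tmul_mul_tmul, mul_one, one_mul, h',
        TensorProduct.tmul_sub, TensorProduct.sub_tmul]
      abel)

/-- The counit. -/
def counit : Uq q →ₐ[ℂ] ℂ := lift 1 1 0 0 (by simp) (by simp) (by simp) (by simp) (by simp)

end Uq

end

/-! ### Representations on vector spaces -/

/-- Equivariance of a linear map between two representations. -/
def Intertwines {q : ℂˣ} {A B : Type*} [AddCommGroup A] [Module ℂ A] [AddCommGroup B] [Module ℂ B]
    (ρ : Uq q →ₐ[ℂ] Module.End ℂ A) (σ : Uq q →ₐ[ℂ] Module.End ℂ B) (f : A →ₗ[ℂ] B) : Prop :=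
  ∀ u : Uq q, f ∘ₗ ρ u = σ u ∘ₗ f

section Representations

variable {q : ℂˣ} {A B A' B' A'' : Type*} [AddCommGroup A] [Module ℂ A] [AddCommGroup B]
  [Module ℂ B] [AddCommGroup A'] [Module ℂ A'] [AddCommGroup B'] [Module ℂ B']
  [AddCommGroup A''] [Module ℂ A'']
  {ρ : Uq q →ₐ[ℂ] Module.End ℂ A} {σ : Uq q →ₐ[ℂ] Module.End ℂ B}
  {ρ' : Uq q →ₐ[ℂ] Module.End ℂ A'} {σ' : Uq q →ₐ[ℂ] Module.End ℂ B'}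
  {ρ'' : Uq q →ₐ[ℂ] Module.End ℂ A''}

theorem Intertwines.of_generators {f : A →ₗ[ℂ] B} (hK : f ∘ₗ ρ (Uq.K q) = σ (Uq.K q) ∘ₗ f)
    (hX : f ∘ₗ ρ (Uq.X q) = σ (Uq.X q) ∘ₗ f) (hY : f ∘ₗ ρ (Uq.Y q) = σ (Uq.Y q) ∘ₗ f) :
    Intertwines ρ σ f := fun u => by
  induction u using Uq.induction with
  | algebraMap c => ext; simp
  | K => exact hK
  | Kinv =>
    have h₁ : ρ (Uq.K q) ∘ₗ ρ (Uq.Kinv q) = .id := by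
      rw [← Module.End.mul_eq_comp, ← map_mul, Uq.K_mul_Kinv, map_one]; rfl
    have h₂ : σ (Uq.Kinv q) ∘ₗ σ (Uq.K q) = .id := by
      rw [← Module.End.mul_eq_comp, ← map_mul, Uq.Kinv_mul_K, map_one]; rfl
    calc f ∘ₗ ρ (Uq.Kinv q) = σ (Uq.Kinv q) ∘ₗ (σ (Uq.K q) ∘ₗ f) ∘ₗ ρ (Uq.Kinv q) := by
          rw [← LinearMap.comp_assoc, ← LinearMap.comp_assoc, h₂, LinearMap.id_comp]
      _ = σ (Uq.Kinv q) ∘ₗ f := by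
          rw [← hK, LinearMap.comp_assoc, h₁, LinearMap.comp_id]
  | X => exact hX
  | Y => exact hY
  | mul u v hu hv =>
    rw [map_mul, map_mul, Module.End.mul_eq_comp, Module.End.mul_eq_comp, ← LinearMap.comp_assoc,
      hu, LinearMap.comp_assoc, hv, LinearMap.comp_assoc]
  | add u v hu hv => rw [map_add, map_add, LinearMap.comp_add, hu, hv, LinearMap.add_comp]

theorem Intertwines.symm {e : A ≃ₗ[ℂ] B} (h : Intertwines ρ σ e.toLinearMap) :
    Intertwines σ ρ e.symm.toLinearMap := fun u => by
  ext x
  obtain ⟨x, rfl⟩ := e.surjective x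
  have := LinearMap.congr_fun (h u) x
  simp only [LinearMap.comp_apply, LinearEquiv.coe_coe] at this ⊢
  rw [← this, e.symm_apply_apply, e.symm_apply_apply]

variable (ρ ρ' ρ'') in
/-- The action on a tensor product, through the comultiplication. -/
def tensorAction : Uq q →ₐ[ℂ] Module.End ℂ (TensorProduct ℂ A A') :=
  (Module.endTensorEndAlgHom (R := ℂ) (S := ℂ) (A := ℂ)).comp
    ((Algebra.TensorProduct.map ρ ρ').comp (Uq.comul q))

theorem tensorAction_K :
    tensorAction ρ ρ' (Uq.K q) = TensorProduct.map (ρ (Uq.K q)) (ρ' (Uq.K q)) := by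
  change Module.endTensorEndAlgHom (R := ℂ) (S := ℂ) (A := ℂ)
    (Algebra.TensorProduct.map ρ ρ' (Uq.comul q (Uq.K q))) = _
  rw [Uq.comul, Uq.lift_K, Algebra.TensorProduct.map_tmul]
  rfl

theorem tensorAction_Kinv :
    tensorAction ρ ρ' (Uq.Kinv q) = TensorProduct.map (ρ (Uq.Kinv q)) (ρ' (Uq.Kinv q)) := by
  change Module.endTensorEndAlgHom (R := ℂ) (S := ℂ) (A := ℂ)
    (Algebra.TensorProduct.map ρ ρ' (Uq.comul q (Uq.Kinv q))) = _
  rw [Uq.comul, Uq.lift_Kinv, Algebra.TensorProduct.map_tmul]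
  rfl

theorem tensorAction_X : tensorAction ρ ρ' (Uq.X q) =
    TensorProduct.map LinearMap.id (ρ' (Uq.X q)) +
      TensorProduct.map (ρ (Uq.X q)) (ρ' (Uq.K q)) := by
  change Module.endTensorEndAlgHom (R := ℂ) (S := ℂ) (A := ℂ)
    (Algebra.TensorProduct.map ρ ρ' (Uq.comul q (Uq.X q))) = _
  rw [Uq.comul, Uq.lift_X, map_add, Algebra.TensorProduct.map_tmul, Algebra.TensorProduct.map_tmul,
    map_add, map_one]
  rfl

theorem tensorAction_Y : tensorAction ρ ρ' (Uq.Y q) =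
    TensorProduct.map (ρ (Uq.Kinv q)) (ρ' (Uq.Y q)) +
      TensorProduct.map (ρ (Uq.Y q)) LinearMap.id := by
  change Module.endTensorEndAlgHom (R := ℂ) (S := ℂ) (A := ℂ)
    (Algebra.TensorProduct.map ρ ρ' (Uq.comul q (Uq.Y q))) = _
  rw [Uq.comul, Uq.lift_Y, map_add, Algebra.TensorProduct.map_tmul, Algebra.TensorProduct.map_tmul,
    map_add, map_one]
  rfl

variable (q) in
/-- The trivial representation, given by the counit. -/
def trivialAction : Uq q →ₐ[ℂ] Module.End ℂ ℂ :=
  (Algebra.ofId ℂ (Module.End ℂ ℂ)).comp (Uq.counit q)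

theorem trivialAction_K : trivialAction q (Uq.K q) = LinearMap.id := by
  change Algebra.ofId ℂ (Module.End ℂ ℂ) (Uq.counit q (Uq.K q)) = _
  rw [Uq.counit, Uq.lift_K, map_one]; rfl

theorem trivialAction_Kinv : trivialAction q (Uq.Kinv q) = LinearMap.id := by
  change Algebra.ofId ℂ (Module.End ℂ ℂ) (Uq.counit q (Uq.Kinv q)) = _
  rw [Uq.counit, Uq.lift_Kinv, map_one]; rfl

theorem trivialAction_X : trivialAction q (Uq.X q) = 0 := by
  change Algebra.ofId ℂ (Module.End ℂ ℂ) (Uq.counit q (Uq.X q)) = _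
  rw [Uq.counit, Uq.lift_X]; exact map_zero _

theorem trivialAction_Y : trivialAction q (Uq.Y q) = 0 := by
  change Algebra.ofId ℂ (Module.End ℂ ℂ) (Uq.counit q (Uq.Y q)) = _
  rw [Uq.counit, Uq.lift_Y]; exact map_zero _

theorem Intertwines.map {f : A →ₗ[ℂ] B} {f' : A' →ₗ[ℂ] B'} (h : Intertwines ρ σ f)
    (h' : Intertwines ρ' σ' f') :
    Intertwines (tensorAction ρ ρ') (tensorAction σ σ') (TensorProduct.map f f') := by
  refine .of_generators ?_ ?_ ?_
  · rw [tensorAction_K, tensorAction_K, ← TensorProduct.map_comp, ← TensorProduct.map_comp, h, h']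
  · rw [tensorAction_X, tensorAction_X, LinearMap.comp_add, LinearMap.add_comp,
      ← TensorProduct.map_comp, ← TensorProduct.map_comp, ← TensorProduct.map_comp,
      ← TensorProduct.map_comp, h, h', h']
    rfl
  · rw [tensorAction_Y, tensorAction_Y, LinearMap.comp_add, LinearMap.add_comp,
      ← TensorProduct.map_comp, ← TensorProduct.map_comp, ← TensorProduct.map_comp,
      ← TensorProduct.map_comp, h, h, h']
    rfl

theorem intertwines_assoc : Intertwines (tensorAction (tensorAction ρ ρ') ρ'')
    (tensorAction ρ (tensorAction ρ' ρ'')) (TensorProduct.assoc ℂ A A' A'').toLinearMap := by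
  refine .of_generators ?_ ?_ ?_ <;> refine TensorProduct.ext_threefold fun x y z => ?_
  · simp [tensorAction_K]
  · simp [tensorAction_X, tensorAction_K, TensorProduct.tmul_add, TensorProduct.add_tmul, add_assoc]
  · simp [tensorAction_Y, tensorAction_Kinv, TensorProduct.tmul_add, TensorProduct.add_tmul,
      add_assoc]

theorem intertwines_lid : Intertwines (tensorAction (trivialAction q) ρ) ρ
    (TensorProduct.lid ℂ A).toLinearMap := by
  refine .of_generators ?_ ?_ ?_ <;> refine TensorProduct.ext' fun x y => ?_
  · simp [tensorAction_K, trivialAction_K]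
  · simp [tensorAction_X, trivialAction_X]
  · simp [tensorAction_Y, trivialAction_Kinv, trivialAction_Y]

theorem intertwines_rid : Intertwines (tensorAction ρ (trivialAction q)) ρ
    (TensorProduct.rid ℂ A).toLinearMap := by
  refine .of_generators ?_ ?_ ?_ <;> refine TensorProduct.ext' fun x y => ?_
  · simp [tensorAction_K, trivialAction_K]
  · simp [tensorAction_X, trivialAction_X, trivialAction_K]
  · simp [tensorAction_Y, trivialAction_Y]

end Representations

/-! ### The category of modules -/

/-- A `U_q(sl_2)`-module. -/
structure UqMod (q : ℂˣ) where
  V : ModuleCat.{0} ℂ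
  ρ : Uq q →ₐ[ℂ] Module.End ℂ V

namespace UqMod

variable {q : ℂˣ}

/-- A `U_q(sl_2)`-linear map. -/
@[ext]
structure Hom (M N : UqMod q) where
  hom : M.V ⟶ N.V
  comm : Intertwines M.ρ N.ρ hom.hom

instance : Category (UqMod q) where
  Hom := Hom
  id M := ⟨𝟙 M.V, fun _ => rfl⟩
  comp f g := ⟨f.hom ≫ g.hom, fun u => by
    rw [ModuleCat.hom_comp, LinearMap.comp_assoc, f.comm, ← LinearMap.comp_assoc, g.comm,
      LinearMap.comp_assoc]⟩

@[ext]
theorem hom_ext {M N : UqMod q} {f g : M ⟶ N} (h : f.hom = g.hom) : f = g := Hom.ext h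

/-- The underlying vector space. -/
def forget (q : ℂˣ) : UqMod q ⥤ ModuleCat.{0} ℂ where
  obj M := M.V
  map f := f.hom

instance : (forget q).Faithful where
  map_injective h := hom_ext h

instance (M N : UqMod q) : Zero (M ⟶ N) := ⟨⟨0, fun u => by simp⟩⟩

instance (M N : UqMod q) : Add (M ⟶ N) := ⟨fun f g => ⟨f.hom + g.hom, fun u => by
  rw [ModuleCat.hom_add, LinearMap.add_comp, f.comm, g.comm, LinearMap.comp_add]⟩⟩

instance (M N : UqMod q) : Neg (M ⟶ N) := ⟨fun f => ⟨-f.hom, fun u => by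
  rw [ModuleCat.hom_neg, LinearMap.neg_comp, f.comm, LinearMap.comp_neg]⟩⟩

instance : Preadditive (UqMod q) where
  homGroup M N :=
    { add_assoc := fun f g h => hom_ext (add_assoc f.hom g.hom h.hom)
      zero_add := fun f => hom_ext (zero_add f.hom)
      add_zero := fun f => hom_ext (add_zero f.hom)
      neg_add_cancel := fun f => hom_ext (neg_add_cancel f.hom)
      add_comm := fun f g => hom_ext (add_comm f.hom g.hom)
      nsmul := nsmulRec
      zsmul := zsmulRec }
  add_comp _ _ _ f f' g := hom_ext (Preadditive.add_comp _ _ _ f.hom f'.hom g.hom)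
  comp_add _ _ _ f g g' := hom_ext (Preadditive.comp_add _ _ _ f.hom g.hom g'.hom)

instance : Linear ℂ (UqMod q) where
  homModule M N :=
    { smul := fun c f => ⟨c • f.hom, fun u => by
        rw [ModuleCat.hom_smul, LinearMap.smul_comp, f.comm, LinearMap.comp_smul]⟩
      one_smul := fun f => hom_ext (one_smul ℂ f.hom)
      mul_smul := fun c d f => hom_ext (mul_smul c d f.hom)
      smul_zero := fun c => hom_ext (smul_zero (A := M.V ⟶ N.V) c)
      smul_add := fun c f g => hom_ext (smul_add c f.hom g.hom)
      add_smul := fun c d f => hom_ext (add_smul c d f.hom)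
      zero_smul := fun f => hom_ext (zero_smul ℂ f.hom) }
  smul_comp _ _ _ c f g := hom_ext (Linear.smul_comp _ _ _ c f.hom g.hom)
  comp_smul _ _ _ f c g := hom_ext (Linear.comp_smul _ _ _ f.hom c g.hom)

instance : (forget q).Additive where
  map_add := rfl

instance : (forget q).Linear ℂ where
  map_smul _ _ := rfl

/-- The isomorphism given by an equivariant linear isomorphism. -/
def isoMk {M N : UqMod q} (e : M.V ≅ N.V) (h : Intertwines M.ρ N.ρ e.hom.hom) : M ≅ N where
  hom := ⟨e.hom, h⟩
  inv := ⟨e.inv, Intertwines.symm (e := e.toLinearEquiv) h⟩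
  hom_inv_id := hom_ext e.hom_inv_id
  inv_hom_id := hom_ext e.inv_hom_id

instance monoidalStruct : MonoidalCategoryStruct (UqMod q) where
  tensorObj M N := ⟨M.V ⊗ N.V, tensorAction M.ρ N.ρ⟩
  tensorUnit := ⟨𝟙_ _, trivialAction q⟩
  tensorHom f g := ⟨f.hom ⊗ₘ g.hom, f.comm.map g.comm⟩
  whiskerLeft M _ _ f := ⟨M.V ◁ f.hom, Intertwines.map (f := LinearMap.id) (fun _ => rfl) f.comm⟩
  whiskerRight f M := ⟨f.hom ▷ M.V, Intertwines.map (f' := LinearMap.id) f.comm (fun _ => rfl)⟩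
  associator M N P := isoMk (α_ M.V N.V P.V) intertwines_assoc
  leftUnitor M := isoMk (λ_ M.V) intertwines_lid
  rightUnitor M := isoMk (ρ_ M.V) intertwines_rid

instance monoidal : MonoidalCategory (UqMod q) where
  tensorHom_def f g := hom_ext (tensorHom_def f.hom g.hom)
  id_tensorHom_id M N := hom_ext (id_tensorHom_id M.V N.V)
  tensorHom_comp_tensorHom f g f' g' :=
    hom_ext (tensorHom_comp_tensorHom f.hom g.hom f'.hom g'.hom)
  whiskerLeft_id M N := hom_ext (whiskerLeft_id M.V N.V)
  id_whiskerRight M N := hom_ext (id_whiskerRight M.V N.V)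
  associator_naturality f g h := hom_ext (associator_naturality f.hom g.hom h.hom)
  leftUnitor_naturality f := hom_ext (leftUnitor_naturality f.hom)
  rightUnitor_naturality f := hom_ext (rightUnitor_naturality f.hom)
  pentagon M N P Q := hom_ext (pentagon M.V N.V P.V Q.V)
  triangle M N := hom_ext (triangle M.V N.V)

instance : MonoidalPreadditive (UqMod q) where
  whiskerLeft_zero {M _ _} := hom_ext (MonoidalPreadditive.whiskerLeft_zero (X := M.V))
  zero_whiskerRight {M _ _} := hom_ext (MonoidalPreadditive.zero_whiskerRight (X := M.V))
  whiskerLeft_add {M _ _} f g := hom_ext (MonoidalPreadditive.whiskerLeft_add (X := M.V) f.hom g.hom)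
  add_whiskerRight {M _ _} f g :=
    hom_ext (MonoidalPreadditive.add_whiskerRight (X := M.V) f.hom g.hom)

instance : MonoidalLinear ℂ (UqMod q) where
  whiskerLeft_smul M _ _ c f := hom_ext (MonoidalLinear.whiskerLeft_smul M.V c f.hom)
  smul_whiskerRight c _ _ f M := hom_ext (MonoidalLinear.smul_whiskerRight c f.hom M.V)

end UqMod

/-! ### The simple modules -/

/-- The quantum integer `[k] = (q^k - q^{-k}) / (q - q^{-1})`. -/
def qint (q : ℂˣ) (k : ℤ) : ℂ := ((q : ℂ) ^ k - (q : ℂ) ^ (-k)) / ((q : ℂ) - (q : ℂ)⁻¹)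

namespace SimpleModule

/-- The basis vector `v_k` of the space with basis `v_0, …, v_n`, and `0` for `k > n`. -/
def vec (n k : ℕ) : Fin (n + 1) → ℂ := if h : k < n + 1 then Pi.single ⟨k, h⟩ 1 else 0

/-- The linear map with prescribed values on `v_0, …, v_n`. -/
def onVec {E : Type*} [AddCommGroup E] [Module ℂ E] (n : ℕ) (g : ℕ → E) :
    (Fin (n + 1) → ℂ) →ₗ[ℂ] E :=
  (Pi.basisFun ℂ (Fin (n + 1))).constr ℂ fun i => g i

/-- The linear map with prescribed values on the vectors `v_i ⊗ v_j`. -/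
def onVec₂ {E : Type*} [AddCommGroup E] [Module ℂ E] (n m : ℕ) (g : ℕ → ℕ → E) :
    TensorProduct ℂ (Fin (n + 1) → ℂ) (Fin (m + 1) → ℂ) →ₗ[ℂ] E :=
  ((Pi.basisFun ℂ (Fin (n + 1))).tensorProduct (Pi.basisFun ℂ (Fin (m + 1)))).constr ℂ
    fun p => g p.1 p.2

section
variable {E : Type*} [AddCommGroup E] [Module ℂ E] {n m : ℕ}

theorem vec_eq_zero {k : ℕ} (h : n < k) : vec n k = 0 := dif_neg (by omega)

theorem vec_fin (i : Fin (n + 1)) : vec n i = Pi.basisFun ℂ _ i := by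
  simp [vec, i.2, Pi.basisFun_apply]

theorem onVec_vec {g : ℕ → E} (hg : ∀ k, n < k → g k = 0) (k : ℕ) : onVec n g (vec n k) = g k := by
  by_cases h : k < n + 1
  · have := (Pi.basisFun ℂ (Fin (n + 1))).constr_basis ℂ (fun i => g i) ⟨k, h⟩
    rw [← vec_fin] at this
    exact this
  · rw [vec_eq_zero (by omega), map_zero, hg k (by omega)]

theorem onVec₂_vec {g : ℕ → ℕ → E} (hg : ∀ i j, n < i ∨ m < j → g i j = 0) (i j : ℕ) :
    onVec₂ n m g (vec n i ⊗ₜ vec m j) = g i j := by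
  by_cases h : i < n + 1
  · by_cases h' : j < m + 1
    · have := ((Pi.basisFun ℂ (Fin (n + 1))).tensorProduct
        (Pi.basisFun ℂ (Fin (m + 1)))).constr_basis ℂ (fun p => g p.1 p.2) (⟨i, h⟩, ⟨j, h'⟩)
      rw [Module.Basis.tensorProduct_apply, ← vec_fin, ← vec_fin] at this
      exact this
    · rw [vec_eq_zero (k := j) (by omega), TensorProduct.tmul_zero, map_zero, hg i j (by omega)]
  · rw [vec_eq_zero (k := i) (by omega), TensorProduct.zero_tmul, map_zero, hg i j (by omega)]

theorem vec_ext {f g : (Fin (n + 1) → ℂ) →ₗ[ℂ] E} (h : ∀ k, f (vec n k) = g (vec n k)) : f = g :=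
  (Pi.basisFun ℂ (Fin (n + 1))).ext fun i => by rw [← vec_fin, h]

theorem vec_ext₂ {f g : TensorProduct ℂ (Fin (n + 1) → ℂ) (Fin (m + 1) → ℂ) →ₗ[ℂ] E}
    (h : ∀ i j, f (vec n i ⊗ₜ vec m j) = g (vec n i ⊗ₜ vec m j)) : f = g :=
  ((Pi.basisFun ℂ (Fin (n + 1))).tensorProduct (Pi.basisFun ℂ (Fin (m + 1)))).ext fun p => by
    rw [Module.Basis.tensorProduct_apply, ← vec_fin, ← vec_fin, h]

end

section
variable (q : ℂˣ)

theorem qint_zero : qint q 0 = 0 := by simp [qint]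

/-- `K v_k = q^{n-2k} v_k` -/
def K (n : ℕ) : Module.End ℂ (Fin (n + 1) → ℂ) :=
  onVec n fun k => (q : ℂ) ^ ((n : ℤ) - 2 * k) • vec n k

/-- `K⁻¹ v_k = q^{-(n-2k)} v_k` -/
def Kinv (n : ℕ) : Module.End ℂ (Fin (n + 1) → ℂ) :=
  onVec n fun k => (q : ℂ) ^ (-((n : ℤ) - 2 * k)) • vec n k

/-- `X v_k = [k] [n-k+1] v_{k-1}` -/
def X (n : ℕ) : Module.End ℂ (Fin (n + 1) → ℂ) :=
  onVec n fun k => (qint q k * qint q (n - k + 1)) • vec n (k - 1)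

/-- `Y v_k = v_{k+1}` -/
def Y (n : ℕ) : Module.End ℂ (Fin (n + 1) → ℂ) := onVec n fun k => vec n (k + 1)

variable (n k : ℕ)

theorem K_vec : K q n (vec n k) = (q : ℂ) ^ ((n : ℤ) - 2 * k) • vec n k :=
  onVec_vec (fun k h => by rw [vec_eq_zero h, smul_zero]) k

theorem Kinv_vec : Kinv q n (vec n k) = (q : ℂ) ^ (-((n : ℤ) - 2 * k)) • vec n k :=
  onVec_vec (fun k h => by rw [vec_eq_zero h, smul_zero]) k

theorem X_vec : X q n (vec n k) = (qint q k * qint q (n - k + 1)) • vec n (k - 1) :=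
  onVec_vec (fun k h => by
    obtain h | h : k = n + 1 ∨ n < k - 1 := by omega
    · rw [show (n : ℤ) - k + 1 = 0 by omega, qint_zero, mul_zero, zero_smul]
    · rw [vec_eq_zero h, smul_zero]) k

theorem Y_vec : Y n (vec n k) = vec n (k + 1) :=
  onVec_vec (fun k h => vec_eq_zero (by omega)) k

end

section
variable (q : ℂˣ)

theorem qint_mul_sub (n k : ℤ) : qint q (k + 1) * qint q (n - k) -
    qint q k * qint q (n - k + 1) = qint q (n - 2 * k) := by
  have hq := q.ne_zero
  by_cases hD : (q : ℂ) - (q : ℂ)⁻¹ = 0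
  · simp [qint, hD]
  · simp only [qint]
    rw [div_mul_div_comm, div_mul_div_comm, ← sub_div, div_eq_div_iff (mul_ne_zero hD hD) hD,
      show (n - 2 * k) = n - k - k by ring]
    simp only [neg_add, neg_sub, zpow_add₀ hq, zpow_sub₀ hq, zpow_neg, zpow_one]
    have := zpow_ne_zero n hq
    have := zpow_ne_zero k hq
    field_simp
    ring

/-- The action on the simple module with basis `v_0, …, v_n`. -/
def action (n : ℕ) : Uq q →ₐ[ℂ] Module.End ℂ (Fin (n + 1) → ℂ) :=
  Uq.lift (K q n) (Kinv q n) (X q n) (Y n)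
    (vec_ext fun k => by
      rw [Module.End.mul_apply, Kinv_vec, map_smul, K_vec, smul_smul, ← zpow_add₀ q.ne_zero,
        neg_add_cancel, zpow_zero, one_smul, Module.End.one_apply])
    (vec_ext fun k => by
      rw [Module.End.mul_apply, K_vec, map_smul, Kinv_vec, smul_smul, ← zpow_add₀ q.ne_zero,
        add_neg_cancel, zpow_zero, one_smul, Module.End.one_apply])
    (vec_ext fun k => by
      simp only [Module.End.mul_apply, Kinv_vec, map_smul, K_vec, X_vec, smul_smul,
        LinearMap.smul_apply]
      obtain _ | k := k
      · simp [qint_zero]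
      · congr 1
        have h : (q : ℂ) ^ (-((n : ℤ) - 2 * (k + 1 : ℕ))) * (q : ℂ) ^ ((n : ℤ) - 2 * (k : ℕ)) =
            (q : ℂ) ^ 2 := by
          rw [← zpow_add₀ q.ne_zero, ← zpow_natCast]
          congr 1
          push_cast; ring
        rw [Nat.add_sub_cancel]
        linear_combination (qint q (k + 1 : ℕ) * qint q (n - (k + 1 : ℕ) + 1)) * h)
    (vec_ext fun k => by
      simp only [Module.End.mul_apply, Kinv_vec, map_smul, K_vec, Y_vec, smul_smul,
        LinearMap.smul_apply]
      congr 1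
      rw [← zpow_add₀ q.ne_zero, ← zpow_natCast, inv_zpow', ]
      congr 1
      push_cast; omega)
    (vec_ext fun k => by
      simp only [Module.End.mul_apply, Kinv_vec, map_smul, K_vec, X_vec, Y_vec,
        LinearMap.smul_apply, LinearMap.sub_apply]
      have h := qint_mul_sub q n k
      rw [← sub_smul, smul_smul, inv_mul_eq_div]
      change _ = qint q _ • _
      have h' : (n : ℤ) - (k + 1 : ℕ) + 1 = n - k := by push_cast; ring
      rw [← h, sub_smul, h', Nat.add_sub_cancel, Nat.cast_succ]
      obtain _ | k := k
      · simp [qint_zero]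
      · rfl)

theorem action_K (n : ℕ) : action q n (Uq.K q) = K q n := Uq.lift_K
theorem action_Kinv (n : ℕ) : action q n (Uq.Kinv q) = Kinv q n := Uq.lift_Kinv
theorem action_X (n : ℕ) : action q n (Uq.X q) = X q n := Uq.lift_X
theorem action_Y (n : ℕ) : action q n (Uq.Y q) = Y n := Uq.lift_Y

end

end SimpleModule

/-! ### The universal R-matrix -/

section

open scoped TensorProduct

namespace Uq

variable (q : ℂˣ)

theorem one_add_qint_mul (l : ℕ) (hD : (q : ℂ) - (q : ℂ)⁻¹ ≠ 0) :
    1 + qint q (l + 1) * ((q : ℂ) ^ l * (q : ℂ) ^ 2) = qint q (l + 1 + 1) * (q : ℂ) ^ (l + 1) := by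
  have hq := q.ne_zero
  simp only [qint]
  rw [eq_comm, ← sub_eq_iff_eq_add, div_mul_eq_mul_div, div_mul_eq_mul_div, ← sub_div,
    div_eq_iff hD]
  simp only [neg_add, zpow_add₀ hq, zpow_neg, zpow_one, zpow_natCast, pow_succ]
  have := pow_ne_zero l hq
  field_simp
  ring

theorem one_add_qint_mul_inv (l : ℕ) (hD : (q : ℂ) - (q : ℂ)⁻¹ ≠ 0) :
    1 + qint q (l + 1) * ((q : ℂ)⁻¹ ^ l * (q : ℂ)⁻¹ ^ 2) =
      qint q (l + 1 + 1) * (q : ℂ)⁻¹ ^ (l + 1) := by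
  have hq := q.ne_zero
  simp only [qint]
  rw [eq_comm, ← sub_eq_iff_eq_add, div_mul_eq_mul_div, div_mul_eq_mul_div, ← sub_div,
    div_eq_iff hD]
  simp only [neg_add, zpow_add₀ hq, zpow_neg, zpow_one, zpow_natCast, pow_succ, inv_pow]
  have := pow_ne_zero l hq
  field_simp
  ring

theorem qint_one_mul (hD : (q : ℂ) - (q : ℂ)⁻¹ ≠ 0) : qint q 1 = 1 := by
  rw [qint, zpow_one, zpow_neg_one, div_self hD]

theorem smul_combine {M : Type*} [AddCommGroup M] [Module ℂ M] (A B : M) {d c c' s t s' t' : ℂ}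
    (h₁ : 1 + c * s = c' * s') (h₂ : 1 + c * t = c' * t') :
    d • (A - B) + (c * d) • (s • A - t • B) = (c' * d) • (s' • A - t' • B) := by
  have : (c' * d) • (s' • A - t' • B) = d • ((c' * s') • A - (c' * t') • B) := by module
  rw [this, ← h₁, ← h₂]
  module

theorem smul_combine' {M : Type*} [AddCommGroup M] [Module ℂ M] (A B : M) {t t' : ℂ} (c : ℂ)
    (h : t * t' = 1) : c • ((t * t) • A - B) = (c * t) • (t • A - t' • B) := by
  have : (c * t) • (t • A - t' • B) = c • ((t * t) • A - (t * t') • B) := by module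
  rw [this, h, one_smul]

theorem smul_combine_neg {M : Type*} [AddCommGroup M] [Module ℂ M] (A B : M) {t t' : ℂ} (c : ℂ)
    (h : t * t' = 1) : c • ((t * t) • A - B) = -((c * t) • (t' • B - t • A)) := by
  rw [smul_combine' A B c h, ← smul_neg, neg_sub]

theorem X_mul_Y_pow (hD : (q : ℂ) - (q : ℂ)⁻¹ ≠ 0) (l : ℕ) :
    X q * Y q ^ (l + 1) = Y q ^ (l + 1) * X q + (qint q (l + 1) * ((q : ℂ) - (q : ℂ)⁻¹)⁻¹) •
      (Y q ^ l * ((q : ℂ)⁻¹ ^ l • K q - (q : ℂ) ^ l • Kinv q)) := by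
  have hXY : X q * Y q = Y q * X q + ((q : ℂ) - (q : ℂ)⁻¹)⁻¹ • (K q - Kinv q) := by
    rw [← X_mul_Y_sub]; abel
  induction l with
  | zero => simp [hXY, qint_one_mul q hD]
  | succ l ih =>
    rw [pow_succ, ← mul_assoc, ih, add_mul, mul_assoc, hXY, smul_mul_assoc, mul_assoc _ _ (Y q),
      sub_mul, smul_mul_assoc, smul_mul_assoc, K_mul_Y, Kinv_mul_Y, smul_smul, smul_smul, mul_add,
      ← mul_assoc, mul_smul_comm, add_assoc]
    congr 1
    simp only [mul_sub, mul_smul_comm, ← mul_assoc, ← pow_succ]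
    rw [← mul_sub]
    rw [mul_sub, Nat.cast_succ]
    exact smul_combine _ _ (one_add_qint_mul_inv q l hD) (one_add_qint_mul q l hD)

theorem Y_mul_X_pow (hD : (q : ℂ) - (q : ℂ)⁻¹ ≠ 0) (l : ℕ) :
    Y q * X q ^ (l + 1) = X q ^ (l + 1) * Y q - (qint q (l + 1) * ((q : ℂ) - (q : ℂ)⁻¹)⁻¹) •
      (X q ^ l * ((q : ℂ) ^ l • K q - (q : ℂ)⁻¹ ^ l • Kinv q)) := by
  have hXY : Y q * X q = X q * Y q - ((q : ℂ) - (q : ℂ)⁻¹)⁻¹ • (K q - Kinv q) := by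
    rw [← X_mul_Y_sub]; abel
  induction l with
  | zero => simp [hXY, qint_one_mul q hD]
  | succ l ih =>
    rw [pow_succ, ← mul_assoc, ih, sub_mul, mul_assoc, hXY, smul_mul_assoc, mul_assoc _ _ (X q),
      sub_mul, smul_mul_assoc, smul_mul_assoc, K_mul_X, Kinv_mul_X, smul_smul, smul_smul, mul_sub,
      ← mul_assoc, mul_smul_comm, sub_sub]
    congr 1
    simp only [mul_sub, mul_smul_comm, ← mul_assoc, ← pow_succ]
    rw [Nat.cast_succ]
    exact smul_combine _ _ (one_add_qint_mul q l hD) (one_add_qint_mul_inv q l hD)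

/-- The coefficient `(q - q⁻¹)^l q^{l(l-1)/2} / [l]!`. -/
def rCoeff : ℕ → ℂ
  | 0 => 1
  | l + 1 => rCoeff l * (((q : ℂ) - (q : ℂ)⁻¹) * (q : ℂ) ^ l / qint q (l + 1))

/-- The truncation `∑_{l ≤ n} (q - q⁻¹)^l q^{l(l-1)/2} / [l]! • X^l ⊗ Y^l` of the
quasi-R-matrix. -/
def quasiR (n : ℕ) : Uq q ⊗[ℂ] Uq q :=
  ∑ l ∈ Finset.range (n + 1), rCoeff q l • ((X q ^ l) ⊗ₜ[ℂ] (Y q ^ l))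

theorem Kinv_mul_Y_pow (n : ℕ) :
    Kinv q * Y q ^ n = ((q : ℂ) ^ n * (q : ℂ) ^ n) • (Y q ^ n * Kinv q) := by
  induction n with
  | zero => simp
  | succ n ih =>
    rw [pow_succ, ← mul_assoc, ih, smul_mul_assoc, mul_assoc, Kinv_mul_Y, mul_smul_comm,
      smul_smul, ← mul_assoc]
    congr 1; ring

theorem K_mul_X_pow (n : ℕ) :
    K q * X q ^ n = ((q : ℂ) ^ n * (q : ℂ) ^ n) • (X q ^ n * K q) := by
  induction n with
  | zero => simp
  | succ n ih =>
    rw [pow_succ, ← mul_assoc, ih, smul_mul_assoc, mul_assoc, K_mul_X, mul_smul_comm,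
      smul_smul, ← mul_assoc]
    congr 1; ring

theorem K_mul_Y_pow (n : ℕ) :
    K q * Y q ^ n = ((q : ℂ)⁻¹ ^ n * (q : ℂ)⁻¹ ^ n) • (Y q ^ n * K q) := by
  induction n with
  | zero => simp
  | succ n ih =>
    rw [pow_succ, ← mul_assoc, ih, smul_mul_assoc, mul_assoc, K_mul_Y, mul_smul_comm,
      smul_smul, ← mul_assoc]
    congr 1; ring

theorem pow_mul_inv_pow (n : ℕ) : (q : ℂ) ^ n * (q : ℂ)⁻¹ ^ n = 1 := by
  rw [← mul_pow, mul_inv_cancel₀ q.ne_zero, one_pow]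

theorem rCoeff_succ_mul (hD : (q : ℂ) - (q : ℂ)⁻¹ ≠ 0) {n : ℕ} (hn : qint q (n + 1) ≠ 0) :
    rCoeff q (n + 1) * (qint q (n + 1) * ((q : ℂ) - (q : ℂ)⁻¹)⁻¹) = rCoeff q n * (q : ℂ) ^ n := by
  rw [rCoeff]
  generalize qint q (n + 1) = x at *
  generalize (q : ℂ) - (q : ℂ)⁻¹ = y at *
  field_simp

theorem quasiR_K (n : ℕ) :
    (K q ⊗ₜ[ℂ] K q) * quasiR q n = quasiR q n * (K q ⊗ₜ[ℂ] K q) := by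
  rw [quasiR, Finset.mul_sum, Finset.sum_mul]
  refine Finset.sum_congr rfl fun l _ => ?_
  rw [mul_smul_comm, smul_mul_assoc, Algebra.TensorProduct.tmul_mul_tmul, K_mul_X_pow, K_mul_Y_pow,
    TensorProduct.smul_tmul_smul, mul_mul_mul_comm, pow_mul_inv_pow, mul_one, one_smul,
    Algebra.TensorProduct.tmul_mul_tmul]

variable {q}

theorem quasiR_X (hD : (q : ℂ) - (q : ℂ)⁻¹ ≠ 0) (n : ℕ)
    (hn : ∀ l < n, qint q (l + 1) ≠ 0) :
    (X q ⊗ₜ[ℂ] Kinv q + 1 ⊗ₜ[ℂ] X q) * quasiR q n =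
      quasiR q n * (1 ⊗ₜ[ℂ] X q + X q ⊗ₜ[ℂ] K q) +
      rCoeff q n • ((X q ^ (n + 1)) ⊗ₜ[ℂ] (Kinv q * Y q ^ n - Y q ^ n * K q)) := by
  induction n with
  | zero =>
    simp [quasiR, rCoeff, ← Algebra.TensorProduct.one_def, TensorProduct.tmul_sub]; abel
  | succ n ih =>
    have ih := ih fun l hl => hn l (hl.trans n.lt_succ_self)
    have hc := rCoeff_succ_mul q hD (hn n n.lt_succ_self)
    rw [quasiR, Finset.sum_range_succ, ← quasiR, mul_add, ih, add_mul (quasiR q n), add_assoc, add_assoc]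
    congr 1
    rw [mul_smul_comm, smul_mul_assoc, add_mul, mul_add]
    simp only [Algebra.TensorProduct.tmul_mul_tmul, one_mul, mul_one, ← pow_succ, ← pow_succ']
    rw [X_mul_Y_pow q hD n, TensorProduct.tmul_add, TensorProduct.tmul_smul, Kinv_mul_Y_pow q n,
      TensorProduct.tmul_sub (_ ^ (n + 1 + 1))]
    have e : rCoeff q n • ((X q ^ (n + 1)) ⊗ₜ[ℂ] (((q : ℂ) ^ n * (q : ℂ) ^ n) •
        (Y q ^ n * Kinv q) - Y q ^ n * K q)) =
        -((rCoeff q (n + 1) * (qint q (n + 1) * ((q : ℂ) - (q : ℂ)⁻¹)⁻¹)) •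
        ((X q ^ (n + 1)) ⊗ₜ[ℂ] (Y q ^ n * ((q : ℂ)⁻¹ ^ n • K q - (q : ℂ) ^ n • Kinv q)))) := by
      have hq := pow_mul_inv_pow q n
      rw [hc]
      simp only [TensorProduct.tmul_sub, TensorProduct.tmul_smul, mul_sub, mul_smul_comm]
      exact smul_combine_neg (M := Uq q ⊗[ℂ] Uq q) _ _ _ hq
    rw [e]
    simp only [smul_add, smul_sub, smul_smul]
    abel

theorem quasiR_Y (hD : (q : ℂ) - (q : ℂ)⁻¹ ≠ 0) (n : ℕ)
    (hn : ∀ l < n, qint q (l + 1) ≠ 0) :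
    (Y q ⊗ₜ[ℂ] 1 + K q ⊗ₜ[ℂ] Y q) * quasiR q n =
      quasiR q n * (Kinv q ⊗ₜ[ℂ] Y q + Y q ⊗ₜ[ℂ] 1) +
      rCoeff q n • ((K q * X q ^ n - X q ^ n * Kinv q) ⊗ₜ[ℂ] (Y q ^ (n + 1))) := by
  induction n with
  | zero =>
    simp [quasiR, rCoeff, ← Algebra.TensorProduct.one_def, TensorProduct.sub_tmul]; abel
  | succ n ih =>
    have ih := ih fun l hl => hn l (hl.trans n.lt_succ_self)
    have hc := rCoeff_succ_mul q hD (hn n n.lt_succ_self)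
    rw [quasiR, Finset.sum_range_succ, ← quasiR, mul_add, ih, add_mul (quasiR q n), add_assoc, add_assoc]
    congr 1
    rw [mul_smul_comm, smul_mul_assoc, add_mul, mul_add]
    simp only [Algebra.TensorProduct.tmul_mul_tmul, one_mul, mul_one, ← pow_succ, ← pow_succ']
    rw [Y_mul_X_pow q hD n, TensorProduct.sub_tmul (X q ^ (n + 1) * Y q), ← TensorProduct.smul_tmul', K_mul_X_pow q n,
      TensorProduct.sub_tmul _ _ (_ ^ (n + 1 + 1))]
    have e : rCoeff q n • ((((q : ℂ) ^ n * (q : ℂ) ^ n) •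
        (X q ^ n * K q) - X q ^ n * Kinv q) ⊗ₜ[ℂ] (Y q ^ (n + 1))) =
        (rCoeff q (n + 1) * (qint q (n + 1) * ((q : ℂ) - (q : ℂ)⁻¹)⁻¹)) •
        ((X q ^ n * ((q : ℂ) ^ n • K q - (q : ℂ)⁻¹ ^ n • Kinv q)) ⊗ₜ[ℂ] (Y q ^ (n + 1))) := by
      have hq := pow_mul_inv_pow q n
      rw [hc]
      simp only [TensorProduct.sub_tmul, ← TensorProduct.smul_tmul', mul_sub, mul_smul_comm]
      exact smul_combine' (M := Uq q ⊗[ℂ] Uq q) _ _ _ hq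
    rw [e]
    simp only [smul_add, smul_sub, smul_smul]
    abel

end Uq

end

/-! ### Braiding and duality of the simple modules -/

/-- The index set of the simple modules: all `n ≥ 0` if `q` is not a root of unity, and
`{0, …, r - 2}` if `q` is a primitive `2r`-th root of unity. -/
def SimpleIndex (q : ℂˣ) : Set ℕ := {n | ∀ r : ℕ, 0 < r → (q : ℂ) ^ (2 * r) = 1 → n + 2 ≤ r}

theorem SimpleIndex.qint_ne_zero {q : ℂˣ} {n : ℕ} (hn : n ∈ SimpleIndex q) {l : ℕ} (hl : l ≤ n) :
    (q : ℂ) ^ ((l : ℤ) + 1) - (q : ℂ) ^ (-((l : ℤ) + 1)) ≠ 0 := fun h => by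
  have h₂ : (q : ℂ) ^ (2 * (l + 1)) = 1 := by
    rw [sub_eq_zero, zpow_neg] at h
    have h' := mul_inv_cancel₀ (zpow_ne_zero ((l : ℤ) + 1) q.ne_zero)
    rw [← h, ← zpow_add₀ q.ne_zero] at h'
    rw [← h', ← zpow_natCast]
    congr 1
    push_cast; ring
  have := hn (l + 1) l.succ_pos h₂
  omega

namespace SimpleModule

section

variable {q : ℂˣ}

theorem sub_ne_zero_of_mem {n : ℕ} (hn : n ∈ SimpleIndex q) : (q : ℂ) - (q : ℂ)⁻¹ ≠ 0 := by
  simpa using SimpleIndex.qint_ne_zero hn n.zero_le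

theorem qint_ne_zero_of_mem {n : ℕ} (hn : n ∈ SimpleIndex q) {l : ℕ} (hl : l < n) :
    qint q (l + 1) ≠ 0 :=
  div_ne_zero (SimpleIndex.qint_ne_zero hn hl.le) (sub_ne_zero_of_mem hn)

theorem X_pow_vec_of_lt (n : ℕ) {p k : ℕ} (h : k < p) : (X q n ^ p) (vec n k) = 0 := by
  induction p generalizing k with
  | zero => omega
  | succ p ih =>
    rw [pow_succ, Module.End.mul_apply, X_vec, map_smul]
    obtain _ | k := k
    · simp [qint_zero]
    · rw [Nat.add_sub_cancel, ih (by omega), smul_zero]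

theorem X_pow_vec_self (n p : ℕ) : ∃ c : ℂ, (X q n ^ p) (vec n p) = c • vec n 0 := by
  induction p with
  | zero => exact ⟨1, by simp⟩
  | succ p ih =>
    obtain ⟨c, hc⟩ := ih
    refine ⟨qint q (p + 1 : ℕ) * qint q (n - (p + 1 : ℕ) + 1) * c, ?_⟩
    rw [pow_succ, Module.End.mul_apply, X_vec, map_smul, Nat.add_sub_cancel, hc, smul_smul]

theorem X_pow_succ_eq_zero (n : ℕ) : X q n ^ (n + 1) = 0 := vec_ext fun k => by
  obtain h | h := le_or_gt k n
  · rw [X_pow_vec_of_lt n (by omega), LinearMap.zero_apply]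
  · rw [vec_eq_zero h, map_zero, map_zero]

theorem K_mul_X_pow_sub (n : ℕ) : K q n * X q n ^ n - X q n ^ n * Kinv q n = 0 :=
  vec_ext fun k => by
    rw [LinearMap.zero_apply, LinearMap.sub_apply, Module.End.mul_apply, Module.End.mul_apply,
      Kinv_vec, map_smul]
    obtain h | h | h := lt_trichotomy k n
    · rw [X_pow_vec_of_lt n h, map_zero, smul_zero, sub_zero]
    · subst h
      obtain ⟨c, hc⟩ := X_pow_vec_self (q := q) k k
      rw [hc, map_smul, K_vec, smul_smul, smul_smul, mul_comm, sub_eq_zero]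
      congr 3
      push_cast; ring
    · rw [vec_eq_zero h, map_zero, map_zero, smul_zero, sub_zero]

variable (q) in
/-- The action of the tensor square of the algebra. -/
def action₂ (n m : ℕ) : TensorProduct ℂ (Uq q) (Uq q) →ₐ[ℂ]
    Module.End ℂ (TensorProduct ℂ (Fin (n + 1) → ℂ) (Fin (m + 1) → ℂ)) :=
  (Module.endTensorEndAlgHom (R := ℂ) (S := ℂ) (A := ℂ)).comp
    (Algebra.TensorProduct.map (action q n) (action q m))

theorem action₂_tmul (n m : ℕ) (u v : Uq q) :
    action₂ q n m (u ⊗ₜ v) = TensorProduct.map (action q n u) (action q m v) := rfl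

theorem action₂_comul (n m : ℕ) (u : Uq q) :
    action₂ q n m (Uq.comul q u) = tensorAction (action q n) (action q m) u := rfl

end

section

variable (a : ℂˣ)

/-- `v_i ⊗ v_j ↦ a^{(n-2i)(m-2j)} v_i ⊗ v_j` -/
def weightTwist (n m : ℕ) :
    Module.End ℂ (TensorProduct ℂ (Fin (n + 1) → ℂ) (Fin (m + 1) → ℂ)) :=
  onVec₂ n m fun i j =>
    (a : ℂ) ^ (((n : ℤ) - 2 * i) * ((m : ℤ) - 2 * j)) • (vec n i ⊗ₜ[ℂ] vec m j)

theorem weightTwist_vec (n m i j : ℕ) : weightTwist a n m (vec n i ⊗ₜ vec m j) =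
    (a : ℂ) ^ (((n : ℤ) - 2 * i) * ((m : ℤ) - 2 * j)) • (vec n i ⊗ₜ[ℂ] vec m j) :=
  onVec₂_vec (fun i j h => by
    obtain h | h := h
    · rw [vec_eq_zero h, TensorProduct.zero_tmul, smul_zero]
    · rw [vec_eq_zero h, TensorProduct.tmul_zero, smul_zero]) i j

variable {a} {q : ℂˣ}

theorem q_zpow (hq : q = a ^ 2) (z : ℤ) : (q : ℂ) ^ z = (a : ℂ) ^ (2 * z) := by
  rw [hq, Units.val_pow_eq_pow_val, zpow_mul]; rfl

variable (n m : ℕ)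

theorem weightTwist_K : weightTwist a n m ∘ₗ TensorProduct.map (K q n) (K q m) =
    TensorProduct.map (K q n) (K q m) ∘ₗ weightTwist a n m :=
  vec_ext₂ fun i j => by
    simp only [LinearMap.comp_apply, TensorProduct.map_tmul, K_vec, weightTwist_vec, map_smul,
      TensorProduct.smul_tmul_smul]
    rw [smul_comm]

/-- Scalar bookkeeping for the next four facts. -/
theorem q_zpow_mul (hq : q = a ^ 2) {x y z : ℤ} (h : 2 * x + y = z) :
    (q : ℂ) ^ x * (a : ℂ) ^ y = (a : ℂ) ^ z := by
  rw [q_zpow hq, ← zpow_add₀ a.ne_zero, h]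

theorem weightTwist_X_left (hq : q = a ^ 2) :
    weightTwist a n m ∘ₗ TensorProduct.map (X q n) (Kinv q m) =
      TensorProduct.map (X q n) LinearMap.id ∘ₗ weightTwist a n m :=
  vec_ext₂ fun i j => by
    simp only [LinearMap.comp_apply, TensorProduct.map_tmul, X_vec, Kinv_vec, weightTwist_vec,
      map_smul, TensorProduct.tmul_smul, ← TensorProduct.smul_tmul', LinearMap.id_apply,
      smul_smul]
    obtain _ | i := i
    · simp [qint_zero]
    · have h := q_zpow_mul hq (x := -((m : ℤ) - 2 * j))
        (y := ((n : ℤ) - 2 * i) * ((m : ℤ) - 2 * j))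
        (z := ((n : ℤ) - 2 * (i + 1 : ℕ)) * ((m : ℤ) - 2 * j)) (by push_cast; ring)
      rw [Nat.add_sub_cancel, ← h]
      congr 1
      ring

theorem weightTwist_X_right (hq : q = a ^ 2) :
    weightTwist a n m ∘ₗ TensorProduct.map LinearMap.id (X q m) =
      TensorProduct.map (K q n) (X q m) ∘ₗ weightTwist a n m :=
  vec_ext₂ fun i j => by
    simp only [LinearMap.comp_apply, TensorProduct.map_tmul, X_vec, K_vec, weightTwist_vec,
      map_smul, TensorProduct.tmul_smul, ← TensorProduct.smul_tmul', LinearMap.id_apply,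
      smul_smul]
    obtain _ | j := j
    · simp [qint_zero]
    · have h := q_zpow_mul hq (x := (n : ℤ) - 2 * i)
        (y := ((n : ℤ) - 2 * i) * ((m : ℤ) - 2 * (j + 1 : ℕ)))
        (z := ((n : ℤ) - 2 * i) * ((m : ℤ) - 2 * j)) (by push_cast; ring)
      rw [Nat.add_sub_cancel, ← h]
      congr 1
      ring

theorem weightTwist_Y_left (hq : q = a ^ 2) :
    weightTwist a n m ∘ₗ TensorProduct.map (Y n) LinearMap.id =
      TensorProduct.map (Y n) (Kinv q m) ∘ₗ weightTwist a n m :=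
  vec_ext₂ fun i j => by
    simp only [LinearMap.comp_apply, TensorProduct.map_tmul, Y_vec, Kinv_vec, weightTwist_vec,
      map_smul, TensorProduct.tmul_smul, LinearMap.id_apply, smul_smul]
    rw [mul_comm _ ((q : ℂ) ^ _), q_zpow_mul hq]
    push_cast; ring

theorem weightTwist_Y_right (hq : q = a ^ 2) :
    weightTwist a n m ∘ₗ TensorProduct.map (K q n) (Y m) =
      TensorProduct.map LinearMap.id (Y m) ∘ₗ weightTwist a n m :=
  vec_ext₂ fun i j => by
    simp only [LinearMap.comp_apply, TensorProduct.map_tmul, Y_vec, K_vec, weightTwist_vec,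
      map_smul, ← TensorProduct.smul_tmul', LinearMap.id_apply, smul_smul]
    rw [q_zpow_mul hq]
    push_cast; ring

variable (a q) in
/-- The braiding of `V_n` and `V_m`: the action of the R-matrix followed by the flip. -/
def braiding : TensorProduct ℂ (Fin (n + 1) → ℂ) (Fin (m + 1) → ℂ) →ₗ[ℂ]
    TensorProduct ℂ (Fin (m + 1) → ℂ) (Fin (n + 1) → ℂ) :=
  (TensorProduct.comm ℂ _ _).toLinearMap ∘ₗ weightTwist a n m ∘ₗ action₂ q n m (Uq.quasiR q n)

variable {n} in
theorem braiding_intertwines (hq : q = a ^ 2) (hn : n ∈ SimpleIndex q) :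
    Intertwines (tensorAction (action q n) (action q m)) (tensorAction (action q m) (action q n))
      (braiding a q n m) := by
  have hD := sub_ne_zero_of_mem hn
  have hl := fun l (hl : l < n) => qint_ne_zero_of_mem hn hl
  have step : ∀ (u : Uq q) (y r : TensorProduct ℂ (Uq q) (Uq q))
      (z : Module.End ℂ (TensorProduct ℂ (Fin (n + 1) → ℂ) (Fin (m + 1) → ℂ))),
      y * Uq.quasiR q n = Uq.quasiR q n * Uq.comul q u + r → action₂ q n m r = 0 →
      weightTwist a n m ∘ₗ action₂ q n m y = z ∘ₗ weightTwist a n m →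
      (TensorProduct.comm ℂ _ _).toLinearMap ∘ₗ z =
        tensorAction (action q m) (action q n) u ∘ₗ (TensorProduct.comm ℂ _ _).toLinearMap →
      braiding a q n m ∘ₗ tensorAction (action q n) (action q m) u =
        tensorAction (action q m) (action q n) u ∘ₗ braiding a q n m := by
    intro u y r z h₁ h₂ h₃ h₄
    have h₅ : action₂ q n m (Uq.quasiR q n) ∘ₗ tensorAction (action q n) (action q m) u =
        action₂ q n m y ∘ₗ action₂ q n m (Uq.quasiR q n) := by
      rw [← action₂_comul, ← Module.End.mul_eq_comp, ← Module.End.mul_eq_comp, ← map_mul,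
        ← map_mul, h₁, map_add, h₂, add_zero]
    rw [braiding, LinearMap.comp_assoc, LinearMap.comp_assoc, h₅, ← LinearMap.comp_assoc _ _
      (weightTwist a n m), h₃, ← LinearMap.comp_assoc, ← LinearMap.comp_assoc,
      ← LinearMap.comp_assoc, ← LinearMap.comp_assoc, h₄]
  refine .of_generators ?_ ?_ ?_
  · refine step _ (Uq.K q ⊗ₜ Uq.K q) 0 (TensorProduct.map (K q n) (K q m)) ?_ (map_zero _)
      ?_ ?_
    · rw [Uq.quasiR_K, Uq.comul, Uq.lift_K, add_zero]
    · rw [action₂_tmul, action_K, action_K, weightTwist_K]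
    · rw [tensorAction_K, action_K, action_K]
      exact TensorProduct.ext' fun x y => rfl
  · refine step _ _ _ (TensorProduct.map (X q n) .id + TensorProduct.map (K q n) (X q m))
      ((Uq.quasiR_X hD n hl).trans (by rw [Uq.comul, Uq.lift_X])) ?_ ?_ ?_
    · rw [map_smul, action₂_tmul, map_pow, action_X, X_pow_succ_eq_zero, TensorProduct.map_zero_left,
        smul_zero]
    · rw [map_add, action₂_tmul, action₂_tmul, action_X, action_X, action_Kinv, map_one,
        LinearMap.comp_add, LinearMap.add_comp, weightTwist_X_left n m hq,
        ← weightTwist_X_right n m hq]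
      rfl
    · rw [tensorAction_X, action_X, action_X, action_K]
      exact TensorProduct.ext' fun x y => rfl
  · refine step _ _ _ (TensorProduct.map (Y n) (Kinv q m) + TensorProduct.map .id (Y m))
      ((Uq.quasiR_Y hD n hl).trans (by rw [Uq.comul, Uq.lift_Y])) ?_ ?_ ?_
    · rw [map_smul, action₂_tmul, map_sub, map_mul, map_mul, map_pow, action_X, action_K,
        action_Kinv, K_mul_X_pow_sub, TensorProduct.map_zero_left, smul_zero]
    · rw [map_add, action₂_tmul, action₂_tmul, action_Y, action_Y, action_K, map_one,
        LinearMap.comp_add, LinearMap.add_comp, ← weightTwist_Y_left n m hq,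
        ← weightTwist_Y_right n m hq]
      rfl
    · rw [tensorAction_Y, action_Y, action_Y, action_Kinv]
      refine TensorProduct.ext' fun x y => ?_
      simp [add_comm]

end

end SimpleModule

namespace SimpleModule

section

variable (q : ℂˣ) (n : ℕ)

/-- The invariant form on `V_n`, with `v_i ⊗ v_{n-i} ↦ (-1)^i q^{-i(n-i+1)}` and all other
`v_i ⊗ v_j ↦ 0`. -/
def ev : TensorProduct ℂ (Fin (n + 1) → ℂ) (Fin (n + 1) → ℂ) →ₗ[ℂ] ℂ :=
  onVec₂ n n fun i j =>
    if i + j = n then (-1) ^ i * (q : ℂ) ^ (-((i : ℤ) * (n - i + 1))) else 0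

theorem ev_vec (i j : ℕ) : ev q n (vec n i ⊗ₜ vec n j) =
    if i + j = n then (-1) ^ i * (q : ℂ) ^ (-((i : ℤ) * (n - i + 1))) else 0 :=
  onVec₂_vec (fun i j h => if_neg (by omega)) i j

/-- The coefficient of `v_i ⊗ v_{n-i}` in the invariant element. -/
def coevCoeff (i : ℕ) : ℂ := (-1) ^ (n - i) * (q : ℂ) ^ (((n : ℤ) - i) * (i + 1))

/-- The invariant element `∑ (-1)^{n-i} q^{(n-i)(i+1)} v_i ⊗ v_{n-i}` of `V_n ⊗ V_n`, as a
linear map. -/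
def coev : ℂ →ₗ[ℂ] TensorProduct ℂ (Fin (n + 1) → ℂ) (Fin (n + 1) → ℂ) :=
  LinearMap.toSpanSingleton ℂ _
    (∑ i ∈ Finset.range (n + 1), coevCoeff q n i • (vec n i ⊗ₜ[ℂ] vec n (n - i)))

theorem ev_intertwines :
    Intertwines (tensorAction (action q n) (action q n)) (trivialAction q) (ev q n) := by
  refine .of_generators ?_ ?_ ?_ <;> refine vec_ext₂ fun i j => ?_
  · rw [tensorAction_K, trivialAction_K, action_K]
    simp only [LinearMap.comp_apply, TensorProduct.map_tmul, K_vec, TensorProduct.smul_tmul_smul,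
      map_smul, LinearMap.id_apply, ev_vec]
    split_ifs with h
    · rw [← zpow_add₀ q.ne_zero, show (n : ℤ) - 2 * i + (n - 2 * j) = 0 by omega, zpow_zero,
        one_smul]
    · rw [smul_zero]
  · rw [tensorAction_X, trivialAction_X, action_X, action_K]
    simp only [LinearMap.comp_apply, LinearMap.add_apply, TensorProduct.map_tmul, K_vec, X_vec,
      ← TensorProduct.smul_tmul', TensorProduct.tmul_smul, map_smul, LinearMap.id_apply, map_add,
      ev_vec, LinearMap.zero_apply]
    by_cases h : i + j = n + 1
    · obtain _ | i := i
      · have : (n : ℤ) - (j : ℕ) + 1 = 0 := by omega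
        simp [qint_zero, this]
      · obtain _ | j := j
        · have : (n : ℤ) - (i + 1 : ℕ) + 1 = 0 := by omega
          rw [this]
          simp [qint_zero]
        · rw [Nat.add_sub_cancel, Nat.add_sub_cancel, if_pos (by omega), if_pos (by omega)]
          have h₁ : (n : ℤ) - (j + 1 : ℕ) + 1 = (i + 1 : ℕ) := by omega
          have h₂ : (n : ℤ) - (i + 1 : ℕ) + 1 = (j + 1 : ℕ) := by omega
          have h₃ : (q : ℂ) ^ (-((i : ℤ) * (n - i + 1))) * (q : ℂ) ^ ((n : ℤ) - 2 * (j + 1 : ℕ)) =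
              (q : ℂ) ^ (-(((i + 1 : ℕ) : ℤ) * (n - (i + 1 : ℕ) + 1))) := by
            rw [← zpow_add₀ q.ne_zero]
            congr 1
            have : (n : ℤ) = i + j + 1 := by omega
            rw [this]; push_cast; ring
          rw [← h₃, h₁, h₂]
          simp only [smul_eq_mul, pow_succ]
          ring
    · have h₁ : (qint q i * qint q (n - i + 1)) * (if i - 1 + j = n then (-1) ^ (i - 1) *
          (q : ℂ) ^ (-(((i - 1 : ℕ) : ℤ) * (n - (i - 1 : ℕ) + 1))) else 0) = 0 := by
        obtain _ | i := i
        · simp [qint_zero]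
        · rw [if_neg (by omega), mul_zero]
      have h₂ : (qint q j * qint q (n - j + 1)) * (if i + (j - 1) = n then (-1) ^ i *
          (q : ℂ) ^ (-((i : ℤ) * (n - i + 1))) else 0) = 0 := by
        obtain _ | j := j
        · simp [qint_zero]
        · rw [if_neg (by omega), mul_zero]
      simp only [smul_eq_mul]
      linear_combination h₂ + (q : ℂ) ^ ((n : ℤ) - 2 * j) * h₁
  · rw [tensorAction_Y, trivialAction_Y, action_Y, action_Kinv]
    simp only [LinearMap.comp_apply, LinearMap.add_apply, TensorProduct.map_tmul, Kinv_vec, Y_vec,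
      ← TensorProduct.smul_tmul', map_smul, LinearMap.id_apply, map_add,
      ev_vec, LinearMap.zero_apply]
    by_cases h : i + 1 + j = n
    · rw [if_pos (by omega), if_pos h, smul_eq_mul]
      have h₃ : (q : ℂ) ^ (-((n : ℤ) - 2 * i)) * (q : ℂ) ^ (-((i : ℤ) * (n - i + 1))) =
          (q : ℂ) ^ (-(((i + 1 : ℕ) : ℤ) * (n - (i + 1 : ℕ) + 1))) := by
        rw [← zpow_add₀ q.ne_zero]
        congr 1
        push_cast; ring
      rw [← h₃]
      ring
    · rw [if_neg (by omega), if_neg h, smul_zero, add_zero]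

theorem coevCoeff_succ {i : ℕ} (hi : i < n) :
    coevCoeff q n (i + 1) * (q : ℂ) ^ (-((n : ℤ) - 2 * (i + 1 : ℕ))) = -coevCoeff q n i := by
  have h₁ : (-1 : ℂ) ^ (n - i) = -(-1) ^ (n - (i + 1)) := by
    rw [show n - i = n - (i + 1) + 1 by omega, pow_succ]; ring
  have h₂ : (q : ℂ) ^ (((n : ℤ) - (i + 1 : ℕ)) * ((i + 1 : ℕ) + 1)) *
      (q : ℂ) ^ (-((n : ℤ) - 2 * (i + 1 : ℕ))) = (q : ℂ) ^ (((n : ℤ) - i) * (i + 1)) := by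
    rw [← zpow_add₀ q.ne_zero]
    congr 1
    push_cast; ring
  rw [coevCoeff, coevCoeff, h₁, ← h₂]
  ring

theorem coev_intertwines :
    Intertwines (trivialAction q) (tensorAction (action q n) (action q n)) (coev q n) := by
  refine .of_generators ?_ ?_ ?_ <;> refine LinearMap.ext_ring ?_
  · rw [tensorAction_K, trivialAction_K, action_K]
    simp only [LinearMap.comp_apply, coev, LinearMap.toSpanSingleton_apply, one_smul, map_sum,
      map_smul, TensorProduct.map_tmul, K_vec, TensorProduct.smul_tmul_smul, LinearMap.id_apply]
    refine Finset.sum_congr rfl fun i hi => ?_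
    have := Finset.mem_range.1 hi
    rw [← zpow_add₀ q.ne_zero, show (n : ℤ) - 2 * i + (n - 2 * (n - i : ℕ)) = 0 by omega,
      zpow_zero, one_smul]
  · rw [tensorAction_X, trivialAction_X, action_X, action_K]
    simp only [LinearMap.comp_apply, coev, LinearMap.toSpanSingleton_apply, one_smul, map_sum,
      map_smul, TensorProduct.map_tmul, K_vec, X_vec, ← TensorProduct.smul_tmul',
      LinearMap.id_apply, LinearMap.zero_apply, map_zero, LinearMap.add_apply,
      TensorProduct.tmul_smul, smul_add, Finset.sum_add_distrib, smul_smul]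
    rw [Finset.sum_range_succ, Finset.sum_range_succ', Nat.sub_self, Nat.cast_zero, qint_zero]
    simp only [mul_zero, zero_mul, zero_smul, add_zero]
    rw [← Finset.sum_add_distrib]
    refine (Finset.sum_eq_zero fun i hi => ?_).symm
    have hi := Finset.mem_range.1 hi
    have h := coevCoeff_succ q n hi
    have e : (n : ℤ) - 2 * (n - (i + 1) : ℕ) = -((n : ℤ) - 2 * (i + 1 : ℕ)) := by omega
    have e₁ : (n : ℤ) - (n - i : ℕ) + 1 = (i + 1 : ℕ) := by omega
    have e₂ : (n : ℤ) - (i + 1 : ℕ) + 1 = (n - i : ℕ) := by omega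
    rw [e, e₁, e₂, Nat.add_sub_cancel, show n - i - 1 = n - (i + 1) by omega, ← add_smul]
    refine smul_eq_zero_of_left ?_ _
    linear_combination (qint q (i + 1 : ℕ) * qint q (n - i : ℕ)) * h
  · rw [tensorAction_Y, trivialAction_Y, action_Y, action_Kinv]
    simp only [LinearMap.comp_apply, coev, LinearMap.toSpanSingleton_apply, one_smul, map_sum,
      map_smul, TensorProduct.map_tmul, Kinv_vec, Y_vec, ← TensorProduct.smul_tmul',
      LinearMap.id_apply, LinearMap.zero_apply, map_zero, LinearMap.add_apply,
      smul_add, Finset.sum_add_distrib, smul_smul]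
    rw [Finset.sum_range_succ', Finset.sum_range_succ, vec_eq_zero (k := n - 0 + 1) (by omega),
      vec_eq_zero (k := n + 1) (by omega)]
    simp only [TensorProduct.tmul_zero, TensorProduct.zero_tmul, smul_zero, add_zero]
    rw [← Finset.sum_add_distrib]
    refine (Finset.sum_eq_zero fun i hi => ?_).symm
    have hi := Finset.mem_range.1 hi
    have h := coevCoeff_succ q n hi
    rw [show n - (i + 1) + 1 = n - i by omega, ← add_smul]
    refine smul_eq_zero_of_left ?_ _
    linear_combination h

end

end SimpleModule

/-! ### The category of tensor products of simple modules -/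

/-- The simple module `V_n` of dimension `n + 1`. -/
def UqMod.simple (q : ℂˣ) (n : ℕ) : UqMod q :=
  ⟨ModuleCat.of ℂ (Fin (n + 1) → ℂ), SimpleModule.action q n⟩

/-- Iterated tensor products of the simple modules `V_n`, including the empty one. -/
inductive RepWord (q : ℂˣ)
  | unit
  | simple (n : SimpleIndex q)
  | tensor (W W' : RepWord q)

namespace RepWord

variable {q : ℂˣ}

/-- The module which is the iterated tensor product. -/
def toMod : RepWord q → UqMod q
  | unit => 𝟙_ (UqMod q)
  | simple n => UqMod.simple q n
  | tensor W W' => toMod W ⊗ toMod W'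

/-- The dual: the modules `V_n` are self-dual. -/
def dual : RepWord q → RepWord q
  | unit => unit
  | simple n => simple n
  | tensor W W' => tensor (dual W') (dual W)

end RepWord

/-- The full subcategory of the category of `U_q(sl_2)`-modules on the tensor products of the simple
modules `V_n`. -/
abbrev RepCat (q : ℂˣ) : Type := InducedCategory (UqMod q) (RepWord.toMod (q := q))

namespace RepCat

variable (q : ℂˣ)

instance monoidalStruct : MonoidalCategoryStruct (RepCat q) where
  tensorObj (W W' : RepWord q) := .tensor W W'
  tensorUnit := (.unit : RepWord q)
  whiskerLeft W _ _ f := InducedCategory.homMk (RepWord.toMod W ◁ f.hom)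
  whiskerRight f W := InducedCategory.homMk (f.hom ▷ RepWord.toMod W)
  tensorHom f g := InducedCategory.homMk (f.hom ⊗ₘ g.hom)
  associator W W' W'' := InducedCategory.isoMk (α_ (RepWord.toMod W) (RepWord.toMod W') (RepWord.toMod W''))
  leftUnitor W := InducedCategory.isoMk (λ_ (RepWord.toMod W))
  rightUnitor W := InducedCategory.isoMk (ρ_ (RepWord.toMod W))

instance monoidal : MonoidalCategory (RepCat q) where
  tensorHom_def f g := InducedCategory.hom_ext (tensorHom_def f.hom g.hom)
  id_tensorHom_id M N := InducedCategory.hom_ext (id_tensorHom_id (RepWord.toMod M) (RepWord.toMod N))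
  tensorHom_comp_tensorHom f g f' g' :=
    InducedCategory.hom_ext (tensorHom_comp_tensorHom f.hom g.hom f'.hom g'.hom)
  whiskerLeft_id M N := InducedCategory.hom_ext (whiskerLeft_id (RepWord.toMod M) (RepWord.toMod N))
  id_whiskerRight M N := InducedCategory.hom_ext (id_whiskerRight (RepWord.toMod M) (RepWord.toMod N))
  associator_naturality f g h :=
    InducedCategory.hom_ext (associator_naturality f.hom g.hom h.hom)
  leftUnitor_naturality f := InducedCategory.hom_ext (leftUnitor_naturality f.hom)
  rightUnitor_naturality f := InducedCategory.hom_ext (rightUnitor_naturality f.hom)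
  pentagon M N P Q := InducedCategory.hom_ext
    (pentagon (RepWord.toMod M) (RepWord.toMod N) (RepWord.toMod P) (RepWord.toMod Q))
  triangle M N := InducedCategory.hom_ext (triangle (RepWord.toMod M) (RepWord.toMod N))

instance monoidalPreadditive : MonoidalPreadditive (RepCat q) where
  whiskerLeft_zero {M _ _} := InducedCategory.hom_ext
    (MonoidalPreadditive.whiskerLeft_zero (X := RepWord.toMod M))
  zero_whiskerRight {M _ _} := InducedCategory.hom_ext
    (MonoidalPreadditive.zero_whiskerRight (X := RepWord.toMod M))
  whiskerLeft_add {M _ _} f g := InducedCategory.hom_ext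
    (MonoidalPreadditive.whiskerLeft_add (X := RepWord.toMod M) f.hom g.hom)
  add_whiskerRight {M _ _} f g := InducedCategory.hom_ext
    (MonoidalPreadditive.add_whiskerRight (X := RepWord.toMod M) f.hom g.hom)

instance monoidalLinear : MonoidalLinear ℂ (RepCat q) where
  whiskerLeft_smul M _ _ c f := InducedCategory.hom_ext
    (MonoidalLinear.whiskerLeft_smul (RepWord.toMod M) c f.hom)
  smul_whiskerRight c _ _ f M := InducedCategory.hom_ext
    (MonoidalLinear.smul_whiskerRight c f.hom (RepWord.toMod M))

variable {q} {a : ℂˣ} (hq : q = a ^ 2)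

/-- The braiding of `V_n` and a tensor product. -/
def braidSimple (n : SimpleIndex q) :
    (W : RepWord q) → (UqMod.simple q n ⊗ W.toMod ⟶ W.toMod ⊗ UqMod.simple q n)
  | .unit => (ρ_ (UqMod.simple q n)).hom ≫ (λ_ (UqMod.simple q n)).inv
  | .simple m => ⟨ModuleCat.ofHom (SimpleModule.braiding a q n m),
      SimpleModule.braiding_intertwines m hq n.2⟩
  | .tensor W W' => (α_ (UqMod.simple q n) W.toMod W'.toMod).inv ≫
      braidSimple n W ▷ W'.toMod ≫ (α_ W.toMod (UqMod.simple q n) W'.toMod).hom ≫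
        W.toMod ◁ braidSimple n W' ≫ (α_ W.toMod W'.toMod (UqMod.simple q n)).inv

/-- The braiding of two tensor products. -/
def braid : (W W' : RepWord q) → (W.toMod ⊗ W'.toMod ⟶ W'.toMod ⊗ W.toMod)
  | .unit, W' => (λ_ W'.toMod).hom ≫ (ρ_ W'.toMod).inv
  | .simple n, W' => braidSimple hq n W'
  | .tensor U W, W' => (α_ U.toMod W.toMod W'.toMod).hom ≫ U.toMod ◁ braid W W' ≫
      (α_ U.toMod W'.toMod W.toMod).inv ≫ braid U W' ▷ W.toMod ≫
        (α_ W'.toMod U.toMod W.toMod).hom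

/-- The twist, equal to `a^{n(n+2)}` on `V_n`. -/
def twist : (W : RepWord q) → (W.toMod ⟶ W.toMod)
  | .unit => 𝟙 _
  | .simple n => (a : ℂ) ^ ((n : ℕ) * (n + 2)) • 𝟙 (UqMod.simple q n)
  | .tensor W W' => (twist W ⊗ₘ twist W') ≫ braid hq W W' ≫ braid hq W' W

/-- The coevaluation. -/
def coev : (W : RepWord q) → (𝟙_ (UqMod q) ⟶ W.toMod ⊗ W.dual.toMod)
  | .unit => (λ_ (𝟙_ (UqMod q))).inv
  | .simple n => ⟨ModuleCat.ofHom (SimpleModule.coev q n), SimpleModule.coev_intertwines q n⟩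
  | .tensor W W' => coev W ≫
      W.toMod ◁ ((λ_ W.dual.toMod).inv ≫ coev W' ▷ W.dual.toMod ≫
        (α_ W'.toMod W'.dual.toMod W.dual.toMod).hom) ≫
          (α_ W.toMod W'.toMod (W'.dual.toMod ⊗ W.dual.toMod)).inv

/-- The evaluation. -/
def ev : (W : RepWord q) → (W.dual.toMod ⊗ W.toMod ⟶ 𝟙_ (UqMod q))
  | .unit => (λ_ (𝟙_ (UqMod q))).hom
  | .simple n => ⟨ModuleCat.ofHom (SimpleModule.ev q n), SimpleModule.ev_intertwines q n⟩
  | .tensor W W' => (α_ W'.dual.toMod W.dual.toMod (W.toMod ⊗ W'.toMod)).hom ≫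
      W'.dual.toMod ◁ ((α_ W.dual.toMod W.toMod W'.toMod).inv ≫ ev W ▷ W'.toMod ≫
        (λ_ W'.toMod).hom) ≫ ev W'

/-- The ribbon structure on tensor products of simple modules; `a` is the chosen square
root of `q`. -/
def ribbonData : RibbonData (RepCat q) where
  braiding W W' := InducedCategory.homMk (braid hq W W')
  dual W := RepWord.dual W
  coev W := InducedCategory.homMk (coev W)
  ev W := InducedCategory.homMk (ev W)
  twist W := InducedCategory.homMk (twist hq W)

end RepCat

/-- A nonzero complex number is generic if it is not a root of unity. -/
def IsGeneric (z : ℂˣ) : Prop := ∀ n : ℕ, 0 < n → z ^ n ≠ 1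

end

/-!
# Turaev's category and the representations of `U_q(sl₂)`

Both categories are described by the Temperley-Lieb category, cut by idempotents. A `TL.Realization`
of a linear monoidal category with ribbon data assigns to each object an idempotent of the
Temperley-Lieb category and says which elements represent a given morphism, in such a way that the
structure morphisms are represented by the crossings, curls, nested cups and nested caps. To calculate
with representatives, the source and the target of a morphism of the Temperley-Lieb category are not
recorded in its type (`TL.Arr`), which makes the tensor product strictly associative. The identities
of a ribbon category then reduce to identities of diagrams (`TL.Realization.isRibbon`). By induction on
the generation by cups and caps (`TL.generated`), the latter follow from Kauffman's resolution of the
crossing: naturality of the braiding (`TL.Arr.isNat`), naturality of the twist (`TL.Arr.isTwistNat`), and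
rotation of diagrams (`TL.Arr.exists_isMate`).

Turaev's category is realized by its definition (`Turaev.realization`). For modules, the
two-dimensional module `V_1` is self-dual with loop value `-(q + q⁻¹)`, and a self-dual object
determines a functor from the Temperley-Lieb category to its tensor powers (`TL.SelfDual.functor`).
The Clebsch-Gordan maps between `V_{n+1}` and `V_n ⊗ V_1` satisfy Wenzl's recursion, so that `V_n` is
the image of the Jones-Wenzl idempotent `f_n` (`UqMod.πS_ιS`). An intertwiner from `V_n ⊗ V_m` is
determined by its value on `v_0 ⊗ v_m` (`SimpleModule.eq_of_vec₂`). On this vector the R-matrix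
reduces to a scalar, and so do the crossings of the corresponding letters; hence the braiding is
represented by the crossing of strands, and similarly for the twist and the duality, the latter up to
quantum factorials. This gives `RepCat.realization`.

The identity of the Temperley-Lieb category factors through the idempotents `f_n` of the simple
modules `V_n` and, if `q` is a root of unity, through the critical idempotent `f_{r-1}` with strands added
on the right (`TL.id_mem_jwSpan`). By Schur's lemma, every intertwiner comes from the
Temperley-Lieb category, up to morphisms which factor through critical idempotents
(`UqMod.mem_range_sup_critSpan`). The quantum trace of an intertwiner `f` is the trace of `K f`
(`RepCat.app_coev_comp_rightEv`), and a morphism through a critical idempotent has trace zero, since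
`V_{r-1}` is simple of quantum dimension `[r] = 0` (`UqMod.ktrace_isCrit`).

Two full realizations in which the zero morphisms have the same representatives are equivalent as
ribbon categories (`TL.Realization.Comparison`). If `q` is generic, there are no critical
idempotents, and the functor to modules is faithful, because the idempotents `f_n` are minimal and their
images are nonzero. If `q` is a root of unity, both realizations are full up to morphisms of trace zero,
so that the negligible morphisms form an ideal, and both purified categories are fully realized. A
represented morphism is negligible if and only if its representative is in the radical of the trace form
of the Temperley-Lieb category (`TL.Realization.IsFullModulo.negligible_iff`); this condition is the same
on both sides.
-/

open CategoryTheory MonoidalCategory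

set_option linter.unusedSectionVars false
set_option linter.unusedSimpArgs false

noncomputable section

/-! ### The Temperley-Lieb category as a tower of algebras -/

namespace TL

variable {a : ℂ}

/-- The morphism `f ⊗ 1`, with one vertical strand added on the right. -/
def addStrand {m n : ℕ} (f : (⟨m⟩ : TL a) ⟶ ⟨n⟩) : (⟨m + 1⟩ : TL a) ⟶ ⟨n + 1⟩ :=
  tensorMap f (𝟙 (⟨1⟩ : TL a))

variable (a) in
/-- The cup, as a morphism between numbers of strands. -/
def cup₂ : (⟨0⟩ : TL a) ⟶ ⟨2⟩ := cup a

variable (a) in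
/-- The cap, as a morphism between numbers of strands. -/
def cap₂ : (⟨2⟩ : TL a) ⟶ ⟨0⟩ := cap a

variable (a) in
/-- The cap on the last two of `n + 2` strands. -/
def capLast (n : ℕ) : (⟨n + 2⟩ : TL a) ⟶ ⟨n⟩ := tensorMap (𝟙 (⟨n⟩ : TL a)) (cap₂ a)

variable (a) in
/-- The cup to the right of `n` strands. -/
def cupLast (n : ℕ) : (⟨n⟩ : TL a) ⟶ ⟨n + 2⟩ := tensorMap (𝟙 (⟨n⟩ : TL a)) (cup₂ a)

theorem tensorMap_tensorMap {m n m' n' m'' n'' : TL a} (f : m ⟶ n) (g : m' ⟶ n') (h : m'' ⟶ n'') :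
    tensorMap f (tensorMap g h) = (eqIso (Nat.add_assoc _ _ _).symm).hom ≫
      tensorMap (tensorMap f g) h ≫ (eqIso (Nat.add_assoc _ _ _)).hom := by
  rw [tensorMap_assoc, ← Category.assoc, eqIso_comp_eqIso]
  exact (Category.id_comp _).symm

section addStrand

variable {m n p : ℕ}

theorem addStrand_id : addStrand (𝟙 (⟨n⟩ : TL a)) = 𝟙 _ := tensorMap_id _ _

theorem addStrand_comp (f : (⟨m⟩ : TL a) ⟶ ⟨n⟩) (g : (⟨n⟩ : TL a) ⟶ ⟨p⟩) :
    addStrand (f ≫ g) = addStrand f ≫ addStrand g :=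
  (congrArg (tensorMap (f ≫ g)) (Category.comp_id _).symm).trans (tensorMap_comp _ _ _ _)

theorem addStrand_add (f g : (⟨m⟩ : TL a) ⟶ ⟨n⟩) :
    addStrand (f + g) = addStrand f + addStrand g := add_tensorMap _ _ _

theorem addStrand_smul (c : ℂ) (f : (⟨m⟩ : TL a) ⟶ ⟨n⟩) :
    addStrand (c • f) = c • addStrand f := smul_tensorMap _ _ _

theorem addStrand_zero : addStrand (0 : (⟨m⟩ : TL a) ⟶ ⟨n⟩) = 0 := zero_tensorMap _

theorem addStrand_addStrand (f : (⟨m⟩ : TL a) ⟶ ⟨n⟩) :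
    addStrand (addStrand f) = tensorMap f (𝟙 (⟨2⟩ : TL a)) := by
  have h := tensorMap_assoc f (𝟙 (⟨1⟩ : TL a)) (𝟙 (⟨1⟩ : TL a))
  rw [tensorMap_id] at h
  exact (Category.comp_id _).symm.trans (h.trans (Category.id_comp _))

theorem tensorMap_unit (f : (⟨m⟩ : TL a) ⟶ ⟨n⟩) : tensorMap f (𝟙 (⟨0⟩ : TL a)) = f :=
  (Category.comp_id _).symm.trans ((tensorMap_empty f).trans (Category.id_comp _))

theorem addStrand_addStrand_capLast (f : (⟨m⟩ : TL a) ⟶ ⟨n⟩) :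
    addStrand (addStrand f) ≫ capLast a n = capLast a m ≫ f := by
  have h₁ := tensorMap_comp f (𝟙 _) (𝟙 (⟨2⟩ : TL a)) (cap₂ a)
  have h₂ := tensorMap_comp (𝟙 _) f (cap₂ a) (𝟙 (⟨0⟩ : TL a))
  rw [Category.comp_id, Category.id_comp] at h₁ h₂
  have h := h₁.symm.trans h₂
  rw [tensorMap_unit] at h
  rw [addStrand_addStrand]
  exact h

theorem cupLast_addStrand_addStrand (f : (⟨m⟩ : TL a) ⟶ ⟨n⟩) :
    cupLast a m ≫ addStrand (addStrand f) = f ≫ cupLast a n := by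
  have h₁ := tensorMap_comp (𝟙 _) f (cup₂ a) (𝟙 (⟨2⟩ : TL a))
  have h₂ := tensorMap_comp f (𝟙 _) (𝟙 (⟨0⟩ : TL a)) (cup₂ a)
  rw [Category.comp_id, Category.id_comp] at h₁ h₂
  have h := h₁.symm.trans h₂
  rw [tensorMap_unit] at h
  rw [addStrand_addStrand]
  exact h

end addStrand

theorem cup_comp_cap : cup a ≫ cap a = (-(a ^ 2 + a⁻¹ ^ 2)) • 𝟙 (𝟙_ (TL a)) := by
  have h : (skein a 0 0).mkQ (Finsupp.single (Tangle.mk (Diagram.cup.comp .cap)) 1 +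
      (a ^ 2 + a⁻¹ ^ 2) • Finsupp.single (Tangle.id 0) 1) = 0 :=
    (Submodule.Quotient.mk_eq_zero _).2 (Submodule.subset_span SkeinRel.circle)
  rw [map_add, map_smul] at h
  rw [neg_smul]
  exact (diagram_comp (m := ⟨0⟩) (n := ⟨2⟩) (p := ⟨0⟩) _ _).trans (eq_neg_of_add_eq_zero_left h)

theorem crossing_eq : crossing a = a • 𝟙 _ + a⁻¹ • (cap a ≫ cup a) := by
  have h : (skein a 2 2).mkQ (Finsupp.single (Tangle.mk .pos) 1 -
      a • Finsupp.single (Tangle.id 2) 1 -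
      a⁻¹ • Finsupp.single (Tangle.mk (Diagram.cap.comp .cup)) 1) = 0 :=
    (Submodule.Quotient.mk_eq_zero _).2 (Submodule.subset_span SkeinRel.kauffman)
  rw [map_sub, map_sub, map_smul, map_smul, sub_sub, sub_eq_zero] at h
  have h' := diagram_comp (a := a) (m := ⟨2⟩) (n := ⟨0⟩) (p := ⟨2⟩) (Tangle.mk .cap) (Tangle.mk .cup)
  exact Eq.trans h (congrArg₂ (· + ·) rfl (congrArg (a⁻¹ • ·) h'.symm))

theorem cupLast_capLast (n : ℕ) :
    cupLast a n ≫ capLast a n = (-(a ^ 2 + a⁻¹ ^ 2)) • 𝟙 _ := by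
  have h := tensorMap_comp (𝟙 (⟨n⟩ : TL a)) (𝟙 _) (cup₂ a) (cap₂ a)
  have h' : cup₂ a ≫ cap₂ a = (-(a ^ 2 + a⁻¹ ^ 2)) • 𝟙 _ := cup_comp_cap
  rw [h', tensorMap_smul, Category.comp_id] at h
  exact h.symm.trans (congrArg _ (tensorMap_id _ _))

theorem zigzag_right : (tensorMap (cup₂ a) (𝟙 (⟨1⟩ : TL a)) : (⟨1⟩ : TL a) ⟶ ⟨3⟩) ≫
    (tensorMap (𝟙 (⟨1⟩ : TL a)) (cap₂ a) : (⟨3⟩ : TL a) ⟶ ⟨1⟩) = 𝟙 (⟨1⟩ : TL a) := by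
  have h₁ := diagram_tensor (a := a) (m := ⟨0⟩) (n := ⟨2⟩) (m' := ⟨1⟩) (n' := ⟨1⟩)
    (Tangle.mk .cup) (Tangle.id 1)
  have h₂ := diagram_tensor (a := a) (m := ⟨1⟩) (n := ⟨1⟩) (m' := ⟨2⟩) (n' := ⟨0⟩)
    (Tangle.id 1) (Tangle.mk .cap)
  have h₃ := diagram_comp (a := a) (m := ⟨1⟩) (n := ⟨3⟩) (p := ⟨1⟩)
    ((Tangle.mk .cup).tensor (Tangle.id 1)) ((Tangle.id 1).tensor (Tangle.mk .cap))
  exact (congrArg₂ (· ≫ ·) h₁ h₂).trans (h₃.trans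
    (congrArg (diagram (m := ⟨1⟩) (n := ⟨1⟩)) (Quotient.sound Diagram.Isotopic.zigzag_right)))

theorem zigzag_left : (tensorMap (𝟙 (⟨1⟩ : TL a)) (cup₂ a) : (⟨1⟩ : TL a) ⟶ ⟨3⟩) ≫
    (tensorMap (cap₂ a) (𝟙 (⟨1⟩ : TL a)) : (⟨3⟩ : TL a) ⟶ ⟨1⟩) = 𝟙 (⟨1⟩ : TL a) := by
  have h₁ := diagram_tensor (a := a) (m := ⟨1⟩) (n := ⟨1⟩) (m' := ⟨0⟩) (n' := ⟨2⟩)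
    (Tangle.id 1) (Tangle.mk .cup)
  have h₂ := diagram_tensor (a := a) (m := ⟨2⟩) (n := ⟨0⟩) (m' := ⟨1⟩) (n' := ⟨1⟩)
    (Tangle.mk .cap) (Tangle.id 1)
  have h₃ := diagram_comp (a := a) (m := ⟨1⟩) (n := ⟨3⟩) (p := ⟨1⟩)
    ((Tangle.id 1).tensor (Tangle.mk .cup)) ((Tangle.mk .cap).tensor (Tangle.id 1))
  exact (congrArg₂ (· ≫ ·) h₁ h₂).trans (h₃.trans
    (congrArg (diagram (m := ⟨1⟩) (n := ⟨1⟩)) (Quotient.sound Diagram.Isotopic.zigzag_left)))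

theorem addStrand_cupLast_capLast (n : ℕ) :
    addStrand (cupLast a n) ≫ capLast a (n + 1) = 𝟙 _ := by
  have h := tensorMap_comp (𝟙 (⟨n⟩ : TL a)) (𝟙 _) (n := ⟨n⟩) (m' := ⟨1⟩) (n' := ⟨3⟩) (p' := ⟨1⟩)
    (tensorMap (cup₂ a) (𝟙 (⟨1⟩ : TL a))) (tensorMap (𝟙 (⟨1⟩ : TL a)) (cap₂ a))
  have h₁ := tensorMap_assoc (𝟙 (⟨n⟩ : TL a)) (cup₂ a) (𝟙 (⟨1⟩ : TL a))
  have h₂ := tensorMap_assoc (𝟙 (⟨n⟩ : TL a)) (𝟙 (⟨1⟩ : TL a)) (cap₂ a)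
  replace h₁ := (Category.comp_id _).symm.trans (h₁.trans (Category.id_comp _))
  replace h₂ := (Category.comp_id _).symm.trans (h₂.trans (Category.id_comp _))
  rw [tensorMap_id] at h₂
  refine (congrArg₂ (· ≫ ·) h₁ h₂).trans (h.symm.trans ?_)
  rw [Category.comp_id]
  refine (congrArg _ zigzag_right).trans (tensorMap_id _ _)

theorem cupLast_addStrand_capLast (n : ℕ) :
    cupLast a (n + 1) ≫ addStrand (capLast a n) = 𝟙 _ := by
  have h := tensorMap_comp (𝟙 (⟨n⟩ : TL a)) (𝟙 _) (n := ⟨n⟩) (m' := ⟨1⟩) (n' := ⟨3⟩) (p' := ⟨1⟩)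
    (tensorMap (𝟙 (⟨1⟩ : TL a)) (cup₂ a)) (tensorMap (cap₂ a) (𝟙 (⟨1⟩ : TL a)))
  have h₁ := tensorMap_assoc (𝟙 (⟨n⟩ : TL a)) (cap₂ a) (𝟙 (⟨1⟩ : TL a))
  have h₂ := tensorMap_assoc (𝟙 (⟨n⟩ : TL a)) (𝟙 (⟨1⟩ : TL a)) (cup₂ a)
  replace h₁ := (Category.comp_id _).symm.trans (h₁.trans (Category.id_comp _))
  replace h₂ := (Category.comp_id _).symm.trans (h₂.trans (Category.id_comp _))
  rw [tensorMap_id] at h₂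
  refine (congrArg₂ (· ≫ ·) h₂ h₁).trans (h.symm.trans ?_)
  rw [Category.comp_id]
  refine (congrArg _ zigzag_left).trans (tensorMap_id _ _)

/-- An elementary cup: one cup between vertical strands. -/
inductive IsCup : ∀ {m n : ℕ}, ((⟨m⟩ : TL a) ⟶ ⟨n⟩) → Prop
  | last (n : ℕ) : IsCup (cupLast a n)
  | add {m n : ℕ} {f : (⟨m⟩ : TL a) ⟶ ⟨n⟩} : IsCup f → IsCup (addStrand f)

/-- An elementary cap: one cap between vertical strands. -/
inductive IsCap : ∀ {m n : ℕ}, ((⟨m⟩ : TL a) ⟶ ⟨n⟩) → Prop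
  | last (n : ℕ) : IsCap (capLast a n)
  | add {m n : ℕ} {f : (⟨m⟩ : TL a) ⟶ ⟨n⟩} : IsCap f → IsCap (addStrand f)

/-- The standard generators `e_i` of the Temperley-Lieb algebras. -/
inductive IsHook : ∀ {n : ℕ}, ((⟨n⟩ : TL a) ⟶ ⟨n⟩) → Prop
  | last (n : ℕ) : IsHook (capLast a n ≫ cupLast a n)
  | add {n : ℕ} {f : (⟨n⟩ : TL a) ⟶ ⟨n⟩} : IsHook f → IsHook (addStrand f)

theorem IsHook.exists_cap_cup {n : ℕ} {e : (⟨n⟩ : TL a) ⟶ ⟨n⟩} (he : IsHook e) :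
    ∃ (k : ℕ) (c : (⟨n⟩ : TL a) ⟶ ⟨k⟩) (u : (⟨k⟩ : TL a) ⟶ ⟨n⟩), IsCap c ∧ IsCup u ∧ e = c ≫ u := by
  induction he with
  | last n => exact ⟨_, _, _, .last n, .last n, rfl⟩
  | add _ ih =>
    obtain ⟨k, c, u, hc, hu, rfl⟩ := ih
    exact ⟨_, _, _, hc.add, hu.add, addStrand_comp _ _⟩

/-- The generators `e_i`, defined with vertical strands on both sides of the cap and the cup, are the
elements obtained from a cap and a cup on the last two strands by adding strands on the right. -/
theorem mem_hooks_iff {n : ℕ} {e : End (⟨n⟩ : TL a)} : e ∈ hooks a n ↔ IsHook (n := n) e := by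
  have base : ∀ i : ℕ, ((⟨i⟩ : TL a) ◁ (cap a ≫ cup a)) ▷ (⟨0⟩ : TL a) =
      capLast a i ≫ cupLast a i := fun i => by
    refine (tensorMap_unit (m := i + (1 + 1)) (n := i + (1 + 1)) _).trans ?_
    exact MonoidalCategory.whiskerLeft_comp _ _ _
  have step : ∀ i j : ℕ, ((⟨i⟩ : TL a) ◁ (cap a ≫ cup a)) ▷ (⟨j + 1⟩ : TL a) =
      addStrand (m := i + (1 + 1) + j) (n := i + (1 + 1) + j)
        (((⟨i⟩ : TL a) ◁ (cap a ≫ cup a)) ▷ (⟨j⟩ : TL a)) := fun i j => by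
    refine (congrArg (tensorMap _) (tensorMap_id (⟨j⟩ : TL a) ⟨1⟩).symm).trans ?_
    refine (tensorMap_tensorMap _ _ _).trans ?_
    exact (Category.id_comp _).trans (Category.comp_id _)
  constructor
  · rintro ⟨i, j, rfl, rfl⟩
    have : IsHook (n := i + (1 + 1) + j) (((⟨i⟩ : TL a) ◁ (cap a ≫ cup a)) ▷ (⟨j⟩ : TL a)) := by
      induction j with
      | zero => rw [base]; exact .last i
      | succ j ih => rw [step]; exact ih.add
    convert this
    exact (Category.id_comp _).trans (Category.comp_id _)
  · intro h
    induction h with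
    | last n =>
      refine ⟨n, 0, rfl, ?_⟩
      rw [base]
      exact ((Category.id_comp _).trans (Category.comp_id _)).symm
    | add _ ih =>
      obtain ⟨i, j, h, ih⟩ := ih
      subst h
      refine ⟨i, j + 1, rfl, ?_⟩
      rw [step, ih]
      refine Eq.trans ?_ ((Category.id_comp _).trans (Category.comp_id _)).symm
      exact congrArg addStrand ((Category.id_comp _).trans (Category.comp_id _))

/-! ### Generation by cups and caps, and normal forms -/

/-- Linear combinations of composites of elementary cups and caps. -/
inductive Generated : ∀ {m n : ℕ}, ((⟨m⟩ : TL a) ⟶ ⟨n⟩) → Prop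
  | zero (m n : ℕ) : Generated (0 : (⟨m⟩ : TL a) ⟶ ⟨n⟩)
  | id (n : ℕ) : Generated (𝟙 (⟨n⟩ : TL a))
  | add {m n : ℕ} {f g : (⟨m⟩ : TL a) ⟶ ⟨n⟩} : Generated f → Generated g → Generated (f + g)
  | smul {m n : ℕ} (c : ℂ) {f : (⟨m⟩ : TL a) ⟶ ⟨n⟩} : Generated f → Generated (c • f)
  | cup {m n p : ℕ} {f : (⟨m⟩ : TL a) ⟶ ⟨n⟩} {u : (⟨n⟩ : TL a) ⟶ ⟨p⟩} :
      Generated f → IsCup u → Generated (f ≫ u)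
  | cap {m n p : ℕ} {f : (⟨m⟩ : TL a) ⟶ ⟨n⟩} {c : (⟨n⟩ : TL a) ⟶ ⟨p⟩} :
      Generated f → IsCap c → Generated (f ≫ c)

namespace Generated

variable {m n p : ℕ} {f : (⟨m⟩ : TL a) ⟶ ⟨n⟩}

theorem congr {g : (⟨m⟩ : TL a) ⟶ ⟨n⟩} (hf : Generated f) (h : g = f) : Generated g := h ▸ hf

theorem comp {g : (⟨n⟩ : TL a) ⟶ ⟨p⟩} (hf : Generated f) (hg : Generated g) :
    Generated (f ≫ g) := by
  induction hg generalizing m with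
  | zero => rw [Limits.comp_zero]; exact .zero _ _
  | id => rwa [Category.comp_id]
  | add _ _ h₁ h₂ => rw [Preadditive.comp_add]; exact (h₁ hf).add (h₂ hf)
  | smul c _ h => rw [Linear.comp_smul]; exact (h hf).smul c
  | cup _ hu h => rw [← Category.assoc]; exact (h hf).cup hu
  | cap _ hu h => rw [← Category.assoc]; exact (h hf).cap hu

theorem addStrand (hf : Generated f) : Generated (addStrand f) := by
  induction hf with
  | zero => rw [addStrand_zero]; exact .zero _ _
  | id => rw [addStrand_id]; exact .id _
  | add _ _ h₁ h₂ => rw [addStrand_add]; exact h₁.add h₂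
  | smul c _ h => rw [addStrand_smul]; exact h.smul c
  | cup _ hu h => rw [addStrand_comp]; exact h.cup hu.add
  | cap _ hu h => rw [addStrand_comp]; exact h.cap hu.add

theorem cast {m' n' : ℕ} (hf : Generated f) (h : m' = m) (h' : n = n') :
    Generated ((eqIso (m := (⟨m'⟩ : TL a)) (n := ⟨m⟩) h).hom ≫ f ≫
      (eqIso (m := (⟨n⟩ : TL a)) (n := ⟨n'⟩) h').hom) := by
  subst h h'
  refine hf.congr ?_
  exact (Category.id_comp _).trans (Category.comp_id _)

theorem tensor_id (hf : Generated f) (k : ℕ) :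
    Generated (m := m + k) (n := n + k) (tensorMap f (𝟙 (⟨k⟩ : TL a))) := by
  induction k with
  | zero => rw [tensorMap_unit]; exact hf
  | succ k ih =>
    refine ih.addStrand.congr ?_
    refine (congrArg (tensorMap _) (tensorMap_id (⟨k⟩ : TL a) ⟨1⟩).symm).trans ?_
    refine (tensorMap_tensorMap _ _ _).trans ?_
    exact (Category.id_comp _).trans (Category.comp_id _)

/-- Every diagram with vertical strands added on the left is generated. -/
theorem of_diagram {k l : ℕ} (D : Diagram k l) (i : ℕ) : Generated (m := i + k) (n := i + l)
    (tensorMap (𝟙 (⟨i⟩ : TL a)) (diagram (m := ⟨k⟩) (n := ⟨l⟩) (Tangle.mk D))) := by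
  have hcomp : ∀ {k l m : ℕ} {D : Diagram k l} {D' : Diagram l m},
      (∀ i : ℕ, Generated (m := i + k) (n := i + l)
        (tensorMap (𝟙 (⟨i⟩ : TL a)) (diagram (m := ⟨k⟩) (n := ⟨l⟩) (Tangle.mk D)))) →
      (∀ i : ℕ, Generated (m := i + l) (n := i + m)
        (tensorMap (𝟙 (⟨i⟩ : TL a)) (diagram (m := ⟨l⟩) (n := ⟨m⟩) (Tangle.mk D')))) →
      ∀ i : ℕ, Generated (m := i + k) (n := i + m)
        (tensorMap (𝟙 (⟨i⟩ : TL a)) (diagram (m := ⟨k⟩) (n := ⟨m⟩) (Tangle.mk (D.comp D')))) := by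
    intro k l m D D' h h' i
    have := (h i).comp (h' i)
    refine this.congr ?_
    rw [← tensorMap_comp, Category.comp_id, diagram_comp (m := ⟨k⟩) (n := ⟨l⟩) (p := ⟨m⟩)]
    rfl
  have htensor : ∀ {k l k' l' : ℕ} {D : Diagram k l} {D' : Diagram k' l'},
      (∀ i : ℕ, Generated (m := i + k) (n := i + l)
        (tensorMap (𝟙 (⟨i⟩ : TL a)) (diagram (m := ⟨k⟩) (n := ⟨l⟩) (Tangle.mk D)))) →
      (∀ i : ℕ, Generated (m := i + k') (n := i + l')
        (tensorMap (𝟙 (⟨i⟩ : TL a)) (diagram (m := ⟨k'⟩) (n := ⟨l'⟩) (Tangle.mk D')))) →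
      ∀ i : ℕ, Generated (m := i + (k + k')) (n := i + (l + l')) (tensorMap (𝟙 (⟨i⟩ : TL a))
        (diagram (m := ⟨k + k'⟩) (n := ⟨l + l'⟩) (Tangle.mk (D.tensor D')))) := by
    intro k l k' l' D D' h h' i
    have h₁ := ((h i).tensor_id k').cast (Nat.add_assoc i k k').symm (Nat.add_assoc i l k')
    have h₂ := (h' (i + l)).cast (Nat.add_assoc i l k').symm (Nat.add_assoc i l l')
    have e₁ := tensorMap_tensorMap (𝟙 (⟨i⟩ : TL a)) (diagram (m := ⟨k⟩) (n := ⟨l⟩) (Tangle.mk D))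
      (𝟙 (⟨k'⟩ : TL a))
    have e₂ := tensorMap_tensorMap (𝟙 (⟨i⟩ : TL a)) (𝟙 (⟨l⟩ : TL a))
      (diagram (m := ⟨k'⟩) (n := ⟨l'⟩) (Tangle.mk D'))
    rw [tensorMap_id] at e₂
    have := h₁.comp h₂
    refine this.congr ?_
    refine Eq.trans ?_ (congrArg₂ (· ≫ ·) e₁ e₂)
    rw [← tensorMap_comp, Category.comp_id, ← tensorMap_comp, Category.comp_id, Category.id_comp,
      diagram_tensor (m := ⟨k⟩) (n := ⟨l⟩) (m' := ⟨k'⟩) (n' := ⟨l'⟩)]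
    rfl
  have hid : ∀ n i : ℕ, Generated (m := i + n) (n := i + n)
      (tensorMap (𝟙 (⟨i⟩ : TL a)) (diagram (m := ⟨n⟩) (n := ⟨n⟩) (Tangle.mk (.id n)))) := by
    intro n i
    exact (Generated.id (a := a) (i + n)).congr (tensorMap_id _ _)
  have hcup : ∀ i : ℕ, Generated (m := i + 0) (n := i + 2)
      (tensorMap (𝟙 (⟨i⟩ : TL a)) (diagram (m := ⟨0⟩) (n := ⟨2⟩) (Tangle.mk .cup))) := by
    intro i
    exact ((Generated.id (a := a) i).cup (.last i)).congr (Category.id_comp _).symm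
  have hcap : ∀ i : ℕ, Generated (m := i + 2) (n := i + 0)
      (tensorMap (𝟙 (⟨i⟩ : TL a)) (diagram (m := ⟨2⟩) (n := ⟨0⟩) (Tangle.mk .cap))) := by
    intro i
    exact ((Generated.id (a := a) (i + 2)).cap (.last i)).congr (Category.id_comp _).symm
  have hpos : ∀ i : ℕ, Generated (m := i + 2) (n := i + 2)
      (tensorMap (𝟙 (⟨i⟩ : TL a)) (diagram (m := ⟨2⟩) (n := ⟨2⟩) (Tangle.mk .pos))) := by
    intro i
    have h := ((hid 2 i).smul a).add ((hcomp hcap hcup i).smul a⁻¹)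
    rw [← tensorMap_smul, ← tensorMap_smul, ← tensorMap_add] at h
    refine h.congr (congrArg (tensorMap _) ?_)
    have h' := diagram_comp (a := a) (m := ⟨2⟩) (n := ⟨0⟩) (p := ⟨2⟩) (Tangle.mk .cap)
      (Tangle.mk .cup)
    exact crossing_eq.trans (congrArg₂ (· + ·) rfl (congrArg (a⁻¹ • ·) h'))
  induction D generalizing i with
  | id n => exact hid n i
  | comp D D' h h' => exact hcomp h h' i
  | tensor D D' h h' => exact htensor h h' i
  | cup => exact hcup i
  | cap => exact hcap i
  | pos => exact hpos i
  | neg =>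
    have t₁ := htensor (hid 2) hcup
    have t₂ := htensor (htensor (hid 1) hpos) (hid 1)
    have t₃ := htensor hcap (hid 2)
    have h₁ := hcomp (D := (Diagram.id 2).tensor .cup)
      (D' := ((Diagram.id 1).tensor .pos).tensor (.id 1)) t₁ t₂
    have h₂ := hcomp (D := ((Diagram.id 2).tensor .cup).comp
      (((Diagram.id 1).tensor .pos).tensor (.id 1))) (D' := Diagram.cap.tensor (.id 2)) h₁ t₃
    have e : Tangle.mk .neg = Tangle.mk _ := (Quotient.sound Diagram.Isotopic.rotate_pos).symm
    -- A negative crossing is a rotated positive one, hence also a composite of generated pieces.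
    rw [e]
    exact h₂ i

end Generated

/-- Every morphism is a linear combination of composites of elementary cups and caps. -/
theorem generated {m n : ℕ} (f : (⟨m⟩ : TL a) ⟶ ⟨n⟩) : Generated f := by
  induction f using TL.induction with
  | zero => exact .zero _ _
  | add x y hx hy => exact hx.add hy
  | smul c x hx => exact hx.smul c
  | diagram D =>
    induction D using Quotient.ind with
    | _ D =>
    have := (Generated.of_diagram (a := a) D 0).cast (Nat.zero_add m).symm (Nat.zero_add n)
    refine this.congr ?_
    have h := empty_tensorMap (m := (⟨m⟩ : TL a)) (n := ⟨n⟩)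
      (diagram (m := (⟨m⟩ : TL a)) (n := ⟨n⟩) (Tangle.mk D))
    exact ((Iso.inv_comp_eq (eqIso (m := (⟨0 + m⟩ : TL a)) (n := ⟨m⟩) (Nat.zero_add m))).2 h).symm

/-- A scalar, or a cap followed by a cup. -/
inductive IsCapCup : ∀ {m n : ℕ}, ((⟨m⟩ : TL a) ⟶ ⟨n⟩) → Prop
  | scalar (n : ℕ) (t : ℂ) : IsCapCup (t • 𝟙 (⟨n⟩ : TL a))
  | mk {m n p : ℕ} {c : (⟨m⟩ : TL a) ⟶ ⟨n⟩} {u : (⟨n⟩ : TL a) ⟶ ⟨p⟩} :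
      IsCap c → IsCup u → IsCapCup (c ≫ u)

theorem IsCapCup.id (n : ℕ) : IsCapCup (𝟙 (⟨n⟩ : TL a)) := by
  simpa using IsCapCup.scalar (a := a) n 1

theorem IsCapCup.addStrand {m n : ℕ} {f : (⟨m⟩ : TL a) ⟶ ⟨n⟩} (hf : IsCapCup f) :
    IsCapCup (addStrand f) := by
  cases hf with
  | scalar t => rw [addStrand_smul, addStrand_id]; exact .scalar _ t
  | mk hc hu => rw [addStrand_comp]; exact .mk hc.add hu.add

/-- A cup followed by a cap is a circle, a zigzag, or a cap followed by a cup. -/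
theorem IsCup.comp_isCap {m n p : ℕ} {u : (⟨m⟩ : TL a) ⟶ ⟨n⟩} {c : (⟨n⟩ : TL a) ⟶ ⟨p⟩}
    (hu : IsCup u) (hc : IsCap c) : IsCapCup (u ≫ c) := by
  induction hu generalizing p with
  | last k =>
    cases hc with
    | last => rw [cupLast_capLast]; exact .scalar _ _
    | add hc =>
      cases hc with
      | last => rw [cupLast_addStrand_capLast]; exact .id _
      | add hc => rw [cupLast_addStrand_addStrand]; exact .mk hc (.last _)
  | add hu ih =>
    cases hc with
    | last =>
      cases hu with
      | last => rw [addStrand_cupLast_capLast]; exact .id _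
      | add hu => rw [addStrand_addStrand_capLast]; exact .mk (.last _) hu
    | add hc => rw [← addStrand_comp]; exact (ih hc).addStrand

/-- Composites of elementary cups. -/
inductive IsCups : ∀ {m n : ℕ}, ((⟨m⟩ : TL a) ⟶ ⟨n⟩) → Prop
  | id (n : ℕ) : IsCups (𝟙 (⟨n⟩ : TL a))
  | comp {m n p : ℕ} {f : (⟨m⟩ : TL a) ⟶ ⟨n⟩} {u : (⟨n⟩ : TL a) ⟶ ⟨p⟩} :
      IsCups f → IsCup u → IsCups (f ≫ u)

/-- The span of the morphisms `g y`, where `y` is a composite of elementary cups. -/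
def cupSpan {m : ℕ} (g : (⟨m⟩ : TL a) ⟶ ⟨m⟩) (n : ℕ) : Submodule ℂ ((⟨m⟩ : TL a) ⟶ ⟨n⟩) :=
  Submodule.span ℂ {z | ∃ y : (⟨m⟩ : TL a) ⟶ ⟨n⟩, IsCups y ∧ z = g ≫ y}

theorem cupSpan_comp_cup {m n p : ℕ} {g : (⟨m⟩ : TL a) ⟶ ⟨m⟩} {z : (⟨m⟩ : TL a) ⟶ ⟨n⟩}
    (hz : z ∈ cupSpan g n) {u : (⟨n⟩ : TL a) ⟶ ⟨p⟩} (hu : IsCup u) : z ≫ u ∈ cupSpan g p := by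
  induction hz using Submodule.span_induction with
  | mem z h =>
    obtain ⟨y, hy, rfl⟩ := h
    exact Submodule.subset_span ⟨y ≫ u, hy.comp hu, Category.assoc _ _ _⟩
  | zero => rw [Limits.zero_comp]; exact zero_mem _
  | add x y _ _ hx hy => rw [Preadditive.add_comp]; exact add_mem hx hy
  | smul c x _ hx => rw [Linear.smul_comp]; exact Submodule.smul_mem _ c hx

/-- If `g` kills the caps, then all caps in `g f` can be cancelled against cups. -/
theorem comp_mem_cupSpan {m n : ℕ} {g : (⟨m⟩ : TL a) ⟶ ⟨m⟩}
    (hg : ∀ {k : ℕ} {c : (⟨m⟩ : TL a) ⟶ ⟨k⟩}, IsCap c → g ≫ c = 0)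
    (f : (⟨m⟩ : TL a) ⟶ ⟨n⟩) : g ≫ f ∈ cupSpan g n := by
  -- A cap is moved through the cups until it cancels or meets `g`.
  have key : ∀ {n p : ℕ} {y : (⟨m⟩ : TL a) ⟶ ⟨n⟩} {c : (⟨n⟩ : TL a) ⟶ ⟨p⟩}, IsCups y → IsCap c →
      (g ≫ y) ≫ c ∈ cupSpan g p := by
    intro n p y c hy
    induction hy generalizing p with
    | id => intro hc; rw [Category.comp_id, hg hc]; exact zero_mem _
    | @comp n' p' y u hy hu ih =>
      intro hc
      have hcu := hu.comp_isCap hc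
      have e : (g ≫ y ≫ u) ≫ c = (g ≫ y) ≫ (u ≫ c) := by simp only [Category.assoc]
      rw [e]
      generalize u ≫ c = w at hcu
      cases hcu with
      | scalar t =>
        rw [Linear.comp_smul, Category.comp_id]
        exact Submodule.smul_mem _ t (Submodule.subset_span ⟨y, hy, rfl⟩)
      | mk hc' hu' =>
        rw [← Category.assoc]
        exact cupSpan_comp_cup (ih hc') hu'
  have hf := generated f
  induction hf with
  | zero => rw [Limits.comp_zero]; exact zero_mem _
  | id => exact Submodule.subset_span ⟨_, .id _, rfl⟩
  | add _ _ h₁ h₂ => rw [Preadditive.comp_add]; exact add_mem h₁ h₂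
  | smul c _ h => rw [Linear.comp_smul]; exact Submodule.smul_mem _ c h
  | cup _ hu h => rw [← Category.assoc]; exact cupSpan_comp_cup h hu
  | cap _ hc h =>
    rw [← Category.assoc]
    generalize g ≫ _ = w at h
    induction h using Submodule.span_induction with
    | mem z hz =>
      obtain ⟨y, hy, rfl⟩ := hz
      exact key hy hc
    | zero => rw [Limits.zero_comp]; exact zero_mem _
    | add x y _ _ hx hy => rw [Preadditive.add_comp]; exact add_mem hx hy
    | smul c x _ hx => rw [Linear.smul_comp]; exact Submodule.smul_mem _ c hx

/-- An idempotent which kills the cups and the caps is minimal: in `g f g` only the multiples of the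
identity in `f` survive. -/
theorem sandwich_eq_smul {m : ℕ} {g : (⟨m⟩ : TL a) ⟶ ⟨m⟩}
    (hg : ∀ {k : ℕ} {c : (⟨m⟩ : TL a) ⟶ ⟨k⟩}, IsCap c → g ≫ c = 0)
    (hg' : ∀ {k : ℕ} {u : (⟨k⟩ : TL a) ⟶ ⟨m⟩}, IsCup u → u ≫ g = 0) (hgg : g ≫ g = g)
    (f : (⟨m⟩ : TL a) ⟶ ⟨m⟩) : ∃ t : ℂ, g ≫ f ≫ g = t • g := by
  have := comp_mem_cupSpan hg f
  rw [← Category.assoc]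
  generalize g ≫ f = w at this
  induction this using Submodule.span_induction with
  | mem z hz =>
    obtain ⟨y, hy, rfl⟩ := hz
    cases hy with
    | id => exact ⟨1, by rw [Category.comp_id, hgg, one_smul]⟩
    | comp hy hu =>
      exact ⟨0, by rw [Category.assoc, Category.assoc, hg' hu, Limits.comp_zero, Limits.comp_zero,
        zero_smul]⟩
  | zero => exact ⟨0, by rw [Limits.zero_comp, zero_smul]⟩
  | add x y _ _ hx hy =>
    obtain ⟨s, hs⟩ := hx
    obtain ⟨t, ht⟩ := hy
    exact ⟨s + t, by rw [Preadditive.add_comp, hs, ht, add_smul]⟩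
  | smul c x _ hx =>
    obtain ⟨s, hs⟩ := hx
    exact ⟨c * s, by rw [Linear.smul_comp, hs, mul_smul]⟩

/-- Between different numbers of strands, every composite of cups and caps contains a cup or a cap
which is killed by `g` or `g'`. -/
theorem sandwich_eq_zero {m n : ℕ} (hmn : m ≠ n) {g : (⟨m⟩ : TL a) ⟶ ⟨m⟩} {g' : (⟨n⟩ : TL a) ⟶ ⟨n⟩}
    (hg : ∀ {k : ℕ} {c : (⟨m⟩ : TL a) ⟶ ⟨k⟩}, IsCap c → g ≫ c = 0)
    (hg' : ∀ {k : ℕ} {u : (⟨k⟩ : TL a) ⟶ ⟨n⟩}, IsCup u → u ≫ g' = 0)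
    (f : (⟨m⟩ : TL a) ⟶ ⟨n⟩) : g ≫ f ≫ g' = 0 := by
  have := comp_mem_cupSpan hg f
  rw [← Category.assoc]
  generalize g ≫ f = w at this
  induction this using Submodule.span_induction with
  | mem z hz =>
    obtain ⟨y, hy, rfl⟩ := hz
    cases hy with
    | id => exact absurd rfl hmn
    | comp hy hu =>
      rw [Category.assoc, Category.assoc, hg' hu, Limits.comp_zero, Limits.comp_zero]
  | zero => rw [Limits.zero_comp]
  | add x y _ _ hx hy => rw [Preadditive.add_comp, hx, hy, add_zero]
  | smul c x _ hx => rw [Linear.smul_comp, hx, smul_zero]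

end TL

/-! ### Quantum integers -/

namespace SimpleIndex

variable {q : ℂˣ} {n : ℕ}

theorem of_le (hn : n ∈ SimpleIndex q) {l : ℕ} (hl : l ≤ n) : l ∈ SimpleIndex q :=
  fun r hr h => (Nat.add_le_add_right hl 2).trans (hn r hr h)

/-- The quantum integers `[1], …, [n + 1]` do not vanish. -/
theorem qint_natCast_ne_zero (hn : n ∈ SimpleIndex q) {l : ℕ} (hl : l ≤ n) :
    qint q ((l + 1 : ℕ) : ℤ) ≠ 0 := by
  have := SimpleIndex.qint_ne_zero hn hl
  rw [qint, Nat.cast_succ]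
  exact div_ne_zero this (SimpleModule.sub_ne_zero_of_mem hn)

end SimpleIndex

/-- The first number outside `SimpleIndex q`; it exists if `q` is a root of unity only, and it is the
number `r - 1` for which `[r] = 0`. -/
def IsCritical (q : ℂˣ) (c : ℕ) : Prop := ∃ k ∈ SimpleIndex q, c = k + 1 ∧ c ∉ SimpleIndex q

theorem IsCritical.qint_eq_zero {q : ℂˣ} {c : ℕ} (hc : IsCritical q c) :
    qint q ((c + 1 : ℕ) : ℤ) = 0 := by
  obtain ⟨k, hk, rfl, hc⟩ := hc
  simp only [SimpleIndex, Set.mem_ofPred_eq, not_forall] at hc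
  obtain ⟨r, hr, h, hr'⟩ := hc
  have := hk r hr h
  obtain rfl : r = k + 2 := by omega
  have h' : (q : ℂ) ^ (((k + 1 + 1 : ℕ) : ℤ)) = (q : ℂ) ^ (-((k + 1 + 1 : ℕ) : ℤ)) := by
    rw [zpow_neg]
    refine eq_inv_of_mul_eq_one_left ?_
    rw [← zpow_add₀ q.ne_zero, ← h,
      ← zpow_natCast]
    congr 1; push_cast; ring
  rw [qint, h', sub_self, zero_div]

theorem IsCritical.qint_ne_zero {q : ℂˣ} {c : ℕ} (hc : IsCritical q c) {i : ℕ} (hi : 1 ≤ i)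
    (hic : i ≤ c) : qint q (i : ℤ) ≠ 0 := by
  obtain ⟨k, hk, rfl, -⟩ := hc
  obtain ⟨l, rfl⟩ : ∃ l, i = l + 1 := ⟨i - 1, by omega⟩
  exact SimpleIndex.qint_natCast_ne_zero hk (by omega)

theorem qint_one {q : ℂˣ} (hD : (q : ℂ) - (q : ℂ)⁻¹ ≠ 0) : qint q 1 = 1 := Uq.qint_one_mul q hD

/-- `[n + 2] = [2] [n + 1] - [n]` -/
theorem qint_add_two {q : ℂˣ} (n : ℤ) :
    qint q (n + 2) = (q + (q : ℂ)⁻¹) * qint q (n + 1) - qint q n := by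
  have hq := q.ne_zero
  simp only [qint]
  rw [mul_div_assoc', ← sub_div]
  congr 1
  rw [show n + 2 = n + 1 + 1 by ring]
  simp only [neg_add, zpow_add₀ hq, zpow_neg, zpow_one]
  have := zpow_ne_zero n hq
  field_simp
  ring

/-! ### The recursion for the Jones-Wenzl idempotents -/

namespace TL

variable {a : ℂ} (q : ℂˣ)

/-- The Jones-Wenzl elements, defined by Wenzl's recursion. -/
def jw : (n : ℕ) → ((⟨n⟩ : TL a) ⟶ ⟨n⟩)
  | 0 => 𝟙 _
  | 1 => 𝟙 _
  | n + 2 => addStrand (jw (n + 1)) + (qint q ((n + 1 : ℕ) : ℤ) / qint q ((n + 2 : ℕ) : ℤ)) •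
      (addStrand (jw (n + 1)) ≫ (capLast a n ≫ cupLast a n) ≫ addStrand (jw (n + 1)))

theorem jw_zero : jw q 0 = 𝟙 (⟨0⟩ : TL a) := rfl
theorem jw_one : jw q 1 = 𝟙 (⟨1⟩ : TL a) := rfl
theorem jw_add_two (n : ℕ) : jw q (n + 2) = addStrand (jw (a := a) q (n + 1)) +
    (qint q ((n + 1 : ℕ) : ℤ) / qint q ((n + 2 : ℕ) : ℤ)) •
      (addStrand (jw q (n + 1)) ≫ (capLast a n ≫ cupLast a n) ≫ addStrand (jw q (n + 1))) := rfl

variable (a) in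
/-- Noncommutative polynomials without constant term in the generators `e_i`. -/
abbrev hookIdeal (n : ℕ) : NonUnitalSubalgebra ℂ (End (⟨n⟩ : TL a)) :=
  NonUnitalAlgebra.adjoin ℂ (hooks a n)

variable {q}

theorem addStrand_mem_hookIdeal {n : ℕ} {x : End (⟨n⟩ : TL a)} (hx : x ∈ hookIdeal a n) :
    (addStrand x : End (⟨n + 1⟩ : TL a)) ∈ hookIdeal a (n + 1) := by
  induction hx using NonUnitalAlgebra.adjoin_induction with
  | mem x hx =>
    exact NonUnitalAlgebra.subset_adjoin _ (mem_hooks_iff.2 (mem_hooks_iff.1 hx).add)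
  | add x y _ _ hx hy => exact (addStrand_add x y).symm ▸ add_mem hx hy
  | zero => exact addStrand_zero (a := a) (m := n) (n := n) ▸ zero_mem (hookIdeal a (n + 1))
  | mul x y _ _ hx hy => exact (addStrand_comp y x).symm ▸ mul_mem hx hy
  | smul c x _ hx => exact (addStrand_smul c x).symm ▸ (hookIdeal a (n + 1)).smul_mem' c hx

theorem hookIdeal_comp_eq_zero {m n : ℕ} {f : (⟨n⟩ : TL a) ⟶ ⟨m⟩}
    (hf : ∀ {k : ℕ} {u : (⟨k⟩ : TL a) ⟶ ⟨n⟩}, IsCup u → u ≫ f = 0) {x : End (⟨n⟩ : TL a)}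
    (hx : x ∈ hookIdeal a n) : (show (⟨n⟩ : TL a) ⟶ ⟨n⟩ from x) ≫ f = 0 := by
  induction hx using NonUnitalAlgebra.adjoin_induction with
  | mem x hx =>
    obtain ⟨k, c, u, -, hu, rfl⟩ := (mem_hooks_iff.1 hx).exists_cap_cup
    exact (Category.assoc _ _ _).trans ((congrArg (c ≫ ·) (hf hu)).trans Limits.comp_zero)
  | add x y _ _ hx hy =>
    exact (Preadditive.add_comp _ _ _ x y f).trans (by rw [hx, hy, add_zero])
  | zero => exact Limits.zero_comp
  | mul x y _ _ hx hy =>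
    exact (Category.assoc _ _ _).trans ((congrArg (_ ≫ ·) hx).trans Limits.comp_zero)
  | smul c x _ hx => exact (Linear.smul_comp _ _ _ c x f).trans (by rw [hx, smul_zero])

theorem comp_hookIdeal_eq_zero {m n : ℕ} {f : (⟨m⟩ : TL a) ⟶ ⟨n⟩}
    (hf : ∀ {k : ℕ} {c : (⟨n⟩ : TL a) ⟶ ⟨k⟩}, IsCap c → f ≫ c = 0) {x : End (⟨n⟩ : TL a)}
    (hx : x ∈ hookIdeal a n) : f ≫ (show (⟨n⟩ : TL a) ⟶ ⟨n⟩ from x) = 0 := by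
  induction hx using NonUnitalAlgebra.adjoin_induction with
  | mem x hx =>
    obtain ⟨k, c, u, hc, -, rfl⟩ := (mem_hooks_iff.1 hx).exists_cap_cup
    exact (Category.assoc _ _ _).symm.trans ((congrArg (· ≫ u) (hf hc)).trans Limits.zero_comp)
  | add x y _ _ hx hy =>
    exact (Preadditive.comp_add _ _ _ f x y).trans (by rw [hx, hy, add_zero])
  | zero => exact Limits.comp_zero
  | mul x y _ _ hx hy =>
    exact (Category.assoc _ _ _).symm.trans ((congrArg (· ≫ _) hy).trans Limits.zero_comp)
  | smul c x _ hx => exact (Linear.comp_smul _ _ _ f c x).trans (by rw [hx, smul_zero])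

/-- The properties which characterize the Jones-Wenzl idempotent. -/
structure JWSpec {n : ℕ} (f : (⟨n⟩ : TL a) ⟶ ⟨n⟩) : Prop where
  sub_one_mem : (show End (⟨n⟩ : TL a) from f - 𝟙 _) ∈ hookIdeal a n
  comp_cap {k : ℕ} {c : (⟨n⟩ : TL a) ⟶ ⟨k⟩} (hc : IsCap c) : f ≫ c = 0
  cup_comp {k : ℕ} {u : (⟨k⟩ : TL a) ⟶ ⟨n⟩} (hu : IsCup u) : u ≫ f = 0

namespace JWSpec

variable {n : ℕ} {f : (⟨n⟩ : TL a) ⟶ ⟨n⟩}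

/-- A morphism which kills the cups absorbs `f ⊗ 1`. -/
theorem addStrand_absorb (hf : JWSpec f) {g : (⟨n + 1⟩ : TL a) ⟶ ⟨n + 1⟩} (hg : JWSpec g) :
    addStrand f ≫ g = g := by
  have h := hookIdeal_comp_eq_zero hg.cup_comp (addStrand_mem_hookIdeal hf.sub_one_mem)
  have e : addStrand f = addStrand (f - 𝟙 _) + 𝟙 _ := by
    rw [← addStrand_id, ← addStrand_add, sub_add_cancel]
  rw [e, Preadditive.add_comp, Category.id_comp]
  exact (congrArg (· + g) h).trans (zero_add g)

theorem absorb_addStrand (hf : JWSpec f) {g : (⟨n + 1⟩ : TL a) ⟶ ⟨n + 1⟩} (hg : JWSpec g) :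
    g ≫ addStrand f = g := by
  have h := comp_hookIdeal_eq_zero hg.comp_cap (addStrand_mem_hookIdeal hf.sub_one_mem)
  have e : addStrand f = addStrand (f - 𝟙 _) + 𝟙 _ := by
    rw [← addStrand_id, ← addStrand_add, sub_add_cancel]
  rw [e, Preadditive.comp_add, Category.comp_id]
  exact (congrArg (· + g) h).trans (zero_add g)

theorem idem (hf : JWSpec f) : f ≫ f = f := by
  have h : (f - 𝟙 _) ≫ f = 0 := hookIdeal_comp_eq_zero hf.cup_comp hf.sub_one_mem
  rwa [Preadditive.sub_comp, Category.id_comp, sub_eq_zero] at h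

theorem isJonesWenzl (hf : JWSpec f) : IsJonesWenzl a (n := n) f where
  sub_one_mem := hf.sub_one_mem
  hook_mul _ he := comp_hookIdeal_eq_zero hf.comp_cap (NonUnitalAlgebra.subset_adjoin _ he)
  mul_hook _ he := hookIdeal_comp_eq_zero hf.cup_comp (NonUnitalAlgebra.subset_adjoin _ he)

theorem eq_of_isJonesWenzl (hf : JWSpec f) {g : End (⟨n⟩ : TL a)} (hg : IsJonesWenzl a g) :
    g = f := by
  have key : ∀ x ∈ hookIdeal a n, g * x = 0 := fun x hx => by
    induction hx using NonUnitalAlgebra.adjoin_induction with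
    | mem x hx => exact hg.mul_hook x hx
    | add x y _ _ hx hy => rw [mul_add, hx, hy, add_zero]
    | zero => exact mul_zero g
    | mul x y _ _ hx _ => rw [← mul_assoc, hx, zero_mul]
    | smul c x _ hx => rw [mul_smul_comm, hx, smul_zero]
  have h₁ : (f - 𝟙 _) ≫ (show (⟨n⟩ : TL a) ⟶ ⟨n⟩ from g) = 0 := key _ hf.sub_one_mem
  have h₂ : f ≫ (show (⟨n⟩ : TL a) ⟶ ⟨n⟩ from g) - f = 0 := by
    have := comp_hookIdeal_eq_zero hf.comp_cap hg.sub_one_mem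
    exact (congrArg _ (Category.comp_id f).symm).trans
      ((Preadditive.comp_sub f _ _).symm.trans this)
  rw [Preadditive.sub_comp, Category.id_comp, sub_eq_zero] at h₁
  rw [sub_eq_zero] at h₂
  exact h₁.symm.trans h₂

theorem jonesWenzl_eq (hf : JWSpec f) : jonesWenzl a n = f := by
  have h : ∃ g : End (⟨n⟩ : TL a), IsJonesWenzl a g := ⟨f, hf.isJonesWenzl⟩
  rw [jonesWenzl, dif_pos h]
  exact hf.eq_of_isJonesWenzl h.choose_spec

end JWSpec

theorem add_smul_sub_one_mem {R : Type*} [Ring R] [Algebra ℂ R] (S : NonUnitalSubalgebra ℂ R)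
    {x y : R} (hx : x ∈ S) (hy : y ∈ S) (t : ℂ) :
    x + 1 + t • ((x + 1) * y * (x + 1)) - 1 ∈ S := by
  have e : x + 1 + t • ((x + 1) * y * (x + 1)) - 1 = x + t • (x * y * x + x * y + y * x + y) := by
    rw [show (x + 1) * y * (x + 1) = x * y * x + x * y + y * x + y by noncomm_ring]
    abel
  rw [e]
  exact add_mem hx (S.smul_mem' _ (add_mem (add_mem (add_mem
    (mul_mem (mul_mem hx hy) hx) (mul_mem hx hy)) (mul_mem hy hx)) hy))

/-- The Jones-Wenzl elements `jw q n` have the characterizing properties as long as `[1], …, [n]` do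
not vanish, and closing the last strand of `jw q (n + 1)` gives a multiple of `jw q n`. -/
theorem jw_spec_aux (hq : (q : ℂ) = a ^ 2) (hD : (q : ℂ) - (q : ℂ)⁻¹ ≠ 0) (n : ℕ)
    (h : ∀ i : ℕ, 1 ≤ i → i ≤ n + 1 → qint q (i : ℤ) ≠ 0) :
    JWSpec (a := a) (jw q n) ∧ JWSpec (a := a) (jw q (n + 1)) ∧
      cupLast a n ≫ addStrand (jw q (n + 1)) ≫ capLast a n =
        (-(qint q ((n + 2 : ℕ) : ℤ) / qint q ((n + 1 : ℕ) : ℤ))) • jw q n := by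
  have hδ : a ^ 2 + a⁻¹ ^ 2 = q + (q : ℂ)⁻¹ := by rw [hq, inv_pow]
  induction n with
  | zero =>
    refine ⟨⟨?_, ?_, ?_⟩, ⟨?_, ?_, ?_⟩, ?_⟩
    · rw [jw_zero]; exact (sub_self (𝟙 (⟨0⟩ : TL a))).symm ▸ zero_mem (hookIdeal a 0)
    · intro k c hc; cases hc
    · intro k u hu; cases hu
    · rw [jw_one]; exact (sub_self (𝟙 (⟨1⟩ : TL a))).symm ▸ zero_mem (hookIdeal a 1)
    · intro k c hc; cases hc with | add hc => cases hc
    · intro k u hu; cases hu with | add hu => cases hu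
    · rw [jw_one, addStrand_id, Category.id_comp, cupLast_capLast, jw_zero, hδ]
      have e : qint q ((0 + 2 : ℕ) : ℤ) = q + (q : ℂ)⁻¹ := by
        have := qint_add_two (q := q) 0
        rw [show qint q 0 = 0 by simp [qint], zero_add, zero_add, qint_one hD] at this
        simpa using this
      rw [e, Nat.zero_add, Nat.cast_one, qint_one hD, div_one]
  | succ n ih =>
    obtain ⟨h₀, h₁, h₂⟩ := ih fun i hi hi' => h i hi (by omega)
    have hn₁ := h (n + 1) (by omega) (by omega)
    have hn₂ := h (n + 2) (by omega) (by omega)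
    set J := jw (a := a) q (n + 1) with hJ
    have ht : (qint q ((n + 1 : ℕ) : ℤ) / qint q ((n + 2 : ℕ) : ℤ)) *
        (-(qint q ((n + 2 : ℕ) : ℤ) / qint q ((n + 1 : ℕ) : ℤ))) = -1 := by
      rw [mul_neg, div_mul_div_cancel₀ hn₂, div_self hn₁]
    -- For the last cap, the coefficient in Wenzl's recursion is chosen to cancel the partial trace
    -- of `jw q (n + 1)`; the other caps are killed by `jw q (n + 1)`.
    have hcap : ∀ {k : ℕ} {c : (⟨n + 2⟩ : TL a) ⟶ ⟨k⟩}, IsCap c → jw q (n + 2) ≫ c = 0 := by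
      intro k c hc
      rw [jw_add_two, ← hJ, Preadditive.add_comp, Linear.smul_comp]
      cases hc with
      | last =>
        have e : addStrand J ≫ capLast a n ≫ jw q n = addStrand J ≫ capLast a n := by
          rw [← addStrand_addStrand_capLast, ← Category.assoc, ← addStrand_comp,
            h₀.absorb_addStrand h₁]
        simp only [Category.assoc]
        rw [h₂, Linear.comp_smul, Linear.comp_smul, e, smul_smul, ht, neg_one_smul, add_neg_cancel]
      | add hc =>
        simp only [Category.assoc]
        rw [← addStrand_comp, h₁.comp_cap hc, addStrand_zero, Limits.comp_zero, Limits.comp_zero,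
          Limits.comp_zero, smul_zero, add_zero]
    have hcup : ∀ {k : ℕ} {u : (⟨k⟩ : TL a) ⟶ ⟨n + 2⟩}, IsCup u → u ≫ jw q (n + 2) = 0 := by
      intro k u hu
      rw [jw_add_two, ← hJ, Preadditive.comp_add, Linear.comp_smul]
      cases hu with
      | last =>
        have e : jw q n ≫ cupLast a n ≫ addStrand J = cupLast a n ≫ addStrand J := by
          rw [← reassoc_of% (cupLast_addStrand_addStrand (a := a)), ← addStrand_comp,
            h₀.addStrand_absorb h₁]
        rw [show cupLast a n ≫ addStrand J ≫ (capLast a n ≫ cupLast a n) ≫ addStrand J =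
          (cupLast a n ≫ addStrand J ≫ capLast a n) ≫ cupLast a n ≫ addStrand J by
            simp only [Category.assoc], h₂, Linear.smul_comp, e, smul_smul, ht, neg_one_smul,
          add_neg_cancel]
      | add hu =>
        rw [← Category.assoc, ← addStrand_comp, h₁.cup_comp hu, addStrand_zero, Limits.zero_comp,
          smul_zero, add_zero]
    have hmem : (show End (⟨n + 2⟩ : TL a) from jw q (n + 2) - 𝟙 _) ∈ hookIdeal a (n + 2) := by
      have hA := addStrand_mem_hookIdeal h₁.sub_one_mem
      have he : (show End (⟨n + 2⟩ : TL a) from capLast a n ≫ cupLast a n) ∈ hookIdeal a (n + 2) :=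
        NonUnitalAlgebra.subset_adjoin _ (mem_hooks_iff.2 (.last n))
      have eA : addStrand J = addStrand (J - 𝟙 _) + 𝟙 _ := by
        rw [← addStrand_id (n := n + 1), ← addStrand_add, sub_add_cancel]
      rw [jw_add_two, ← hJ, eA]
      exact add_smul_sub_one_mem _ hA he _
    refine ⟨h₁, ⟨hmem, hcap, hcup⟩, ?_⟩
    -- Closing the last strand in the recursion gives a circle and a zigzag, whence the coefficient
    -- `-[2] + [n + 1] / [n + 2] = -[n + 3] / [n + 2]`.
    rw [jw_add_two, ← hJ, addStrand_add, addStrand_smul, Preadditive.add_comp,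
      Preadditive.comp_add, Linear.smul_comp, Linear.comp_smul]
    simp only [addStrand_comp, Category.assoc]
    rw [reassoc_of% @cupLast_addStrand_addStrand, cupLast_capLast, addStrand_addStrand_capLast,
      reassoc_of% @cupLast_addStrand_addStrand, reassoc_of% @cupLast_addStrand_capLast,
      reassoc_of% @addStrand_cupLast_capLast, h₁.idem, Linear.comp_smul, Category.comp_id, ← add_smul, hδ]
    congr 1
    have e₂ := qint_add_two (q := q) ((n + 1 : ℕ) : ℤ)
    rw [show (((n + 1 : ℕ) : ℤ) + 2) = ((n + 1 + 2 : ℕ) : ℤ) by push_cast; ring,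
      show (((n + 1 : ℕ) : ℤ) + 1) = ((n + 2 : ℕ) : ℤ) by push_cast; ring] at e₂
    rw [e₂]
    change _ = -(_ / qint q ((n + 2 : ℕ) : ℤ))
    field_simp
    ring

theorem jw_spec (hq : (q : ℂ) = a ^ 2) (hD : (q : ℂ) - (q : ℂ)⁻¹ ≠ 0) {n : ℕ}
    (h : ∀ i : ℕ, 1 ≤ i → i ≤ n → qint q (i : ℤ) ≠ 0) :
    JWSpec (a := a) (jw q n) := by
  obtain _ | n := n
  · refine (jw_spec_aux hq hD 0 fun i hi hi' => ?_).1
    obtain rfl : i = 1 := by omega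
    rw [Nat.cast_one, qint_one hD]; exact one_ne_zero
  · exact (jw_spec_aux hq hD n h).2.1

theorem jw_spec_of_mem (hq : (q : ℂ) = a ^ 2) {n : ℕ} (hn : n ∈ SimpleIndex q) :
    JWSpec (a := a) (jw q n) :=
  jw_spec hq (SimpleModule.sub_ne_zero_of_mem hn) fun i hi hi' => by
    obtain ⟨l, rfl⟩ : ∃ l, i = l + 1 := ⟨i - 1, by omega⟩
    exact SimpleIndex.qint_natCast_ne_zero hn (by omega)

/-! ### The decomposition of the identity -/

/-- The critical Jones-Wenzl idempotent with vertical strands on the right. -/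
inductive IsCrit (q : ℂˣ) : ∀ {n : ℕ}, ((⟨n⟩ : TL a) ⟶ ⟨n⟩) → Prop
  | base {c : ℕ} (hc : IsCritical q c) : IsCrit q (jw q c)
  | add {n : ℕ} {f : (⟨n⟩ : TL a) ⟶ ⟨n⟩} : IsCrit q f → IsCrit q (addStrand f)

/-- The span of the morphisms which factor through a Jones-Wenzl idempotent `f_i`, where `V_i` is one
of the given simple modules, or through a critical idempotent. -/
def jwSpan (q : ℂˣ) (m n : ℕ) : Submodule ℂ ((⟨m⟩ : TL a) ⟶ ⟨n⟩) :=
  Submodule.span ℂ {z | (∃ i ∈ SimpleIndex q, ∃ (x : (⟨m⟩ : TL a) ⟶ ⟨i⟩) (y : (⟨i⟩ : TL a) ⟶ ⟨n⟩),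
    z = x ≫ jw q i ≫ y) ∨ ∃ (i : ℕ) (e : (⟨i⟩ : TL a) ⟶ ⟨i⟩) (x : (⟨m⟩ : TL a) ⟶ ⟨i⟩)
      (y : (⟨i⟩ : TL a) ⟶ ⟨n⟩), IsCrit q e ∧ z = x ≫ e ≫ y}

theorem comp_jwSpan_comp {m n m' n' : ℕ} (x : (⟨m'⟩ : TL a) ⟶ ⟨m⟩) (y : (⟨n⟩ : TL a) ⟶ ⟨n'⟩)
    {f : (⟨m⟩ : TL a) ⟶ ⟨n⟩} (hf : f ∈ jwSpan q m n) : x ≫ f ≫ y ∈ jwSpan q m' n' := by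
  induction hf using Submodule.span_induction with
  | mem z hz =>
    obtain ⟨i, hi, x', y', rfl⟩ | ⟨i, e, x', y', he, rfl⟩ := hz
    · exact Submodule.subset_span (Or.inl ⟨i, hi, x ≫ x', y' ≫ y, by simp only [Category.assoc]⟩)
    · exact Submodule.subset_span
        (Or.inr ⟨i, e, x ≫ x', y' ≫ y, he, by simp only [Category.assoc]⟩)
  | zero => rw [Limits.zero_comp, Limits.comp_zero]; exact zero_mem _
  | add f g _ _ hf hg =>
    rw [Preadditive.add_comp, Preadditive.comp_add]; exact add_mem hf hg
  | smul c f _ hf =>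
    rw [Linear.smul_comp, Linear.comp_smul]; exact Submodule.smul_mem _ c hf

/-- Wenzl's recursion, read as a decomposition of `f_i ⊗ 1` into `f_{i+1}`, which may be critical,
and a morphism which factors through `f_{i-1}`. -/
theorem addStrand_jw_mem_jwSpan (hq : (q : ℂ) = a ^ 2) (h1 : 1 ∈ SimpleIndex q) {i : ℕ}
    (hi : i ∈ SimpleIndex q) : addStrand (jw q i) ∈ jwSpan (a := a) q (i + 1) (i + 1) := by
  have hmem : ∀ j, j ∈ SimpleIndex q ∨ IsCritical q j → jw q j ∈ jwSpan (a := a) q j j := by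
    rintro j (hj | hj)
    · exact Submodule.subset_span (Or.inl ⟨j, hj, 𝟙 _, 𝟙 _, by simp⟩)
    · exact Submodule.subset_span (Or.inr ⟨j, jw q j, 𝟙 _, 𝟙 _, .base hj, by simp⟩)
  obtain _ | n := i
  · rw [jw_zero, addStrand_id]
    exact hmem 1 (Or.inl h1)
  · have e := jw_add_two (a := a) q n
    rw [← sub_eq_iff_eq_add] at e
    rw [← e]
    have hn : n ∈ SimpleIndex q := SimpleIndex.of_le hi (Nat.le_succ n)
    refine sub_mem (hmem _ ?_) (Submodule.smul_mem _ _ (Submodule.subset_span (Or.inl ?_)))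
    · by_cases h : n + 2 ∈ SimpleIndex q
      · exact Or.inl h
      · exact Or.inr ⟨n + 1, hi, rfl, h⟩
    · refine ⟨n, hn, addStrand (jw q (n + 1)) ≫ capLast a n,
        cupLast a n ≫ addStrand (jw q (n + 1)), ?_⟩
      have e' : addStrand (jw q (n + 1)) ≫ capLast a n ≫ jw q n =
          addStrand (jw q (n + 1)) ≫ capLast a n := by
        rw [← addStrand_addStrand_capLast, ← Category.assoc, ← addStrand_comp,
          (jw_spec_of_mem hq hn).absorb_addStrand (jw_spec_of_mem hq hi)]
      simp only [Category.assoc]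
      rw [reassoc_of% e']

theorem id_mem_jwSpan (hq : (q : ℂ) = a ^ 2) (h1 : 1 ∈ SimpleIndex q) (n : ℕ) :
    𝟙 (⟨n⟩ : TL a) ∈ jwSpan q n n := by
  induction n with
  | zero =>
    exact Submodule.subset_span (Or.inl ⟨0, SimpleIndex.of_le h1 (Nat.zero_le 1), 𝟙 _, 𝟙 _,
      by simp [jw_zero]⟩)
  | succ n ih =>
    rw [← addStrand_id]
    generalize 𝟙 (⟨n⟩ : TL a) = f at ih
    induction ih using Submodule.span_induction with
    | mem z hz =>
      obtain ⟨i, hi, x, y, rfl⟩ | ⟨i, e, x, y, he, rfl⟩ := hz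
      · rw [addStrand_comp, addStrand_comp]
        exact comp_jwSpan_comp _ _ (addStrand_jw_mem_jwSpan hq h1 hi)
      · rw [addStrand_comp, addStrand_comp]
        exact Submodule.subset_span (Or.inr ⟨_, _, _, _, he.add, rfl⟩)
    | zero => rw [addStrand_zero]; exact zero_mem _
    | add f g _ _ hf hg => rw [addStrand_add]; exact add_mem hf hg
    | smul c f _ hf => rw [addStrand_smul]; exact Submodule.smul_mem _ c hf

end TL

/-! ### Strict calculus in the Temperley-Lieb category -/

namespace TL

/-- Morphisms of the Temperley-Lieb category, with source and target not recorded in the type. The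
tensor product of such arrows is strictly associative. -/
structure Arr (a : ℂ) where
  src : ℕ
  tgt : ℕ
  hom : (⟨src⟩ : TL a) ⟶ ⟨tgt⟩

namespace Arr

variable {a : ℂ}

/-- A morphism as an arrow. -/
def of {m n : TL a} (f : m ⟶ n) : Arr a := ⟨m.strands, n.strands, f⟩

variable (a) in
/-- The vertical strands. -/
def idn (n : ℕ) : Arr a := of (𝟙 ⟨n⟩)

theorem of_injective {m n : TL a} {f g : m ⟶ n} (h : of f = of g) : f = g := by
  simpa [of] using h

theorem ext' {x y : Arr a} (h : x.src = y.src) (h' : x.tgt = y.tgt)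
    (e : x.hom ≫ (eqIso (m := (⟨x.tgt⟩ : TL a)) (n := ⟨y.tgt⟩) h').hom =
      (eqIso (m := (⟨x.src⟩ : TL a)) (n := ⟨y.src⟩) h).hom ≫ y.hom) : x = y := by
  obtain ⟨s, t, f⟩ := x
  obtain ⟨s', t', g⟩ := y
  dsimp only at h h'
  subst h h'
  have e : f ≫ 𝟙 _ = 𝟙 _ ≫ g := e
  rw [Category.comp_id, Category.id_comp] at e
  rw [e]

/-- Composition; the result is zero if the numbers of end points do not match. -/
def comp (x y : Arr a) : Arr a :=
  if h : x.tgt = y.src then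
    ⟨x.src, y.tgt, x.hom ≫ (eqIso (m := (⟨x.tgt⟩ : TL a)) (n := ⟨y.src⟩) h).hom ≫ y.hom⟩
  else ⟨x.src, y.tgt, 0⟩

theorem comp_mk {m n p : ℕ} (f : (⟨m⟩ : TL a) ⟶ ⟨n⟩) (g : (⟨n⟩ : TL a) ⟶ ⟨p⟩) :
    comp ⟨m, n, f⟩ ⟨n, p, g⟩ = ⟨m, p, f ≫ g⟩ :=
  (dif_pos rfl).trans (congrArg (Arr.mk m p) (congrArg (f ≫ ·) (Category.id_comp g)))

theorem comp_of_ne {x y : Arr a} (h : x.tgt ≠ y.src) : comp x y = ⟨x.src, y.tgt, 0⟩ := dif_neg h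

theorem comp_src (x y : Arr a) : (x.comp y).src = x.src := by unfold comp; split_ifs <;> rfl
theorem comp_tgt (x y : Arr a) : (x.comp y).tgt = y.tgt := by unfold comp; split_ifs <;> rfl

instance : Mul (Arr a) := ⟨fun x y => ⟨x.src + y.src, x.tgt + y.tgt, tensorMap x.hom y.hom⟩⟩
instance : One (Arr a) := ⟨idn a 0⟩

theorem mk_assoc {m n m' n' m'' n'' : ℕ} (f : (⟨m⟩ : TL a) ⟶ ⟨n⟩) (g : (⟨m'⟩ : TL a) ⟶ ⟨n'⟩)
    (h : (⟨m''⟩ : TL a) ⟶ ⟨n''⟩) :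
    Arr.mk (m + m' + m'') (n + n' + n'') (tensorMap (tensorMap f g) h) =
      Arr.mk (m + (m' + m'')) (n + (n' + n'')) (tensorMap f (tensorMap g h)) :=
  have e := tensorMap_assoc f g h
  ext' (x := Arr.mk (m + m' + m'') (n + n' + n'') (tensorMap (tensorMap f g) h))
    (y := Arr.mk (m + (m' + m'')) (n + (n' + n'')) (tensorMap f (tensorMap g h)))
    (Nat.add_assoc _ _ _) (Nat.add_assoc _ _ _) e

instance : Monoid (Arr a) where
  mul_assoc x y z := mk_assoc x.hom y.hom z.hom
  one_mul x := ext' (x := ⟨0 + x.src, 0 + x.tgt, tensorMap (𝟙 (⟨0⟩ : TL a)) x.hom⟩) (y := x)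
    (Nat.zero_add _) (Nat.zero_add _) (empty_tensorMap (m := ⟨x.src⟩) (n := ⟨x.tgt⟩) x.hom)
  mul_one x := congrArg (Arr.mk x.src x.tgt) (tensorMap_unit x.hom)
  npow := npowRec

theorem mul_src (x y : Arr a) : (x * y).src = x.src + y.src := rfl
theorem mul_tgt (x y : Arr a) : (x * y).tgt = x.tgt + y.tgt := rfl
theorem idn_src (n : ℕ) : (idn a n).src = n := rfl
theorem idn_tgt (n : ℕ) : (idn a n).tgt = n := rfl
theorem of_src {m n : TL a} (f : m ⟶ n) : (of f).src = m.strands := rfl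
theorem of_tgt {m n : TL a} (f : m ⟶ n) : (of f).tgt = n.strands := rfl
theorem idn_zero : idn a 0 = 1 := rfl

theorem idn_add (m n : ℕ) : idn a (m + n) = idn a m * idn a n :=
  congrArg (Arr.mk (m + n) (m + n)) (tensorMap_id (⟨m⟩ : TL a) ⟨n⟩).symm

theorem of_comp {m n p : TL a} (f : m ⟶ n) (g : n ⟶ p) : of (f ≫ g) = (of f).comp (of g) := by
  obtain ⟨m⟩ := m
  obtain ⟨n⟩ := n
  obtain ⟨p⟩ := p
  exact (comp_mk f g).symm

theorem of_tensorHom {m n m' n' : TL a} (f : m ⟶ n) (g : m' ⟶ n') :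
    of (f ⊗ₘ g) = of f * of g := rfl
theorem of_whiskerLeft (m : TL a) {n n' : TL a} (g : n ⟶ n') :
    of (m ◁ g) = idn a m.strands * of g := rfl
theorem of_whiskerRight {m m' : TL a} (g : m ⟶ m') (n : TL a) :
    of (g ▷ n) = of g * idn a n.strands := rfl

theorem of_eqIso_hom {m n : TL a} (h : m.strands = n.strands) :
    of (eqIso h).hom = idn a m.strands := by
  obtain ⟨m⟩ := m
  obtain ⟨n⟩ := n
  dsimp only at h
  subst h
  rfl

theorem of_eqIso_inv {m n : TL a} (h : m.strands = n.strands) :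
    of (eqIso h).inv = idn a m.strands := by
  obtain ⟨m⟩ := m
  obtain ⟨n⟩ := n
  dsimp only at h
  subst h
  rfl

theorem of_associator_hom (m n p : TL a) :
    of (α_ m n p).hom = idn a (m.strands + n.strands + p.strands) := of_eqIso_hom _
theorem of_associator_inv (m n p : TL a) :
    of (α_ m n p).inv = idn a (m.strands + n.strands + p.strands) := of_eqIso_inv _
theorem of_leftUnitor_hom (m : TL a) : of (λ_ m).hom = idn a m.strands :=
  (of_eqIso_hom _).trans (congrArg _ (Nat.zero_add _))
theorem of_leftUnitor_inv (m : TL a) : of (λ_ m).inv = idn a m.strands :=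
  (of_eqIso_inv _).trans (congrArg _ (Nat.zero_add _))
theorem of_rightUnitor_hom (m : TL a) : of (ρ_ m).hom = idn a m.strands := of_eqIso_hom _
theorem of_rightUnitor_inv (m : TL a) : of (ρ_ m).inv = idn a m.strands := of_eqIso_inv _

theorem comp_assoc (x y z : Arr a) : (x.comp y).comp z = x.comp (y.comp z) := by
  obtain ⟨s, t, f⟩ := x
  obtain ⟨s', t', g⟩ := y
  obtain ⟨s'', t'', h⟩ := z
  by_cases h₁ : t = s' <;> by_cases h₂ : t' = s''
  · subst h₁ h₂
    simp only [comp_mk, Category.assoc]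
  · subst h₁
    rw [comp_of_ne (x := ⟨t, t', g⟩) h₂, comp_mk, comp_mk, comp_of_ne (x := ⟨s, t', f ≫ g⟩) h₂,
      Limits.comp_zero]
  · subst h₂
    rw [comp_of_ne (x := ⟨s, t, f⟩) h₁, comp_mk, comp_mk, comp_of_ne (x := ⟨s, t, f⟩) h₁,
      Limits.zero_comp]
  · rw [comp_of_ne (x := ⟨s, t, f⟩) h₁, comp_of_ne (x := ⟨s', t', g⟩) h₂,
      comp_of_ne (x := ⟨s, t, f⟩) h₁, comp_of_ne (x := ⟨s, t', 0⟩) h₂]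

theorem idn_comp {n : ℕ} {x : Arr a} (h : n = x.src) : (idn a n).comp x = x := by
  subst h
  exact (of_comp (𝟙 _) x.hom).symm.trans (congrArg of (Category.id_comp x.hom))

theorem comp_idn {n : ℕ} {x : Arr a} (h : n = x.tgt) : x.comp (idn a n) = x := by
  subst h
  exact (of_comp x.hom (𝟙 _)).symm.trans (congrArg of (Category.comp_id x.hom))

theorem idn_mul_comp (m : ℕ) (x y : Arr a) :
    (idn a m * x).comp (idn a m * y) = idn a m * x.comp y := by
  obtain ⟨s, t, f⟩ := x
  obtain ⟨s', t', g⟩ := y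
  by_cases h : t = s'
  · subst h
    have e₁ := of_comp f g
    have e₂ := of_comp ((⟨m⟩ : TL a) ◁ f) (⟨m⟩ ◁ g)
    rw [← MonoidalCategory.whiskerLeft_comp] at e₂
    exact e₂.symm.trans (congrArg (idn a m * ·) e₁)
  · rw [comp_of_ne (x := ⟨s, t, f⟩) h,
      comp_of_ne fun h' : m + t = m + s' => h (Nat.add_left_cancel h')]
    exact congrArg (Arr.mk (m + s) (m + t')) (tensorMap_zero _).symm

theorem mul_idn_comp (m : ℕ) (x y : Arr a) :
    (x * idn a m).comp (y * idn a m) = x.comp y * idn a m := by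
  obtain ⟨s, t, f⟩ := x
  obtain ⟨s', t', g⟩ := y
  by_cases h : t = s'
  · subst h
    have e₁ := of_comp f g
    have e₂ := of_comp (f ▷ (⟨m⟩ : TL a)) (g ▷ ⟨m⟩)
    rw [← MonoidalCategory.comp_whiskerRight] at e₂
    exact e₂.symm.trans (congrArg (· * idn a m) e₁)
  · rw [comp_of_ne (x := ⟨s, t, f⟩) h,
      comp_of_ne fun h' : t + m = s' + m => h (Nat.add_right_cancel h')]
    exact congrArg (Arr.mk (s + m) (t' + m)) (zero_tensorMap _).symm

/-- Interchange of distant pieces. -/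
theorem mul_eq_comp {x y : Arr a} {m n : ℕ} (hm : m = y.src) (hn : n = x.tgt) :
    x * y = (x * idn a m).comp (idn a n * y) := by
  subst hm hn
  have e := of_comp (x.hom ▷ (⟨y.src⟩ : TL a)) (⟨x.tgt⟩ ◁ y.hom)
  rw [← MonoidalCategory.tensorHom_def] at e
  exact e

theorem mul_eq_comp' {x y : Arr a} {m n : ℕ} (hm : m = x.src) (hn : n = y.tgt) :
    x * y = (idn a m * y).comp (x * idn a n) := by
  subst hm hn
  have e := of_comp ((⟨x.src⟩ : TL a) ◁ y.hom) (x.hom ▷ (⟨y.tgt⟩ : TL a))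
  rw [← MonoidalCategory.tensorHom_def'] at e
  exact e

theorem mul_comp_mul {x y x' y' : Arr a} (h : x.tgt = x'.src) (h' : y.tgt = y'.src) :
    (x * y).comp (x' * y') = x.comp x' * y.comp y' := by
  obtain ⟨s, t, f⟩ := x
  obtain ⟨s', t', g⟩ := y
  obtain ⟨u, v, f'⟩ := x'
  obtain ⟨u', v', g'⟩ := y'
  dsimp only at h h'
  subst h h'
  have e := of_comp (f ⊗ₘ g) (f' ⊗ₘ g')
  rw [MonoidalCategory.tensorHom_comp_tensorHom] at e
  refine e.symm.trans ((of_tensorHom _ _).trans ?_)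
  rw [of_comp, of_comp]
  rfl

/-! ### Nested cups and caps -/

variable (a) in
/-- The cup, as an arrow. -/
def cupA : Arr a := of (cup a)
variable (a) in
/-- The cap, as an arrow. -/
def capA : Arr a := of (cap a)
variable (a) in
/-- The `n` nested cups. -/
def coevA (n : ℕ) : Arr a := of (coev a n)
variable (a) in
/-- The `n` nested caps. -/
def evA (n : ℕ) : Arr a := of (ev a n)

theorem coevA_zero : coevA a 0 = 1 := of_leftUnitor_inv _
theorem evA_zero : evA a 0 = 1 := of_leftUnitor_hom _

theorem coevA_succ (n : ℕ) :
    coevA a (n + 1) = (coevA a n).comp (idn a n * (cupA a * idn a n)) := by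
  unfold coevA
  rw [coev, of_comp, of_comp, of_whiskerLeft, of_comp, of_leftUnitor_inv, of_whiskerRight,
    of_eqIso_hom, idn_comp, comp_idn]
  · rfl
  · change _ = n + (2 + n)
    rfl
  · exact (Nat.zero_add n).symm

theorem evA_succ (n : ℕ) :
    evA a (n + 1) = (idn a n * (capA a * idn a n)).comp (evA a n) := by
  unfold evA
  rw [ev, of_comp, of_comp, of_whiskerLeft, of_comp, of_leftUnitor_hom, of_whiskerRight,
    of_eqIso_hom, idn_comp, comp_idn]
  · rfl
  · exact (Nat.zero_add n).symm
  · rw [comp_src, mul_src, comp_src]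
    change n + 1 + (n + 1) = n + (2 + n)
    omega

theorem cupA_src : (cupA a).src = 0 := rfl
theorem cupA_tgt : (cupA a).tgt = 2 := rfl
theorem capA_src : (capA a).src = 2 := rfl
theorem capA_tgt : (capA a).tgt = 0 := rfl
theorem coevA_src (n : ℕ) : (coevA a n).src = 0 := rfl
theorem coevA_tgt (n : ℕ) : (coevA a n).tgt = n + n := rfl
theorem evA_src (n : ℕ) : (evA a n).src = n + n := rfl
theorem evA_tgt (n : ℕ) : (evA a n).tgt = 0 := rfl

theorem cup_zigzag : (cupA a * idn a 1).comp (idn a 1 * capA a) = idn a 1 :=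
  (of_comp (m := ⟨1⟩) (n := ⟨3⟩) (p := ⟨1⟩) _ _).symm.trans (congrArg of (zigzag_right (a := a)))

theorem cup_zigzag' : (idn a 1 * cupA a).comp (capA a * idn a 1) = idn a 1 :=
  (of_comp (m := ⟨1⟩) (n := ⟨3⟩) (p := ⟨1⟩) _ _).symm.trans (congrArg of (zigzag_left (a := a)))

theorem coevA_add (m n : ℕ) :
    coevA a (m + n) = (coevA a m).comp (idn a m * (coevA a n * idn a m)) := by
  induction n with
  | zero =>
    rw [Nat.add_zero, coevA_zero, one_mul, ← idn_add, comp_idn (coevA_tgt m).symm]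
  | succ n ih =>
    rw [← Nat.add_assoc, coevA_succ, ih, coevA_succ, comp_assoc]
    congr 1
    rw [← mul_idn_comp, ← idn_mul_comp]
    congr 1
    nth_rewrite 2 [Nat.add_comm m n]
    simp only [idn_add, mul_assoc]

theorem evA_add (m n : ℕ) :
    evA a (m + n) = (idn a m * (evA a n * idn a m)).comp (evA a m) := by
  induction n with
  | zero =>
    rw [Nat.add_zero, evA_zero, one_mul, ← idn_add, idn_comp (evA_src m).symm]
  | succ n ih =>
    rw [← Nat.add_assoc, evA_succ, ih, evA_succ, ← comp_assoc]
    congr 1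
    rw [← mul_idn_comp, ← idn_mul_comp]
    congr 1
    nth_rewrite 2 [Nat.add_comm m n]
    simp only [idn_add, mul_assoc]

theorem coevA_one : coevA a 1 = cupA a := by
  rw [coevA_succ, coevA_zero, idn_zero, mul_one, one_mul, ← idn_zero, idn_comp]
  rfl

theorem evA_one : evA a 1 = capA a := by
  rw [evA_succ, evA_zero, idn_zero, mul_one, one_mul, ← idn_zero, comp_idn]
  rfl

theorem coevA_evA (n : ℕ) : (coevA a n * idn a n).comp (idn a n * evA a n) = idn a n := by
  induction n with
  | zero => rw [coevA_zero, evA_zero, idn_zero, one_mul, ← idn_zero]; exact idn_comp rfl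
  | succ n ih =>
    have h₁ : (idn a n * (cupA a * idn a n) * idn a (n + 1)).comp
        (idn a (n + 1) * (idn a 1 * (evA a n * idn a 1))) =
        (idn a n * (evA a n * idn a 1)).comp (idn a n * (cupA a * idn a 1)) := by
      have e : cupA a * evA a n = (cupA a * idn a (n + n)).comp (idn a 2 * evA a n) :=
        mul_eq_comp rfl rfl
      have e' : cupA a * evA a n = (idn a 0 * evA a n).comp (cupA a * idn a 0) :=
        mul_eq_comp' rfl rfl
      have e₁ := congrArg (fun z => idn a n * (z * idn a 1)) (e.symm.trans e')
      rw [← mul_idn_comp, ← mul_idn_comp, ← idn_mul_comp, ← idn_mul_comp, idn_zero, one_mul,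
        mul_one] at e₁
      rw [← e₁]
      simp only [show (2 : ℕ) = 1 + 1 from rfl, idn_add, mul_assoc]
    rw [coevA_succ, Nat.add_comm n 1, evA_add 1 n, Nat.add_comm 1 n, evA_one, ← mul_idn_comp,
      ← idn_mul_comp, comp_assoc, ← comp_assoc _ _ (idn a (n + 1) * capA a), h₁, comp_assoc,
      ← comp_assoc]
    have h₂ : (coevA a n * idn a (n + 1)).comp (idn a n * (evA a n * idn a 1)) =
        idn a (n + 1) := by
      rw [idn_add, ← mul_assoc, ← mul_assoc, mul_idn_comp, ih]
    have h₃ : (idn a n * (cupA a * idn a 1)).comp (idn a (n + 1) * capA a) = idn a (n + 1) := by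
      rw [idn_add, mul_assoc, idn_mul_comp, cup_zigzag]
    rw [h₂, h₃]
    exact idn_comp rfl

theorem evA_coevA (n : ℕ) : (idn a n * coevA a n).comp (evA a n * idn a n) = idn a n := by
  induction n with
  | zero => rw [coevA_zero, evA_zero, idn_zero, one_mul, ← idn_zero]; exact idn_comp rfl
  | succ n ih =>
    have h₁ : (idn a (n + 1) * (idn a 1 * (coevA a n * idn a 1))).comp
        (idn a n * (capA a * idn a n) * idn a (n + 1)) =
        (idn a n * (capA a * idn a 1)).comp (idn a n * (coevA a n * idn a 1)) := by
      have e : capA a * coevA a n = (capA a * idn a 0).comp (idn a 0 * coevA a n) :=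
        mul_eq_comp rfl rfl
      have e' : capA a * coevA a n = (idn a 2 * coevA a n).comp (capA a * idn a (n + n)) :=
        mul_eq_comp' rfl rfl
      have e₁ := congrArg (fun z => idn a n * (z * idn a 1)) (e.symm.trans e')
      rw [← mul_idn_comp, ← mul_idn_comp, ← idn_mul_comp, ← idn_mul_comp, idn_zero, one_mul,
        mul_one] at e₁
      rw [e₁]
      simp only [show (2 : ℕ) = 1 + 1 from rfl, idn_add, mul_assoc]
    rw [evA_succ, Nat.add_comm n 1, coevA_add 1 n, Nat.add_comm 1 n, coevA_one, ← mul_idn_comp,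
      ← idn_mul_comp, comp_assoc, ← comp_assoc _ _ (evA a n * idn a (n + 1)), h₁, comp_assoc,
      ← comp_assoc]
    have h₂ : (idn a n * (coevA a n * idn a 1)).comp (evA a n * idn a (n + 1)) =
        idn a (n + 1) := by
      rw [idn_add, ← mul_assoc, ← mul_assoc, mul_idn_comp, ih]
    have h₃ : (idn a (n + 1) * cupA a).comp (idn a n * (capA a * idn a 1)) = idn a (n + 1) := by
      rw [idn_add, mul_assoc, idn_mul_comp, cup_zigzag']
    rw [h₂, h₃]
    exact idn_comp rfl

/-- `y` is obtained from `x` by a rotation through nested cups. -/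
structure IsMate (x y : Arr a) : Prop where
  src_eq : y.src = x.tgt
  tgt_eq : y.tgt = x.src
  eq : (coevA a x.src).comp (x * idn a x.src) = (coevA a x.tgt).comp (idn a x.tgt * y)

theorem isMate_idn (n : ℕ) : IsMate (idn a n) (idn a n) := ⟨rfl, rfl, rfl⟩

theorem isMate_cup : IsMate (cupA a) (capA a) where
  src_eq := rfl
  tgt_eq := rfl
  eq := by
    change (coevA a 0).comp (cupA a * idn a 0) = (coevA a 2).comp (idn a 2 * capA a)
    rw [coevA_zero, idn_zero, mul_one, show (2 : ℕ) = 1 + 1 from rfl, coevA_succ, coevA_one,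
      comp_assoc, idn_add, mul_assoc, idn_mul_comp, cup_zigzag, ← idn_add, ← idn_zero,
      idn_comp cupA_src.symm, comp_idn cupA_tgt.symm]

theorem isMate_cap : IsMate (capA a) (cupA a) where
  src_eq := rfl
  tgt_eq := rfl
  eq := by
    change (coevA a 2).comp (capA a * idn a 2) = (coevA a 0).comp (idn a 0 * cupA a)
    rw [coevA_zero, idn_zero, one_mul, show (2 : ℕ) = 1 + 1 from rfl, coevA_succ, coevA_one,
      comp_assoc, idn_add, ← mul_assoc, ← mul_assoc, mul_idn_comp, cup_zigzag', ← idn_add,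
      ← idn_zero, idn_comp cupA_src.symm, comp_idn cupA_tgt.symm]

theorem IsMate.comp {x y x' y' : Arr a} (h : IsMate x y) (h' : IsMate x' y')
    (hx : x.tgt = x'.src) : IsMate (x.comp x') (y'.comp y) where
  src_eq := by rw [comp_src, comp_tgt, h'.src_eq]
  tgt_eq := by rw [comp_src, comp_tgt, h.tgt_eq]
  eq := by
    rw [comp_src, comp_tgt, ← mul_idn_comp, ← comp_assoc, h.eq, comp_assoc,
      ← mul_eq_comp' hx h.tgt_eq.symm, mul_eq_comp h.src_eq.symm rfl, ← comp_assoc, hx, h'.eq,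
      comp_assoc, idn_mul_comp]

/-- Rotation reverses the order of juxtaposed pieces. -/
theorem IsMate.mul {x y x' y' : Arr a} (h : IsMate x y) (h' : IsMate x' y') :
    IsMate (x * x') (y' * y) where
  src_eq := by rw [mul_src, mul_tgt, h.src_eq, h'.src_eq, add_comm]
  tgt_eq := by rw [mul_src, mul_tgt, h.tgt_eq, h'.tgt_eq, add_comm]
  eq := by
    have e₁ : x * x' * idn a (x.src + x'.src) =
        x * ((x' * idn a x'.src) * idn a x.src) := by
      rw [add_comm, idn_add]; simp only [mul_assoc]
    have e₂ : (idn a x.src * (coevA a x'.src * idn a x.src)).comp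
        (x * ((x' * idn a x'.src) * idn a x.src)) =
        (x * idn a x.src).comp
          (idn a x.tgt * ((coevA a x'.tgt).comp (idn a x'.tgt * y') * idn a x.src)) := by
      rw [mul_comp_mul rfl, idn_comp rfl, mul_idn_comp, h'.eq]
      · exact mul_eq_comp (by rw [mul_src, comp_src, coevA_src, idn_src, zero_add]) rfl
      · rw [mul_tgt, mul_src, mul_src, coevA_tgt, idn_src, idn_src, idn_tgt]
    have e₃ : (idn a x.tgt * y).comp
        (idn a x.tgt * ((coevA a x'.tgt).comp (idn a x'.tgt * y') * idn a x.src)) =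
        (idn a x.tgt * (coevA a x'.tgt * idn a x.tgt)).comp
          (idn a (x.tgt + x'.tgt) * (y' * y)) := by
      have e₄ : (coevA a x'.tgt).comp (idn a x'.tgt * y') * y =
          y.comp ((coevA a x'.tgt).comp (idn a x'.tgt * y') * idn a x.src) := by
        rw [mul_eq_comp' rfl h.tgt_eq.symm, comp_src, coevA_src, idn_zero, one_mul]
      rw [idn_mul_comp, ← e₄, idn_add, mul_assoc, idn_mul_comp, ← mul_assoc _ y',
        mul_comp_mul (x := coevA a x'.tgt) (y := idn a x.tgt) _ h.src_eq.symm,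
        idn_comp h.src_eq.symm]
      rw [coevA_tgt, mul_src, idn_src, h'.src_eq]
    rw [mul_src, mul_tgt, coevA_add, coevA_add, comp_assoc, comp_assoc, e₁, e₂, ← e₃, ← comp_assoc,
      h.eq, comp_assoc]

theorem IsMate.eq_comp {x y : Arr a} (h : IsMate x y) : y = (idn a x.tgt * coevA a x.src).comp
    ((idn a x.tgt * (x * idn a x.src)).comp (evA a x.tgt * idn a x.src)) := by
  rw [← comp_assoc, idn_mul_comp, h.eq, ← idn_mul_comp, comp_assoc]
  have e : (idn a x.tgt * (idn a x.tgt * y)).comp (evA a x.tgt * idn a x.src) =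
      (evA a x.tgt * idn a x.tgt).comp y := by
    rw [← mul_assoc, ← idn_add, ← mul_eq_comp' (evA_src _).symm h.tgt_eq.symm,
      mul_eq_comp h.src_eq.symm (evA_tgt _).symm, idn_zero, one_mul]
  rw [e, ← comp_assoc, evA_coevA, idn_comp h.src_eq.symm]

theorem IsMate.unique {x y y' : Arr a} (h : IsMate x y) (h' : IsMate x y') : y = y' :=
  h.eq_comp.trans h'.eq_comp.symm

/-- Mates with respect to nested cups are mates with respect to nested caps. -/
theorem IsMate.ev_eq {x y : Arr a} (h : IsMate x y) :
    (y * idn a x.src).comp (evA a x.src) = (idn a x.tgt * x).comp (evA a x.tgt) := by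
  have e₁ : (evA a x.tgt * idn a x.src * idn a x.src).comp (evA a x.src) =
      (idn a x.tgt * idn a x.tgt * evA a x.src).comp (evA a x.tgt) := by
    rw [mul_assoc, ← idn_add, ← idn_add]
    have e := (mul_eq_comp (x := evA a x.tgt) (y := evA a x.src) rfl rfl).symm.trans
      (mul_eq_comp' rfl rfl)
    simp only [evA_src, evA_tgt, idn_zero, one_mul, mul_one] at e
    exact e
  have e₂ : (idn a x.tgt * (x * idn a x.src) * idn a x.src).comp
      (idn a x.tgt * idn a x.tgt * evA a x.src) =
      (idn a x.tgt * (idn a x.src * evA a x.src)).comp (idn a x.tgt * x) := by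
    rw [mul_assoc, mul_assoc, mul_assoc (idn a x.tgt), idn_mul_comp, idn_mul_comp, ← idn_add]
    congr 1
    have e := (mul_eq_comp (x := x) (y := evA a x.src) rfl rfl).symm.trans
      (mul_eq_comp' rfl rfl)
    simp only [evA_src, evA_tgt, idn_zero, mul_one] at e
    exact e
  conv_lhs => rw [h.eq_comp]
  rw [← mul_idn_comp, ← mul_idn_comp, comp_assoc, comp_assoc, e₁, ← comp_assoc _ _ (evA a x.tgt),
    e₂, comp_assoc, ← comp_assoc, mul_assoc, idn_mul_comp, coevA_evA, ← idn_add,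
    idn_comp (by rw [comp_src]; rfl)]

/-- The zigzag identity, with an idempotent on the strands. -/
theorem zigzag_of_idem {F : Arr a} {N : ℕ} (hs : F.src = N) (ht : F.tgt = N)
    (hF : F.comp F = F) : ((coevA a N).comp (F * idn a N) * F).comp
      (F * (idn a N * F).comp (evA a N)) = F := by
  have h₁ : (coevA a N).comp (F * idn a N) * F = (coevA a N * F).comp (F * idn a N * idn a N) := by
    rw [mul_comp_mul _ ht, comp_idn ht.symm]
    rw [mul_src, hs]; rfl
  have h₂ : F * (idn a N * F).comp (evA a N) = (idn a N * idn a N * F).comp (F * evA a N) := by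
    rw [mul_assoc, mul_comp_mul hs.symm, idn_comp hs.symm]
    rw [mul_tgt, ht]; rfl
  have h₃ : (F * idn a N * idn a N).comp (idn a N * idn a N * F) =
      (idn a N * idn a N * F).comp (F * idn a N * idn a N) := by
    rw [← idn_add]
    refine (mul_eq_comp (x := F * idn a N) (y := F) hs.symm ?_).symm.trans
      (mul_eq_comp' ?_ ht.symm)
    · rw [mul_tgt, ht]; rfl
    · rw [mul_src, hs]; rfl
  have h₄ : (coevA a N * F).comp (idn a N * idn a N * F) = (idn a 0 * F).comp
      (coevA a N * idn a N) := by
    rw [← idn_add, mul_comp_mul rfl (ht.trans hs.symm), hF, comp_idn (coevA_tgt N).symm]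
    exact mul_eq_comp' rfl ht.symm
  have h₅ : (F * idn a N * idn a N).comp (F * evA a N) = (idn a N * evA a N).comp (F * idn a 0) := by
    rw [mul_assoc, ← idn_add, mul_comp_mul (ht.trans hs.symm) rfl, hF, idn_comp (evA_src N).symm]
    exact mul_eq_comp' hs.symm rfl
  rw [h₁, h₂, comp_assoc, ← comp_assoc _ _ (F * evA a N), h₃, comp_assoc, h₅, ← comp_assoc, h₄,
    comp_assoc, ← comp_assoc (coevA a N * idn a N), coevA_evA, idn_zero, one_mul, mul_one,
    idn_comp hs.symm, hF]

/-- The other zigzag identity, with an idempotent on the strands. -/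
theorem zigzag_of_idem' {F : Arr a} {N : ℕ} (hs : F.src = N) (ht : F.tgt = N)
    (hF : F.comp F = F) : (F * (coevA a N).comp (idn a N * F)).comp
      ((F * idn a N).comp (evA a N) * F) = F := by
  have h₁ : F * (coevA a N).comp (idn a N * F) = (F * coevA a N).comp (idn a N * idn a N * F) := by
    rw [mul_assoc, mul_comp_mul ht, comp_idn ht.symm]
    rw [mul_src, hs]; rfl
  have h₂ : (F * idn a N).comp (evA a N) * F = (F * idn a N * idn a N).comp (evA a N * F) := by
    rw [mul_comp_mul _ hs.symm, idn_comp hs.symm]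
    rw [mul_tgt, ht]; rfl
  have h₃ : (idn a N * idn a N * F).comp (F * idn a N * idn a N) =
      (F * idn a N * idn a N).comp (idn a N * idn a N * F) := by
    rw [← idn_add]
    refine (mul_eq_comp' (x := F * idn a N) (y := F) ?_ ht.symm).symm.trans
      (mul_eq_comp hs.symm ?_)
    · rw [mul_src, hs]; rfl
    · rw [mul_tgt, ht]; rfl
  have h₄ : (F * coevA a N).comp (F * idn a N * idn a N) = (F * idn a 0).comp
      (idn a N * coevA a N) := by
    rw [mul_assoc, ← idn_add, mul_comp_mul (ht.trans hs.symm) rfl, hF, comp_idn (coevA_tgt N).symm]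
    exact mul_eq_comp rfl ht.symm
  have h₅ : (idn a N * idn a N * F).comp (evA a N * F) = (evA a N * idn a N).comp (idn a 0 * F) := by
    rw [← idn_add, mul_comp_mul rfl (ht.trans hs.symm), hF, idn_comp (evA_src N).symm]
    exact mul_eq_comp hs.symm rfl
  rw [h₁, h₂, comp_assoc, ← comp_assoc _ _ (evA a N * F), h₃, comp_assoc, h₅, ← comp_assoc, h₄,
    comp_assoc, ← comp_assoc (idn a N * coevA a N), evA_coevA, idn_zero, one_mul, mul_one,
    idn_comp hs.symm, hF]

end Arr

open Arr

variable {a : ℂ}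

section

variable {n : ℕ}

theorem isMate_iff {f g : (⟨n⟩ : TL a) ⟶ ⟨n⟩} :
    IsMate (of f) (of g) ↔ coev a n ≫ f ▷ (⟨n⟩ : TL a) = coev a n ≫ (⟨n⟩ : TL a) ◁ g := by
  constructor
  · intro h
    refine of_injective ?_
    rw [of_comp, of_comp]
    exact h.eq
  · intro h
    have h := congrArg of h
    rw [of_comp, of_comp] at h
    exact ⟨rfl, rfl, h⟩

theorem isMate_add {f g f' g' : (⟨n⟩ : TL a) ⟶ ⟨n⟩} (h : IsMate (of f) (of g))
    (h' : IsMate (of f') (of g')) : IsMate (of (f + f')) (of (g + g')) := by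
  rw [isMate_iff] at *
  rw [MonoidalPreadditive.add_whiskerRight, MonoidalPreadditive.whiskerLeft_add,
    Preadditive.comp_add, Preadditive.comp_add, h, h']

theorem isMate_smul (c : ℂ) {f g : (⟨n⟩ : TL a) ⟶ ⟨n⟩} (h : IsMate (of f) (of g)) :
    IsMate (of (c • f)) (of (c • g)) := by
  rw [isMate_iff] at *
  rw [MonoidalLinear.smul_whiskerRight, MonoidalLinear.whiskerLeft_smul, Linear.comp_smul,
    Linear.comp_smul, h]

theorem isMate_zero : IsMate (of (0 : (⟨n⟩ : TL a) ⟶ ⟨n⟩)) (of (0 : (⟨n⟩ : TL a) ⟶ ⟨n⟩)) := by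
  rw [isMate_iff, MonoidalPreadditive.zero_whiskerRight, MonoidalPreadditive.whiskerLeft_zero,
    Limits.comp_zero]

theorem isMate_comp {f g f' g' : (⟨n⟩ : TL a) ⟶ ⟨n⟩} (h : IsMate (of f) (of g))
    (h' : IsMate (of f') (of g')) : IsMate (of (f ≫ f')) (of (g' ≫ g)) := by
  rw [of_comp, of_comp]
  exact h.comp h' rfl

/-- The mirror image of a generator is a generator. -/
theorem exists_isMate_of_mem_hooks {e : End (⟨n⟩ : TL a)} (he : e ∈ hooks a n) :
    ∃ e' ∈ hooks a n, IsMate (of (show (⟨n⟩ : TL a) ⟶ ⟨n⟩ from e))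
      (of (show (⟨n⟩ : TL a) ⟶ ⟨n⟩ from e')) ∧ IsMate (of (show (⟨n⟩ : TL a) ⟶ ⟨n⟩ from e'))
        (of (show (⟨n⟩ : TL a) ⟶ ⟨n⟩ from e)) := by
  obtain ⟨i, j, h, he⟩ := he
  have h' : n = j + (1 + 1) + i := by omega
  have key : ∀ (i j : ℕ) (h : n = i + (1 + 1) + j), of ((eqIso (m := (⟨n⟩ : TL a)) h).hom ≫
      (((⟨i⟩ : TL a) ◁ (cap a ≫ cup a)) ▷ (⟨j⟩ : TL a)) ≫
        (eqIso (n := (⟨n⟩ : TL a)) h.symm).hom) =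
      idn a i * (capA a).comp (cupA a) * idn a j := by
    intro i j h
    subst h
    rw [of_comp, of_comp, of_eqIso_hom, of_whiskerRight, of_whiskerLeft, of_comp]
    exact (idn_comp (by rw [comp_src]; rfl)).trans (comp_idn rfl)
  have key' : ∀ (i j : ℕ), IsMate (idn a i * (capA a).comp (cupA a) * idn a j)
      (idn a j * (capA a).comp (cupA a) * idn a i) := by
    intro i j
    have := ((isMate_idn (a := a) i).mul (isMate_cap.comp isMate_cup rfl)).mul (isMate_idn j)
    rwa [← mul_assoc] at this
  refine ⟨_, ⟨j, i, h', rfl⟩, ?_, ?_⟩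
  · subst he
    exact (congrArg₂ IsMate (key i j h) (key j i h')).mpr (key' i j)
  · subst he
    exact (congrArg₂ IsMate (key j i h') (key i j h)).mpr (key' j i)

theorem exists_isMate_of_mem_hookIdeal {x : End (⟨n⟩ : TL a)} (hx : x ∈ hookIdeal a n) :
    ∃ y ∈ hookIdeal a n, IsMate (of (show (⟨n⟩ : TL a) ⟶ ⟨n⟩ from x))
      (of (show (⟨n⟩ : TL a) ⟶ ⟨n⟩ from y)) := by
  induction hx using NonUnitalAlgebra.adjoin_induction with
  | mem x hx =>
    obtain ⟨e, he, h, -⟩ := exists_isMate_of_mem_hooks hx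
    exact ⟨e, NonUnitalAlgebra.subset_adjoin _ he, h⟩
  | add x y _ _ hx hy =>
    obtain ⟨x', hx', hx⟩ := hx
    obtain ⟨y', hy', hy⟩ := hy
    exact ⟨x' + y', add_mem hx' hy', isMate_add hx hy⟩
  | zero => exact ⟨0, zero_mem _, isMate_zero⟩
  | mul x y _ _ hx hy =>
    obtain ⟨x', hx', hx⟩ := hx
    obtain ⟨y', hy', hy⟩ := hy
    exact ⟨y' * x', mul_mem hy' hx', isMate_comp hy hx⟩
  | smul c x _ hx =>
    obtain ⟨x', hx', hx⟩ := hx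
    exact ⟨c • x', (hookIdeal a n).smul_mem' c hx', isMate_smul c hx⟩

/-- The Jones-Wenzl idempotents are invariant under rotation: the rotated idempotent has the
characterizing properties. -/
theorem JWSpec.isMate_self {f : (⟨n⟩ : TL a) ⟶ ⟨n⟩} (hf : JWSpec f) : IsMate (of f) (of f) := by
  obtain ⟨y, hy, hxy⟩ := exists_isMate_of_mem_hookIdeal hf.sub_one_mem
  set g : End (⟨n⟩ : TL a) := y + 1 with hg
  have hfg : IsMate (of f) (of (show (⟨n⟩ : TL a) ⟶ ⟨n⟩ from g)) := by
    have := isMate_add hxy (isMate_idn n : IsMate (of (𝟙 (⟨n⟩ : TL a))) (of (𝟙 _)))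
    exact (congrArg (fun z => IsMate (of z) _) (sub_add_cancel f (𝟙 _))).mp this
  have hz : ∀ z : (⟨n⟩ : TL a) ⟶ ⟨n⟩, IsMate (of 0) (of z) → z = 0 := fun z hz =>
    of_injective (hz.unique isMate_zero)
  have hj := hf.isJonesWenzl
  have hgf : g = f := by
    refine hf.eq_of_isJonesWenzl ⟨?_, ?_, ?_⟩
    · rw [hg, add_sub_cancel_right]; exact hy
    · intro e he
      obtain ⟨e', he', -, h⟩ := exists_isMate_of_mem_hooks he
      have h₁ := isMate_comp h hfg
      exact hz _ ((congrArg (fun z => IsMate (of z) _) (hj.mul_hook e' he')).mp h₁)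
    · intro e he
      obtain ⟨e', he', -, h⟩ := exists_isMate_of_mem_hooks he
      have h₁ := isMate_comp hfg h
      exact hz _ ((congrArg (fun z => IsMate (of z) _) (hj.hook_mul e' he')).mp h₁)
  rw [hgf] at hfg
  exact hfg

end

end TL

/-! ### Duality in Turaev's category -/

namespace Turaev

open TL TL.Arr

variable {a : ℂ}

/-- The idempotent `f_s`, as an arrow. -/
def seqA (s : List (J a)) : Arr a := 
  (s.map fun n : J a => of (m := (⟨n⟩ : TL a)) (n := ⟨n⟩) (jonesWenzl a n)).prod

theorem of_seqObj_p (s : List (J a)) : of (seqObj a s).p = seqA s := by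
  induction s with
  | nil => rfl
  | cons n s ih => rw [seqA, List.map_cons, List.prod_cons, ← seqA, ← ih]; rfl

theorem seqA_append (s t : List (J a)) : seqA (s ++ t) = seqA s * seqA t := by
  rw [seqA, List.map_append, List.prod_append]; rfl

theorem seqA_src (s : List (J a)) : (seqA s).src = (seqObj a s).X.strands := by
  rw [← of_seqObj_p]; rfl

theorem seqA_tgt (s : List (J a)) : (seqA s).tgt = (seqObj a s).X.strands := by
  rw [← of_seqObj_p]; rfl

theorem seqA_comp_seqA (s : List (J a)) : (seqA s).comp (seqA s) = seqA s := by
  rw [← of_seqObj_p, ← of_comp, (seqObj a s).idem]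

theorem isMate_seqA (h : ∀ n ∈ J a, JWSpec (jonesWenzl a n)) (s : List (J a)) :
    IsMate (seqA s) (seqA s.reverse) := by
  induction s with
  | nil => exact isMate_idn 0
  | cons n s ih =>
    rw [List.reverse_cons, seqA_append]
    have : seqA (a := a) [n] = of (m := (⟨n⟩ : TL a)) (n := ⟨n⟩) (jonesWenzl a n) := by
      rw [seqA, List.map_singleton, List.prod_singleton]
    rw [← List.singleton_append, seqA_append, this]
    exact (h n n.2).isMate_self.mul ih


theorem of_hat {P Q : Idempotents.Karoubi (TL a)} (g : P.X ⟶ Q.X) :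
    of (KaroubiMonoidal.hat g : P ⟶ Q).f = (of P.p).comp ((of g).comp (of Q.p)) := by
  rw [← of_comp, ← of_comp]; rfl

theorem of_comp_f {P Q R : Idempotents.Karoubi (TL a)} (f : P ⟶ Q) (g : Q ⟶ R) :
    of (f ≫ g).f = (of f.f).comp (of g.f) := of_comp _ _

theorem of_seqIso_hom (s t : List (J a)) : of (seqIso a s t).hom.f = seqA s * seqA t := by
  induction s with
  | nil =>
    have e : of (seqIso a [] t).hom.f = of ((λ_ (seqObj a t).X).hom ≫ (seqObj a t).p) := rfl
    rw [e, of_comp, of_leftUnitor_hom, of_seqObj_p, idn_comp (seqA_src t).symm]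
    exact (one_mul _).symm
  | cons n s ih =>
    have e : seqIso a (n :: s) t =
      α_ (⟨⟨n⟩, TL.jonesWenzl a n, TL.jonesWenzl_idem a n⟩ : Idempotents.Karoubi (TL a))
        (seqObj a s) (seqObj a t) ≪≫ whiskerLeftIso _ (seqIso a s t) := rfl
    rw [e]
    have e₁ : of (α_ (⟨⟨n⟩, TL.jonesWenzl a n, TL.jonesWenzl_idem a n⟩ : Idempotents.Karoubi (TL a))
        (seqObj a s) (seqObj a t)).hom.f = seqA (n :: s) * seqA t := by
      have : of (α_ (⟨⟨n⟩, TL.jonesWenzl a n, TL.jonesWenzl_idem a n⟩ : Idempotents.Karoubi (TL a))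
        (seqObj a s) (seqObj a t)).hom.f = of ((α_ (⟨n⟩ : TL a) (seqObj a s).X
          (seqObj a t).X).hom ≫ (jonesWenzl a n ⊗ₘ (seqObj a s).p ⊗ₘ (seqObj a t).p)) := rfl
      rw [this, of_comp, of_associator_hom, of_tensorHom, of_tensorHom, of_seqObj_p, of_seqObj_p,
        ← mul_assoc]
      have e₂ : seqA (n :: s) = of (m := (⟨n⟩ : TL a)) (n := ⟨n⟩) (jonesWenzl a n) * seqA s :=
        List.prod_cons
      rw [e₂]
      refine idn_comp ?_
      rw [mul_src, mul_src, seqA_src, seqA_src]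
      rfl
    have e₂ : of (whiskerLeftIso (⟨⟨n⟩, TL.jonesWenzl a n, TL.jonesWenzl_idem a n⟩ :
        Idempotents.Karoubi (TL a)) (seqIso a s t)).hom.f = seqA (n :: s) * seqA t := by
      have : of (whiskerLeftIso (⟨⟨n⟩, TL.jonesWenzl a n, TL.jonesWenzl_idem a n⟩ :
        Idempotents.Karoubi (TL a)) (seqIso a s t)).hom.f =
          of (jonesWenzl a n ⊗ₘ (seqIso a s t).hom.f) := rfl
      rw [this, of_tensorHom, ih, ← mul_assoc]
      have e₂ : seqA (n :: s) = of (m := (⟨n⟩ : TL a)) (n := ⟨n⟩) (jonesWenzl a n) * seqA s :=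
        List.prod_cons
      rw [e₂]
    refine (of_comp _ _).trans ((congrArg₂ Arr.comp e₁ e₂).trans ?_)
    rw [← seqA_append, seqA_comp_seqA]

theorem of_seqIso_inv (s t : List (J a)) : of (seqIso a s t).inv.f = seqA s * seqA t := by
  have h : of ((seqIso a s t).inv ≫ (seqIso a s t).hom).f = seqA s * seqA t := by
    rw [Iso.inv_hom_id]
    exact (of_seqObj_p _).trans (seqA_append s t)
  rw [of_comp_f, of_seqIso_hom] at h
  rw [← h]
  have h' : (seqIso a s t).inv = (seqIso a s t).inv ≫ 𝟙 _ := (Category.comp_id _).symm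
  rw [h', of_comp_f]
  have h'' : of (𝟙 (seqObj a s ⊗ seqObj a t) : _ ⟶ _).f = seqA s * seqA t := by
    rw [← of_seqObj_p, ← of_seqObj_p]; rfl
  rw [h'', comp_assoc, ← seqA_append, seqA_comp_seqA]

/-- The arrow underlying a morphism of Turaev's category. -/
def ofHom {s t : TuraevCat a} (f : s ⟶ t) : Arr a := of f.hom.f

theorem ofHom_injective {s t : TuraevCat a} {f g : s ⟶ t} (h : ofHom f = ofHom g) : f = g :=
  InducedCategory.hom_ext (Idempotents.Karoubi.hom_ext _ _ (of_injective h))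

theorem ofHom_comp {s t u : TuraevCat a} (f : s ⟶ t) (g : t ⟶ u) :
    ofHom (f ≫ g) = (ofHom f).comp (ofHom g) := of_comp _ _

theorem seqA_comp_ofHom {s t : TuraevCat a} (f : s ⟶ t) : (seqA s).comp (ofHom f) = ofHom f := by
  rw [ofHom, ← of_seqObj_p, ← of_comp, Idempotents.Karoubi.p_comp]

theorem ofHom_comp_seqA {s t : TuraevCat a} (f : s ⟶ t) : (ofHom f).comp (seqA t) = ofHom f := by
  rw [ofHom, ← of_seqObj_p, ← of_comp, Idempotents.Karoubi.comp_p]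

theorem ofHom_src {s t : TuraevCat a} (f : s ⟶ t) : (ofHom f).src = (seqA s).src := by
  rw [seqA_src]; rfl

theorem ofHom_tgt {s t : TuraevCat a} (f : s ⟶ t) : (ofHom f).tgt = (seqA t).src := by
  rw [seqA_src]; rfl

theorem seqA_tgt_eq (s : List (J a)) : (seqA s).tgt = (seqA s).src := by rw [seqA_src, seqA_tgt]

theorem ofHom_tensorHom {s t s' t' : TuraevCat a} (f : s ⟶ t) (g : s' ⟶ t') :
    ofHom (f ⊗ₘ g) = ofHom f * ofHom g := by
  have e : (f ⊗ₘ g).hom = (seqIso a s s').inv ≫ (f.hom ⊗ₘ g.hom) ≫ (seqIso a t t').hom := rfl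
  rw [ofHom, e, of_comp_f, of_comp_f, of_seqIso_inv, of_seqIso_hom]
  have e' : of (f.hom ⊗ₘ g.hom).f = ofHom f * ofHom g := rfl
  rw [e', mul_comp_mul, mul_comp_mul, ofHom_comp_seqA, ofHom_comp_seqA, seqA_comp_ofHom,
    seqA_comp_ofHom]
  · rw [comp_src, ofHom_src, seqA_tgt_eq]
  · rw [comp_src, ofHom_src, seqA_tgt_eq]
  · rw [ofHom_tgt]
  · rw [ofHom_tgt]

theorem ofHom_id (s : TuraevCat a) : ofHom (𝟙 s) = seqA s := of_seqObj_p s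

theorem seqA_tensor (s t : TuraevCat a) : seqA (s ⊗ t : TuraevCat a) = seqA s * seqA t :=
  seqA_append (a := a) s t

theorem ofHom_associator_hom (s t u : TuraevCat a) :
    ofHom (α_ s t u).hom = seqA s * seqA t * seqA u := by
  have e : (α_ s t u).hom.hom = (seqIso a (s ⊗ t : TuraevCat a) u).inv ≫
      (seqIso a s t).inv ▷ (seqObj a u) ≫ (α_ (seqObj a s) (seqObj a t) (seqObj a u)).hom ≫
        seqObj a s ◁ (seqIso a t u).hom ≫ (seqIso a s (t ⊗ u : TuraevCat a)).hom := rfl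
  have e₁ : of ((seqIso a s t).inv ▷ (seqObj a u)).f = seqA s * seqA t * seqA u := by
    rw [← of_seqIso_inv, ← of_seqObj_p u]; rfl
  have e₂ : of (seqObj a s ◁ (seqIso a t u).hom).f = seqA s * seqA t * seqA u := by
    rw [mul_assoc, ← of_seqIso_hom, ← of_seqObj_p s]; rfl
  have e₃ : of (α_ (seqObj a s) (seqObj a t) (seqObj a u)).hom.f = seqA s * seqA t * seqA u := by
    have : of (α_ (seqObj a s) (seqObj a t) (seqObj a u)).hom.f = of ((α_ (seqObj a s).X
      (seqObj a t).X (seqObj a u).X).hom ≫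
        ((seqObj a s).p ⊗ₘ (seqObj a t).p ⊗ₘ (seqObj a u).p)) := rfl
    rw [this, of_comp, of_associator_hom, of_tensorHom, of_tensorHom, of_seqObj_p, of_seqObj_p,
      of_seqObj_p, ← mul_assoc]
    refine idn_comp ?_
    rw [mul_src, mul_src, seqA_src, seqA_src, seqA_src]
  rw [ofHom, e]
  refine (of_comp _ _).trans ((congrArg₂ Arr.comp (of_seqIso_inv (a := a) (s ⊗ t : TuraevCat a) u)
    ((of_comp _ _).trans (congrArg₂ Arr.comp e₁ ((of_comp _ _).trans (congrArg₂ Arr.comp e₃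
      ((of_comp _ _).trans (congrArg₂ Arr.comp e₂
        (of_seqIso_hom (a := a) s (t ⊗ u : TuraevCat a))))))))).trans ?_)
  rw [seqA_tensor, seqA_tensor, ← mul_assoc, ← seqA_tensor, ← seqA_tensor]
  simp only [seqA_comp_seqA]

theorem ofHom_leftUnitor_hom (s : TuraevCat a) : ofHom (λ_ s).hom = seqA s := by
  have e : (λ_ s).hom.hom = (seqIso a [] s).inv ≫ (λ_ (seqObj a s)).hom := rfl
  have e₁ : of (λ_ (seqObj a s)).hom.f = seqA s := by
    have := of_seqIso_hom [] s
    rw [show seqA (a := a) [] = 1 from rfl, one_mul] at this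
    exact this
  rw [ofHom, e]
  refine (of_comp _ _).trans ((congrArg₂ Arr.comp (of_seqIso_inv [] s) e₁).trans ?_)
  rw [show seqA (a := a) [] = 1 from rfl, one_mul, seqA_comp_seqA]

theorem ofHom_rightUnitor_hom (s : TuraevCat a) : ofHom (ρ_ s).hom = seqA s := by
  have e : (ρ_ s).hom.hom = (seqIso a s []).inv ≫ (ρ_ (seqObj a s)).hom := rfl
  have e₁ : of (ρ_ (seqObj a s)).hom.f = seqA s := by
    have : of (ρ_ (seqObj a s)).hom.f = of ((ρ_ (seqObj a s).X).hom ≫ (seqObj a s).p) := rfl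
    rw [this, of_comp, of_rightUnitor_hom, of_seqObj_p, idn_comp (seqA_src s).symm]
  rw [ofHom, e]
  refine (of_comp _ _).trans ((congrArg₂ Arr.comp (of_seqIso_inv s []) e₁).trans ?_)
  rw [show seqA (a := a) [] = 1 from rfl, mul_one, seqA_comp_seqA]

section

variable (s : TuraevCat a)

theorem ofHom_coev (h : ∀ n ∈ J a, JWSpec (jonesWenzl a n)) :
    ofHom ((ribbonData a).coev s) = (coevA a (seqA s).src).comp (seqA s * idn a (seqA s).src) := by
  have hm := isMate_seqA h s
  have e : ((ribbonData a).coev s).hom = KaroubiMonoidal.hat (P := 𝟙_ (Idempotents.Karoubi (TL a)))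
      (Q := seqObj a s ⊗ seqObj a (List.reverse s)) (TL.coev a (seqObj a s).X.strands ≫
        (seqObj a s).X ◁ (TL.eqIso (seqObj_reverse_strands a s)).hom) ≫
      (seqIso a s (List.reverse s)).hom := rfl
  have e₁ : of (seqObj a s ⊗ seqObj a (List.reverse s)).p = seqA s * seqA s.reverse := by
    rw [← of_seqObj_p, ← of_seqObj_p]; rfl
  have e₂ : of (𝟙_ (Idempotents.Karoubi (TL a))).p = idn a 0 := rfl
  have e₃ : of (TL.coev a (seqObj a s).X.strands ≫
      (seqObj a s).X ◁ (TL.eqIso (seqObj_reverse_strands a s)).hom) = coevA a (seqA s).src := by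
    refine (of_comp _ _).trans ((congrArg₂ Arr.comp rfl ((of_whiskerLeft _ _).trans
      (congrArg (idn a _ * ·) (of_eqIso_hom _)))).trans ?_)
    rw [← idn_add, seqA_src]
    exact comp_idn rfl
  rw [ofHom, e]
  refine (of_comp _ _).trans ((congrArg₂ Arr.comp ((of_hat _).trans (congrArg₂ Arr.comp e₂
    (congrArg₂ Arr.comp e₃ e₁))) (of_seqIso_hom (a := a) s (List.reverse s))).trans ?_)
  rw [comp_assoc, comp_assoc, ← seqA_append, seqA_comp_seqA, seqA_append,
    idn_comp (by rw [comp_src]; rfl), mul_eq_comp' (m := (seqA s).src) rfl rfl, ← comp_assoc]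
  have h₁ := hm.eq
  rw [seqA_tgt_eq] at h₁
  rw [← h₁, comp_assoc, hm.tgt_eq, mul_idn_comp, seqA_comp_seqA]

theorem ofHom_ev (h : ∀ n ∈ J a, JWSpec (jonesWenzl a n)) :
    ofHom ((ribbonData a).ev s) = (idn a (seqA s).src * seqA s).comp (evA a (seqA s).src) := by
  have hm := isMate_seqA h s
  have e : ((ribbonData a).ev s).hom = (seqIso a (List.reverse s) s).inv ≫
    KaroubiMonoidal.hat (P := seqObj a (List.reverse s) ⊗ seqObj a s)
      (Q := 𝟙_ (Idempotents.Karoubi (TL a)))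
      ((TL.eqIso (seqObj_reverse_strands a s).symm).hom ▷ (seqObj a s).X ≫
        TL.ev a (seqObj a s).X.strands) := rfl
  have e₁ : of (seqObj a (List.reverse s) ⊗ seqObj a s).p = seqA s.reverse * seqA s := by
    rw [← of_seqObj_p, ← of_seqObj_p]; rfl
  have e₂ : of (𝟙_ (Idempotents.Karoubi (TL a))).p = idn a 0 := rfl
  have e₃ : of ((TL.eqIso (seqObj_reverse_strands a s).symm).hom ▷ (seqObj a s).X ≫
      TL.ev a (seqObj a s).X.strands) = evA a (seqA s).src := by
    refine (of_comp _ _).trans ((congrArg₂ Arr.comp ((of_whiskerRight _ _).trans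
      (congrArg (· * idn a _) (of_eqIso_hom _))) rfl).trans ?_)
    rw [← idn_add, seqA_src, ← seqObj_reverse_strands]
    exact idn_comp rfl
  rw [ofHom, e]
  refine (of_comp _ _).trans ((congrArg₂ Arr.comp (of_seqIso_inv (a := a) (List.reverse s) s)
    ((of_hat _).trans (congrArg₂ Arr.comp e₁ (congrArg₂ Arr.comp e₃ e₂)))).trans ?_)
  rw [comp_idn (evA_tgt _).symm, ← comp_assoc, ← seqA_append, seqA_comp_seqA, seqA_append,
    mul_eq_comp' rfl rfl, comp_assoc]
  have h₁ := hm.ev_eq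
  rw [seqA_tgt_eq] at h₁
  rw [seqA_tgt_eq, h₁, ← comp_assoc, hm.src_eq, seqA_tgt_eq, idn_mul_comp, seqA_comp_seqA]

end

end Turaev

/-! ### The braiding of the Temperley-Lieb category -/

namespace TL

variable {a : ℂ}

section

variable {C : Type*} [Category C] [Preadditive C] [Linear ℂ C] {A B : C} {u v : A ⟶ B} {c d : B ⟶ A}

/-- Kauffman's computation of the second Reidemeister move: two crossings slide off a cap. -/
theorem cross_cross_cap (ha : a ≠ 0) (hc : u ≫ c = (-(a ^ 2 + a⁻¹ ^ 2)) • 𝟙 A) (hv : v ≫ c = 𝟙 A)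
    (hu : u ≫ d = 𝟙 A) :
    (a • 𝟙 B + a⁻¹ • (c ≫ u)) ≫ (a • 𝟙 B + a⁻¹ • (d ≫ v)) ≫ c = d := by
  simp only [Preadditive.add_comp, Preadditive.comp_add, Linear.smul_comp, Linear.comp_smul,
    Category.id_comp, Category.assoc, hc, hv, hu, Category.comp_id, smul_smul, ha, smul_add,
    inv_mul_cancel₀, mul_inv_cancel₀, one_smul, Preadditive.comp_neg, Preadditive.neg_comp,
    smul_neg, neg_smul, ne_eq, not_false_eq_true]
  match_scalars <;> field_simp <;> ring

theorem cup_cross_cross (ha : a ≠ 0) (hc : u ≫ c = (-(a ^ 2 + a⁻¹ ^ 2)) • 𝟙 A) (hv : v ≫ c = 𝟙 A)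
    (hu : u ≫ d = 𝟙 A) :
    u ≫ (a • 𝟙 B + a⁻¹ • (d ≫ v)) ≫ (a • 𝟙 B + a⁻¹ • (c ≫ u)) = v := by
  have hc' := reassoc_of% hc
  have hv' := reassoc_of% hv
  have hu' := reassoc_of% hu
  simp only [Preadditive.add_comp, Preadditive.comp_add, Linear.smul_comp, Linear.comp_smul,
    Category.id_comp, Category.assoc, hc', hv', hu', Category.comp_id, smul_smul, ha, smul_add,
    inv_mul_cancel₀, mul_inv_cancel₀, one_smul, Preadditive.comp_neg, Preadditive.neg_comp,
    smul_neg, neg_smul, ne_eq, not_false_eq_true]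
  match_scalars <;> field_simp <;> ring

/-- The inverse of the crossing is the crossing with the opposite over-strand. -/
theorem cross_inv_cross (ha : a ≠ 0) {u : A ⟶ B} {c : B ⟶ A}
    (hc : u ≫ c = (-(a ^ 2 + a⁻¹ ^ 2)) • 𝟙 A) :
    (a • 𝟙 B + a⁻¹ • (c ≫ u)) ≫ (a⁻¹ • 𝟙 B + a • (c ≫ u)) = 𝟙 B ∧
    (a⁻¹ • 𝟙 B + a • (c ≫ u)) ≫ (a • 𝟙 B + a⁻¹ • (c ≫ u)) = 𝟙 B := by
  have hc' := reassoc_of% hc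
  simp only [Preadditive.add_comp, Preadditive.comp_add, Linear.smul_comp, Linear.comp_smul,
    Category.id_comp, Category.assoc, hc', Category.comp_id, smul_smul, ha, smul_add,
    inv_mul_cancel₀, mul_inv_cancel₀, one_smul, Preadditive.comp_neg, Preadditive.neg_comp,
    smul_neg, neg_smul, ne_eq, not_false_eq_true]
  constructor <;> match_scalars <;> field_simp <;> ring

end

theorem isIso_crossing (ha : a ≠ 0) : IsIso (crossing a) := by
  obtain ⟨h, h'⟩ := cross_inv_cross ha (cup_comp_cap (a := a))
  rw [← crossing_eq] at h h'
  exact ⟨_, h, h'⟩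

theorem isIso_braidOne (ha : a ≠ 0) (m : ℕ) : IsIso (braidOne a m) := by
  have := isIso_crossing ha
  induction m with
  | zero => rw [braidOne]; infer_instance
  | succ m ih => rw [braidOne]; infer_instance

theorem isIso_braid (ha : a ≠ 0) (n m : ℕ) : IsIso (braid a n m) := by
  have := isIso_braidOne ha m
  induction n with
  | zero => rw [braid]; infer_instance
  | succ m ih => rw [braid]; infer_instance

namespace Arr

variable (a) in
/-- The crossing, as an arrow. -/
def crossA : Arr a := of (crossing a)
variable (a) in
/-- The braiding of `n` strands with `m` strands, as an arrow. -/
def braidA (n m : ℕ) : Arr a := of (braid a n m)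

theorem braidA_src (n m : ℕ) : (braidA a n m).src = n + m := rfl
theorem braidA_tgt (n m : ℕ) : (braidA a n m).tgt = m + n := rfl

attribute [simp] comp_src comp_tgt mul_src mul_tgt idn_src idn_tgt
  braidA_src braidA_tgt of_src of_tgt cupA_src cupA_tgt capA_src capA_tgt coevA_src coevA_tgt
  evA_src evA_tgt

theorem of_braidOne_zero : of (braidOne a 0) = idn a 1 := by
  rw [braidOne, of_comp, of_rightUnitor_hom, of_leftUnitor_inv]
  exact idn_comp rfl

theorem of_braidOne_succ (m : ℕ) : of (braidOne a (m + 1)) =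
    (of (braidOne a m) * idn a 1).comp (idn a m * crossA a) := by
  rw [braidOne, of_comp, of_comp, of_comp, of_comp, of_associator_inv, of_associator_hom,
    of_associator_inv, of_whiskerRight, of_whiskerLeft, idn_comp, idn_comp, comp_idn]
  · rfl
  · exact Nat.add_assoc _ _ _
  · simp only [comp_src]
    exact Nat.add_assoc _ _ _
  · simp only [comp_src]
    rfl

theorem braidA_zero_left (m : ℕ) : braidA a 0 m = idn a m := by
  rw [braidA, braid, of_comp, of_leftUnitor_hom, of_rightUnitor_inv]
  exact idn_comp rfl

theorem braidA_succ_left' (n m : ℕ) : braidA a (n + 1) m =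
    (idn a n * of (braidOne a m)).comp (braidA a n m * idn a 1) := by
  rw [braidA, braid, of_comp, of_comp, of_comp, of_comp, of_associator_inv, of_associator_hom,
    of_associator_hom, of_whiskerRight, of_whiskerLeft, idn_comp, idn_comp, comp_idn]
  · rfl
  · rfl
  · simp only [comp_src]
    rfl
  · simp only [comp_src]
    exact Nat.add_assoc _ _ _

theorem braidA_one_left (m : ℕ) : braidA a 1 m = of (braidOne a m) := by
  rw [braidA_succ_left', braidA_zero_left, idn_zero, one_mul, ← idn_add, comp_idn]
  rfl

theorem braidA_zero_right (n : ℕ) : braidA a n 0 = idn a n := by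
  induction n with
  | zero => exact braidA_zero_left 0
  | succ n ih =>
    rw [braidA_succ_left', ih, of_braidOne_zero, ← idn_add, idn_comp]
    rfl

theorem braidA_one_one : braidA a 1 1 = crossA a := by
  rw [braidA_one_left, of_braidOne_succ, of_braidOne_zero, ← idn_add, idn_zero, one_mul, idn_comp]
  rfl

theorem braidA_one_succ (m : ℕ) : braidA a 1 (m + 1) =
    (braidA a 1 m * idn a 1).comp (idn a m * crossA a) := by
  rw [braidA_one_left, braidA_one_left, of_braidOne_succ]

theorem braidA_succ_left (n m : ℕ) : braidA a (n + 1) m =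
    (idn a n * braidA a 1 m).comp (braidA a n m * idn a 1) := by
  rw [braidA_one_left, braidA_succ_left']

theorem braidA_add_left (n k m : ℕ) : braidA a (n + k) m =
    (idn a n * braidA a k m).comp (braidA a n m * idn a k) := by
  induction k with
  | zero =>
    rw [braidA_zero_left, idn_zero, mul_one, ← idn_add, idn_comp]
    · rfl
    · rfl
  | succ k ih =>
    rw [← Nat.add_assoc, braidA_succ_left, ih, braidA_succ_left k, ← mul_idn_comp, ← idn_mul_comp,
      comp_assoc]
    simp only [idn_add, mul_assoc]

theorem braidA_one_add (m k : ℕ) : braidA a 1 (m + k) =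
    (braidA a 1 m * idn a k).comp (idn a m * braidA a 1 k) := by
  induction k with
  | zero =>
    rw [braidA_zero_right, idn_zero, mul_one, ← idn_add, comp_idn]
    · rfl
    · rfl
  | succ k ih =>
    rw [← Nat.add_assoc, braidA_one_succ, ih, braidA_one_succ k, ← mul_idn_comp, ← idn_mul_comp,
      comp_assoc]
    simp only [idn_add, mul_assoc]

/-- Interchange of distant pieces, with the vertical strands made explicit. -/
theorem interchange (x y : Arr a) :
    (x * idn a y.src).comp (idn a x.tgt * y) = (idn a x.src * y).comp (x * idn a y.tgt) :=
  (mul_eq_comp (x := x) (y := y) rfl rfl).symm.trans (mul_eq_comp' (x := x) (y := y) rfl rfl)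

theorem braidA_add_right (n m k : ℕ) : braidA a n (m + k) =
    (braidA a n m * idn a k).comp (idn a m * braidA a n k) := by
  induction n with
  | zero => simp only [braidA_zero_left, ← idn_add]; exact (idn_comp rfl).symm
  | succ n ih =>
    have h := interchange (braidA a n m) (braidA a 1 k)
    simp only [braidA_src, braidA_tgt] at h
    rw [braidA_succ_left, ih, braidA_succ_left n m, braidA_succ_left n k, braidA_one_add,
      ← mul_idn_comp, ← idn_mul_comp, ← mul_idn_comp, ← idn_mul_comp, comp_assoc, comp_assoc]
    congr 1
    · simp only [mul_assoc]
    rw [← comp_assoc, ← comp_assoc]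
    simp only [idn_add, mul_assoc] at h ⊢
    rw [h]

/-- The braiding is natural with respect to `x`, in each of the two variables. -/
structure IsNat (x : Arr a) : Prop where
  left (k : ℕ) : (x * idn a k).comp (braidA a x.tgt k) = (braidA a x.src k).comp (idn a k * x)
  right (k : ℕ) : (idn a k * x).comp (braidA a k x.tgt) = (braidA a k x.src).comp (x * idn a k)

/-- Naturality with respect to the braiding with one strand implies the general case by the hexagon
identities. -/
theorem IsNat.of_one {x : Arr a}
    (hl : (x * idn a 1).comp (braidA a x.tgt 1) = (braidA a x.src 1).comp (idn a 1 * x))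
    (hr : (idn a 1 * x).comp (braidA a 1 x.tgt) = (braidA a 1 x.src).comp (x * idn a 1)) :
    IsNat x where
  left k := by
    induction k with
    | zero =>
      simp only [braidA_zero_right, idn_zero, one_mul, mul_one]
      exact (comp_idn rfl).trans (idn_comp rfl).symm
    | succ k ih =>
      rw [braidA_add_right, braidA_add_right, idn_add, ← mul_assoc, ← comp_assoc, mul_idn_comp, ih,
        ← mul_idn_comp, comp_assoc, mul_assoc (idn a k), idn_mul_comp, hl, ← idn_mul_comp,
        comp_assoc, mul_assoc]
  right k := by
    induction k with
    | zero =>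
      simp only [braidA_zero_left, idn_zero, one_mul, mul_one]
      exact (comp_idn rfl).trans (idn_comp rfl).symm
    | succ k ih =>
      rw [braidA_add_left, braidA_add_left, idn_add, mul_assoc, ← comp_assoc, idn_mul_comp, hr,
        ← idn_mul_comp, comp_assoc, ← mul_assoc (idn a k), mul_idn_comp, ih, ← mul_idn_comp,
        comp_assoc, mul_assoc]

theorem IsNat.comp {x y : Arr a} (hx : IsNat x) (hy : IsNat y) (h : x.tgt = y.src) :
    IsNat (x.comp y) where
  left k := by
    rw [comp_src, comp_tgt, ← mul_idn_comp, ← idn_mul_comp, comp_assoc, hy.left, ← h, ← comp_assoc,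
      hx.left, comp_assoc]
  right k := by
    rw [comp_src, comp_tgt, ← mul_idn_comp, ← idn_mul_comp, comp_assoc, hy.right, ← h, ← comp_assoc,
      hx.right, comp_assoc]

theorem isNat_idn (n : ℕ) : IsNat (idn a n) where
  left k := by
    rw [← idn_add, ← idn_add, idn_src, idn_tgt]
    exact (idn_comp (x := braidA a n k) rfl).trans (comp_idn (x := braidA a n k) rfl).symm
  right k := by
    rw [← idn_add, ← idn_add, idn_src, idn_tgt]
    exact (idn_comp (x := braidA a k n) rfl).trans (comp_idn (x := braidA a k n) rfl).symm

theorem IsNat.mul_idn {x : Arr a} (hx : IsNat x) (n : ℕ) : IsNat (x * idn a n) where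
  left k := by
    have h := interchange x (braidA a n k)
    simp only [braidA_src, braidA_tgt, idn_add] at h
    rw [mul_src, mul_tgt, braidA_add_left, braidA_add_left, idn_src, idn_tgt, mul_assoc,
      ← comp_assoc, h, comp_assoc, comp_assoc, ← mul_assoc, mul_idn_comp, hx.left, ← mul_idn_comp,
      mul_assoc]
  right k := by
    have h := interchange x (braidA a k n)
    simp only [braidA_src, braidA_tgt, idn_add] at h
    rw [mul_src, mul_tgt, braidA_add_right, braidA_add_right, idn_src, idn_tgt, ← mul_assoc,
      ← comp_assoc, mul_idn_comp, hx.right, ← mul_idn_comp, comp_assoc, comp_assoc, mul_assoc,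
      h, mul_assoc]

theorem IsNat.idn_mul {x : Arr a} (hx : IsNat x) (n : ℕ) : IsNat (idn a n * x) where
  left k := by
    have h := interchange (braidA a n k) x
    simp only [braidA_src, braidA_tgt, idn_add] at h
    rw [mul_src, mul_tgt, braidA_add_left, braidA_add_left, idn_src, idn_tgt, mul_assoc,
      ← comp_assoc, idn_mul_comp, hx.left, ← idn_mul_comp, comp_assoc, comp_assoc, ← mul_assoc,
      ← h, mul_assoc]
  right k := by
    have h := interchange (braidA a k n) x
    simp only [braidA_src, braidA_tgt, idn_add] at h
    rw [mul_src, mul_tgt, braidA_add_right, braidA_add_right, idn_src, idn_tgt, ← mul_assoc,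
      ← comp_assoc, ← h, comp_assoc, comp_assoc, mul_assoc, idn_mul_comp, hx.right, ← idn_mul_comp,
      mul_assoc]

theorem braidA_one_two : braidA a 1 2 = (crossA a * idn a 1).comp (idn a 1 * crossA a) := by
  rw [braidA_one_succ, braidA_one_one]

theorem braidA_two_one : braidA a 2 1 = (idn a 1 * crossA a).comp (crossA a * idn a 1) := by
  rw [braidA_succ_left, braidA_one_one]

variable (a) in
/-- The cup to the left of a strand. -/
def cupL : (⟨1⟩ : TL a) ⟶ ⟨3⟩ := tensorMap (cup₂ a) (𝟙 (⟨1⟩ : TL a))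
variable (a) in
/-- The cup to the right of a strand. -/
def cupR : (⟨1⟩ : TL a) ⟶ ⟨3⟩ := tensorMap (𝟙 (⟨1⟩ : TL a)) (cup₂ a)
variable (a) in
/-- The cap on the first two of three strands. -/
def capL : (⟨3⟩ : TL a) ⟶ ⟨1⟩ := tensorMap (cap₂ a) (𝟙 (⟨1⟩ : TL a))
variable (a) in
/-- The cap on the last two of three strands. -/
def capR : (⟨3⟩ : TL a) ⟶ ⟨1⟩ := tensorMap (𝟙 (⟨1⟩ : TL a)) (cap₂ a)

theorem cupL_capR : cupL a ≫ capR a = 𝟙 _ := zigzag_right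
theorem cupR_capL : cupR a ≫ capL a = 𝟙 _ := zigzag_left
theorem cupR_capR : cupR a ≫ capR a = (-(a ^ 2 + a⁻¹ ^ 2)) • 𝟙 _ := cupLast_capLast 1

theorem cupL_capL : cupL a ≫ capL a = (-(a ^ 2 + a⁻¹ ^ 2)) • 𝟙 _ := by
  have h := tensorMap_comp (cup₂ a) (cap₂ a) (𝟙 (⟨1⟩ : TL a)) (𝟙 _)
  have h' : cup₂ a ≫ cap₂ a = (-(a ^ 2 + a⁻¹ ^ 2)) • 𝟙 _ := cup_comp_cap
  rw [h', smul_tensorMap, Category.comp_id] at h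
  exact h.symm.trans (congrArg _ (tensorMap_id (⟨0⟩ : TL a) ⟨1⟩))

variable (a) in
/-- The crossing of the first two of three strands, resolved. -/
def crossL : (⟨3⟩ : TL a) ⟶ ⟨3⟩ := a • 𝟙 _ + a⁻¹ • (capL a ≫ cupL a)
variable (a) in
/-- The crossing of the last two of three strands, resolved. -/
def crossR : (⟨3⟩ : TL a) ⟶ ⟨3⟩ := a • 𝟙 _ + a⁻¹ • (capR a ≫ cupR a)

theorem crossA_mul_idn : crossA a * idn a 1 = of (crossL a) := by
  have h₀ : (crossing a : (⟨2⟩ : TL a) ⟶ ⟨2⟩) = a • 𝟙 _ + a⁻¹ • (cap₂ a ≫ cup₂ a) := crossing_eq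
  have e : addStrand (m := 2) (n := 2) (crossing a) = crossL a := by
    rw [h₀, addStrand_add, addStrand_smul, addStrand_smul, addStrand_id, addStrand_comp]
    rfl
  rw [← e]
  rfl

theorem idn_mul_crossA : idn a 1 * crossA a = of (crossR a) := by
  have h₀ : (crossing a : (⟨2⟩ : TL a) ⟶ ⟨2⟩) = a • 𝟙 _ + a⁻¹ • (cap₂ a ≫ cup₂ a) := crossing_eq
  have h := tensorMap_comp (m' := ⟨2⟩) (p' := ⟨2⟩) (𝟙 (⟨1⟩ : TL a)) (𝟙 _) (cap₂ a) (cup₂ a)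
  rw [Category.comp_id] at h
  have e : (tensorMap (m' := ⟨2⟩) (n' := ⟨2⟩) (𝟙 (⟨1⟩ : TL a)) (crossing a) :
      (⟨3⟩ : TL a) ⟶ ⟨3⟩) = crossR a := by
    rw [h₀]
    have h₁ := tensorMap_add (m := ⟨1⟩) (n := ⟨1⟩) (m' := ⟨2⟩) (n' := ⟨2⟩) (𝟙 (⟨1⟩ : TL a))
      (a • 𝟙 (⟨2⟩ : TL a)) (a⁻¹ • (cap₂ a ≫ cup₂ a))
    rw [tensorMap_smul, tensorMap_smul, h, tensorMap_id] at h₁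
    exact h₁
  rw [← e]
  rfl

theorem isNat_cupA (ha : a ≠ 0) : IsNat (cupA a) := by
  refine .of_one ?_ ?_
  · rw [cupA_src, cupA_tgt, braidA_zero_left, braidA_two_one, crossA_mul_idn, idn_mul_crossA,
      idn_comp (by rfl), ← of_comp]
    refine (of_comp (cupL a) _).symm.trans (congrArg of ?_)
    exact cup_cross_cross ha cupL_capL cupR_capL cupL_capR
  · rw [cupA_src, cupA_tgt, braidA_zero_right, braidA_one_two, crossA_mul_idn, idn_mul_crossA,
      idn_comp (by rfl), ← of_comp]
    refine (of_comp (cupR a) _).symm.trans (congrArg of ?_)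
    exact cup_cross_cross ha cupR_capR cupL_capR cupR_capL

theorem isNat_capA (ha : a ≠ 0) : IsNat (capA a) := by
  refine .of_one ?_ ?_
  · rw [capA_src, capA_tgt, braidA_zero_left, braidA_two_one, crossA_mul_idn, idn_mul_crossA,
      comp_idn (by rfl), ← of_comp]
    refine Eq.symm ((of_comp _ (capR a)).symm.trans (congrArg of ?_))
    rw [Category.assoc]
    exact cross_cross_cap ha cupR_capR cupL_capR cupR_capL
  · rw [capA_src, capA_tgt, braidA_zero_right, braidA_one_two, crossA_mul_idn, idn_mul_crossA,
      comp_idn (by rfl), ← of_comp]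
    refine Eq.symm ((of_comp _ (capL a)).symm.trans (congrArg of ?_))
    rw [Category.assoc]
    exact cross_cross_cap ha cupL_capL cupR_capL cupL_capR

theorem isNat_of_isCup (ha : a ≠ 0) {m n : ℕ} {u : (⟨m⟩ : TL a) ⟶ ⟨n⟩} (hu : IsCup u) :
    IsNat (of u) := by
  induction hu with
  | last n => exact (isNat_cupA ha).idn_mul n
  | add _ ih => exact ih.mul_idn 1

theorem isNat_of_isCap (ha : a ≠ 0) {m n : ℕ} {c : (⟨m⟩ : TL a) ⟶ ⟨n⟩} (hc : IsCap c) :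
    IsNat (of c) := by
  induction hc with
  | last n => exact (isNat_capA ha).idn_mul n
  | add _ ih => exact ih.mul_idn 1

theorem isNat_iff {m n : ℕ} {f : (⟨m⟩ : TL a) ⟶ ⟨n⟩} : IsNat (of f) ↔ ∀ k : ℕ,
    f ▷ (⟨k⟩ : TL a) ≫ braid a n k = braid a m k ≫ (⟨k⟩ : TL a) ◁ f ∧
    (⟨k⟩ : TL a) ◁ f ≫ braid a k n = braid a k m ≫ f ▷ (⟨k⟩ : TL a) := by
  constructor
  · intro h k
    constructor
    · refine of_injective ((of_comp _ _).trans ((h.left k).trans (of_comp _ _).symm))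
    · refine of_injective ((of_comp _ _).trans ((h.right k).trans (of_comp _ _).symm))
  · intro h
    constructor <;> intro k
    · exact (of_comp _ _).symm.trans ((congrArg of (h k).1).trans (of_comp _ _))
    · exact (of_comp _ _).symm.trans ((congrArg of (h k).2).trans (of_comp _ _))

/-- The braiding is natural: by generation, only cups and caps have to pass a strand, and this is
the second Reidemeister move. -/
theorem isNat (ha : a ≠ 0) (x : Arr a) : IsNat x := by
  obtain ⟨m, n, f⟩ := x
  change IsNat (of f)
  have hf := generated f
  induction hf with
  | zero => exact isNat_iff.2 fun k => by simp
  | id => exact isNat_idn _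
  | add _ _ h₁ h₂ =>
    rw [isNat_iff] at h₁ h₂ ⊢
    refine fun k => ⟨?_, ?_⟩
    · rw [MonoidalPreadditive.add_whiskerRight, MonoidalPreadditive.whiskerLeft_add,
        Preadditive.add_comp, Preadditive.comp_add, (h₁ k).1, (h₂ k).1]
    · rw [MonoidalPreadditive.add_whiskerRight, MonoidalPreadditive.whiskerLeft_add,
        Preadditive.add_comp, Preadditive.comp_add, (h₁ k).2, (h₂ k).2]
  | smul c _ h =>
    rw [isNat_iff] at h ⊢
    refine fun k => ⟨?_, ?_⟩
    · rw [MonoidalLinear.smul_whiskerRight, MonoidalLinear.whiskerLeft_smul,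
        Linear.smul_comp, Linear.comp_smul, (h k).1]
    · rw [MonoidalLinear.smul_whiskerRight, MonoidalLinear.whiskerLeft_smul,
        Linear.smul_comp, Linear.comp_smul, (h k).2]
  | cup _ hu h => rw [of_comp]; exact h.comp (isNat_of_isCup ha hu) rfl
  | cap _ hc h => rw [of_comp]; exact h.comp (isNat_of_isCap ha hc) rfl

theorem mul_comp_braidA (ha : a ≠ 0) (x y : Arr a) :
    (x * y).comp (braidA a x.tgt y.tgt) = (braidA a x.src y.src).comp (y * x) := by
  rw [mul_eq_comp (x := x) (y := y) rfl rfl, comp_assoc, (isNat ha y).right, ← comp_assoc,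
    (isNat ha x).left, comp_assoc,
    ← mul_eq_comp' (x := y) (y := x) rfl rfl]

end Arr
end TL

/-! ### Curls and the twist of the Temperley-Lieb category -/

namespace TL

variable {a : ℂ}

namespace Arr

instance : SMul ℂ (Arr a) := ⟨fun c x => ⟨x.src, x.tgt, c • x.hom⟩⟩

theorem of_smul (c : ℂ) {m n : TL a} (f : m ⟶ n) : of (c • f) = c • of f := rfl

theorem smul_comp (c : ℂ) (x y : Arr a) : (c • x).comp y = c • x.comp y := by
  obtain ⟨s, t, f⟩ := x
  obtain ⟨s', t', g⟩ := y
  by_cases h : t = s'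
  · subst h
    exact (comp_mk (c • f) g).trans ((congrArg (Arr.mk s t') (Linear.smul_comp _ _ _ c f g)).trans
      (congrArg (c • ·) (comp_mk f g).symm))
  · rw [comp_of_ne (x := c • ⟨s, t, f⟩) h, comp_of_ne (x := ⟨s, t, f⟩) h]
    exact congrArg (Arr.mk s t') (smul_zero c).symm

theorem comp_smul (c : ℂ) (x y : Arr a) : x.comp (c • y) = c • x.comp y := by
  obtain ⟨s, t, f⟩ := x
  obtain ⟨s', t', g⟩ := y
  by_cases h : t = s'
  · subst h
    exact (comp_mk f (c • g)).trans ((congrArg (Arr.mk s t') (Linear.comp_smul _ _ _ f c g)).trans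
      (congrArg (c • ·) (comp_mk f g).symm))
  · rw [comp_of_ne (y := c • ⟨s', t', g⟩) h, comp_of_ne (x := ⟨s, t, f⟩) h]
    exact congrArg (Arr.mk s t') (smul_zero c).symm

theorem smul_mul (c : ℂ) (x y : Arr a) : (c • x) * y = c • (x * y) :=
  congrArg (Arr.mk (x.src + y.src) (x.tgt + y.tgt)) (smul_tensorMap c x.hom y.hom)

theorem mul_smul' (c : ℂ) (x y : Arr a) : x * (c • y) = c • (x * y) :=
  congrArg (Arr.mk (x.src + y.src) (x.tgt + y.tgt)) (tensorMap_smul c x.hom y.hom)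

theorem smul_smul' (c d : ℂ) (x : Arr a) : c • d • x = (c * d) • x :=
  congrArg (Arr.mk x.src x.tgt) (smul_smul c d x.hom)

theorem one_smul' (x : Arr a) : (1 : ℂ) • x = x :=
  congrArg (Arr.mk x.src x.tgt) (one_smul ℂ x.hom)

variable (a) in
/-- The curl of `n` parallel strands. -/
def curlA (n : ℕ) : Arr a :=
  (idn a n * coevA a n).comp ((braidA a n n * idn a n).comp (idn a n * evA a n))

@[simp] theorem curlA_src (n : ℕ) : (curlA a n).src = n := by simp [curlA]
@[simp] theorem curlA_tgt (n : ℕ) : (curlA a n).tgt = n := by simp [curlA]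

/-- The braiding of `n + m` strands with `m` strands, partially closed on the latter. -/
theorem partial_curl (n m : ℕ) : (idn a (n + m) * coevA a m).comp
    ((braidA a (n + m) m * idn a m).comp (idn a (m + n) * evA a m)) =
    (idn a n * curlA a m).comp (braidA a n m) := by
  have h := interchange (braidA a n m) (evA a m)
  rw [curlA, braidA_add_left, ← mul_idn_comp, ← idn_mul_comp, ← idn_mul_comp]
  simp only [braidA_src, braidA_tgt, evA_src, evA_tgt, idn_zero, mul_one, idn_add, mul_assoc,
    comp_assoc] at h ⊢
  rw [h]

theorem comp_reassoc {x y x' y' : Arr a} (h : x.comp y = x'.comp y') (w : Arr a) :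
    x.comp (y.comp w) = x'.comp (y'.comp w) := by
  rw [← comp_assoc, h, comp_assoc]

/-- The curl of `n + m` strands is made of the curls of `n` and of `m` strands and a full twist of
the two bundles. -/
theorem curlA_add (ha : a ≠ 0) (n m : ℕ) : curlA a (n + m) =
    (curlA a n * curlA a m).comp ((braidA a n m).comp (braidA a m n)) := by
  have hs : idn a (n + m) = idn a m * idn a n := by rw [Nat.add_comm, idn_add]
  have hb : braidA a (n + m) (n + m) * idn a (n + m) =
      (braidA a (n + m) n * (idn a m * (idn a m * idn a n))).comp
        (idn a n * (braidA a (n + m) m * (idn a m * idn a n))) := by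
    rw [braidA_add_right, ← mul_idn_comp, hs]
    simp only [mul_assoc]
  have i₁ := interchange (braidA a (n + m) n) (coevA a m * idn a n)
  have hQ := congrArg (fun z => idn a n * (z * idn a n)) (partial_curl (a := a) n m)
  have h₁ := (isNat ha (idn a n * curlA a m)).left n
  rw [show (idn a n * curlA a m).src = n + m by simp,
    show (idn a n * curlA a m).tgt = n + m by simp] at h₁
  have i₂ := interchange (idn a n * curlA a m) (coevA a n)
  have h₂ := (isNat ha (braidA a n m)).left n
  rw [braidA_src, braidA_tgt, braidA_add_left m n n] at h₂
  have i₃ := interchange (braidA a n m) (coevA a n)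
  have i₄ := interchange (braidA a m n) (evA a n)
  have h₃ := (isNat ha (curlA a n)).left m
  have h₁ := congrArg (· * idn a n) h₁
  have h₂ := congrArg (· * idn a n) h₂
  have hQ := congrArg (fun z => z.comp (idn a n * (idn a m * evA a n))) hQ
  have h₄ := mul_eq_comp' (x := curlA a n) (y := curlA a m) rfl rfl
  have hc : idn a m * curlA a n = (idn a m * (idn a n * coevA a n)).comp
      ((idn a m * (braidA a n n * idn a n)).comp (idn a m * (idn a n * evA a n))) := by
    rw [curlA, ← idn_mul_comp, ← idn_mul_comp]
  conv_lhs => rw [curlA, hb, coevA_add, evA_add]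
  simp only [← mul_idn_comp, ← idn_mul_comp, braidA_src, braidA_tgt, evA_src, evA_tgt, coevA_src,
    coevA_tgt, curlA_src, curlA_tgt, mul_src, mul_tgt, idn_src, idn_tgt, zero_add, add_zero,
    idn_zero, mul_one, one_mul, idn_add, mul_assoc, comp_assoc] at i₁ hQ h₁ i₂ h₂ i₃ i₄ h₃ h₄ ⊢
  rw [← comp_reassoc i₁, hQ, ← comp_reassoc h₁, ← comp_reassoc i₂, ← comp_reassoc h₂,
    ← comp_reassoc i₃, comp_assoc, i₄, h₄, comp_assoc, comp_reassoc h₃, hc]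
  simp only [comp_assoc]

theorem exists_braidA_inv (ha : a ≠ 0) (n m : ℕ) : ∃ y : Arr a, y.src = m + n ∧ y.tgt = n + m ∧
    (braidA a n m).comp y = idn a (n + m) ∧ y.comp (braidA a n m) = idn a (m + n) := by
  have := isIso_braid ha n m
  refine ⟨of (inv (braid a n m)), rfl, rfl, ?_, ?_⟩
  · exact (of_comp _ _).symm.trans (congrArg of (IsIso.hom_inv_id _))
  · exact (of_comp _ _).symm.trans (congrArg of (IsIso.inv_hom_id _))

/-- A cap whose strands cross is a cap with an opposite curl. -/
theorem curlA_braidA_evA (ha : a ≠ 0) (n : ℕ) :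
    (curlA a n * idn a n).comp ((braidA a n n).comp (evA a n)) = evA a n := by
  obtain ⟨y, hs, ht, h₁, h₂⟩ := exists_braidA_inv ha n n
  have N₁ := (isNat ha (evA a n)).left n
  have N₂ := (isNat ha (evA a n)).right n
  have N₃ := (isNat ha (coevA a n)).left n
  have Y := (isNat ha (braidA a n n)).left n
  rw [evA_src, evA_tgt, braidA_zero_left, braidA_add_left, comp_idn (by simp)] at N₁
  rw [evA_src, evA_tgt, braidA_zero_right, braidA_add_right, comp_idn (by simp)] at N₂
  rw [coevA_src, coevA_tgt, braidA_zero_left, braidA_add_left, idn_comp (by simp)] at N₃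
  rw [braidA_src, braidA_tgt, braidA_add_left] at Y
  have e₁ := congrArg (idn a n * ·) h₂
  have e₁' := congrArg (idn a n * ·) h₁
  have e₂ := congrArg (· * idn a n) h₂
  have I := interchange (evA a n) ((braidA a n n).comp (evA a n))
  simp only [← mul_idn_comp, ← idn_mul_comp, braidA_src, braidA_tgt, evA_src, evA_tgt, coevA_src,
    coevA_tgt, curlA_src, curlA_tgt, mul_src, mul_tgt, idn_src, idn_tgt, zero_add, add_zero,
    idn_zero, mul_one, one_mul, idn_add, mul_assoc, comp_assoc, comp_src, comp_tgt]
    at N₁ N₂ N₃ Y e₁ e₂ e₁' I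
  -- Moving a strand across a cap inverts the crossing.
  have key : (braidA a n n * idn a n).comp (idn a n * evA a n) =
      (idn a n * y).comp (evA a n * idn a n) := by
    rw [N₁, ← comp_assoc, e₁, ← idn_add, ← idn_add, idn_comp (by simp [Nat.add_assoc])]
  -- What remains is undone by naturality of the braiding and a zigzag.
  have bracket : (coevA a n * idn a n).comp ((y * idn a n).comp
      ((idn a n * braidA a n n).comp (idn a n * evA a n))) = idn a n := by
    have Y' := fun w => congrArg (Arr.comp · w) Y
    simp only [comp_assoc] at Y'
    have E := congrArg (fun z => z.comp ((idn a n * braidA a n n).comp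
      ((braidA a n n * idn a n).comp (evA a n * idn a n)))) e₂
    simp only [comp_assoc] at E
    have N₃' := fun w => congrArg (Arr.comp · w) N₃
    simp only [comp_assoc] at N₃'
    rw [N₂, ← Y', E, ← idn_add, ← idn_add, idn_comp (by simp [Nat.add_assoc]), N₃', evA_coevA]
  have K := congrArg (· * idn a n) key
  have br := congrArg (fun z => (idn a n * z).comp (evA a n)) bracket
  rw [← idn_add, idn_comp (by simp)] at br
  rw [curlA]
  simp only [← mul_idn_comp, ← idn_mul_comp, mul_assoc, comp_assoc] at br K ⊢
  rw [comp_reassoc K, I, br]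

variable (a) in
/-- The twist, as an arrow. -/
def twistA (n : ℕ) : Arr a := of (twist a n)

@[simp] theorem twistA_src (n : ℕ) : (twistA a n).src = n := rfl
@[simp] theorem twistA_tgt (n : ℕ) : (twistA a n).tgt = n := rfl

theorem twistA_eq (n : ℕ) : twistA a n = (-1 : ℂ) ^ n • curlA a n := by
  unfold twistA twist curlA
  refine (of_smul _ _).trans (congrArg _ ?_)
  have h₁ : (idn a n * coevA a n).src = n := by simp [coevA_src, mul_src, idn_src]
  have h₂ : (idn a n * evA a n).tgt = n := by simp [evA_tgt, mul_tgt, idn_tgt]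
  rw [of_comp, of_comp, of_comp, of_comp, of_comp, of_comp, of_whiskerLeft, of_whiskerLeft,
    of_whiskerRight, of_rightUnitor_inv, of_rightUnitor_hom, of_associator_hom,
    of_associator_inv]
  have e₁ : (idn a n * of (coev a n)).src = n := h₁
  have e₂ : (idn a n * of (ev a n)).tgt = n := h₂
  rw [comp_idn (x := idn a (⟨n⟩ : TL a).strands * of (ev a n)) e₂.symm,
    idn_comp (x := idn a (⟨n⟩ : TL a).strands * of (ev a n)) (Nat.add_assoc n n n),
    idn_comp (x := Arr.comp (of (braid a n n) * idn a (⟨n⟩ : TL a).strands) _) (by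
      rw [comp_src]; rfl), ← comp_assoc, idn_comp (x := idn a _ * of (coev a n)) e₁.symm]
  rfl

theorem twistA_add (ha : a ≠ 0) (n m : ℕ) : twistA a (n + m) =
    (twistA a n * twistA a m).comp ((braidA a n m).comp (braidA a m n)) := by
  rw [twistA_eq, twistA_eq, twistA_eq, curlA_add ha, smul_mul, mul_smul', smul_comp, smul_comp,
    smul_smul', pow_add]

theorem twistA_zero : twistA a 0 = 1 := by
  rw [twistA_eq, pow_zero, one_smul', curlA, coevA_zero, evA_zero, braidA_zero_left, idn_zero]
  simp only [mul_one]
  exact (idn_comp (n := 0) (by rw [comp_src]; rfl)).trans (idn_comp (n := 0) rfl)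

theorem crossing_cap (ha : a ≠ 0) : crossing a ≫ cap a = (-a⁻¹ ^ 3) • cap a := by
  rw [crossing_eq, Preadditive.add_comp, Linear.smul_comp, Category.id_comp, Linear.smul_comp,
    Category.assoc, cup_comp_cap, Linear.comp_smul, Category.comp_id]
  match_scalars
  field_simp
  ring

theorem cup_crossing (ha : a ≠ 0) : cup a ≫ crossing a = (-a⁻¹ ^ 3) • cup a := by
  rw [crossing_eq, Preadditive.comp_add, Linear.comp_smul, Category.comp_id, Linear.comp_smul,
    ← Category.assoc, cup_comp_cap, Linear.smul_comp, Category.id_comp]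
  match_scalars
  field_simp
  ring

/-- Resolving the crossing of the curl of one strand gives `-a³`, and the twist has another sign. -/
theorem twistA_one (ha : a ≠ 0) : twistA a 1 = a ^ 3 • idn a 1 := by
  have e : of (crossL a) = crossA a * idn a 1 := crossA_mul_idn.symm
  have : cupR a ≫ crossL a ≫ capR a = (-a ^ 3) • 𝟙 _ := by
    unfold crossL
    rw [Preadditive.add_comp, Linear.smul_comp, Category.id_comp, Linear.smul_comp,
      Category.assoc, cupL_capR, Category.comp_id, Preadditive.comp_add, Linear.comp_smul,
      Linear.comp_smul, cupR_capR, cupR_capL]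
    match_scalars
    field_simp
    ring
  have := congrArg of this
  rw [of_comp, of_comp, of_smul, e] at this
  rw [twistA_eq, pow_one, curlA, braidA_one_one, coevA_one, evA_one]
  refine (congrArg _ this).trans ?_
  rw [smul_smul']
  ring_nf
  rfl

/-- Invertible arrows. -/
def IsInvertible (x : Arr a) : Prop :=
  ∃ y : Arr a, y.src = x.tgt ∧ y.tgt = x.src ∧ x.comp y = idn a x.src ∧ y.comp x = idn a x.tgt

theorem IsInvertible.comp {x y : Arr a} (hx : IsInvertible x) (hy : IsInvertible y)
    (h : x.tgt = y.src) : IsInvertible (x.comp y) := by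
  obtain ⟨x', h₁, h₂, h₃, h₄⟩ := hx
  obtain ⟨y', k₁, k₂, k₃, k₄⟩ := hy
  refine ⟨y'.comp x', by rw [comp_src, comp_tgt, k₁], by rw [comp_src, comp_tgt, h₂], ?_, ?_⟩
  · rw [comp_assoc, ← comp_assoc y, k₃, ← h, ← h₁, idn_comp rfl, h₃, comp_src]
  · rw [comp_assoc, ← comp_assoc x', h₄, h, idn_comp rfl, k₄, comp_tgt]

theorem IsInvertible.mul {x y : Arr a} (hx : IsInvertible x) (hy : IsInvertible y) :
    IsInvertible (x * y) := by
  obtain ⟨x', h₁, h₂, h₃, h₄⟩ := hx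
  obtain ⟨y', k₁, k₂, k₃, k₄⟩ := hy
  refine ⟨x' * y', by rw [mul_src, mul_tgt, h₁, k₁], by rw [mul_src, mul_tgt, h₂, k₂], ?_, ?_⟩
  · rw [mul_comp_mul h₁.symm k₁.symm, h₃, k₃, mul_src, idn_add]
  · rw [mul_comp_mul h₂ k₂, h₄, k₄, mul_tgt, idn_add]

theorem isInvertible_idn (n : ℕ) : IsInvertible (idn a n) :=
  ⟨idn a n, rfl, rfl, idn_comp rfl, idn_comp rfl⟩

theorem isInvertible_braidA (ha : a ≠ 0) (n m : ℕ) : IsInvertible (braidA a n m) :=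
  exists_braidA_inv ha n m

theorem isInvertible_twistA (ha : a ≠ 0) (n : ℕ) : IsInvertible (twistA a n) := by
  induction n with
  | zero => rw [twistA_zero]; exact isInvertible_idn 0
  | succ n ih =>
    rw [twistA_add ha]
    have h₁ : IsInvertible (twistA a 1) := by
      rw [twistA_one ha]
      have h₃ : a ^ 3 ≠ 0 := pow_ne_zero 3 ha
      refine ⟨(a ^ 3)⁻¹ • idn a 1, rfl, rfl, ?_, ?_⟩
      · rw [smul_comp, comp_smul, smul_smul', mul_inv_cancel₀ h₃, one_smul']; exact idn_comp rfl
      · rw [smul_comp, comp_smul, smul_smul', inv_mul_cancel₀ h₃, one_smul']; exact idn_comp rfl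
    refine (ih.mul h₁).comp ((isInvertible_braidA ha n 1).comp (isInvertible_braidA ha 1 n) rfl) ?_
    rw [comp_src]
    rfl

/-- The twist is natural with respect to `x`. -/
def IsTwistNat (x : Arr a) : Prop := x.comp (twistA a x.tgt) = (twistA a x.src).comp x

theorem IsTwistNat.mul (ha : a ≠ 0) {x y : Arr a} (hx : IsTwistNat x) (hy : IsTwistNat y) :
    IsTwistNat (x * y) := by
  have h := mul_comp_braidA ha x y
  have h' := mul_comp_braidA ha y x
  unfold IsTwistNat at *
  rw [mul_src, mul_tgt, twistA_add ha, twistA_add ha, ← comp_assoc, mul_comp_mul rfl rfl, hx, hy,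
    ← mul_comp_mul rfl rfl, comp_assoc, comp_reassoc h, h', comp_assoc, comp_assoc]

theorem IsTwistNat.comp {x y : Arr a} (hx : IsTwistNat x) (hy : IsTwistNat y)
    (h : x.tgt = y.src) : IsTwistNat (x.comp y) := by
  unfold IsTwistNat at *
  rw [comp_src, comp_tgt, comp_assoc, hy, ← h, ← comp_assoc, hx, comp_assoc]

theorem isTwistNat_idn (n : ℕ) : IsTwistNat (idn a n) :=
  (idn_comp (x := twistA a n) rfl).trans (comp_idn (x := twistA a n) rfl).symm

theorem twistA_two (ha : a ≠ 0) : twistA a 2 = a ^ 6 • (crossA a).comp (crossA a) := by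
  rw [show (2 : ℕ) = 1 + 1 from rfl, twistA_add ha, twistA_one ha, braidA_one_one, smul_mul,
    mul_smul', smul_smul', smul_comp, ← idn_add, idn_comp (by rw [comp_src]; rfl), ← pow_add]

/-- The two crossings in the twist of two strands are absorbed by the cup, each with the factor
`-a⁻³`, which cancels the factors `a³` of the two single twists. -/
theorem isTwistNat_cupA (ha : a ≠ 0) : IsTwistNat (cupA a) := by
  have h := congrArg of (cup_crossing ha)
  rw [of_comp, of_smul] at h
  change (cupA a).comp (crossA a) = _ • cupA a at h
  change (cupA a).comp (twistA a 2) = (twistA a 0).comp (cupA a)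
  rw [twistA_two ha, comp_smul, ← comp_assoc, h, smul_comp, h, smul_smul', smul_smul', twistA_zero]
  refine Eq.trans ?_ (idn_comp (x := cupA a) rfl).symm
  rw [show a ^ 6 * -a⁻¹ ^ 3 * -a⁻¹ ^ 3 = 1 by field_simp, one_smul']

theorem isTwistNat_capA (ha : a ≠ 0) : IsTwistNat (capA a) := by
  have h := congrArg of (crossing_cap ha)
  rw [of_comp, of_smul] at h
  change (crossA a).comp (capA a) = _ • capA a at h
  change (capA a).comp (twistA a 0) = (twistA a 2).comp (capA a)
  rw [twistA_two ha, smul_comp, comp_assoc, h, comp_smul, h, smul_smul', smul_smul', twistA_zero]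
  refine (comp_idn (x := capA a) rfl).trans ?_
  rw [show a ^ 6 * -a⁻¹ ^ 3 * -a⁻¹ ^ 3 = 1 by field_simp, one_smul']

theorem isTwistNat_of_isCup (ha : a ≠ 0) {m n : ℕ} {u : (⟨m⟩ : TL a) ⟶ ⟨n⟩} (hu : IsCup u) :
    IsTwistNat (of u) := by
  induction hu with
  | last n => exact (isTwistNat_idn n).mul ha (isTwistNat_cupA ha)
  | add _ ih => exact ih.mul ha (isTwistNat_idn 1)

theorem isTwistNat_of_isCap (ha : a ≠ 0) {m n : ℕ} {c : (⟨m⟩ : TL a) ⟶ ⟨n⟩} (hc : IsCap c) :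
    IsTwistNat (of c) := by
  induction hc with
  | last n => exact (isTwistNat_idn n).mul ha (isTwistNat_capA ha)
  | add _ ih => exact ih.mul ha (isTwistNat_idn 1)

theorem isTwistNat_iff {m n : ℕ} {f : (⟨m⟩ : TL a) ⟶ ⟨n⟩} :
    IsTwistNat (of f) ↔ f ≫ twist a n = twist a m ≫ f :=
  ⟨fun h => of_injective ((of_comp _ _).trans (h.trans (of_comp _ _).symm)),
    fun h => (of_comp _ _).symm.trans ((congrArg of h).trans (of_comp _ _))⟩

/-- The twist is natural: by generation and multiplicativity, only a cup and a cap have to be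
checked. -/
theorem isTwistNat (ha : a ≠ 0) (x : Arr a) : IsTwistNat x := by
  obtain ⟨m, n, f⟩ := x
  change IsTwistNat (of f)
  have hf := generated f
  induction hf with
  | zero => exact isTwistNat_iff.2 (by rw [Limits.zero_comp, Limits.comp_zero])
  | id => exact isTwistNat_idn _
  | add _ _ h₁ h₂ =>
    rw [isTwistNat_iff] at h₁ h₂ ⊢
    rw [Preadditive.add_comp, Preadditive.comp_add, h₁, h₂]
  | smul c _ h =>
    rw [isTwistNat_iff] at h ⊢
    rw [Linear.smul_comp, Linear.comp_smul, h]
  | cup _ hu h =>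
    rw [of_comp]
    exact h.comp (isTwistNat_of_isCup ha hu) rfl
  | cap _ hc h =>
    rw [of_comp]
    exact h.comp (isTwistNat_of_isCap ha hc) rfl

theorem twistA_braidA_evA (ha : a ≠ 0) (n : ℕ) :
    (twistA a n * idn a n).comp ((braidA a n n).comp (evA a n)) = (-1 : ℂ) ^ n • evA a n := by
  rw [twistA_eq, smul_mul, smul_comp, curlA_braidA_evA ha]

theorem isMate_general_iff {m n : ℕ} {f : (⟨m⟩ : TL a) ⟶ ⟨n⟩} {g : (⟨n⟩ : TL a) ⟶ ⟨m⟩} :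
    IsMate (of f) (of g) ↔ coev a m ≫ f ▷ (⟨m⟩ : TL a) = coev a n ≫ (⟨n⟩ : TL a) ◁ g := by
  constructor
  · intro h
    exact of_injective ((of_comp _ _).trans (h.eq.trans (of_comp _ _).symm))
  · intro h
    exact ⟨rfl, rfl, (of_comp _ _).symm.trans ((congrArg of h).trans (of_comp _ _))⟩

theorem isMate_crossA : IsMate (crossA a) (crossA a) := by
  have h : IsMate (of (cap₂ a ≫ cup₂ a)) (of (cap₂ a ≫ cup₂ a)) := by
    rw [of_comp]
    exact isMate_cap.comp isMate_cup rfl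
  have h₁ := isMate_add (isMate_smul a (isMate_idn 2)) (isMate_smul a⁻¹ h)
  have e : (a • 𝟙 (⟨2⟩ : TL a) + a⁻¹ • (cap₂ a ≫ cup₂ a)) = crossing a := crossing_eq.symm
  rw [e] at h₁
  exact h₁

theorem isMate_braidA_one (m : ℕ) : IsMate (braidA a 1 m) (braidA a 1 m) := by
  induction m with
  | zero => rw [braidA_zero_right]; exact isMate_idn 1
  | succ m ih =>
    have := (ih.mul (isMate_idn 1)).comp ((isMate_idn m).mul isMate_crossA) rfl
    rw [← braidA_one_succ] at this
    have e := braidA_add_right (a := a) 1 1 m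
    rw [braidA_one_one, Nat.add_comm 1 m] at e
    rwa [← e] at this

theorem isMate_braidA (n m : ℕ) : IsMate (braidA a n m) (braidA a n m) := by
  induction n with
  | zero => rw [braidA_zero_left]; exact isMate_idn m
  | succ n ih =>
    have := ((isMate_idn n).mul (isMate_braidA_one m)).comp (ih.mul (isMate_idn 1)) (by
      simp [mul_src, mul_tgt, idn_src, idn_tgt]; omega)
    rw [← braidA_add_left] at this
    have e := braidA_add_left (a := a) 1 n m
    rw [Nat.add_comm 1 n] at e
    rwa [← e] at this

theorem isMate_twistA (ha : a ≠ 0) (n : ℕ) : IsMate (twistA a n) (twistA a n) := by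
  induction n with
  | zero => rw [twistA_zero]; exact isMate_idn 0
  | succ n ih =>
    have h₁ : IsMate (twistA a 1) (twistA a 1) := by
      rw [twistA_one ha]
      exact isMate_smul _ (isMate_idn 1)
    have h := (ih.mul h₁).comp ((isMate_braidA n 1).comp (isMate_braidA 1 n) rfl) (by
      rw [comp_src]; rfl)
    rw [← twistA_add ha] at h
    have e := mul_comp_braidA ha (twistA a 1) (twistA a n)
    have e' := mul_comp_braidA ha (twistA a n) (twistA a 1)
    simp only [twistA_src, twistA_tgt] at e e'
    rw [comp_assoc, ← e', comp_reassoc e.symm, ← twistA_add ha, Nat.add_comm 1 n] at h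
    exact h

theorem exists_isMate_of_isCup {m n : ℕ} {u : (⟨m⟩ : TL a) ⟶ ⟨n⟩} (hu : IsCup u) :
    ∃ y, IsMate (of u) y ∧ IsMate y (of u) := by
  induction hu with
  | last n => exact ⟨_, (isMate_idn n).mul isMate_cup, isMate_cap.mul (isMate_idn n)⟩
  | add _ ih =>
    obtain ⟨y, h, h'⟩ := ih
    exact ⟨_, h.mul (isMate_idn 1), (isMate_idn 1).mul h'⟩

theorem exists_isMate_of_isCap {m n : ℕ} {c : (⟨m⟩ : TL a) ⟶ ⟨n⟩} (hc : IsCap c) :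
    ∃ y, IsMate (of c) y ∧ IsMate y (of c) := by
  induction hc with
  | last n => exact ⟨_, (isMate_idn n).mul isMate_cap, isMate_cup.mul (isMate_idn n)⟩
  | add _ ih =>
    obtain ⟨y, h, h'⟩ := ih
    exact ⟨_, h.mul (isMate_idn 1), (isMate_idn 1).mul h'⟩

/-- Every arrow can be rotated, and rotating twice by half a turn is the identity. -/
theorem exists_isMate (x : Arr a) : ∃ y, IsMate x y ∧ IsMate y x := by
  obtain ⟨m, n, f⟩ := x
  change ∃ y, IsMate (of f) y ∧ IsMate y (of f)
  have hf := generated f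
  suffices ∃ g : (⟨n⟩ : TL a) ⟶ ⟨m⟩, IsMate (of f) (of g) ∧ IsMate (of g) (of f) from
    ⟨_, this.choose_spec⟩
  have key : ∀ {m n p : ℕ} {f : (⟨m⟩ : TL a) ⟶ ⟨n⟩} {u : (⟨n⟩ : TL a) ⟶ ⟨p⟩},
      (∃ g : (⟨n⟩ : TL a) ⟶ ⟨m⟩, IsMate (of f) (of g) ∧ IsMate (of g) (of f)) →
      (∃ y, IsMate (of u) y ∧ IsMate y (of u)) →
      (∃ g : (⟨p⟩ : TL a) ⟶ ⟨m⟩, IsMate (of (f ≫ u)) (of g) ∧ IsMate (of g) (of (f ≫ u))) := by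
    rintro m n p f u ⟨g, h₁, h₂⟩ ⟨⟨s, t, y⟩, h₃, h₄⟩
    have e₁ := h₃.src_eq
    have e₂ := h₃.tgt_eq
    dsimp only [of_src, of_tgt] at e₁ e₂
    subst e₁ e₂
    refine ⟨y ≫ g, ?_, ?_⟩
    · rw [of_comp, of_comp]
      exact h₁.comp h₃ rfl
    · rw [of_comp, of_comp]
      exact h₄.comp h₂ rfl
  induction hf with
  | zero =>
    refine ⟨0, isMate_general_iff.2 ?_, isMate_general_iff.2 ?_⟩ <;> simp
  | id => exact ⟨𝟙 _, isMate_idn _, isMate_idn _⟩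
  | add _ _ h₁ h₂ =>
    obtain ⟨g, h₁, h₁'⟩ := h₁
    obtain ⟨g', h₂, h₂'⟩ := h₂
    refine ⟨g + g', ?_, ?_⟩ <;> rw [isMate_general_iff] at * <;>
      simp only [MonoidalPreadditive.add_whiskerRight, MonoidalPreadditive.whiskerLeft_add,
        Preadditive.comp_add, *]
  | smul c _ h₁ =>
    obtain ⟨g, h₁, h₁'⟩ := h₁
    refine ⟨c • g, ?_, ?_⟩ <;> rw [isMate_general_iff] at * <;>
      simp only [MonoidalLinear.smul_whiskerRight, MonoidalLinear.whiskerLeft_smul,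
        Linear.comp_smul, *]
  | cup _ hu h =>
    exact key h (exists_isMate_of_isCup hu)
  | cap _ hc h =>
    exact key h (exists_isMate_of_isCap hc)

end Arr
end TL

/-! ### Ideals of negligible morphisms -/

namespace RibbonData

variable {C : Type*} [Category C] [MonoidalCategory C] [Preadditive C] [Linear ℂ C]
  [MonoidalPreadditive C] [MonoidalLinear ℂ C] (D : RibbonData C)

theorem trace_add {X : C} (f g : X ⟶ X) : D.trace (f + g) = D.trace f + D.trace g := by
  simp only [trace, Preadditive.add_comp, MonoidalPreadditive.add_whiskerRight,
    Preadditive.comp_add]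

theorem trace_smul {X : C} (c : ℂ) (f : X ⟶ X) : D.trace (c • f) = c • D.trace f := by
  simp only [trace, Linear.smul_comp, MonoidalLinear.smul_whiskerRight, Linear.comp_smul]

theorem trace_zero {X : C} : D.trace (0 : X ⟶ X) = 0 := by
  simpa using D.trace_smul 0 (0 : X ⟶ X)

/-- The negligible morphisms between two objects. -/
def negligible (X Y : C) : Submodule ℂ (X ⟶ Y) where
  carrier := {f | D.Negligible f}
  zero_mem' g := by rw [Limits.comp_zero, trace_zero]
  add_mem' h h' g := by rw [Preadditive.comp_add, trace_add, h g, h' g, add_zero]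
  smul_mem' c f h g := by rw [Linear.comp_smul, trace_smul, h g, smul_zero]

/-- If the trace is cyclic and has partial traces, then the negligible morphisms form an ideal. -/
def negligibleIdeal (cyc : ∀ {X Y : C} (f : X ⟶ Y) (g : Y ⟶ X),
      D.trace (f ≫ g) = 0 ↔ D.trace (g ≫ f) = 0)
    (hr : ∀ {X Y : C} (Z : C) (g : Y ⊗ Z ⟶ X ⊗ Z), ∃ g' : Y ⟶ X, ∀ f : X ⟶ Y,
      D.trace (g ≫ f ▷ Z) = 0 ↔ D.trace (g' ≫ f) = 0)
    (hl : ∀ {X Y : C} (Z : C) (g : Z ⊗ Y ⟶ Z ⊗ X), ∃ g' : Y ⟶ X, ∀ f : X ⟶ Y,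
      D.trace (g ≫ Z ◁ f) = 0 ↔ D.trace (g' ≫ f) = 0) : NegligibleIdeal D where
  toSubmodule := D.negligible
  mem_iff _ := Iff.rfl
  comp_left f g hg h := by rw [← Category.assoc]; exact hg (h ≫ f)
  comp_right {X Y Z f} g hf h := by
    rw [← Category.assoc, cyc, ← Category.assoc]
    exact hf (g ≫ h)
  whiskerLeft Z {X Y f} hf g := by
    obtain ⟨g', h⟩ := hl Z g
    exact (h f).2 (hf g')
  whiskerRight {X Y f} Z hf g := by
    obtain ⟨g', h⟩ := hr Z g
    exact (h f).2 (hf g')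

end RibbonData

/-! ### Categories realized by the Temperley-Lieb category -/

namespace TL

open TL.Arr

variable {a : ℂ}

namespace Arr

section

variable {S T U : Arr a}

theorem hexagon_left (ha : a ≠ 0) (hS : S.comp S = S) (hT : T.comp T = T) (hU : U.comp U = U)
    (hS' : S.tgt = S.src) (hT' : T.tgt = T.src) (hU' : U.tgt = U.src) :
    (S * T * U).comp (braidA a (S.src + T.src) U.src) =
      (S * T * U).comp ((S * (T * U).comp (braidA a T.src U.src)).comp ((S * U * T).comp
        (((S * U).comp (braidA a S.src U.src) * T).comp (U * S * T)))) := by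
  have n₁ := mul_comp_braidA ha T U
  have n₂ := mul_comp_braidA ha S U
  have n₃ := mul_comp_braidA ha (S * T) U
  rw [hT', hU'] at n₁
  rw [hS', hU'] at n₂
  rw [mul_tgt, mul_src, hS', hT', hU'] at n₃
  have i : ∀ {X Y Z : Arr a}, X.comp X = X → Y.comp Y = Y → Z.comp Z = Z → X.tgt = X.src →
      Y.tgt = Y.src → Z.tgt = Z.src → (X * Y * Z).comp (X * Y * Z) = X * Y * Z := by
    intro X Y Z h₁ h₂ h₃ h₄ h₅ h₆
    rw [mul_comp_mul _ h₆, mul_comp_mul h₄ h₅, h₁, h₂, h₃]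
    rw [mul_src, mul_tgt, h₄, h₅]
  have e₁ : S * (T * U).comp (braidA a T.src U.src) =
      (idn a S.src * braidA a T.src U.src).comp (S * U * T) := by
    rw [n₁, mul_assoc, mul_comp_mul rfl, idn_comp rfl]
    rw [mul_src, braidA_tgt]
  have e₂ : (S * U).comp (braidA a S.src U.src) * T =
      (braidA a S.src U.src * idn a T.src).comp (U * S * T) := by
    rw [n₂, mul_comp_mul _ rfl, idn_comp rfl]
    rw [mul_src, braidA_tgt]
  have e₃ : (S * U * T).comp (braidA a S.src U.src * idn a T.src) =
      (braidA a S.src U.src * idn a T.src).comp (U * S * T) := by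
    rw [← e₂, mul_comp_mul (y' := idn a T.src) _ hT', comp_idn hT'.symm]
    rw [mul_tgt, braidA_src, hS', hU']
  rw [e₁, e₂, comp_assoc, comp_assoc, ← comp_assoc (S * U * T), i hS hU hT hS' hU' hT',
    i hU hS hT hU' hS' hT', ← comp_assoc (S * U * T), e₃, comp_assoc, i hU hS hT hU' hS' hT',
    ← comp_assoc (idn _ _ * _), ← braidA_add_left, mul_assoc U, ← n₃, ← comp_assoc, i hS hT hU hS' hT' hU']

theorem hexagon_right (ha : a ≠ 0) (hS : S.comp S = S) (hT : T.comp T = T) (hU : U.comp U = U)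
    (hS' : S.tgt = S.src) (hT' : T.tgt = T.src) (hU' : U.tgt = U.src) :
    (S * T * U).comp (braidA a S.src (T.src + U.src)) =
      (S * T * U).comp (((S * T).comp (braidA a S.src T.src) * U).comp ((T * S * U).comp
        ((T * (S * U).comp (braidA a S.src U.src)).comp (T * U * S)))) := by
  have n₁ := mul_comp_braidA ha S T
  have n₂ := mul_comp_braidA ha S U
  have n₃ := mul_comp_braidA ha S (T * U)
  rw [hT', hS'] at n₁
  rw [hS', hU'] at n₂
  rw [mul_tgt, mul_src, hS', hT', hU'] at n₃
  have i : ∀ {X Y Z : Arr a}, X.comp X = X → Y.comp Y = Y → Z.comp Z = Z → X.tgt = X.src →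
      Y.tgt = Y.src → Z.tgt = Z.src → (X * Y * Z).comp (X * Y * Z) = X * Y * Z := by
    intro X Y Z h₁ h₂ h₃ h₄ h₅ h₆
    rw [mul_comp_mul _ h₆, mul_comp_mul h₄ h₅, h₁, h₂, h₃]
    rw [mul_src, mul_tgt, h₄, h₅]
  have e₁ : (S * T).comp (braidA a S.src T.src) * U =
      (braidA a S.src T.src * idn a U.src).comp (T * S * U) := by
    rw [n₁, mul_comp_mul _ rfl, idn_comp rfl]
    rw [mul_src, braidA_tgt]
  have e₂ : T * (S * U).comp (braidA a S.src U.src) =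
      (idn a T.src * braidA a S.src U.src).comp (T * U * S) := by
    rw [n₂, mul_assoc, mul_comp_mul rfl, idn_comp rfl]
    rw [mul_src, braidA_tgt]
  have e₃ : (T * S * U).comp (idn a T.src * braidA a S.src U.src) =
      (idn a T.src * braidA a S.src U.src).comp (T * U * S) := by
    rw [← e₂, mul_assoc, mul_comp_mul (x' := idn a T.src) hT', comp_idn hT'.symm]
    rw [mul_tgt, braidA_src, hS', hU']
  rw [e₁, e₂, comp_assoc, comp_assoc, ← comp_assoc (T * S * U), i hT hS hU hT' hS' hU',
    i hT hU hS hT' hU' hS', ← comp_assoc (T * S * U), e₃, comp_assoc, i hT hU hS hT' hU' hS',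
    ← comp_assoc (_ * idn _ _), ← braidA_add_right, ← n₃, mul_assoc S T U, ← comp_assoc,
    ← mul_assoc, i hS hT hU hS' hT' hU']

end


end Arr

universe v w

/-- A presentation of the morphisms of a category with ribbon data by elements of the
Temperley-Lieb category: each object `X` has an idempotent `E X`, and `Rep f x` says that
the morphism `f` is represented by `x`, where `x` is fixed by the idempotents on both sides. The
structure morphisms are represented by those of the Temperley-Lieb category, cut by the idempotents; the
dualities are allowed to differ from the latter by scalars. -/
structure Realization (a : ℂ) {C : Type w} [Category.{v} C] [MonoidalCategory C] [Preadditive C]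
    [Linear ℂ C] (D : RibbonData C) where
  E : C → Arr a
  Rep : ∀ {X Y : C}, (X ⟶ Y) → Arr a → Prop
  κ : C → ℂ
  κ' : C → ℂ
  κ_mul (X : C) : κ X * κ' X = 1
  E_idem (X : C) : (E X).comp (E X) = E X
  E_tgt (X : C) : (E X).tgt = (E X).src
  E_tensor (X Y : C) : E (X ⊗ Y) = E X * E Y
  E_unit : E (𝟙_ C) = 1
  E_dual (X : C) : IsMate (E X) (E (D.dual X))
  src {X Y : C} {f : X ⟶ Y} {x : Arr a} : Rep f x → x.src = (E X).src
  tgt {X Y : C} {f : X ⟶ Y} {x : Arr a} : Rep f x → x.tgt = (E Y).src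
  left {X Y : C} {f : X ⟶ Y} {x : Arr a} : Rep f x → (E X).comp x = x
  right {X Y : C} {f : X ⟶ Y} {x : Arr a} : Rep f x → x.comp (E Y) = x
  unique {X Y : C} {f g : X ⟶ Y} {x : Arr a} : Rep f x → Rep g x → f = g
  exists_rep (X Y : C) {x : Arr a} : x.src = (E X).src → x.tgt = (E Y).src →
    ∃ f : X ⟶ Y, Rep f ((E X).comp (x.comp (E Y)))
  id (X : C) : Rep (𝟙 X) (E X)
  comp {X Y Z : C} {f : X ⟶ Y} {g : Y ⟶ Z} {x y : Arr a} : Rep f x → Rep g y →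
    Rep (f ≫ g) (x.comp y)
  tensor {X Y X' Y' : C} {f : X ⟶ Y} {g : X' ⟶ Y'} {x y : Arr a} : Rep f x → Rep g y →
    Rep (f ⊗ₘ g) (x * y)
  add {X Y : C} {f g : X ⟶ Y} {m n : ℕ} {x y : (⟨m⟩ : TL a) ⟶ ⟨n⟩} : Rep f (of x) → Rep g (of y) →
    Rep (f + g) (of (x + y))
  smul {X Y : C} (c : ℂ) {f : X ⟶ Y} {x : Arr a} : Rep f x → Rep (c • f) (c • x)
  associator_hom (X Y Z : C) : Rep (α_ X Y Z).hom (E X * E Y * E Z)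
  leftUnitor_hom (X : C) : Rep (λ_ X).hom (E X)
  rightUnitor_hom (X : C) : Rep (ρ_ X).hom (E X)
  braiding (X Y : C) : Rep (D.braiding X Y) ((E X * E Y).comp (braidA a (E X).src (E Y).src))
  twist (X : C) : Rep (D.twist X) ((E X).comp (twistA a (E X).src))
  coev (X : C) : Rep (D.coev X) (κ X • (coevA a (E X).src).comp (E X * idn a (E X).src))
  ev (X : C) : Rep (D.ev X) (κ' X • (idn a (E X).src * E X).comp (evA a (E X).src))

namespace Realization

variable {C : Type w} [Category.{v} C] [MonoidalCategory C] [Preadditive C] [Linear ℂ C]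
  {D : RibbonData C} (R : Realization a D)

theorem unique' {X Y : C} {f g : X ⟶ Y} {x y : Arr a} (h : R.Rep f x) (h' : R.Rep g y)
    (e : x = y) : f = g := R.unique (e ▸ h) h'

theorem congr {X Y : C} {f : X ⟶ Y} {x y : Arr a} (h : R.Rep f x) (e : x = y) : R.Rep f y := e ▸ h

theorem whiskerLeft (X : C) {Y Z : C} {f : Y ⟶ Z} {x : Arr a} (h : R.Rep f x) :
    R.Rep (X ◁ f) (R.E X * x) := by
  rw [← id_tensorHom]
  exact R.tensor (R.id X) h

theorem whiskerRight (X : C) {Y Z : C} {f : Y ⟶ Z} {x : Arr a} (h : R.Rep f x) :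
    R.Rep (f ▷ X) (x * R.E X) := by
  rw [← tensorHom_id]
  exact R.tensor h (R.id X)

/-- Two objects with the same idempotent are isomorphic. -/
theorem exists_iso {X Y : C} (h : R.E X = R.E Y) :
    ∃ e : X ≅ Y, R.Rep e.hom (R.E X) ∧ R.Rep e.inv (R.E X) := by
  have e₁ : (R.E X).comp ((R.E X).comp (R.E Y)) = R.E X := by rw [← h, R.E_idem, R.E_idem]
  have e₂ : (R.E Y).comp ((R.E X).comp (R.E X)) = R.E X := by rw [← h, R.E_idem, R.E_idem]
  obtain ⟨f, hf⟩ := R.exists_rep X Y (x := R.E X) rfl (by rw [R.E_tgt, h])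
  obtain ⟨g, hg⟩ := R.exists_rep Y X (x := R.E X) (by rw [h]) (by rw [R.E_tgt])
  rw [e₁] at hf
  rw [e₂] at hg
  exact ⟨⟨f, g, R.unique' (R.comp hf hg) (R.id X) (R.E_idem X),
    R.unique' (R.comp hg hf) (R.id Y) ((R.E_idem X).trans h)⟩, hf, hg⟩

theorem rep_inv {X Y : C} (e : X ≅ Y) (h : R.Rep e.hom (R.E X)) (h' : R.E X = R.E Y) :
    R.Rep e.inv (R.E X) := by
  obtain ⟨e', h₁, h₂⟩ := R.exists_iso h'
  have : e = e' := Iso.ext (R.unique h h₁)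
  rwa [this]

theorem associator_inv (X Y Z : C) : R.Rep (α_ X Y Z).inv (R.E X * R.E Y * R.E Z) := by
  have h := R.associator_hom X Y Z
  have e : R.E ((X ⊗ Y) ⊗ Z) = R.E X * R.E Y * R.E Z := by rw [R.E_tensor, R.E_tensor]
  have e' : R.E (X ⊗ Y ⊗ Z) = R.E X * R.E Y * R.E Z := by rw [R.E_tensor, R.E_tensor, mul_assoc]
  rw [← e]
  exact R.rep_inv _ (by rwa [e]) (e.trans e'.symm)

theorem leftUnitor_inv (X : C) : R.Rep (λ_ X).inv (R.E X) := by
  have e : R.E (𝟙_ C ⊗ X) = R.E X := by rw [R.E_tensor, R.E_unit, one_mul]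
  have := R.rep_inv (λ_ X) (by rw [e]; exact R.leftUnitor_hom X) e
  rwa [e] at this

theorem rightUnitor_inv (X : C) : R.Rep (ρ_ X).inv (R.E X) := by
  have e : R.E (X ⊗ 𝟙_ C) = R.E X := by rw [R.E_tensor, R.E_unit, mul_one]
  have := R.rep_inv (ρ_ X) (by rw [e]; exact R.rightUnitor_hom X) e
  rwa [e] at this

theorem twist' (ha : a ≠ 0) (X : C) : R.Rep (D.twist X) ((twistA a (R.E X).src).comp (R.E X)) := by
  refine R.congr (R.twist X) ?_
  have h := isTwistNat ha (R.E X)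
  unfold IsTwistNat at h
  rwa [R.E_tgt] at h

theorem coev_ev (R : Realization a D) (X : C) : D.coev X ▷ X ≫ (α_ X (D.dual X) X).hom ≫ X ◁ D.ev X =
    (λ_ X).hom ≫ (ρ_ X).inv := by
  refine R.unique' (R.comp (R.whiskerRight X (R.coev X)) (R.comp (R.associator_hom X (D.dual X) X)
    (R.whiskerLeft X (R.ev X)))) (R.comp (R.leftUnitor_hom X) (R.rightUnitor_inv X)) ?_
  have h₁ := R.right (R.whiskerRight X (R.coev X))
  rw [R.E_tensor, R.E_tensor] at h₁
  rw [R.E_idem, ← comp_assoc, h₁, smul_mul, mul_smul', smul_comp, comp_smul, smul_smul',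
    R.κ_mul, one_smul']
  have hN' := R.E_tgt X
  have hF := R.E_idem X
  generalize hN : (R.E X).src = N at *
  generalize R.E X = F at *
  exact zigzag_of_idem hN hN' hF

theorem ev_coev (R : Realization a D) (X : C) : D.dual X ◁ D.coev X ≫ (α_ (D.dual X) X (D.dual X)).inv ≫
    D.ev X ▷ D.dual X = (ρ_ (D.dual X)).hom ≫ (λ_ (D.dual X)).inv := by
  refine R.unique' (R.comp (R.whiskerLeft _ (R.coev X)) (R.comp (R.associator_inv _ X _)
    (R.whiskerRight _ (R.ev X)))) (R.comp (R.rightUnitor_hom _) (R.leftUnitor_inv _)) ?_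
  have h₁ := R.right (R.whiskerLeft (D.dual X) (R.coev X))
  rw [R.E_tensor, R.E_tensor, ← mul_assoc] at h₁
  rw [R.E_idem, ← comp_assoc, h₁, smul_mul, mul_smul', smul_comp, comp_smul, smul_smul',
    R.κ_mul, one_smul']
  have hm := R.E_dual X
  have hN' := R.E_tgt X
  have hF := R.E_idem (D.dual X)
  have h₁ := hm.eq
  have h₂ := hm.ev_eq
  generalize hN : (R.E X).src = N at *
  have h₃ : (R.E (D.dual X)).src = N := by rw [hm.src_eq, hN']
  have h₄ : (R.E (D.dual X)).tgt = N := by rw [hm.tgt_eq, hN]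
  rw [hN'] at h₁ h₂
  rw [h₁, ← h₂]
  generalize R.E X = F at *
  generalize R.E (D.dual X) = F' at *
  exact zigzag_of_idem' h₃ h₄ hF

theorem isIso_of_isInvertible {X Y : C} {f : X ⟶ Y} {x : Arr a} (hx : IsInvertible x)
    (hs : x.src = (R.E X).src) (ht : x.tgt = (R.E Y).src) (h : R.Rep f ((R.E X).comp x))
    (h' : (R.E X).comp x = x.comp (R.E Y)) : IsIso f := by
  obtain ⟨y, h₁, h₂, h₃, h₄⟩ := hx
  obtain ⟨g, hg⟩ := R.exists_rep Y X (x := y) (h₁.trans ht) (h₂.trans hs)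
  have h'' : y.comp (R.E X) = (R.E Y).comp y := by
    have e := congrArg (fun z => y.comp (z.comp y)) h'
    simp only [comp_assoc] at e
    rw [h₃, comp_idn (by rw [hs, R.E_tgt]), ← comp_assoc y x, h₄, idn_comp] at e
    · exact e
    · rw [comp_src, ht]
  refine ⟨g, R.unique' (R.comp h hg) (R.id X) ?_, R.unique' (R.comp hg h) (R.id Y) ?_⟩
  · rw [h'', ← comp_assoc (R.E Y), R.E_idem, ← h'', comp_assoc, ← comp_assoc x, h₃,
      idn_comp hs, R.E_idem]
  · rw [h', h'', ← comp_assoc, comp_assoc _ _ x, comp_assoc _ y, h₄,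
      comp_assoc, comp_assoc, idn_comp ht, R.E_idem, R.E_idem]

theorem isIso_braiding (R : Realization a D) (ha : a ≠ 0) (X Y : C) : IsIso (D.braiding X Y) := by
  have h := mul_comp_braidA ha (R.E X) (R.E Y)
  rw [R.E_tgt, R.E_tgt] at h
  refine R.isIso_of_isInvertible (isInvertible_braidA ha (R.E X).src (R.E Y).src) ?_ ?_
    (R.congr (R.braiding X Y) (by rw [R.E_tensor])) ?_
  · rw [R.E_tensor]; rfl
  · rw [R.E_tensor]; rfl
  · rw [R.E_tensor, R.E_tensor, h]

theorem braiding_naturality (ha : a ≠ 0) {X X' Y Y' : C} {f : X ⟶ X'} {g : Y ⟶ Y'} {x y : Arr a}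
    (hx : R.Rep f x) (hy : R.Rep g y) :
    (f ⊗ₘ g) ≫ D.braiding X' Y' = D.braiding X Y ≫ (g ⊗ₘ f) := by
  have h := mul_comp_braidA ha x y
  rw [R.src hx, R.src hy, R.tgt hx, R.tgt hy] at h
  refine R.unique' (R.comp (R.tensor hx hy) (R.braiding X' Y'))
    (R.comp (R.braiding X Y) (R.tensor hy hx)) ?_
  rw [← comp_assoc, mul_comp_mul (R.tgt hx) (R.tgt hy), R.right hx,
    R.right hy, comp_assoc, ← h, ← comp_assoc, mul_comp_mul, R.left hx, R.left hy]
  · rw [R.E_tgt, R.src hx]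
  · rw [R.E_tgt, R.src hy]

/-- A full realization makes a category ribbon: the identities hold for the representatives, which
determine the morphisms. -/
theorem isRibbon (R : Realization a D) (ha : a ≠ 0) (full : ∀ {X Y : C} (f : X ⟶ Y), ∃ x, R.Rep f x)
    (h₀ : Module.finrank ℂ (𝟙_ C ⟶ 𝟙_ C) = 1) : D.IsRibbon where
  finrank_end_unit := h₀
  isIso_braiding := R.isIso_braiding ha
  braiding_naturality f g := by
    obtain ⟨x, hx⟩ := full f
    obtain ⟨y, hy⟩ := full g
    exact R.braiding_naturality ha hx hy
  braiding_tensor_left X Y Z := by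
    refine R.unique' (R.braiding (X ⊗ Y) Z) (R.comp (R.associator_hom _ _ _)
      (R.comp (R.whiskerLeft _ (R.braiding _ _)) (R.comp (R.associator_inv _ _ _)
      (R.comp (R.whiskerRight _ (R.braiding _ _)) (R.associator_hom _ _ _))))) ?_
    rw [R.E_tensor]
    exact hexagon_left ha (R.E_idem X) (R.E_idem Y) (R.E_idem Z)
      (R.E_tgt X) (R.E_tgt Y) (R.E_tgt Z)
  braiding_tensor_right X Y Z := by
    refine R.unique' (R.braiding X (Y ⊗ Z)) (R.comp (R.associator_inv _ _ _)
      (R.comp (R.whiskerRight _ (R.braiding _ _)) (R.comp (R.associator_hom _ _ _)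
      (R.comp (R.whiskerLeft _ (R.braiding _ _)) (R.associator_inv _ _ _))))) ?_
    rw [R.E_tensor, ← mul_assoc]
    exact hexagon_right ha (R.E_idem X) (R.E_idem Y) (R.E_idem Z)
      (R.E_tgt X) (R.E_tgt Y) (R.E_tgt Z)
  coev_ev := R.coev_ev
  ev_coev := R.ev_coev
  isIso_twist X := by
    have h := isTwistNat ha (R.E X)
    unfold IsTwistNat at h
    rw [R.E_tgt] at h
    exact R.isIso_of_isInvertible (isInvertible_twistA ha (R.E X).src) rfl rfl (R.twist X) h
  twist_naturality {X Y} f := by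
    obtain ⟨x, hx⟩ := full f
    have h := isTwistNat ha x
    unfold IsTwistNat at h
    rw [R.src hx, R.tgt hx] at h
    refine R.unique' (R.comp hx (R.twist Y)) (R.comp (R.twist' ha X) hx) ?_
    rw [comp_assoc, R.left hx, ← comp_assoc, R.right hx, h]
  twist_tensor X Y := by
    have h := mul_comp_braidA ha (R.E X) (R.E Y)
    have h' := mul_comp_braidA ha (R.E Y) (R.E X)
    rw [R.E_tgt, R.E_tgt] at h h'
    refine R.unique' (R.twist' ha (X ⊗ Y)) (R.comp (R.tensor (R.twist' ha X) (R.twist' ha Y))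
      (R.comp (R.braiding X Y) (R.braiding Y X))) ?_
    rw [R.E_tensor, mul_src, twistA_add ha, ← mul_comp_mul]
    · have hi := R.E_idem (X ⊗ Y)
      rw [R.E_tensor] at hi
      simp only [comp_assoc]
      rw [h', comp_reassoc h, comp_reassoc h', hi, comp_reassoc h, comp_reassoc h', hi]
    · rfl
    · rfl
  twist_dual X := by
    refine R.unique' (R.comp (R.coev X) (R.whiskerRight _ (R.twist' ha X)))
      (R.comp (R.coev X) (R.whiskerLeft X (R.twist (D.dual X)))) ?_
    have hm := R.E_dual X
    have hθ := (isMate_twistA ha (R.E X).src).eq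
    have h₁ := hm.eq
    have h₂ := R.E_idem X
    have h₃ := R.E_idem (D.dual X)
    have hN' := R.E_tgt X
    have e : (R.E (D.dual X)).src = (R.E X).src := hm.src_eq.trans hN'
    have e' : (R.E (D.dual X)).tgt = (R.E X).src := hm.tgt_eq
    rw [twistA_src, twistA_tgt] at hθ
    rw [hN'] at h₁
    rw [e]
    generalize hN : (R.E X).src = N at *
    generalize R.E X = F at *
    generalize R.E (D.dual X) = F' at *
    have e₁ : (F * idn a N).comp ((twistA a N).comp F * F') =
        (twistA a N * idn a N).comp (F * F') := by
      have h := isTwistNat ha F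
      unfold IsTwistNat at h
      rw [hN, hN'] at h
      rw [mul_comp_mul, mul_comp_mul, ← comp_assoc, h, comp_assoc, h₂]
      · exact hN.symm
      · exact e.symm
      · rw [hN', comp_src]; rfl
      · exact e.symm
    have e₂ : (idn a N * F').comp (F * F'.comp (twistA a N)) =
        (idn a N * twistA a N).comp (F * F') := by
      have h := isTwistNat ha F'
      unfold IsTwistNat at h
      rw [e, e'] at h
      rw [mul_comp_mul, mul_comp_mul, ← comp_assoc, h₃, h]
      · exact hN.symm
      · exact e.symm
      · exact hN.symm
      · rw [e', comp_src, e]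
    rw [smul_comp, smul_comp, comp_assoc, e₁, ← comp_assoc, hθ, h₁, comp_assoc, comp_assoc, e₂]

/-- The right evaluation `d c (θ ⊗ id)` is given by nested caps, up to the sign of the loop. -/
theorem rightEv (ha : a ≠ 0) (X : C) : R.Rep (D.twist X ▷ D.dual X ≫ D.braiding X (D.dual X) ≫
    D.ev X) (((-1) ^ (R.E X).src * R.κ' X) •
      (R.E X * idn a (R.E X).src).comp (evA a (R.E X).src)) := by
  refine R.congr (R.comp (R.whiskerRight (D.dual X) (R.twist X))
    (R.comp (R.braiding X (D.dual X)) (R.ev X))) ?_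
  have hm := R.E_dual X
  have h₁ := hm.ev_eq
  have h₂ := R.E_idem X
  have h₃ := R.E_idem (D.dual X)
  have h₄ := twistA_braidA_evA ha (R.E X).src
  have hN' := R.E_tgt X
  have e : (R.E (D.dual X)).src = (R.E X).src := hm.src_eq.trans hN'
  have e' : (R.E (D.dual X)).tgt = (R.E X).src := hm.tgt_eq
  have h₅ := mul_comp_braidA ha (R.E X) (R.E (D.dual X))
  have h₆ := isTwistNat ha (R.E X)
  unfold IsTwistNat at h₆
  rw [hN'] at h₁ h₅ h₆
  rw [e, e'] at h₅
  rw [e]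
  generalize hN : (R.E X).src = N at *
  generalize R.E X = S at *
  generalize R.E (D.dual X) = S' at *
  have h₇ := mul_comp_braidA ha S (idn a N)
  rw [hN, hN', idn_src, idn_tgt] at h₇
  -- The idempotents slide along the caps.
  have e₁ : (S * S').comp ((braidA a N N).comp ((idn a N * S).comp (evA a N))) =
      (S * idn a N).comp ((braidA a N N).comp (evA a N)) := by
    have k₁ : (S' * S).comp ((idn a N * S).comp (evA a N)) = (idn a N * S).comp (evA a N) := by
      rw [← comp_assoc, mul_comp_mul (x' := idn a N) e' (by rw [hN, hN']), h₂,
        comp_idn e'.symm, mul_eq_comp' (m := N) e.symm hN'.symm, comp_assoc, h₁, ← comp_assoc,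
        idn_mul_comp, h₂]
    rw [comp_reassoc h₅, k₁, comp_reassoc h₇]
  have e₂ : (S.comp (twistA a N) * S').comp (S * S') =
      (S * idn a N).comp ((twistA a N * idn a N).comp (S * S')) := by
    rw [mul_comp_mul (x := S.comp _) (by rw [comp_tgt]; exact hN.symm)
      (e'.trans e.symm), h₃, ← comp_assoc (S * _), mul_idn_comp, mul_comp_mul (y := idn a N)
      (by rw [comp_tgt]; exact hN.symm) e.symm, idn_comp e.symm, h₆]
  have e₃ : (S * idn a N).comp ((twistA a N * idn a N).comp (S * idn a N)) =
      (S * idn a N).comp (twistA a N * idn a N) := by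
    rw [mul_idn_comp, mul_idn_comp, mul_idn_comp, ← h₆, ← comp_assoc, h₂]
  have e₃ := congrArg (fun z => z.comp ((braidA a N N).comp (evA a N))) e₃
  simp only [comp_assoc] at e₃
  rw [comp_smul, comp_smul]
  have e₂' := congrArg (fun z => z.comp ((braidA a N N).comp ((idn a N * S).comp (evA a N)))) e₂
  simp only [comp_assoc] at e₂'
  rw [e₁, e₃, h₄, comp_smul] at e₂'
  rw [comp_assoc, e₁, e₂', smul_smul', mul_comm]

end Realization

end TL

/-! ### Traces and negligible morphisms in a realization -/

namespace TL

open TL.Arr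

variable {a : ℂ}

/-- Every endomorphism of the unit object is a multiple of the identity. -/
theorem end_unit_eq_smul (f : (⟨0⟩ : TL a) ⟶ ⟨0⟩) : ∃ t : ℂ, f = t • 𝟙 _ := by
  have h₁ : ∀ {k m : ℕ} {c : (⟨m⟩ : TL a) ⟶ ⟨k⟩}, IsCap c → m ≠ 0 := by
    intro k m c hc
    cases hc <;> omega
  have h₂ : ∀ {k m : ℕ} {c : (⟨k⟩ : TL a) ⟶ ⟨m⟩}, IsCup c → m ≠ 0 := by
    intro k m c hc
    cases hc <;> omega
  obtain ⟨t, ht⟩ := sandwich_eq_smul (g := 𝟙 (⟨0⟩ : TL a)) (fun hc => absurd rfl (h₁ hc))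
    (fun hc => absurd rfl (h₂ hc)) (Category.id_comp _) f
  rw [Category.id_comp, Category.comp_id] at ht
  exact ⟨t, ht⟩

namespace Arr

/-- The planar closure is cyclic. -/
theorem coevA_comp_evA_comm (x y : Arr a) (h : y.src = x.tgt) (h' : y.tgt = x.src) :
    (coevA a x.src).comp ((x.comp y * idn a x.src).comp (evA a x.src)) =
      (coevA a x.tgt).comp ((y.comp x * idn a x.tgt).comp (evA a x.tgt)) := by
  obtain ⟨z, hz, hz'⟩ := exists_isMate x
  have e := hz'.ev_eq
  have i := mul_eq_comp (x := y) (y := z) hz.src_eq.symm rfl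
  have i' := mul_eq_comp' (x := y) (y := z) rfl rfl
  rw [hz.src_eq, hz.tgt_eq] at e
  rw [h, hz.tgt_eq] at i'
  rw [h'] at i
  rw [← mul_idn_comp, ← mul_idn_comp, comp_assoc, comp_assoc, ← comp_assoc (coevA a x.src),
    hz.eq, comp_assoc, ← comp_reassoc (i.symm.trans i' ), e]

/-- The element `x` pairs to zero with everything under the planar closure, where `P` and `Q` are the
idempotents of its source and target. -/
def IsNull (P Q x : Arr a) : Prop := ∀ y : Arr a, y.src = Q.src → y.tgt = P.src →
  (coevA a Q.src).comp (((Q.comp (y.comp P)).comp x * idn a Q.src).comp (evA a Q.src)) =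
    of (0 : (⟨0⟩ : TL a) ⟶ ⟨0⟩)

end Arr

namespace Realization

universe v w

variable {C : Type w} [Category.{v} C] [MonoidalCategory C] [Preadditive C] [Linear ℂ C]
  {D : RibbonData C} (R : Realization a D)

/-- The trace is the planar closure, up to the sign of the loop. -/
theorem trace (ha : a ≠ 0) {X : C} {f : X ⟶ X} {x : Arr a} (hf : R.Rep f x) :
    R.Rep (D.trace f) ((-1 : ℂ) ^ (R.E X).src •
      (coevA a (R.E X).src).comp ((x * idn a (R.E X).src).comp (evA a (R.E X).src))) := by
  have e : D.trace f = D.coev X ≫ f ▷ D.dual X ≫ D.twist X ▷ D.dual X ≫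
      D.braiding X (D.dual X) ≫ D.ev X := by
    unfold RibbonData.trace
    rw [comp_whiskerRight]
    simp only [Category.assoc]
  rw [e]
  refine R.congr (R.comp (R.coev X) (R.comp (R.whiskerRight _ hf) (R.rightEv ha X))) ?_
  have hm := R.E_dual X
  have h₁ := hm.eq
  have h₂ := R.left hf
  have h₃ := R.right hf
  have hs := R.src hf
  have ht := R.tgt hf
  have hN' := R.E_tgt X
  have hκ := R.κ_mul X
  have e₁ : (R.E (D.dual X)).src = (R.E X).src := hm.src_eq.trans hN'
  have e₂ : (R.E (D.dual X)).tgt = (R.E X).src := hm.tgt_eq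
  rw [hN'] at h₁
  generalize hN : (R.E X).src = N at *
  generalize R.E X = S at *
  generalize R.E (D.dual X) = S' at *
  have k₁ : (S * idn a N).comp (x * S') = (idn a N * S').comp (x * idn a N) := by
    rw [mul_comp_mul (y := idn a N) (hN'.trans hs.symm) e₁.symm, h₂, idn_comp e₁.symm]
    exact mul_eq_comp' hs.symm e₂.symm
  have k₂ : (x * idn a N).comp (S * idn a N) = x * idn a N := by
    rw [mul_idn_comp, h₃]
  have k₃ : (S * idn a N).comp (x * idn a N) = x * idn a N := by
    rw [mul_idn_comp, h₂]
  rw [comp_smul, comp_smul, smul_comp, smul_smul', comp_assoc, comp_reassoc k₁,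
    comp_reassoc h₁.symm, ← comp_assoc (S * _) (x * _), k₃, ← comp_assoc (x * _) (S * _), k₂,
    _root_.mul_assoc, mul_comm (R.κ' X),
    hκ, _root_.mul_one]

variable {R}

theorem zero (X Y : C) : R.Rep (0 : X ⟶ Y) (of (0 : (⟨(R.E X).src⟩ : TL a) ⟶ ⟨(R.E Y).src⟩)) := by
  obtain ⟨f, hf⟩ := R.exists_rep X Y (x := of (0 : (⟨(R.E X).src⟩ : TL a) ⟶ ⟨(R.E Y).src⟩)) rfl rfl
  generalize hx : (R.E X).comp ((of (0 : (⟨(R.E X).src⟩ : TL a) ⟶ ⟨(R.E Y).src⟩)).comp (R.E Y)) = x at hf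
  obtain ⟨m, n, x⟩ := x
  have h₁ := R.src hf
  have h₂ := R.tgt hf
  dsimp only at h₁ h₂
  subst h₁ h₂
  have := R.add hf (R.smul (-1) hf)
  rw [neg_smul, one_smul, add_neg_cancel] at this
  refine R.congr this ?_
  change of (x + (-1 : ℂ) • x) = _
  rw [neg_smul, one_smul, add_neg_cancel]

/-- Under a comparison of representatives, the image of a morphism is well defined as soon as zero
has the same representatives on both sides. -/
theorem eq_of_rep {C' : Type*} [Category C'] [MonoidalCategory C'] [Preadditive C'] [Linear ℂ C']
    {D' : RibbonData C'} (R' : Realization a D') {X Y : C} {X' Y' : C'}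
    (hz : ∀ x, R.Rep (0 : X ⟶ Y) x → R'.Rep (0 : X' ⟶ Y') x) {f : X ⟶ Y} {g g' : X' ⟶ Y'}
    {x x' : Arr a} (h : R.Rep f x) (h' : R.Rep f x') (hg : R'.Rep g x) (hg' : R'.Rep g' x') :
    g = g' := by
  obtain ⟨m, n, x⟩ := x
  obtain ⟨m', n', x'⟩ := x'
  obtain rfl : m = m' := (R.src h).trans (R.src h').symm
  obtain rfl : n = n' := (R.tgt h).trans (R.tgt h').symm
  have e := R.add h (R.smul (-1) h')
  rw [neg_smul, one_smul, add_neg_cancel] at e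
  have e' := R'.unique (R'.add hg (R'.smul (-1) hg')) (hz _ e)
  rwa [neg_smul, one_smul, ← sub_eq_add_neg, sub_eq_zero] at e'

theorem rep_iff (X Y : C) (x : Arr a) : (∃ f : X ⟶ Y, R.Rep f x) ↔ x.src = (R.E X).src ∧
    x.tgt = (R.E Y).src ∧ (R.E X).comp x = x ∧ x.comp (R.E Y) = x := by
  constructor
  · rintro ⟨f, hf⟩
    exact ⟨R.src hf, R.tgt hf, R.left hf, R.right hf⟩
  · rintro ⟨h₁, h₂, h₃, h₄⟩
    obtain ⟨f, hf⟩ := R.exists_rep X Y h₁ h₂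
    rw [h₄, h₃] at hf
    exact ⟨f, hf⟩

theorem eq_zero_iff_of_rep (h₀ : 𝟙 (𝟙_ C) ≠ 0) {f : 𝟙_ C ⟶ 𝟙_ C} {x : Arr a} (h : R.Rep f x) :
    f = 0 ↔ x = of (0 : (⟨0⟩ : TL a) ⟶ ⟨0⟩) := by
  have hE := R.E_unit
  have h₁ := R.id (𝟙_ C)
  have hz := R.zero (𝟙_ C) (𝟙_ C)
  obtain ⟨m, n, x⟩ := x
  have hm := R.src h
  have hn := R.tgt h
  rw [hE] at h₁ hz hm hn
  obtain rfl : m = 0 := hm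
  obtain rfl : n = 0 := hn
  obtain ⟨t, rfl⟩ := end_unit_eq_smul x
  obtain rfl : f = t • 𝟙 (𝟙_ C) := R.unique h (R.smul t h₁)
  constructor
  · intro e
    obtain rfl : t = 0 := (smul_eq_zero.1 e).resolve_right h₀
    rw [zero_smul]; rfl
  · intro e
    exact R.unique h (R.congr hz e.symm)

theorem exists_partial_trace (ha : a ≠ 0) {X Y : C} (Z : C) {g : Y ⊗ Z ⟶ X ⊗ Z} {y : Arr a}
    (hg : R.Rep g y) : ∃ (g' : Y ⟶ X) (y' : Arr a), R.Rep g' y' ∧ ∀ {f : X ⟶ Y} {x : Arr a},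
      R.Rep f x → D.trace (g ≫ f ▷ Z) = (-1 : ℂ) ^ (R.E Z).src • D.trace (g' ≫ f) := by
  set M := (R.E Z).src with hM
  have hs := R.src hg
  have ht := R.tgt hg
  rw [R.E_tensor, mul_src, ← hM] at hs ht
  obtain ⟨g', hg'⟩ := R.exists_rep Y X
    (x := (idn a (R.E Y).src * coevA a M).comp ((y * idn a M).comp
      (idn a (R.E X).src * evA a M))) (by rw [comp_src]; rfl) (by rw [comp_tgt, comp_tgt]; rfl)
  refine ⟨g', _, hg', fun {f x} hx => R.unique' (R.trace ha (R.comp hg (R.whiskerRight Z hx)))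
    (R.smul _ (R.trace ha (R.comp hg' hx))) ?_⟩
  have hf := R.left hx
  have hf' := R.right hx
  have hfs := R.src hx
  have hft := R.tgt hx
  rw [smul_smul', R.E_tensor, mul_src, ← hM, pow_add, mul_comm]
  congr 1
  have hg := R.left hg
  have hg₁ := R.right ‹R.Rep g y›
  rw [R.E_tensor] at hg hg₁
  have hU := R.E_idem Z
  have hU' := R.E_tgt Z
  have hS' := R.E_tgt X
  have hT' := R.E_tgt Y
  have hT := R.E_idem Y
  rw [← hM] at hU'
  clear hg'
  generalize R.E Z = U at *
  generalize hNt : (R.E Y).src = N at *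
  generalize hNs : (R.E X).src = N' at *
  generalize R.E X = S at *
  generalize R.E Y = T at *
  have e₁ : y.comp (x * U) = y.comp (x * idn a M) := by
    have : y.comp (idn a N' * U) = y := by
      rw [← hg₁, comp_assoc, mul_comp_mul hS' (hU'.trans hM), hU, comp_idn hS'.symm]
    rw [mul_eq_comp' (m := N') hfs.symm hU'.symm, ← comp_assoc, this]
  have i₁ := congrArg (· * idn a N) (interchange T (coevA a M))
  have i₂ := congrArg (· * idn a N) (interchange x (evA a M))
  have e₂ : (T * (idn a M * idn a M)).comp (y * idn a M) = y * idn a M := by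
    have : (T * idn a M).comp y = y := by
      rw [← hg, ← comp_assoc, mul_comp_mul (by rw [hT', hNt]) hM, hT, idn_comp hM]
    rw [← mul_assoc, mul_idn_comp, this]
  have e₂ := congrArg (· * idn a N) e₂
  have e₃ : idn a (N + M) = idn a M * idn a N := by rw [Nat.add_comm, idn_add]
  rw [e₁, coevA_add, evA_add, e₃, ← mul_assoc (y.comp _), ← mul_idn_comp M, ← mul_idn_comp N]
  simp only [hNt, hNs, hT', hfs, hft, ← mul_idn_comp, ← idn_mul_comp, evA_src, evA_tgt, coevA_src,
    coevA_tgt, zero_add, add_zero, idn_zero, mul_one, one_mul, idn_add, mul_assoc, comp_assoc]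
    at i₁ i₂ e₂ ⊢
  rw [comp_reassoc i₁, ← comp_assoc (T * _), e₂, ← comp_assoc (S * _), mul_idn_comp, hf,
    comp_reassoc i₂]

theorem trace_comm (ha : a ≠ 0) {X Y : C} {f : X ⟶ Y} {g : Y ⟶ X} {x y : Arr a} (hf : R.Rep f x)
    (hg : R.Rep g y) : (-1 : ℂ) ^ (R.E Y).src • D.trace (f ≫ g) =
      (-1 : ℂ) ^ (R.E X).src • D.trace (g ≫ f) := by
  refine R.unique' (R.smul _ (R.trace ha (R.comp hf hg))) (R.smul _ (R.trace ha (R.comp hg hf))) ?_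
  rw [smul_smul', smul_smul', mul_comm]
  have := coevA_comp_evA_comm x y (by rw [R.src hg, R.tgt hf]) (by rw [R.src hf, R.tgt hg])
  rw [R.src hf, R.tgt hf] at this
  rw [this]

/-- The realization is full up to an ideal of morphisms of trace zero. -/
structure IsFullModulo (R : Realization a D) (I : ∀ {X Y : C}, (X ⟶ Y) → Prop) : Prop where
  full {X Y : C} (f : X ⟶ Y) : ∃ g x, R.Rep g x ∧ I (f - g)
  comp_left {X Y Z : C} (f : X ⟶ Y) {g : Y ⟶ Z} : I g → I (f ≫ g)
  comp_right {X Y Z : C} {f : X ⟶ Y} (g : Y ⟶ Z) : I f → I (f ≫ g)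
  whiskerLeft (Z : C) {X Y : C} {f : X ⟶ Y} : I f → I (Z ◁ f)
  whiskerRight {X Y : C} {f : X ⟶ Y} (Z : C) : I f → I (f ▷ Z)
  trace {X : C} {f : X ⟶ X} : I f → D.trace f = 0

section

variable [MonoidalPreadditive C] [MonoidalLinear ℂ C] {I : ∀ {X Y : C}, (X ⟶ Y) → Prop}

namespace IsFullModulo

theorem trace_eq (hI : R.IsFullModulo I) {X : C} {f g : X ⟶ X} (h : I (f - g)) :
    D.trace f = D.trace g := by
  rw [← sub_add_cancel f g, D.trace_add, hI.trace h, zero_add]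

theorem smul_eq_zero_iff {X Y : C} (n : ℕ) (f : X ⟶ Y) : (-1 : ℂ) ^ n • f = 0 ↔ f = 0 :=
  smul_eq_zero_iff_right (pow_ne_zero n (neg_ne_zero.2 one_ne_zero))

theorem trace_comm (hI : R.IsFullModulo I) (ha : a ≠ 0) {X Y : C} (f : X ⟶ Y) (g : Y ⟶ X) :
    D.trace (f ≫ g) = 0 ↔ D.trace (g ≫ f) = 0 := by
  obtain ⟨f₀, x, hx, hf⟩ := hI.full f
  obtain ⟨g₀, y, hy, hg⟩ := hI.full g
  have e₁ : D.trace (f ≫ g) = D.trace (f₀ ≫ g₀) := by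
    rw [hI.trace_eq (f := f ≫ g) (g := f₀ ≫ g), hI.trace_eq (f := f₀ ≫ g) (g := f₀ ≫ g₀)]
    · rw [← Preadditive.comp_sub]; exact hI.comp_left _ hg
    · rw [← Preadditive.sub_comp]; exact hI.comp_right _ hf
  have e₂ : D.trace (g ≫ f) = D.trace (g₀ ≫ f₀) := by
    rw [hI.trace_eq (f := g ≫ f) (g := g₀ ≫ f), hI.trace_eq (f := g₀ ≫ f) (g := g₀ ≫ f₀)]
    · rw [← Preadditive.comp_sub]; exact hI.comp_left _ hf
    · rw [← Preadditive.sub_comp]; exact hI.comp_right _ hg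
  rw [e₁, e₂, ← smul_eq_zero_iff (R.E Y).src, R.trace_comm ha hx hy, smul_eq_zero_iff]

theorem exists_partial_trace (hI : R.IsFullModulo I) (ha : a ≠ 0) {X Y : C} (Z : C)
    (g : Y ⊗ Z ⟶ X ⊗ Z) : ∃ (g' : Y ⟶ X), ∀ f : X ⟶ Y,
      D.trace (g ≫ f ▷ Z) = 0 ↔ D.trace (g' ≫ f) = 0 := by
  obtain ⟨g₀, y, hy, hg⟩ := hI.full g
  obtain ⟨g', y', hy', h⟩ := R.exists_partial_trace ha Z hy
  refine ⟨g', fun f => ?_⟩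
  obtain ⟨f₀, x, hx, hf⟩ := hI.full f
  have e₁ : D.trace (g ≫ f ▷ Z) = D.trace (g₀ ≫ f₀ ▷ Z) := by
    rw [hI.trace_eq (f := g ≫ f ▷ Z) (g := g₀ ≫ f ▷ Z),
      hI.trace_eq (f := g₀ ≫ f ▷ Z) (g := g₀ ≫ f₀ ▷ Z)]
    · have := hI.comp_left g₀ (hI.whiskerRight Z hf)
      have e := ((tensorRight Z).map_sub (f := f) (g := f₀))
      change (f - f₀) ▷ Z = f ▷ Z - f₀ ▷ Z at e
      rwa [e, Preadditive.comp_sub] at this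
    · rw [← Preadditive.sub_comp]; exact hI.comp_right _ hg
  have e₂ : D.trace (g' ≫ f) = D.trace (g' ≫ f₀) := by
    refine hI.trace_eq ?_
    rw [← Preadditive.comp_sub]; exact hI.comp_left _ hf
  rw [e₁, e₂, h hx, smul_eq_zero_iff]

/-- The negligible morphisms form an ideal. -/
def negligibleIdeal (hI : R.IsFullModulo I) (ha : a ≠ 0) : NegligibleIdeal D := by
  refine D.negligibleIdeal (hI.trace_comm ha) (hI.exists_partial_trace ha) ?_
  intro X Y Z g
  have := R.isIso_braiding ha Z X
  have := R.isIso_braiding ha Z Y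
  obtain ⟨g', h⟩ := hI.exists_partial_trace ha Z
    (inv (D.braiding Z Y) ≫ g ≫ D.braiding Z X)
  refine ⟨g', fun f => ?_⟩
  rw [← h]
  obtain ⟨f₀, x, hx, hf⟩ := hI.full f
  have e := R.braiding_naturality ha (R.id Z) hx
  rw [id_tensorHom, tensorHom_id] at e
  have e₁ : D.trace (g ≫ Z ◁ f) = D.trace (g ≫ Z ◁ f₀) := by
    refine hI.trace_eq ?_
    have := hI.comp_left g (hI.whiskerLeft Z hf)
    have e := ((tensorLeft Z).map_sub (f := f) (g := f₀))
    change Z ◁ (f - f₀) = Z ◁ f - Z ◁ f₀ at e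
    rwa [e, Preadditive.comp_sub] at this
  have e₂ : D.trace ((inv (D.braiding Z Y) ≫ g ≫ D.braiding Z X) ≫ f ▷ Z) =
      D.trace ((inv (D.braiding Z Y) ≫ g ≫ D.braiding Z X) ≫ f₀ ▷ Z) := by
    refine hI.trace_eq ?_
    have := hI.comp_left (inv (D.braiding Z Y) ≫ g ≫ D.braiding Z X) (hI.whiskerRight Z hf)
    have e := ((tensorRight Z).map_sub (f := f) (g := f₀))
    change (f - f₀) ▷ Z = f ▷ Z - f₀ ▷ Z at e
    rwa [e, Preadditive.comp_sub] at this
  have e' : g ≫ Z ◁ f₀ = (g ≫ D.braiding Z X ≫ f₀ ▷ Z) ≫ inv (D.braiding Z Y) := by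
    rw [← e, Category.assoc, Category.assoc, IsIso.hom_inv_id, Category.comp_id]
  rw [e₁, e₂, e', hI.trace_comm ha]
  simp only [Category.assoc]

/-- Negligibility of a represented morphism only depends on the representative. -/
theorem negligible_iff (hI : R.IsFullModulo I) (ha : a ≠ 0) (h₀ : 𝟙 (𝟙_ C) ≠ 0) {X Y : C}
    {f : X ⟶ Y} {x : Arr a} (hx : R.Rep f x) : D.Negligible f ↔ IsNull (R.E X) (R.E Y) x := by
  have key : ∀ {g : Y ⟶ X} {y : Arr a}, R.Rep g y → (D.trace (g ≫ f) = 0 ↔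
      (coevA a (R.E Y).src).comp ((y.comp x * idn a (R.E Y).src).comp (evA a (R.E Y).src)) =
        of (0 : (⟨0⟩ : TL a) ⟶ ⟨0⟩)) := by
    intro g y hy
    have ht := R.smul ((-1) ^ (R.E Y).src) (R.trace ha (R.comp hy hx))
    rw [smul_smul', ← mul_pow, neg_one_mul, neg_neg, one_pow, one_smul'] at ht
    rw [← R.eq_zero_iff_of_rep h₀ ht, smul_eq_zero_iff]
  constructor
  · intro h y h₁ h₂
    obtain ⟨g, hg⟩ := R.exists_rep Y X h₁ h₂
    exact (key hg).1 (h g)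
  · intro h g
    obtain ⟨g₀, y, hy, hg⟩ := hI.full g
    have e : D.trace (g ≫ f) = D.trace (g₀ ≫ f) := by
      refine hI.trace_eq ?_
      rw [← Preadditive.sub_comp]; exact hI.comp_right _ hg
    rw [e, key hy]
    have := h y (R.src hy) (R.tgt hy)
    rwa [R.right hy, R.left hy] at this

end IsFullModulo

/-- The realization of the purified category, with the same representatives. -/
def purified (R : Realization a D) (N : NegligibleIdeal D) : Realization a (Purified.ribbonData N) where
  E X := R.E X.of
  Rep {X Y} f x := ∃ g : X.of ⟶ Y.of, (Purified.proj N).map g = f ∧ R.Rep g x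
  κ X := R.κ X.of
  κ' X := R.κ' X.of
  κ_mul X := R.κ_mul X.of
  E_idem X := R.E_idem X.of
  E_tgt X := R.E_tgt X.of
  E_tensor X Y := R.E_tensor X.of Y.of
  E_unit := R.E_unit
  E_dual X := R.E_dual X.of
  src := fun ⟨_, _, h⟩ => R.src h
  tgt := fun ⟨_, _, h⟩ => R.tgt h
  left := fun ⟨_, _, h⟩ => R.left h
  right := fun ⟨_, _, h⟩ => R.right h
  unique := fun ⟨_, e, h⟩ ⟨_, e', h'⟩ => by rw [← e, ← e', R.unique h h']
  exists_rep X Y x hs ht := by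
    obtain ⟨f, hf⟩ := R.exists_rep X.of Y.of hs ht
    exact ⟨_, f, rfl, hf⟩
  id X := ⟨_, rfl, R.id X.of⟩
  comp := fun ⟨_, e, h⟩ ⟨_, e', h'⟩ => ⟨_, by rw [← e, ← e']; rfl, R.comp h h'⟩
  tensor := fun ⟨_, e, h⟩ ⟨_, e', h'⟩ =>
    ⟨_, by rw [← e, ← e']; exact (Purified.proj_tensorHom N _ _).symm, R.tensor h h'⟩
  add := fun ⟨_, e, h⟩ ⟨_, e', h'⟩ => ⟨_, by rw [← e, ← e']; rfl, R.add h h'⟩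
  smul := by
    rintro X Y c f x ⟨g, e, h⟩
    exact ⟨c • g, by rw [← e]; rfl, R.smul c h⟩
  associator_hom X Y Z := ⟨_, rfl, R.associator_hom X.of Y.of Z.of⟩
  leftUnitor_hom X := ⟨_, rfl, R.leftUnitor_hom X.of⟩
  rightUnitor_hom X := ⟨_, rfl, R.rightUnitor_hom X.of⟩
  braiding X Y := ⟨_, rfl, R.braiding X.of Y.of⟩
  twist X := ⟨_, rfl, R.twist X.of⟩
  coev X := ⟨_, rfl, R.coev X.of⟩
  ev X := ⟨_, rfl, R.ev X.of⟩

theorem purified_rep_iff (R : Realization a D) (N : NegligibleIdeal D) {X Y : Purified N} {f : X ⟶ Y}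
    {x : Arr a} : (R.purified N).Rep f x ↔
      ∃ g : X.of ⟶ Y.of, (Purified.proj N).map g = f ∧ R.Rep g x := Iff.rfl

/-- Morphisms in an ideal of trace zero are negligible, so that the realization becomes full after
purification. -/
theorem IsFullModulo.purified_full (hI : R.IsFullModulo I) (N : NegligibleIdeal D)
    {X Y : Purified N} (f : X ⟶ Y) : ∃ x, (R.purified N).Rep f x := by
  obtain ⟨f, rfl⟩ := Purified.proj_map_surjective N f
  obtain ⟨g, x, hx, h⟩ := hI.full f
  refine ⟨x, (R.purified_rep_iff N).2 ⟨g, ?_, hx⟩⟩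
  refine ((Submodule.Quotient.eq _).2 ?_).symm
  exact (N.mem_iff _).2 fun g' => hI.trace (hI.comp_left g' h)

/-- After purification, the representatives of zero can be told from the idempotents and the planar
closure alone; this is why they agree for two realizations. -/
theorem IsFullModulo.purified_rep_zero (hI : R.IsFullModulo I) (ha : a ≠ 0) (h₀ : 𝟙 (𝟙_ C) ≠ 0)
    (N : NegligibleIdeal D) {X Y : Purified N} (x : Arr a) :
    (R.purified N).Rep (0 : X ⟶ Y) x ↔ (x.src = (R.E X.of).src ∧ x.tgt = (R.E Y.of).src ∧
      (R.E X.of).comp x = x ∧ x.comp (R.E Y.of) = x) ∧ IsNull (R.E X.of) (R.E Y.of) x := by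
  rw [← rep_iff, purified_rep_iff]
  constructor
  · rintro ⟨g, hg, h⟩
    exact ⟨⟨g, h⟩, (hI.negligible_iff ha h₀ h).1 ((N.mem_iff _).1
      ((Submodule.Quotient.mk_eq_zero _).1 hg))⟩
  · rintro ⟨⟨g, h⟩, h'⟩
    exact ⟨g, (Submodule.Quotient.mk_eq_zero _).2 ((N.mem_iff _).2
      ((hI.negligible_iff ha h₀ h).2 h')), h⟩

end

end Realization

end TL

/-! ### The equivalence between two realizations -/

namespace TL.Realization

open TL.Arr

universe v w v' w'

variable {a : ℂ} {C : Type w} [Category.{v} C] [MonoidalCategory C] [Preadditive C] [Linear ℂ C]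
  {D : RibbonData C} {C' : Type w'} [Category.{v'} C'] [MonoidalCategory C'] [Preadditive C']
  [Linear ℂ C'] {D' : RibbonData C'}

/-- A comparison of two full realizations: a map on objects which preserves the idempotents, such that zero
morphisms have the same representatives on both sides. -/
structure Comparison (R : Realization a D) (R' : Realization a D') where
  obj : C → C'
  E_obj (X : C) : R'.E (obj X) = R.E X
  exists_E_eq (Y : C') : ∃ X, R.E X = R'.E Y
  full {X Y : C} (f : X ⟶ Y) : ∃ x, R.Rep f x
  full' {X Y : C'} (f : X ⟶ Y) : ∃ x, R'.Rep f x
  rep_zero_iff (X Y : C) (x : Arr a) :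
    R.Rep (0 : X ⟶ Y) x ↔ R'.Rep (0 : obj X ⟶ obj Y) x

namespace Comparison

variable {R : Realization a D} {R' : Realization a D'} (F : Comparison R R')

theorem exists_map {X Y : C} (f : X ⟶ Y) :
    ∃ g : F.obj X ⟶ F.obj Y, ∃ x, R.Rep f x ∧ R'.Rep g x := by
  obtain ⟨x, hx⟩ := F.full f
  obtain ⟨g, hg⟩ := (R'.rep_iff (F.obj X) (F.obj Y) x).2 (by
    rw [F.E_obj, F.E_obj]
    exact (R.rep_iff X Y x).1 ⟨f, hx⟩)
  exact ⟨g, x, hx, hg⟩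

/-- The morphism with the same representatives. -/
def map {X Y : C} (f : X ⟶ Y) : F.obj X ⟶ F.obj Y := (F.exists_map f).choose

theorem rep_map {X Y : C} {f : X ⟶ Y} {x : Arr a} (h : R.Rep f x) : R'.Rep (F.map f) x := by
  obtain ⟨x', h₁, h₂⟩ := (F.exists_map f).choose_spec
  obtain ⟨g, hg⟩ := (R'.rep_iff (F.obj X) (F.obj Y) x).2 (by
    rw [F.E_obj, F.E_obj]
    exact (R.rep_iff X Y x).1 ⟨f, h⟩)
  have : F.map f = g := R.eq_of_rep R' (fun x => (F.rep_zero_iff X Y x).1) h₁ h h₂ hg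
  rwa [this]

theorem map_eq {X Y : C} {f : X ⟶ Y} {x : Arr a} {g : F.obj X ⟶ F.obj Y} (h : R.Rep f x)
    (hg : R'.Rep g x) : F.map f = g := R'.unique (F.rep_map h) hg

/-- The functor which preserves representatives. -/
def functor : C ⥤ C' where
  obj := F.obj
  map f := F.map f
  map_id X := F.map_eq (R.id X) (R'.congr (R'.id (F.obj X)) (F.E_obj X))
  map_comp f g := by
    obtain ⟨x, hx⟩ := F.full f
    obtain ⟨y, hy⟩ := F.full g
    exact F.map_eq (R.comp hx hy) (R'.comp (F.rep_map hx) (F.rep_map hy))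

theorem rep_functor_map {X Y : C} {f : X ⟶ Y} {x : Arr a} (h : R.Rep f x) :
    R'.Rep (F.functor.map f) x := F.rep_map h

instance : F.functor.Additive where
  map_add {X Y f g} := by
    obtain ⟨x, hx⟩ := F.full f
    obtain ⟨y, hy⟩ := F.full g
    obtain ⟨m, n, x⟩ := x
    obtain ⟨m', n', y⟩ := y
    obtain rfl : m = m' := (R.src hx).trans (R.src hy).symm
    obtain rfl : n = n' := (R.tgt hx).trans (R.tgt hy).symm
    exact F.map_eq (R.add hx hy) (R'.add (F.rep_map hx) (F.rep_map hy))

instance : F.functor.Linear ℂ where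
  map_smul f c := by
    obtain ⟨x, hx⟩ := F.full f
    exact F.map_eq (R.smul c hx) (R'.smul c (F.rep_map hx))

instance : F.functor.Faithful where
  map_injective {X Y f g} h := by
    obtain ⟨x, hx⟩ := F.full f
    obtain ⟨y, hy⟩ := F.full g
    have h₁ := F.rep_functor_map hx
    rw [h] at h₁
    exact R'.eq_of_rep R (fun x => (F.rep_zero_iff X Y x).2) h₁ (F.rep_functor_map hy) hx hy

instance : F.functor.Full where
  map_surjective {X Y} g := by
    obtain ⟨y, hy⟩ := F.full' g
    obtain ⟨f, hf⟩ := (R.rep_iff X Y y).2 (by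
      rw [← F.E_obj, ← F.E_obj]
      exact (R'.rep_iff _ _ y).1 ⟨g, hy⟩)
    exact ⟨f, F.map_eq hf hy⟩

instance : F.functor.EssSurj where
  mem_essImage Y := by
    obtain ⟨X, hX⟩ := F.exists_E_eq Y
    obtain ⟨e, -, -⟩ := R'.exists_iso ((F.E_obj X).trans hX)
    exact ⟨X, ⟨e⟩⟩

instance : F.functor.IsEquivalence where

theorem exists_μIso (X Y : C) : ∃ e : F.obj X ⊗ F.obj Y ≅ F.obj (X ⊗ Y),
    R'.Rep e.hom (R.E X * R.E Y) ∧ R'.Rep e.inv (R.E X * R.E Y) := by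
  obtain ⟨e, h, h'⟩ := R'.exists_iso (X := F.obj X ⊗ F.obj Y) (Y := F.obj (X ⊗ Y))
    (by rw [R'.E_tensor, F.E_obj, F.E_obj, F.E_obj, R.E_tensor])
  rw [R'.E_tensor, F.E_obj, F.E_obj] at h h'
  exact ⟨e, h, h'⟩

theorem exists_εIso : ∃ e : 𝟙_ C' ≅ F.obj (𝟙_ C), R'.Rep e.hom 1 ∧ R'.Rep e.inv 1 := by
  obtain ⟨e, h, h'⟩ := R'.exists_iso (X := 𝟙_ C') (Y := F.obj (𝟙_ C))
    (by rw [R'.E_unit, F.E_obj, R.E_unit])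
  rw [R'.E_unit] at h h'
  exact ⟨e, h, h'⟩

/-- The compatibility with tensor products. -/
def μIso (X Y : C) : F.obj X ⊗ F.obj Y ≅ F.obj (X ⊗ Y) := (F.exists_μIso X Y).choose

/-- The compatibility with the unit objects. -/
def εIso : 𝟙_ C' ≅ F.obj (𝟙_ C) := F.exists_εIso.choose

theorem rep_μ (X Y : C) : R'.Rep (F.μIso X Y).hom (R.E X * R.E Y) :=
  (F.exists_μIso X Y).choose_spec.1

theorem rep_ε : R'.Rep F.εIso.hom 1 := F.exists_εIso.choose_spec.1

theorem rep_whiskerLeft (X : C) {Y Z : C'} {f : Y ⟶ Z} {x : Arr a} (h : R'.Rep f x) :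
    R'.Rep (F.obj X ◁ f) (R.E X * x) := R'.congr (R'.whiskerLeft (F.obj X) h) (by rw [F.E_obj])

theorem rep_whiskerRight (X : C) {Y Z : C'} {f : Y ⟶ Z} {x : Arr a} (h : R'.Rep f x) :
    R'.Rep (f ▷ F.obj X) (x * R.E X) := R'.congr (R'.whiskerRight (F.obj X) h) (by rw [F.E_obj])

/-- The monoidal structure of the functor. -/
def coreMonoidal : F.functor.CoreMonoidal where
  εIso := F.εIso
  μIso := F.μIso
  μIso_hom_natural_left {X Y} f Z := by
    obtain ⟨x, hx⟩ := F.full f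
    refine R'.unique' (R'.comp (F.rep_whiskerRight Z (F.rep_map hx)) (F.rep_μ Y Z))
      (R'.comp (F.rep_μ X Z) (F.rep_map (R.whiskerRight Z hx))) ?_
    have h₁ := R.right (R.whiskerRight Z hx)
    have h₂ := R.left (R.whiskerRight Z hx)
    rw [R.E_tensor] at h₁ h₂
    rw [h₁, h₂]
  μIso_hom_natural_right {X Y} Z f := by
    obtain ⟨x, hx⟩ := F.full f
    refine R'.unique' (R'.comp (F.rep_whiskerLeft Z (F.rep_map hx)) (F.rep_μ Z Y))
      (R'.comp (F.rep_μ Z X) (F.rep_map (R.whiskerLeft Z hx))) ?_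
    have h₁ := R.right (R.whiskerLeft Z hx)
    have h₂ := R.left (R.whiskerLeft Z hx)
    rw [R.E_tensor] at h₁ h₂
    rw [h₁, h₂]
  associativity X Y Z := by
    refine R'.unique' (R'.comp (F.rep_whiskerRight Z (F.rep_μ X Y)) (R'.comp (F.rep_μ (X ⊗ Y) Z)
      (F.rep_map (R.associator_hom X Y Z)))) (R'.comp (R'.associator_hom (F.obj X) (F.obj Y) (F.obj Z))
      (R'.comp (F.rep_whiskerLeft X (F.rep_μ Y Z)) (F.rep_μ X (Y ⊗ Z)))) ?_
    rw [R.E_tensor, R.E_tensor, F.E_obj, F.E_obj, F.E_obj, mul_assoc]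
  left_unitality X := by
    refine R'.unique' (R'.leftUnitor_hom (F.obj X)) (R'.comp (F.rep_whiskerRight X F.rep_ε)
      (R'.comp (F.rep_μ _ X) (F.rep_map (R.leftUnitor_hom X)))) ?_
    rw [R.E_unit, F.E_obj, one_mul, R.E_idem, R.E_idem]
  right_unitality X := by
    refine R'.unique' (R'.rightUnitor_hom (F.obj X)) (R'.comp (F.rep_whiskerLeft X F.rep_ε)
      (R'.comp (F.rep_μ X _) (F.rep_map (R.rightUnitor_hom X)))) ?_
    rw [R.E_unit, F.E_obj, mul_one, R.E_idem, R.E_idem]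

instance monoidal : F.functor.Monoidal := F.coreMonoidal.toMonoidal

theorem isPreservedBy : D.IsPreservedBy D' F.functor where
  map_braiding X Y := by
    refine R'.unique' (R'.comp (F.rep_μ X Y) (F.rep_map (R.braiding X Y)))
      (R'.comp (R'.braiding (F.obj X) (F.obj Y)) (F.rep_μ Y X)) ?_
    have h := R.left (R.braiding X Y)
    have h' := R.right (R.braiding X Y)
    rw [R.E_tensor] at h h'
    rw [F.E_obj, F.E_obj, h, h']
  map_twist X := F.map_eq (R.twist X) (R'.congr (R'.twist (F.obj X)) (by rw [F.E_obj]))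
  map_dual X := by
    -- The idempotents of both duals are rotations of the same idempotent, and a rotation is
    -- determined by the original.
    have hE : R'.E (F.obj (D.dual X)) = R'.E (D'.dual (F.obj X)) := by
      have h := R'.E_dual (F.obj X)
      rw [F.E_obj] at h
      rw [F.E_obj]
      exact (R.E_dual X).unique h
    obtain ⟨e, h, h'⟩ := R'.exists_iso hE
    have hc : R'.κ (F.obj X) * R.κ' X * (R'.κ' (F.obj X) * R.κ X) = 1 := by
      have h₁ := R.κ_mul X
      have h₂ := R'.κ_mul (F.obj X)
      linear_combination (R'.κ (F.obj X) * R'.κ' (F.obj X)) * h₁ + h₂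
    -- The comparison of the duals absorbs the scalars of the two dualities.
    let u : F.obj (D.dual X) ≅ D'.dual (F.obj X) :=
      ⟨(R'.κ (F.obj X) * R.κ' X) • e.hom, (R'.κ' (F.obj X) * R.κ X) • e.inv,
        by rw [Linear.smul_comp, Linear.comp_smul, smul_smul, hc, one_smul, e.hom_inv_id],
        by rw [Linear.smul_comp, Linear.comp_smul, smul_smul, mul_comm, hc, one_smul, e.inv_hom_id]⟩
    have hu := R'.smul (R'.κ (F.obj X) * R.κ' X) h
    have hu' := R'.smul (R'.κ' (F.obj X) * R.κ X) h'
    rw [F.E_obj] at hu hu'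
    refine ⟨u, ?_, ?_⟩
    · refine R'.unique' (R'.comp F.rep_ε (F.rep_map (R.coev X))) (R'.comp (R'.coev (F.obj X))
        (R'.comp (F.rep_whiskerLeft X hu') (F.rep_μ X (D.dual X)))) ?_
      have h₁ := R.right (R.coev X)
      have h₂ := R.left (R.coev X)
      have h₃ := R.E_idem (X ⊗ D.dual X)
      have h₄ := R'.κ_mul (F.obj X)
      rw [R.E_unit] at h₂
      rw [R.E_tensor] at h₁ h₃
      rw [h₂, F.E_obj, mul_smul', smul_comp, smul_comp, comp_smul, h₃, smul_smul']
      rw [smul_comp] at h₁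
      have h₅ := congrArg (R.κ' X • ·) h₁
      simp only [smul_smul'] at h₅
      rw [mul_comm (R.κ' X), R.κ_mul, one_smul', one_smul'] at h₅
      rw [h₅, ← _root_.mul_assoc, h₄, _root_.one_mul]
    · refine R'.unique' (R'.comp (F.rep_μ (D.dual X) X) (F.rep_map (R.ev X)))
        (R'.comp (F.rep_whiskerRight X hu) (R'.comp (R'.ev (F.obj X)) F.rep_ε)) ?_
      have h₁ := R.left (R.ev X)
      have h₂ := R'.right (R'.ev (F.obj X))
      have h₄ := R'.κ_mul (F.obj X)
      rw [R'.E_unit] at h₂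
      rw [R.E_tensor] at h₁
      rw [h₁, h₂, F.E_obj, smul_mul, smul_comp, comp_smul, smul_smul']
      rw [comp_smul] at h₁
      have h₅ := congrArg (R.κ X • ·) h₁
      simp only [smul_smul'] at h₅
      rw [R.κ_mul, one_smul', one_smul'] at h₅
      rw [h₅, mul_right_comm, h₄, _root_.one_mul]

end Comparison

end TL.Realization

/-! ### The realization of Turaev's category -/

namespace Turaev

open TL TL.Arr

variable {a : ℂ}

theorem ofHom_hat {s t : TuraevCat a} (f : (seqObj a s).X ⟶ (seqObj a t).X) :
    of (KaroubiMonoidal.hat (P := seqObj a s) (Q := seqObj a t) f).f =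
      (seqA s).comp ((of f).comp (seqA t)) :=
  (of_hat _).trans (congrArg₂ Arr.comp (of_seqObj_p s) (congrArg _ (of_seqObj_p t)))

theorem ofHom_twist (s : TuraevCat a) : ofHom ((ribbonData a).twist s) =
    (seqA s).comp ((twistA a (seqA s).src).comp (seqA s)) := by
  refine (ofHom_hat (s := s) (t := s) _).trans ?_
  rw [seqA_src]
  rfl

theorem ofHom_twist_eq (ha : a ≠ 0) (s : TuraevCat a) : ofHom ((ribbonData a).twist s) =
    (seqA s).comp (twistA a (seqA s).src) := by
  have h := isTwistNat ha (seqA s)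
  unfold IsTwistNat at h
  rw [seqA_tgt_eq] at h
  rw [ofHom_twist, ← h, ← comp_assoc, seqA_comp_seqA]

theorem ofHom_braiding (ha : a ≠ 0) (s t : TuraevCat a) : ofHom ((ribbonData a).braiding s t) =
    (seqA s * seqA t).comp (braidA a (seqA s).src (seqA t).src) := by
  have e₁ : ∀ s t : TuraevCat a, of (seqObj a s ⊗ seqObj a t).p = seqA s * seqA t := fun s t => by
    rw [← of_seqObj_p, ← of_seqObj_p]; rfl
  have e : ((ribbonData a).braiding s t).hom = (seqIso a s t).inv ≫
    KaroubiMonoidal.hat (P := seqObj a s ⊗ seqObj a t) (Q := seqObj a t ⊗ seqObj a s)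
      (TL.braid a (seqObj a s).X.strands (seqObj a t).X.strands) ≫ (seqIso a t s).hom := rfl
  rw [ofHom, e]
  refine (of_comp _ _).trans ((congrArg₂ Arr.comp (of_seqIso_inv (a := a) s t)
    ((of_comp _ _).trans (congrArg₂ Arr.comp ((of_hat _).trans (congrArg₂ Arr.comp (e₁ s t)
      (congrArg₂ Arr.comp rfl (e₁ t s)))) (of_seqIso_hom (a := a) t s)))).trans ?_)
  have h := mul_comp_braidA ha (seqA s) (seqA t)
  rw [seqA_tgt_eq, seqA_tgt_eq] at h
  change (seqA s * seqA t).comp (((seqA s * seqA t).comp ((braidA a (seqObj a s).X.strands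
    (seqObj a t).X.strands).comp (seqA t * seqA s))).comp (seqA t * seqA s)) = _
  rw [← seqA_src, ← seqA_src, comp_assoc, comp_assoc, ← seqA_tensor t s, seqA_comp_seqA,
    seqA_tensor, ← h, ← comp_assoc, ← comp_assoc, ← seqA_tensor, seqA_comp_seqA, seqA_comp_seqA]

theorem exists_ofHom_eq {s t : TuraevCat a} {x : Arr a} (hs : x.src = (seqA s).src)
    (ht : x.tgt = (seqA t).src) : ∃ f : s ⟶ t, ofHom f = (seqA s).comp (x.comp (seqA t)) := by
  obtain ⟨m, n, x⟩ := x
  rw [seqA_src] at hs ht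
  dsimp only at hs ht
  subst hs ht
  exact ⟨InducedCategory.homMk (KaroubiMonoidal.hat (P := seqObj a s) (Q := seqObj a t) x),
    ofHom_hat (s := s) (t := t) x⟩

/-- Turaev's category is realized by the Temperley-Lieb category by construction. -/
def realization (ha : a ≠ 0) (h : ∀ n ∈ J a, JWSpec (jonesWenzl a n)) :
    Realization a (ribbonData a) where
  E s := seqA s
  Rep f x := ofHom f = x
  κ _ := 1
  κ' _ := 1
  κ_mul _ := one_mul 1
  E_idem s := seqA_comp_seqA s
  E_tgt s := seqA_tgt_eq s
  E_tensor s t := seqA_tensor s t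
  E_unit := rfl
  E_dual s := isMate_seqA h s
  src := by rintro s t f _ rfl; exact ofHom_src f
  tgt := by rintro s t f _ rfl; exact ofHom_tgt f
  left := by rintro s t f _ rfl; exact seqA_comp_ofHom f
  right := by rintro s t f _ rfl; exact ofHom_comp_seqA f
  unique e e' := ofHom_injective (e.trans e'.symm)
  exists_rep s t _ hs ht := exists_ofHom_eq hs ht
  id s := ofHom_id s
  comp := by rintro s t u f g _ _ rfl rfl; exact ofHom_comp f g
  tensor := by rintro s t s' t' f g _ _ rfl rfl; exact ofHom_tensorHom f g
  add := by
    intro s t f g m n x y hx hy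
    have h₁ : (seqObj a s).X.strands = m := congrArg Arr.src hx
    have h₂ : (seqObj a t).X.strands = n := congrArg Arr.tgt hx
    subst h₁ h₂
    exact congrArg of (congrArg₂ (· + ·) (of_injective (m := ⟨_⟩) (n := ⟨_⟩) hx)
      (of_injective (m := ⟨_⟩) (n := ⟨_⟩) hy))
  smul := by rintro s t c f _ rfl; rfl
  associator_hom := ofHom_associator_hom
  leftUnitor_hom := ofHom_leftUnitor_hom
  rightUnitor_hom := ofHom_rightUnitor_hom
  braiding s t := ofHom_braiding ha s t
  twist s := ofHom_twist_eq ha s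
  coev s := (ofHom_coev s h).trans (one_smul' _).symm
  ev s := (ofHom_ev s h).trans (one_smul' _).symm

end Turaev

/-! ### The universal property of the Temperley-Lieb category -/

namespace TL

universe v w

variable {C : Type w} [Category.{v} C] [MonoidalCategory C]

/-- The tensor powers of an object. -/
def pow (V : C) : ℕ → C
  | 0 => 𝟙_ C
  | n + 1 => pow V n ⊗ V

namespace pow

variable (V : C)

/-- Transport along an equality of exponents. -/
def cast {m n : ℕ} (h : m = n) : pow V m ≅ pow V n := eqToIso (congrArg (pow V) h)

/-- The tensor product of two tensor powers. -/
def mul (m : ℕ) : (n : ℕ) → (pow V m ⊗ pow V n ≅ pow V (m + n))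
  | 0 => ρ_ (pow V m)
  | n + 1 => (α_ (pow V m) (pow V n) V).symm ≪≫ whiskerRightIso (mul m n) V

theorem cast_succ {m n : ℕ} (h : m = n) (h' : m + 1 = n + 1) :
    (cast V h').hom = ((cast V h).hom ▷ V : pow V m ⊗ V ⟶ pow V n ⊗ V) := by
  subst h
  exact (id_whiskerRight _ _).symm

theorem zero_mul (n : ℕ) : (mul V 0 n).hom ≫ (cast V (Nat.zero_add n)).hom =
    (λ_ (pow V n)).hom := by
  induction n with
  | zero =>
    refine (Category.comp_id _).trans ?_
    exact unitors_equal.symm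
  | succ n ih =>
    rw [cast_succ V (Nat.zero_add n)]
    change ((α_ (pow V 0) (pow V n) V).inv ≫ (mul V 0 n).hom ▷ V) ≫
      (cast V (Nat.zero_add n)).hom ▷ V = (λ_ (pow V n ⊗ V)).hom
    rw [Category.assoc, ← comp_whiskerRight, ih]
    exact (leftUnitor_tensor_hom _ _).symm

theorem mul_assoc (k l m : ℕ) :
    (mul V k l).hom ▷ pow V m ≫ (mul V (k + l) m).hom ≫ (cast V (Nat.add_assoc k l m)).hom =
      (α_ (pow V k) (pow V l) (pow V m)).hom ≫ pow V k ◁ (mul V l m).hom ≫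
        (mul V k (l + m)).hom := by
  induction m with
  | zero =>
    refine (congrArg _ (Category.comp_id (mul V (k + l) 0).hom)).trans ?_
    change (mul V k l).hom ▷ 𝟙_ C ≫ (ρ_ (pow V (k + l))).hom =
      (α_ (pow V k) (pow V l) (𝟙_ C)).hom ≫ pow V k ◁ (ρ_ (pow V l)).hom ≫ (mul V k l).hom
    refine (rightUnitor_naturality _).trans ?_
    rw [rightUnitor_tensor_hom, Category.assoc]
  | succ m ih =>
    rw [cast_succ V (Nat.add_assoc k l m)]
    have ih := congrArg (fun f => (α_ (pow V k ⊗ pow V l) (pow V m) V).inv ≫ f ▷ V) ih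
    change (mul V k l).hom ▷ (pow V m ⊗ V) ≫ ((α_ (pow V (k + l)) (pow V m) V).inv ≫
      (mul V (k + l) m).hom ▷ V) ≫ (cast V (Nat.add_assoc k l m)).hom ▷ V =
      (α_ (pow V k) (pow V l) (pow V m ⊗ V)).hom ≫
        pow V k ◁ ((α_ (pow V l) (pow V m) V).inv ≫ (mul V l m).hom ▷ V) ≫
          (α_ (pow V k) (pow V (l + m)) V).inv ≫ (mul V k (l + m)).hom ▷ V
    simp only [comp_whiskerRight] at ih
    simp only [MonoidalCategory.whiskerLeft_comp, Category.assoc,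
      associator_inv_naturality_left_assoc] at ih ⊢
    rw [ih]
    simp

/-- Juxtaposition of morphisms of tensor powers. -/
def tens {m n m' n' : ℕ} (f : pow V m ⟶ pow V n) (g : pow V m' ⟶ pow V n') :
    pow V (m + m') ⟶ pow V (n + n') :=
  (mul V m m').inv ≫ (f ⊗ₘ g) ≫ (mul V n n').hom

variable {V}

theorem tens_id (m n : ℕ) : tens V (𝟙 (pow V m)) (𝟙 (pow V n)) = 𝟙 _ := by
  rw [tens, id_tensorHom_id, Category.id_comp, Iso.inv_hom_id]

theorem tens_comp {k l m k' l' m' : ℕ} (f : pow V k ⟶ pow V l) (g : pow V l ⟶ pow V m)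
    (f' : pow V k' ⟶ pow V l') (g' : pow V l' ⟶ pow V m') :
    tens V (f ≫ g) (f' ≫ g') = tens V f f' ≫ tens V g g' := by
  simp only [tens, Category.assoc, Iso.hom_inv_id_assoc, tensorHom_comp_tensorHom_assoc]

theorem mul_tens {k l k' l' : ℕ} (f : pow V k ⟶ pow V l) (g : pow V k' ⟶ pow V l') :
    (mul V k k').hom ≫ tens V f g = (f ⊗ₘ g) ≫ (mul V l l').hom := by
  rw [tens, Iso.hom_inv_id_assoc]

theorem tens_assoc {k l k' l' k'' l'' : ℕ} (f : pow V k ⟶ pow V l) (g : pow V k' ⟶ pow V l')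
    (h : pow V k'' ⟶ pow V l'') :
    tens V (tens V f g) h ≫ (cast V (Nat.add_assoc l l' l'')).hom =
      (cast V (Nat.add_assoc k k' k'')).hom ≫ tens V f (tens V g h) := by
  rw [← cancel_epi (mul V (k + k') k'').hom, ← cancel_epi ((mul V k k').hom ▷ pow V k'')]
  have h₁ := mul_assoc V k k' k''
  have h₂ := mul_assoc V l l' l''
  rw [← Category.assoc (mul V _ k'').hom, mul_tens]
  have e : (mul V k k').hom ▷ pow V k'' ≫ (tens V f g ⊗ₘ h) =
      ((f ⊗ₘ g) ⊗ₘ h) ≫ (mul V l l').hom ▷ pow V l'' := by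
    rw [← tensorHom_id, ← tensorHom_id, tensorHom_comp_tensorHom, tensorHom_comp_tensorHom,
      mul_tens, Category.id_comp, Category.comp_id]
  rw [Category.assoc, ← Category.assoc _ (tens V f g ⊗ₘ h), e, Category.assoc, h₂,
    ← Category.assoc (mul V _ _).hom, ← Category.assoc (_ ▷ _), h₁]
  have e' : pow V k ◁ (mul V k' k'').hom ≫ (f ⊗ₘ tens V g h) =
      (f ⊗ₘ (g ⊗ₘ h)) ≫ pow V l ◁ (mul V l' l'').hom := by
    rw [← id_tensorHom, ← id_tensorHom, tensorHom_comp_tensorHom, tensorHom_comp_tensorHom,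
      mul_tens, Category.id_comp, Category.comp_id]
  rw [Category.assoc, Category.assoc, mul_tens, ← Category.assoc (_ ◁ _) (_ ⊗ₘ _), e',
    associator_naturality_assoc, Category.assoc]

theorem empty_tens {k l : ℕ} (f : pow V k ⟶ pow V l) :
    tens V (𝟙 (pow V 0)) f ≫ (cast V (Nat.zero_add l)).hom =
      (cast V (Nat.zero_add k)).hom ≫ f := by
  rw [← cancel_epi (mul V 0 k).hom, ← Category.assoc, mul_tens, Category.assoc, zero_mul,
    ← Category.assoc, zero_mul]
  change (𝟙 (𝟙_ C) ⊗ₘ f) ≫ _ = _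
  rw [id_tensorHom]
  exact leftUnitor_naturality f

theorem tens_empty {k l : ℕ} (f : pow V k ⟶ pow V l) : tens V f (𝟙 (pow V 0)) = f := by
  rw [← cancel_epi (mul V k 0).hom, mul_tens]
  change (f ⊗ₘ 𝟙 (𝟙_ C)) ≫ (ρ_ _).hom = (ρ_ _).hom ≫ f
  rw [tensorHom_id]
  exact rightUnitor_naturality f

end pow

section

variable [Preadditive C] [MonoidalPreadditive C] [Linear ℂ C] [MonoidalLinear ℂ C]

/-- A self-dual object `V` of a linear monoidal category, whose loop has the value
`-(a² + a⁻²)`. -/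
structure SelfDual (a : ℂ) (V : C) where
  cup : 𝟙_ C ⟶ V ⊗ V
  cap : V ⊗ V ⟶ 𝟙_ C
  zigzag_left : V ◁ cup ≫ (α_ V V V).inv ≫ cap ▷ V = (ρ_ V).hom ≫ (λ_ V).inv
  zigzag_right : cup ▷ V ≫ (α_ V V V).hom ≫ V ◁ cap = (λ_ V).hom ≫ (ρ_ V).inv
  loop : cup ≫ cap = (-(a ^ 2 + a⁻¹ ^ 2)) • 𝟙 (𝟙_ C)

namespace SelfDual

open pow

variable {a : ℂ} {V : C} (S : SelfDual a V)

/-- The cup, as a morphism of tensor powers. -/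
def cupP : pow V 0 ⟶ pow V 2 := S.cup ≫ (λ_ V).inv ▷ V
/-- The cap, as a morphism of tensor powers. -/
def capP : pow V 2 ⟶ pow V 0 := (λ_ V).hom ▷ V ≫ S.cap

theorem cupP_capP : S.cupP ≫ S.capP = (-(a ^ 2 + a⁻¹ ^ 2)) • 𝟙 _ := by
  have h : (S.cup ≫ (λ_ V).inv ▷ V) ≫ (λ_ V).hom ▷ V ≫ S.cap =
      (-(a ^ 2 + a⁻¹ ^ 2)) • 𝟙 (𝟙_ C) := by
    rw [← S.loop]
    simp
  exact h

theorem zigzag_leftP : (tens V (𝟙 (pow V 1)) S.cupP : pow V 1 ⟶ pow V 3) ≫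
    (tens V S.capP (𝟙 (pow V 1)) : pow V 3 ⟶ pow V 1) = 𝟙 _ := by
  have h : ((ρ_ (𝟙_ C ⊗ V)).inv ≫ (𝟙 (𝟙_ C ⊗ V) ⊗ₘ (S.cup ≫ (λ_ V).inv ▷ V)) ≫
      (α_ (𝟙_ C ⊗ V) (𝟙_ C ⊗ V) V).inv ≫ ((α_ (𝟙_ C ⊗ V) (𝟙_ C) V).inv ≫
        (ρ_ (𝟙_ C ⊗ V)).hom ▷ V) ▷ V) ≫ ((ρ_ ((𝟙_ C ⊗ V) ⊗ V)).inv ▷ V ≫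
      (α_ ((𝟙_ C ⊗ V) ⊗ V) (𝟙_ C) V).hom) ≫ (((λ_ V).hom ▷ V ≫ S.cap) ⊗ₘ 𝟙 (𝟙_ C ⊗ V)) ≫
      (α_ (𝟙_ C) (𝟙_ C) V).inv ≫ (ρ_ (𝟙_ C)).hom ▷ V = 𝟙 (𝟙_ C ⊗ V) := by
    calc _ = (λ_ V).hom ≫ (ρ_ V).inv ≫ (V ◁ S.cup ≫ (α_ V V V).inv ≫ S.cap ▷ V) ≫
          (λ_ V).hom ≫ (λ_ V).inv := by monoidal
      _ = _ := by rw [S.zigzag_left]; monoidal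
  exact h

theorem zigzag_rightP : (tens V S.cupP (𝟙 (pow V 1)) : pow V 1 ⟶ pow V 3) ≫
    (tens V (𝟙 (pow V 1)) S.capP : pow V 3 ⟶ pow V 1) = 𝟙 _ := by
  have h : (((ρ_ (𝟙_ C)).inv ▷ V ≫ (α_ (𝟙_ C) (𝟙_ C) V).hom) ≫
      ((S.cup ≫ (λ_ V).inv ▷ V) ⊗ₘ 𝟙 (𝟙_ C ⊗ V)) ≫ (α_ ((𝟙_ C ⊗ V) ⊗ V) (𝟙_ C) V).inv ≫
        (ρ_ ((𝟙_ C ⊗ V) ⊗ V)).hom ▷ V) ≫ ((((ρ_ (𝟙_ C ⊗ V)).inv ▷ V ≫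
      (α_ (𝟙_ C ⊗ V) (𝟙_ C) V).hom) ▷ V) ≫ (α_ (𝟙_ C ⊗ V) (𝟙_ C ⊗ V) V).hom) ≫
      (𝟙 (𝟙_ C ⊗ V) ⊗ₘ ((λ_ V).hom ▷ V ≫ S.cap)) ≫ (ρ_ (𝟙_ C ⊗ V)).hom = 𝟙 (𝟙_ C ⊗ V) := by
    calc _ = (λ_ V).hom ≫ (λ_ V).inv ≫ (S.cup ▷ V ≫ (α_ V V V).hom ≫ V ◁ S.cap) ≫
          (ρ_ V).hom ≫ (λ_ V).inv := by monoidal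
      _ = _ := by rw [S.zigzag_right]; monoidal
  exact h

/-- The value of a diagram. -/
def eval : {k l : ℕ} → Diagram k l → (pow V k ⟶ pow V l)
  | _, _, .id n => 𝟙 _
  | _, _, .comp D D' => eval D ≫ eval D'
  | _, _, .tensor D D' => tens V (eval D) (eval D')
  | _, _, .cup => S.cupP
  | _, _, .cap => S.capP
  | _, _, .pos => a • 𝟙 _ + a⁻¹ • (S.capP ≫ S.cupP)
  | _, _, .neg => a⁻¹ • 𝟙 _ + a • (S.capP ≫ S.cupP)

theorem eval_cast {k l k' l' : ℕ} (hk : k = k') (hl : l = l') (D : Diagram k l) :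
    (pow.cast V hk).hom ≫ S.eval (D.cast hk hl) = S.eval D ≫ (pow.cast V hl).hom := by
  subst hk hl
  exact (Category.id_comp _).trans (Category.comp_id _).symm

theorem tens_add_left {k l k' l' : ℕ} (f g : pow V k ⟶ pow V l) (h : pow V k' ⟶ pow V l') :
    tens V (f + g) h = tens V f h + tens V g h := by
  simp only [tens, MonoidalCategory.tensorHom_def, MonoidalPreadditive.add_whiskerRight,
    Preadditive.add_comp, Preadditive.comp_add]

theorem tens_add_right {k l k' l' : ℕ} (h : pow V k' ⟶ pow V l') (f g : pow V k ⟶ pow V l) :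
    tens V h (f + g) = tens V h f + tens V h g := by
  simp only [tens, MonoidalCategory.tensorHom_def, MonoidalPreadditive.whiskerLeft_add,
    Preadditive.add_comp, Preadditive.comp_add]

theorem tens_smul_left {k l k' l' : ℕ} (c : ℂ) (f : pow V k ⟶ pow V l) (h : pow V k' ⟶ pow V l') :
    tens V (c • f) h = c • tens V f h := by
  simp only [tens, MonoidalCategory.tensorHom_def, MonoidalLinear.smul_whiskerRight,
    Linear.smul_comp,
    Linear.comp_smul]

theorem tens_smul_right {k l k' l' : ℕ} (c : ℂ) (h : pow V k' ⟶ pow V l') (f : pow V k ⟶ pow V l) :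
    tens V h (c • f) = c • tens V h f := by
  simp only [tens, MonoidalCategory.tensorHom_def, MonoidalLinear.whiskerLeft_smul,
    Linear.comp_smul,
    Linear.smul_comp]

/-- The rotation of a resolved crossing by a quarter turn exchanges the two resolutions. -/
theorem rotate (x y : ℂ) :
    ((tens V (𝟙 (pow V 2)) S.cupP : pow V 2 ⟶ pow V 4) ≫
      (tens V (tens V (𝟙 (pow V 1)) (x • 𝟙 (pow V 2) + y • (S.capP ≫ S.cupP))) (𝟙 (pow V 1)) :
        pow V 4 ⟶ pow V 4)) ≫ (tens V S.capP (𝟙 (pow V 2)) : pow V 4 ⟶ pow V 2) =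
      y • 𝟙 (pow V 2) + x • (S.capP ≫ S.cupP) := by
  have e₁ : (tens V (𝟙 (pow V 2)) S.cupP : pow V 2 ⟶ pow V 4) ≫
      (tens V S.capP (𝟙 (pow V 2)) : pow V 4 ⟶ pow V 2) = S.capP ≫ S.cupP := by
    have h₁ := tens_comp (𝟙 (pow V 2)) S.capP S.cupP (𝟙 (pow V 2))
    have h₂ := tens_comp S.capP (𝟙 (pow V 0)) (𝟙 (pow V 0)) S.cupP
    rw [Category.id_comp, Category.comp_id] at h₁ h₂
    have h₃ : tens V (𝟙 (pow V 0)) S.cupP = S.cupP := by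
      have := empty_tens S.cupP
      exact (Category.comp_id _).symm.trans (this.trans (Category.id_comp _))
    exact h₁.symm.trans (h₂.trans (congrArg₂ (· ≫ ·) (tens_empty S.capP) h₃))
  have e₂ : (tens V (𝟙 (pow V 2)) S.cupP : pow V 2 ⟶ pow V 4) ≫
      (tens V (tens V (𝟙 (pow V 1)) S.capP) (𝟙 (pow V 1)) : pow V 4 ⟶ pow V 2) = 𝟙 _ := by
    have h₁ : (tens V (𝟙 (pow V 2)) S.cupP : pow V 2 ⟶ pow V 4) =
        tens V (𝟙 (pow V 1)) (tens V (𝟙 (pow V 1)) S.cupP) := by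
      have := tens_assoc (𝟙 (pow V 1)) (𝟙 (pow V 1)) S.cupP
      rw [tens_id] at this
      exact (Category.comp_id _).symm.trans (this.trans (Category.id_comp _))
    have h₂ : (tens V (tens V (𝟙 (pow V 1)) S.capP) (𝟙 (pow V 1)) : pow V 4 ⟶ pow V 2) =
        tens V (𝟙 (pow V 1)) (tens V S.capP (𝟙 (pow V 1))) :=
      (Category.comp_id _).symm.trans ((tens_assoc (𝟙 (pow V 1)) S.capP
        (𝟙 (pow V 1))).trans (Category.id_comp _))
    rw [h₁, h₂]
    have h₃ := tens_comp (𝟙 (pow V 1)) (𝟙 (pow V 1)) (tens V (𝟙 (pow V 1)) S.cupP : pow V 1 ⟶ pow V 3)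
      (tens V S.capP (𝟙 (pow V 1)) : pow V 3 ⟶ pow V 1)
    refine h₃.symm.trans ((congrArg₂ (tens V) (Category.id_comp _) S.zigzag_leftP).trans ?_)
    exact tens_id 1 1
  have e₃ : (tens V (tens V (𝟙 (pow V 1)) S.cupP) (𝟙 (pow V 1)) : pow V 2 ⟶ pow V 4) ≫
      (tens V S.capP (𝟙 (pow V 2)) : pow V 4 ⟶ pow V 2) = 𝟙 _ := by
    have h₁ : (tens V S.capP (𝟙 (pow V 2)) : pow V 4 ⟶ pow V 2) =
        tens V (tens V S.capP (𝟙 (pow V 1))) (𝟙 (pow V 1)) := by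
      have := tens_assoc S.capP (𝟙 (pow V 1)) (𝟙 (pow V 1))
      rw [tens_id] at this
      exact ((Category.comp_id _).symm.trans (this.trans (Category.id_comp _))).symm
    rw [h₁]
    have h₃ := tens_comp (tens V (𝟙 (pow V 1)) S.cupP : pow V 1 ⟶ pow V 3)
      (tens V S.capP (𝟙 (pow V 1)) : pow V 3 ⟶ pow V 1)
      (𝟙 (pow V 1)) (𝟙 (pow V 1))
    refine h₃.symm.trans ((congrArg₂ (tens V) S.zigzag_leftP (Category.id_comp _)).trans ?_)
    exact tens_id 1 1
  have e₄ : (tens V (tens V (𝟙 (pow V 1)) (S.capP ≫ S.cupP)) (𝟙 (pow V 1)) :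
      pow V 4 ⟶ pow V 4) = (tens V (tens V (𝟙 (pow V 1)) S.capP) (𝟙 (pow V 1)) :
      pow V 4 ⟶ pow V 2) ≫ (tens V (tens V (𝟙 (pow V 1)) S.cupP) (𝟙 (pow V 1))) := by
    have h₁ := tens_comp (𝟙 (pow V 1)) (𝟙 (pow V 1)) S.capP S.cupP
    have h₂ := tens_comp (tens V (𝟙 (pow V 1)) S.capP) (tens V (𝟙 (pow V 1)) S.cupP)
      (𝟙 (pow V 1)) (𝟙 (pow V 1))
    rw [Category.id_comp] at h₁ h₂
    rw [← h₁] at h₂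
    exact h₂
  have e₅ : (tens V (tens V (𝟙 (pow V 1)) (𝟙 (pow V 2))) (𝟙 (pow V 1)) :
      pow V 4 ⟶ pow V 4) = 𝟙 _ := by
    rw [tens_id]
    exact tens_id 3 1
  have e₆ : (tens V (tens V (𝟙 (pow V 1)) (x • 𝟙 (pow V 2) + y • (S.capP ≫ S.cupP)))
      (𝟙 (pow V 1)) : pow V 4 ⟶ pow V 4) =
      x • 𝟙 (pow V 4) + y • ((tens V (tens V (𝟙 (pow V 1)) S.capP) (𝟙 (pow V 1)) :
      pow V 4 ⟶ pow V 2) ≫ (tens V (tens V (𝟙 (pow V 1)) S.cupP) (𝟙 (pow V 1)))) := by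
    rw [← e₄, ← e₅, tens_add_right, tens_add_left, tens_smul_right, tens_smul_left,
      tens_smul_right, tens_smul_left]
  refine (congrArg (fun z => (_ ≫ z) ≫ _) e₆).trans ?_
  rw [Preadditive.comp_add, Preadditive.add_comp, Linear.comp_smul, Linear.comp_smul,
    Linear.smul_comp, Linear.smul_comp, Category.comp_id]
  refine (congrArg₂ (fun z w => x • z + y • w) e₁ ?_).trans (add_comm _ _)
  refine (Category.assoc _ _ _).trans ((congrArg _ (Category.assoc _ _ _)).trans ?_)
  refine (congrArg (fun z => _ ≫ _ ≫ z) e₃).trans ((congrArg _ (Category.comp_id _)).trans e₂)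

/-- Isotopic diagrams have the same value. -/
theorem eval_eq {k l : ℕ} {D D' : Diagram k l} (h : Diagram.Isotopic D D') :
    S.eval D = S.eval D' := by
  induction h with
  | refl => rfl
  | symm _ h => exact h.symm
  | trans _ _ h h' => exact h.trans h'
  | comp_congr _ _ h h' => rw [eval, eval, h, h']
  | tensor_congr _ _ h h' => rw [eval, eval, h, h']
  | id_comp => exact Category.id_comp _
  | comp_id => exact Category.comp_id _
  | comp_assoc => exact Category.assoc _ _ _
  | id_tensor_id m n => exact tens_id m n
  | interchange => exact tens_comp _ _ _ _
  | tensor_assoc D D' D'' =>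
    rw [← cancel_epi (pow.cast V (Nat.add_assoc _ _ _)).hom, eval_cast]
    exact tens_assoc _ _ _
  | empty_tensor D =>
    rw [← cancel_epi (pow.cast V (Nat.zero_add _)).hom, eval_cast]
    exact empty_tens _
  | tensor_empty D => exact tens_empty _
  | zigzag_left => exact S.zigzag_leftP
  | zigzag_right => exact S.zigzag_rightP
  | rotate_pos => exact S.rotate a a⁻¹
  | rotate_neg => exact S.rotate a⁻¹ a

/-- The value of an isotopy class. -/
def evalT {k l : ℕ} : Tangle k l → (pow V k ⟶ pow V l) :=
  Quotient.lift S.eval fun _ _ h => S.eval_eq h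

/-- The value of a formal linear combination. -/
def evalF (k l : ℕ) : (Tangle k l →₀ ℂ) →ₗ[ℂ] (pow V k ⟶ pow V l) :=
  Finsupp.linearCombination ℂ S.evalT

/-- The skein relations hold for the values. -/
theorem evalF_eq_zero {k l : ℕ} {x : Tangle k l →₀ ℂ} (h : SkeinRel a x) : S.evalF k l x = 0 := by
  have key : ∀ {k l k' l' : ℕ} (op : Tangle k l → Tangle k' l')
      (L : (pow V k ⟶ pow V l) →ₗ[ℂ] (pow V k' ⟶ pow V l'))
      (h : ∀ D, S.evalT (op D) = L (S.evalT D)) (x : Tangle k l →₀ ℂ), S.evalF k l x = 0 →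
      S.evalF k' l' (x.mapDomain op) = 0 := by
    intro k l k' l' op L h x hx
    have : S.evalF k' l' (x.mapDomain op) = L (S.evalF k l x) := by
      have e : S.evalF k' l' ∘ₗ Finsupp.lmapDomain ℂ ℂ op = L ∘ₗ S.evalF k l := by
        refine Finsupp.lhom_ext' fun D => LinearMap.ext_ring ?_
        simp [evalF, h]
      exact LinearMap.congr_fun e x
    rw [this, hx, map_zero]
  induction h with
  | circle =>
    simp only [evalF, map_add, map_smul, Finsupp.linearCombination_single, one_smul]
    change S.cupP ≫ S.capP + _ • 𝟙 _ = 0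
    rw [cupP_capP, neg_smul, neg_add_cancel]
  | kauffman =>
    simp only [evalF, map_sub, map_smul, Finsupp.linearCombination_single, one_smul]
    change (a • 𝟙 _ + a⁻¹ • (S.capP ≫ S.cupP)) - a • 𝟙 _ - a⁻¹ • (S.capP ≫ S.cupP) = 0
    abel
  | comp_left D _ ih =>
    refine key _ (Linear.leftComp ℂ _ (S.evalT D)) (fun D' => ?_) _ ih
    induction D using Quotient.ind; induction D' using Quotient.ind; rfl
  | comp_right D _ ih =>
    refine key _ (Linear.rightComp ℂ _ (S.evalT D)) (fun D' => ?_) _ ih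
    induction D using Quotient.ind; induction D' using Quotient.ind; rfl
  | tensor_left D _ ih =>
    refine key _ (IsLinearMap.mk' (tens V (S.evalT D))
      ⟨tens_add_right _, fun c => tens_smul_right c _⟩) (fun D' => ?_) _ ih
    induction D using Quotient.ind; induction D' using Quotient.ind; rfl
  | tensor_right D _ ih =>
    refine key _ (IsLinearMap.mk' (fun f => tens V f (S.evalT D))
      ⟨fun f g => tens_add_left f g _, fun c f => tens_smul_left c f _⟩) (fun D' => ?_) _ ih
    induction D using Quotient.ind; induction D' using Quotient.ind; rfl

/-- The value of a morphism of the Temperley-Lieb category. -/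
def mapL (m n : TL a) : (m ⟶ n) →ₗ[ℂ] (pow V m.strands ⟶ pow V n.strands) :=
  (skein a m.strands n.strands).liftQ (S.evalF _ _)
    (Submodule.span_le.2 fun _ h => S.evalF_eq_zero h)

theorem mapL_diagram {m n : TL a} (D : Diagram m.strands n.strands) :
    S.mapL m n (diagram (Tangle.mk D)) = S.eval D := by
  refine (Submodule.liftQ_apply _ _ _).trans ?_
  rw [evalF, Finsupp.linearCombination_single, one_smul]
  rfl

/-- The functor from the Temperley-Lieb category determined by a self-dual object. -/
def functor : TL a ⥤ C where
  obj n := pow V n.strands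
  map {m n} f := S.mapL m n f
  map_id n := S.mapL_diagram (.id _)
  map_comp {m n p} f g := by
    induction f using TL.induction with
    | zero => rw [Limits.zero_comp, map_zero, map_zero, Limits.zero_comp]
    | add x y hx hy => rw [Preadditive.add_comp, map_add, map_add, hx, hy, Preadditive.add_comp]
    | smul c x hx => rw [Linear.smul_comp, map_smul, map_smul, hx, Linear.smul_comp]
    | diagram D =>
    induction g using TL.induction with
    | zero => rw [Limits.comp_zero, map_zero, map_zero, Limits.comp_zero]
    | add x y hx hy => rw [Preadditive.comp_add, map_add, map_add, hx, hy, Preadditive.comp_add]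
    | smul c x hx => rw [Linear.comp_smul, map_smul, map_smul, hx, Linear.comp_smul]
    | diagram D' =>
    rw [diagram_comp]
    induction D using Quotient.ind
    induction D' using Quotient.ind
    exact (S.mapL_diagram _).trans (congrArg₂ (· ≫ ·) (S.mapL_diagram _) (S.mapL_diagram _)).symm

instance : S.functor.Additive where
  map_add := map_add (S.mapL _ _) _ _

instance : S.functor.Linear ℂ where
  map_smul f c := map_smul (S.mapL _ _) c f

theorem functor_map_eqIso {m n : TL a} (h : m.strands = n.strands) :
    S.functor.map (eqIso h).hom = (pow.cast V h).hom := by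
  obtain ⟨m⟩ := m
  obtain ⟨n⟩ := n
  dsimp only at h
  subst h
  exact S.functor.map_id _

theorem functor_map_tensorMap {m n m' n' : TL a} (f : m ⟶ n) (g : m' ⟶ n') :
    S.functor.map (tensorMap f g) = tens V (S.functor.map f) (S.functor.map g) := by
  change S.mapL ⟨m.strands + m'.strands⟩ ⟨n.strands + n'.strands⟩ (tensorMap f g) =
    tens V (S.mapL m n f) (S.mapL m' n' g)
  induction f using TL.induction with
  | zero =>
    rw [zero_tensorMap, map_zero, map_zero]
    exact ((congrArg (fun z => tens V z _) (zero_smul ℂ 0).symm).trans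
      ((tens_smul_left 0 0 _).trans (zero_smul ℂ _))).symm
  | add x y hx hy => rw [add_tensorMap, map_add, hx, hy, map_add, tens_add_left]
  | smul c x hx => rw [smul_tensorMap, map_smul, hx, map_smul, tens_smul_left]
  | diagram D =>
  induction g using TL.induction with
  | zero =>
    rw [tensorMap_zero, map_zero, map_zero]
    exact ((congrArg (tens V _) (zero_smul ℂ 0).symm).trans
      ((tens_smul_right 0 _ 0).trans (zero_smul ℂ _))).symm
  | add x y hx hy => rw [tensorMap_add, map_add, hx, hy, map_add, tens_add_right]
  | smul c x hx => rw [tensorMap_smul, map_smul, hx, map_smul, tens_smul_right]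
  | diagram D' =>
  rw [diagram_tensor]
  induction D using Quotient.ind
  induction D' using Quotient.ind
  exact (S.mapL_diagram _).trans (congrArg₂ (tens V) (S.mapL_diagram _) (S.mapL_diagram _)).symm

theorem functor_map_cup : S.functor.map (TL.cup a) = S.cupP := S.mapL_diagram (n := ⟨2⟩) .cup
theorem functor_map_cap : S.functor.map (TL.cap a) = S.capP := S.mapL_diagram (m := ⟨2⟩) .cap

theorem mul_functor_map_tensorMap {m n m' n' : TL a} (f : m ⟶ n) (g : m' ⟶ n') :
    (pow.mul V m.strands m'.strands).hom ≫ S.functor.map (tensorMap f g) =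
      (S.functor.map f ⊗ₘ S.functor.map g) ≫ (pow.mul V n.strands n'.strands).hom :=
  (congrArg _ (S.functor_map_tensorMap f g)).trans (mul_tens _ _)

instance functorMonoidal : S.functor.Monoidal := Functor.CoreMonoidal.toMonoidal
  { εIso := Iso.refl _
    μIso := fun m n => pow.mul V m.strands n.strands
    μIso_hom_natural_left := fun f n => by
      have h := S.mul_functor_map_tensorMap f (𝟙 n)
      rw [S.functor.map_id, tensorHom_id] at h
      exact h.symm
    μIso_hom_natural_right := fun n f => by
      have h := S.mul_functor_map_tensorMap (𝟙 n) f
      rw [S.functor.map_id, id_tensorHom] at h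
      exact h.symm
    associativity := fun m n p => by
      refine (congrArg (fun z => _ ≫ _ ≫ z) (S.functor_map_eqIso _)).trans ?_
      exact pow.mul_assoc V _ _ _
    left_unitality := fun m => by
      refine Eq.symm ((congrArg (fun z => _ ≫ _ ≫ z) (S.functor_map_eqIso _)).trans ?_)
      refine (congrArg (· ≫ _) (id_whiskerRight _ _)).trans ((Category.id_comp _).trans ?_)
      exact pow.zero_mul V _
    right_unitality := fun m => by
      refine Eq.symm ((congrArg (fun z => _ ≫ _ ≫ z) (S.functor_map_eqIso _)).trans ?_)
      refine (congrArg (· ≫ _) (whiskerLeft_id _ _)).trans ((Category.id_comp _).trans ?_)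
      exact Category.comp_id _ }

end SelfDual

end

end TL

/-! ### Objects cut out by idempotents of the Temperley-Lieb category -/

namespace TL

open TL.Arr Functor.LaxMonoidal Functor.OplaxMonoidal Functor.Monoidal

universe v w

variable {a : ℂ} {C : Type w} [Category.{v} C] [MonoidalCategory C]

/-- A presentation of the object `M` as the image of an idempotent of the Temperley-Lieb category. -/
structure Summand (F : TL a ⥤ C) (M : C) where
  X : TL a
  e : X ⟶ X
  idem : e ≫ e = e
  ι : M ⟶ F.obj X
  π : F.obj X ⟶ M
  ι_π : ι ≫ π = 𝟙 M
  π_ι : π ≫ ι = F.map e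

namespace Summand

variable {F : TL a ⥤ C} {M N P M' N' : C} (s : Summand F M) (t : Summand F N) (u : Summand F P)
  (s' : Summand F M') (t' : Summand F N')

theorem ι_map : s.ι ≫ F.map s.e = s.ι := by rw [← s.π_ι, reassoc_of% s.ι_π]

theorem map_π : F.map s.e ≫ s.π = s.π := by rw [← s.π_ι, Category.assoc, s.ι_π, Category.comp_id]

/-- The representatives of a morphism between two such objects. -/
def Rep (f : M ⟶ N) (x : Arr a) : Prop :=
  ∃ g : s.X ⟶ t.X, x = of g ∧ s.e ≫ g = g ∧ g ≫ t.e = g ∧ f = s.ι ≫ F.map g ≫ t.π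

variable {s t u s' t'}

theorem Rep.unique {f f' : M ⟶ N} {x : Arr a} (h : s.Rep t f x) (h' : s.Rep t f' x) : f = f' := by
  obtain ⟨g, rfl, -, -, rfl⟩ := h
  obtain ⟨g', e, -, -, rfl⟩ := h'
  rw [of_injective e]

variable (s t) in
theorem rep_hat (g : s.X ⟶ t.X) {x : Arr a} (hx : of g = x) :
    s.Rep t (s.ι ≫ F.map g ≫ t.π) ((of s.e).comp (x.comp (of t.e))) :=
  ⟨s.e ≫ g ≫ t.e, by rw [of_comp, of_comp, hx], by rw [reassoc_of% s.idem],
    by simp only [Category.assoc, t.idem], by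
      rw [F.map_comp, F.map_comp, Category.assoc, Category.assoc, t.map_π, reassoc_of% s.ι_map]⟩

/-- To represent a morphism, it suffices to check that it is compatible with the inclusions; no
intertwining with the projections is needed. -/
theorem Rep.of_ι {f : M ⟶ N} (g : s.X ⟶ t.X) (h : s.ι ≫ F.map g = f ≫ t.ι) {x : Arr a}
    (hx : of g = x) : s.Rep t f ((of s.e).comp (x.comp (of t.e))) := by
  have := rep_hat s t g hx
  rwa [← Category.assoc, h, Category.assoc, t.ι_π, Category.comp_id] at this

variable (s) in
theorem rep_id : s.Rep s (𝟙 M) (of s.e) :=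
  ⟨s.e, rfl, s.idem, s.idem, by rw [s.map_π, s.ι_π]⟩

theorem Rep.comp {f : M ⟶ N} {g : N ⟶ P} {x y : Arr a} (hf : s.Rep t f x) (hg : t.Rep u g y) :
    s.Rep u (f ≫ g) (x.comp y) := by
  obtain ⟨x, rfl, h₁, h₂, rfl⟩ := hf
  obtain ⟨y, rfl, h₃, h₄, rfl⟩ := hg
  refine ⟨x ≫ y, (of_comp _ _).symm, by rw [← Category.assoc, h₁], by rw [Category.assoc, h₄], ?_⟩
  simp only [Category.assoc]
  rw [reassoc_of% t.π_ι, ← F.map_comp_assoc t.e, h₃, F.map_comp_assoc]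

section tensor

variable [F.Monoidal]

/-- The trivial summand. -/
def unit : Summand F (𝟙_ C) where
  X := 𝟙_ (TL a)
  e := 𝟙 _
  idem := Category.comp_id _
  ι := ε F
  π := η F
  ι_π := ε_η F
  π_ι := (η_ε F).trans (F.map_id _).symm

variable (s t) in
/-- The tensor product of two summands. -/
def tensor : Summand F (M ⊗ N) where
  X := s.X ⊗ t.X
  e := s.e ⊗ₘ t.e
  idem := by rw [tensorHom_comp_tensorHom, s.idem, t.idem]
  ι := (s.ι ⊗ₘ t.ι) ≫ μ F s.X t.X
  π := δ F s.X t.X ≫ (s.π ⊗ₘ t.π)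
  ι_π := by
    rw [Category.assoc, μ_δ_assoc, tensorHom_comp_tensorHom, s.ι_π, t.ι_π, id_tensorHom_id]
  π_ι := by
    rw [Category.assoc, tensorHom_comp_tensorHom_assoc, s.π_ι, t.π_ι, map_tensor]

variable (s t) in
theorem of_tensor_e : of (s.tensor t).e = of s.e * of t.e := of_tensorHom _ _

theorem of_unit_e : of (unit (F := F)).e = 1 := rfl

theorem Rep.tensor {f : M ⟶ N} {g : M' ⟶ N'} {x y : Arr a} (hf : s.Rep t f x)
    (hg : s'.Rep t' g y) : (s.tensor s').Rep (t.tensor t') (f ⊗ₘ g) (x * y) := by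
  obtain ⟨x, rfl, h₁, h₂, rfl⟩ := hf
  obtain ⟨y, rfl, h₃, h₄, rfl⟩ := hg
  refine ⟨x ⊗ₘ y, (of_tensorHom _ _).symm, ?_, ?_, ?_⟩
  · exact (tensorHom_comp_tensorHom _ _ _ _).trans (congrArg₂ _ h₁ h₃)
  · exact (tensorHom_comp_tensorHom _ _ _ _).trans (congrArg₂ _ h₂ h₄)
  · change _ = ((s.ι ⊗ₘ s'.ι) ≫ μ F _ _) ≫ F.map (x ⊗ₘ y) ≫ δ F _ _ ≫ (t.π ⊗ₘ t'.π)
    rw [Category.assoc, ← μ_natural_assoc, μ_δ_assoc, tensorHom_comp_tensorHom,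
      tensorHom_comp_tensorHom]

variable (s t u) in
theorem rep_associator : ((s.tensor t).tensor u).Rep (s.tensor (t.tensor u)) (α_ M N P).hom
    (of s.e * of t.e * of u.e) := by
  have h : ((s.tensor t).tensor u).ι ≫ F.map (α_ s.X t.X u.X).hom =
      (α_ M N P).hom ≫ (s.tensor (t.tensor u)).ι := by
    change ((((s.ι ⊗ₘ t.ι) ≫ μ F s.X t.X) ⊗ₘ u.ι) ≫ μ F (s.X ⊗ t.X) u.X) ≫ F.map (α_ s.X t.X u.X).hom =
      (α_ M N P).hom ≫ (s.ι ⊗ₘ ((t.ι ⊗ₘ u.ι) ≫ μ F t.X u.X)) ≫ μ F s.X (t.X ⊗ u.X)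
    have e₁ : ((s.ι ⊗ₘ t.ι) ≫ μ F s.X t.X) ⊗ₘ u.ι =
        ((s.ι ⊗ₘ t.ι) ⊗ₘ u.ι) ≫ μ F s.X t.X ▷ F.obj u.X := by
      rw [← tensorHom_id, tensorHom_comp_tensorHom, Category.comp_id]
    have e₂ : s.ι ⊗ₘ ((t.ι ⊗ₘ u.ι) ≫ μ F t.X u.X) =
        (s.ι ⊗ₘ (t.ι ⊗ₘ u.ι)) ≫ F.obj s.X ◁ μ F t.X u.X := by
      rw [← id_tensorHom, tensorHom_comp_tensorHom, Category.comp_id]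
    rw [e₁, e₂, Category.assoc, Category.assoc, Functor.LaxMonoidal.associativity, Category.assoc,
      associator_naturality_assoc]
  have h := Rep.of_ι (s := (s.tensor t).tensor u) (t := s.tensor (t.tensor u)) _ h
    (of_associator_hom s.X t.X u.X)
  have e : of ((s.tensor t).tensor u).e = of s.e * of t.e * of u.e := by
    rw [of_tensor_e, of_tensor_e]
  have e' : of (s.tensor (t.tensor u)).e = of s.e * of t.e * of u.e := by
    rw [of_tensor_e, of_tensor_e, mul_assoc]
  have e'' : (of s.e * of t.e * of u.e).comp (of s.e * of t.e * of u.e) =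
      of s.e * of t.e * of u.e := by
    rw [← e, ← of_comp, Summand.idem]
  rw [e, e', idn_comp (by rfl), e''] at h
  exact h

variable (s t u) in
theorem rep_associator_inv : (s.tensor (t.tensor u)).Rep ((s.tensor t).tensor u) (α_ M N P).inv
    (of s.e * of t.e * of u.e) := by
  have h := rep_associator s t u
  obtain ⟨g, e, h₁, h₂, h₃⟩ := h
  have e₁ : of ((s.tensor t).tensor u).e = of s.e * of t.e * of u.e := by
    rw [of_tensor_e, of_tensor_e]
  have e₂ : of (s.tensor (t.tensor u)).e = of s.e * of t.e * of u.e := by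
    rw [of_tensor_e, of_tensor_e, mul_assoc]
  have e₃ : (of s.e * of t.e * of u.e).comp (of s.e * of t.e * of u.e) =
      of s.e * of t.e * of u.e := by
    rw [← e₁, ← of_comp, Summand.idem]
  have h := rep_hat (s.tensor (t.tensor u)) ((s.tensor t).tensor u) (α_ s.X t.X u.X).inv
    (of_associator_inv s.X t.X u.X)
  rw [e₁, e₂, idn_comp (by rfl), e₃] at h
  have h' := (rep_associator s t u).comp h
  rw [e₃] at h'
  have h'' := h'.unique (e₁ ▸ rep_id _)
  rw [← Category.comp_id (α_ M N P).inv, ← h'', Iso.inv_hom_id_assoc]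
  exact h

variable (s) in
theorem rep_leftUnitor : (unit.tensor s).Rep s (λ_ M).hom (of s.e) := by
  have h : (unit.tensor s).ι ≫ F.map (λ_ s.X).hom = (λ_ M).hom ≫ s.ι := by
    change ((ε F ⊗ₘ s.ι) ≫ μ F (𝟙_ _) s.X) ≫ F.map (λ_ s.X).hom = (λ_ M).hom ≫ s.ι
    rw [← leftUnitor_naturality, Functor.LaxMonoidal.left_unitality,
      MonoidalCategory.tensorHom_def']
    simp only [Category.assoc]
  have h := Rep.of_ι (s := unit.tensor s) (t := s) _ h (of_leftUnitor_hom s.X)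
  rw [of_tensor_e, of_unit_e, one_mul, idn_comp (by rfl), ← of_comp, s.idem] at h
  exact h

variable (s) in
theorem rep_rightUnitor : (s.tensor unit).Rep s (ρ_ M).hom (of s.e) := by
  have h : (s.tensor unit).ι ≫ F.map (ρ_ s.X).hom = (ρ_ M).hom ≫ s.ι := by
    change ((s.ι ⊗ₘ ε F) ≫ μ F s.X (𝟙_ _)) ≫ F.map (ρ_ s.X).hom = (ρ_ M).hom ≫ s.ι
    rw [← rightUnitor_naturality, Functor.LaxMonoidal.right_unitality,
      MonoidalCategory.tensorHom_def]
    simp only [Category.assoc]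
  have h := Rep.of_ι (s := s.tensor unit) (t := s) _ h (of_rightUnitor_hom s.X)
  rw [of_tensor_e, of_unit_e, mul_one, idn_comp (by rfl), ← of_comp, s.idem] at h
  exact h

variable (s) in
theorem rep_leftUnitor_inv : s.Rep (unit.tensor s) (λ_ M).inv (of s.e) := by
  have h := rep_hat s (unit.tensor s) (λ_ s.X).inv (of_leftUnitor_inv s.X)
  rw [of_tensor_e, of_unit_e, one_mul, idn_comp (by rfl), ← of_comp, s.idem] at h
  have h' := h.comp (rep_leftUnitor s)
  rw [← of_comp, s.idem] at h'
  have h'' := h'.unique (rep_id _)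
  rw [← Category.id_comp (λ_ M).inv, ← h'', Category.assoc, Iso.hom_inv_id, Category.comp_id]
  exact h

variable (s) in
theorem rep_rightUnitor_inv : s.Rep (s.tensor unit) (ρ_ M).inv (of s.e) := by
  have h := rep_hat s (s.tensor unit) (ρ_ s.X).inv (of_rightUnitor_inv s.X)
  rw [of_tensor_e, of_unit_e, mul_one, idn_comp (by rfl), ← of_comp, s.idem] at h
  have h' := h.comp (rep_rightUnitor s)
  rw [← of_comp, s.idem] at h'
  have h'' := h'.unique (rep_id _)
  rw [← Category.id_comp (ρ_ M).inv, ← h'', Category.assoc, Iso.hom_inv_id, Category.comp_id]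
  exact h

theorem Rep.whiskerLeft (hs : Summand F P) {f : M ⟶ N} {x : Arr a} (hf : s.Rep t f x) :
    (hs.tensor s).Rep (hs.tensor t) (P ◁ f) (of hs.e * x) := by
  rw [← id_tensorHom]
  exact hs.rep_id.tensor hf

theorem Rep.whiskerRight (hs : Summand F P) {f : M ⟶ N} {x : Arr a} (hf : s.Rep t f x) :
    (s.tensor hs).Rep (t.tensor hs) (f ▷ P) (x * of hs.e) := by
  rw [← tensorHom_id]
  exact hf.tensor hs.rep_id

end tensor

section linear

variable [Preadditive C] [Linear ℂ C] [F.Additive] [F.Linear ℂ]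

theorem Rep.add {f f' : M ⟶ N} {m n : ℕ} {x y : (⟨m⟩ : TL a) ⟶ ⟨n⟩} (h : s.Rep t f (of x))
    (h' : s.Rep t f' (of y)) : s.Rep t (f + f') (of (x + y)) := by
  obtain ⟨g, e, h₁, h₂, rfl⟩ := h
  obtain ⟨g', e', h₁', h₂', rfl⟩ := h'
  obtain rfl : m = s.X.strands := congrArg Arr.src e
  obtain rfl : n = t.X.strands := congrArg Arr.tgt e
  have e₁ : x = g := of_injective (m := s.X) (n := t.X) e
  have e₂ : y = g' := of_injective (m := s.X) (n := t.X) e'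
  refine ⟨g + g', by rw [e₁, e₂], by rw [Preadditive.comp_add, h₁, h₁'],
    by rw [Preadditive.add_comp, h₂, h₂'], ?_⟩
  rw [F.map_add, Preadditive.add_comp, Preadditive.comp_add]

theorem Rep.smul (c : ℂ) {f : M ⟶ N} {x : Arr a} (h : s.Rep t f x) : s.Rep t (c • f) (c • x) := by
  obtain ⟨g, rfl, h₁, h₂, rfl⟩ := h
  refine ⟨c • g, rfl, by rw [Linear.comp_smul, h₁], by rw [Linear.smul_comp, h₂], ?_⟩
  rw [F.map_smul, Linear.smul_comp, Linear.comp_smul]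

end linear

end Summand

end TL

/-! ### Intertwiners between the simple modules -/

namespace SimpleModule

open TL

variable {q : ℂˣ}

theorem qint_add_one (hD : (q : ℂ) - (q : ℂ)⁻¹ ≠ 0) (m : ℤ) :
    qint q (m + 1) = q * qint q m + (q : ℂ) ^ (-m) := by
  have hq := q.ne_zero
  rw [qint, qint, ← mul_div_assoc, div_add' _ _ _ hD, neg_add, zpow_add₀ hq, zpow_add₀ hq,
    zpow_neg_one, zpow_one]
  congr 1
  ring

theorem qint_add_one' (hD : (q : ℂ) - (q : ℂ)⁻¹ ≠ 0) (m : ℤ) :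
    qint q (m + 1) = (q : ℂ)⁻¹ * qint q m + (q : ℂ) ^ m := by
  have hq := q.ne_zero
  rw [qint, qint, ← mul_div_assoc, div_add' _ _ _ hD, neg_add, zpow_add₀ hq, zpow_add₀ hq,
    zpow_neg_one, zpow_one]
  congr 1
  ring

/-- The quantum integers `[1], …, [m]` are nonzero. -/
def IsRegular (q : ℂˣ) (m : ℕ) : Prop := ∀ j : ℕ, 1 ≤ j → j ≤ m → qint q j ≠ 0

section

variable {n m : ℕ} {B : Type*} [AddCommGroup B] [Module ℂ B] {σ : Uq q →ₐ[ℂ] Module.End ℂ B}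

/-- The highest weight vector generates `V_n`. -/
theorem eq_of_vec_zero {f g : (Fin (n + 1) → ℂ) →ₗ[ℂ] B} (hf : Intertwines (action q n) σ f)
    (hg : Intertwines (action q n) σ g) (h : f (vec n 0) = g (vec n 0)) : f = g := by
  refine vec_ext fun k => ?_
  induction k with
  | zero => exact h
  | succ k ih =>
    have e : ∀ {f : (Fin (n + 1) → ℂ) →ₗ[ℂ] B}, Intertwines (action q n) σ f →
        f (vec n (k + 1)) = σ (Uq.Y q) (f (vec n k)) := fun {f} hf => by
      have := LinearMap.congr_fun (hf (Uq.Y q)) (vec n k)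
      rw [LinearMap.comp_apply, LinearMap.comp_apply, action_Y, Y_vec] at this
      exact this
    rw [e hf, e hg, ih]

/-- The vector `v_0 ⊗ v_m` generates `V_n ⊗ V_m`. -/
theorem eq_of_vec₂ (hm : IsRegular q m)
    {f g : TensorProduct ℂ (Fin (n + 1) → ℂ) (Fin (m + 1) → ℂ) →ₗ[ℂ] B}
    (hf : Intertwines (tensorAction (action q n) (action q m)) σ f)
    (hg : Intertwines (tensorAction (action q n) (action q m)) σ g)
    (h : f (vec n 0 ⊗ₜ[ℂ] vec m m) = g (vec n 0 ⊗ₜ[ℂ] vec m m)) : f = g := by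
  have hX : ∀ {f : TensorProduct ℂ (Fin (n + 1) → ℂ) (Fin (m + 1) → ℂ) →ₗ[ℂ] B},
      Intertwines (tensorAction (action q n) (action q m)) σ f → ∀ i j : ℕ,
      (qint q (j + 1 : ℕ) * qint q (m - j)) • f (vec n i ⊗ₜ[ℂ] vec m j) =
      σ (Uq.X q) (f (vec n i ⊗ₜ[ℂ] vec m (j + 1))) -
        ((qint q i * qint q (n - i + 1)) * (q : ℂ) ^ ((m : ℤ) - 2 * (j + 1 : ℕ))) •
          f (vec n (i - 1) ⊗ₜ[ℂ] vec m (j + 1)) := by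
    intro f hf i j
    rw [eq_sub_iff_add_eq]
    have := LinearMap.congr_fun (hf (Uq.X q)) (vec n i ⊗ₜ[ℂ] vec m (j + 1))
    rw [LinearMap.comp_apply, LinearMap.comp_apply, tensorAction_X, action_X, action_X,
      action_K] at this
    simp only [LinearMap.add_apply, TensorProduct.map_tmul, LinearMap.id_apply, X_vec, K_vec,
      TensorProduct.tmul_smul, ← TensorProduct.smul_tmul', smul_smul, Nat.add_sub_cancel, map_add,
      map_smul] at this
    rw [← this]
    congr 2
    · congr 2
      push_cast
      ring
    · ring
  have hY : ∀ {f : TensorProduct ℂ (Fin (n + 1) → ℂ) (Fin (m + 1) → ℂ) →ₗ[ℂ] B},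
      Intertwines (tensorAction (action q n) (action q m)) σ f → ∀ i : ℕ,
      f (vec n (i + 1) ⊗ₜ[ℂ] vec m m) = σ (Uq.Y q) (f (vec n i ⊗ₜ[ℂ] vec m m)) := by
    intro f hf i
    have := LinearMap.congr_fun (hf (Uq.Y q)) (vec n i ⊗ₜ[ℂ] vec m m)
    rw [LinearMap.comp_apply, LinearMap.comp_apply, tensorAction_Y, action_Y, action_Y,
      action_Kinv] at this
    simpa only [LinearMap.add_apply, TensorProduct.map_tmul, LinearMap.id_apply, Y_vec, Kinv_vec,
      vec_eq_zero (Nat.lt_succ_self m), TensorProduct.tmul_zero, zero_add] using this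
  -- On `v_i ⊗ v_m`, the element `Y` only acts on the first factor.
  have h₁ : ∀ i, f (vec n i ⊗ₜ[ℂ] vec m m) = g (vec n i ⊗ₜ[ℂ] vec m m) := by
    intro i
    induction i with
    | zero => exact h
    | succ i ih => rw [hY hf, hY hg, ih]
  -- By descending induction on `j`: the element `X` reaches `v_i ⊗ v_j` from `v_i ⊗ v_{j+1}`, up to
  -- a multiple of `v_{i-1} ⊗ v_{j+1}`.
  have h₂ : ∀ k j, k + j = m → ∀ i,
      f (vec n i ⊗ₜ[ℂ] vec m j) = g (vec n i ⊗ₜ[ℂ] vec m j) := by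
    intro k
    induction k with
    | zero =>
      intro j hj i
      obtain rfl : j = m := by omega
      exact h₁ i
    | succ k ih =>
      intro j hj i
      have e : qint q (j + 1 : ℕ) * qint q (m - j) ≠ 0 := by
        refine mul_ne_zero (hm _ (by omega) (by omega)) ?_
        have := hm (m - j) (by omega) (by omega)
        rwa [Nat.cast_sub (by omega)] at this
      have := hX hf i j
      rw [ih (j + 1) (by omega), ih (j + 1) (by omega), ← hX hg i j] at this
      exact smul_right_injective _ e this
  refine vec_ext₂ fun i j => ?_
  by_cases hj : j ≤ m
  · exact h₂ (m - j) j (by omega) i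
  · rw [vec_eq_zero (n := m) (by omega), TensorProduct.tmul_zero, map_zero, map_zero]

end

/-! ### The Clebsch-Gordan maps -/

section

variable (q : ℂˣ)

theorem X_vec_zero (n : ℕ) : X q n (vec n 0) = 0 := by
  rw [X_vec, Nat.cast_zero, qint_zero, zero_mul, zero_smul]

theorem qint_one' (hD : (q : ℂ) - (q : ℂ)⁻¹ ≠ 0) : qint q 1 = 1 := by
  rw [qint, zpow_one, zpow_neg_one, div_self hD]

theorem X_vec_one (hD : (q : ℂ) - (q : ℂ)⁻¹ ≠ 0) : X q 1 (vec 1 1) = vec 1 0 := by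
  rw [X_vec, Nat.cast_one, sub_self, zero_add, qint_one' q hD, mul_one, one_smul]

theorem K_vec_zero : K q 1 (vec 1 0) = (q : ℂ) • vec 1 0 := by
  rw [K_vec]; simp

theorem K_vec_one : K q 1 (vec 1 1) = (q : ℂ)⁻¹ • vec 1 1 := by
  rw [K_vec, ← zpow_neg_one]; simp

theorem Y_vec_one : Y 1 (vec 1 1) = 0 := by
  rw [Y_vec, vec_eq_zero (by omega)]

end

/-- The inclusion of `V_{n+1}` in `V_n ⊗ V_1`, as a linear map. -/
def inclMap (q : ℂˣ) (n : ℕ) : (Fin (n + 1 + 1) → ℂ) →ₗ[ℂ]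
    TensorProduct ℂ (Fin (n + 1) → ℂ) (Fin (1 + 1) → ℂ) :=
  onVec (n + 1) fun k => vec n k ⊗ₜ[ℂ] vec 1 0 +
    ((q : ℂ) ^ ((k : ℤ) - 1 - n) * qint q k) • (vec n (k - 1) ⊗ₜ[ℂ] vec 1 1)

theorem inclMap_vec (n k : ℕ) : inclMap q n (vec (n + 1) k) = vec n k ⊗ₜ[ℂ] vec 1 0 +
    ((q : ℂ) ^ ((k : ℤ) - 1 - n) * qint q k) • (vec n (k - 1) ⊗ₜ[ℂ] vec 1 1) :=
  onVec_vec (fun k hk => by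
    rw [vec_eq_zero (n := n) (k := k) (by omega), vec_eq_zero (n := n) (k := k - 1) (by omega),
      TensorProduct.zero_tmul, TensorProduct.zero_tmul, smul_zero, add_zero]) k

theorem inclMap_intertwines (n : ℕ) (hD : (q : ℂ) - (q : ℂ)⁻¹ ≠ 0) :
    Intertwines (action q (n + 1)) (tensorAction (action q n) (action q 1)) (inclMap q n) := by
  have hq := q.ne_zero
  refine .of_generators ?_ ?_ ?_ <;> refine vec_ext fun k => ?_
  · rw [tensorAction_K, action_K, action_K, action_K]
    simp only [LinearMap.comp_apply, K_vec, map_smul, inclMap_vec, map_add, TensorProduct.map_tmul,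
      TensorProduct.tmul_smul, ← TensorProduct.smul_tmul', smul_add, smul_smul]
    congr 2
    · rw [← zpow_add₀ hq]
      congr 1
      push_cast; ring
    · obtain _ | k := k
      · simp [qint_zero]
      · have : (q : ℂ) ^ (((n + 1 : ℕ) : ℤ) - 2 * (k + 1 : ℕ)) =
            (q : ℂ) ^ (((1 : ℕ) : ℤ) - 2 * (1 : ℕ)) * (q : ℂ) ^ ((n : ℤ) - 2 * (k + 1 - 1 : ℕ)) := by
          rw [← zpow_add₀ hq]
          congr 1
          push_cast [Nat.add_sub_cancel]; ring
        rw [this]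
        ring
  · rw [tensorAction_X, action_X, action_X, action_X, action_K]
    obtain _ | k := k
    · simp [LinearMap.comp_apply, X_vec, inclMap_vec, qint_zero]
    · have h := qint_add_one hD ((n : ℤ) - (k + 1 : ℕ) + 1)
      have e : -((n : ℤ) - (k + 1 : ℕ) + 1) = (k + 1 : ℕ) - 1 - n := by ring
      have e' : ((n + 1 : ℕ) : ℤ) - (k + 1 : ℕ) + 1 = n - (k + 1 : ℕ) + 1 + 1 := by push_cast; ring
      have e₁ : (n : ℤ) - k + 1 = n - (k + 1 : ℕ) + 1 + 1 := by push_cast; ring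
      have e₄ : (q : ℂ) ^ ((k + 1 : ℕ) - 1 - n : ℤ) = q * (q : ℂ) ^ ((k : ℤ) - 1 - n) := by
        rw [← zpow_one_add₀ hq]
        congr 1
        push_cast; ring
      rw [e] at h
      simp only [LinearMap.comp_apply, LinearMap.add_apply, X_vec_zero, X_vec_one q hD, K_vec_zero,
        K_vec_one, X_vec _ n, X_vec _ (n + 1), map_smul, inclMap_vec, map_add,
        TensorProduct.map_tmul, LinearMap.id_apply, Nat.add_sub_cancel, TensorProduct.tmul_zero,
        TensorProduct.tmul_smul, ← TensorProduct.smul_tmul', smul_add, smul_smul, e', h, e₁,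
        zero_add, e₄]
      have h2 : (q : ℂ) * (q : ℂ)⁻¹ = 1 := mul_inv_cancel₀ hq
      match_scalars
      · ring
      · linear_combination (-(q : ℂ) ^ ((k : ℤ) - 1 - n) * qint q (k + 1) *
          qint q k * (q * qint q (n - (k + 1) + 1) + q * (q : ℂ) ^ ((k : ℤ) - 1 - n))) * h2
  · rw [tensorAction_Y, action_Y, action_Y, action_Y, action_Kinv]
    have h := qint_add_one' hD k
    have e : (q : ℂ) ^ (((k + 1 : ℕ) : ℤ) - 1 - n) = (q : ℂ) ^ (k : ℤ) * (q : ℂ) ^ (-(n : ℤ)) := by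
      rw [← zpow_add₀ hq]
      congr 1
      push_cast; ring
    have e₁ : (q : ℂ) ^ (-((n : ℤ) - 2 * k)) =
        (q : ℂ) ^ (k : ℤ) * (q : ℂ) ^ (k : ℤ) * (q : ℂ) ^ (-(n : ℤ)) := by
      rw [← zpow_add₀ hq, ← zpow_add₀ hq]
      congr 1
      ring
    have e₂ : (q : ℂ) ^ ((k : ℤ) - 1 - n) = (q : ℂ) ^ (k : ℤ) * (q : ℂ) ^ (-(n : ℤ)) * (q : ℂ)⁻¹ := by
      rw [← zpow_neg_one, ← zpow_add₀ hq, ← zpow_add₀ hq]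
      congr 1
      ring
    have e₃ : (qint q k) • vec n (k - 1 + 1) = (qint q k) • vec n k := by
      obtain _ | k := k
      · simp [qint_zero]
      · rfl
    have e₄ : vec 1 (1 + 1) = 0 := vec_eq_zero (by omega)
    have e₅ : ((k + 1 : ℕ) : ℤ) = k + 1 := by push_cast; rfl
    have e₆ : ∀ c : ℂ, (c * qint q k) • (vec n (k - 1 + 1) ⊗ₜ[ℂ] vec 1 1) =
        (c * qint q k) • (vec n k ⊗ₜ[ℂ] vec 1 1) := fun c => by
      rw [mul_smul, TensorProduct.smul_tmul', e₃, ← TensorProduct.smul_tmul', ← mul_smul]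
    simp only [LinearMap.comp_apply, LinearMap.add_apply, Y_vec, Kinv_vec, map_smul, inclMap_vec,
      map_add, TensorProduct.map_tmul, LinearMap.id_apply, e₄, TensorProduct.tmul_zero,
      ← TensorProduct.smul_tmul', zero_add, Nat.add_sub_cancel]
    rw [e₆, e, e₁, e₂, e₅, h]
    module

/-- The projection of `V_n ⊗ V_1` to `V_{n+1}`, as a linear map. -/
def projMap (q : ℂˣ) (n : ℕ) : TensorProduct ℂ (Fin (n + 1) → ℂ) (Fin (1 + 1) → ℂ) →ₗ[ℂ]
    (Fin (n + 1 + 1) → ℂ) :=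
  onVec₂ n 1 fun k j => if n < k then 0 else
    if j = 0 then ((q : ℂ) ^ (k : ℤ) * qint q (n + 1 - k) / qint q (n + 1)) • vec (n + 1) k else
    if j = 1 then (qint q (n + 1))⁻¹ • vec (n + 1) (k + 1) else 0

theorem projMap_vec_zero (n k : ℕ) : projMap q n (vec n k ⊗ₜ[ℂ] vec 1 0) =
    ((q : ℂ) ^ (k : ℤ) * qint q (n + 1 - k) / qint q (n + 1)) • vec (n + 1) k := by
  rw [projMap, onVec₂_vec (fun i j h => by split_ifs <;> first | rfl | omega)]
  by_cases h : n < k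
  · rw [if_pos h]
    obtain rfl | h := (Nat.succ_le_of_lt h).eq_or_lt
    · simp [qint_zero]
    · rw [vec_eq_zero h, smul_zero]
  · rw [if_neg h, if_pos rfl]

theorem projMap_vec_one (n k : ℕ) : projMap q n (vec n k ⊗ₜ[ℂ] vec 1 1) =
    (qint q (n + 1))⁻¹ • vec (n + 1) (k + 1) := by
  rw [projMap, onVec₂_vec (fun i j h => by split_ifs <;> first | rfl | omega)]
  by_cases h : n < k
  · rw [if_pos h, vec_eq_zero (by omega), smul_zero]
  · rw [if_neg h, if_neg one_ne_zero, if_pos rfl]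

theorem ext_vec_one {n : ℕ} {E : Type*} [AddCommGroup E] [Module ℂ E]
    {f g : TensorProduct ℂ (Fin (n + 1) → ℂ) (Fin (1 + 1) → ℂ) →ₗ[ℂ] E}
    (h₀ : ∀ k, f (vec n k ⊗ₜ vec 1 0) = g (vec n k ⊗ₜ vec 1 0))
    (h₁ : ∀ k, f (vec n k ⊗ₜ vec 1 1) = g (vec n k ⊗ₜ vec 1 1)) : f = g :=
  vec_ext₂ fun k j => by
    obtain _ | _ | j := j
    · exact h₀ k
    · exact h₁ k
    · rw [vec_eq_zero (n := 1) (by omega), TensorProduct.tmul_zero, map_zero, map_zero]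

theorem projMap_intertwines (n : ℕ) (hD : (q : ℂ) - (q : ℂ)⁻¹ ≠ 0) :
    Intertwines (tensorAction (action q n) (action q 1)) (action q (n + 1)) (projMap q n) := by
  have hq := q.ne_zero
  have h2 : (q : ℂ) * (q : ℂ)⁻¹ = 1 := mul_inv_cancel₀ hq
  refine .of_generators ?_ ?_ ?_ <;> refine ext_vec_one (fun k => ?_) fun k => ?_
  · rw [tensorAction_K, action_K, action_K, action_K]
    simp only [LinearMap.comp_apply, TensorProduct.map_tmul, K_vec q n, K_vec_zero, map_smul,
      K_vec q (n + 1), TensorProduct.tmul_smul, ← TensorProduct.smul_tmul', projMap_vec_zero]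
    have e : (q : ℂ) ^ (((n + 1 : ℕ) : ℤ) - 2 * k) = q * (q : ℂ) ^ ((n : ℤ) - 2 * k) := by
      rw [← zpow_one_add₀ hq]
      congr 1
      push_cast; ring
    rw [e]
    module
  · rw [tensorAction_K, action_K, action_K, action_K]
    simp only [LinearMap.comp_apply, TensorProduct.map_tmul, K_vec q n, K_vec_one, map_smul,
      K_vec q (n + 1), TensorProduct.tmul_smul, ← TensorProduct.smul_tmul', projMap_vec_one]
    have e : (q : ℂ) ^ (((n + 1 : ℕ) : ℤ) - 2 * (k + 1 : ℕ)) =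
        (q : ℂ)⁻¹ * (q : ℂ) ^ ((n : ℤ) - 2 * k) := by
      rw [← zpow_neg_one, ← zpow_add₀ hq]
      congr 1
      push_cast; ring
    rw [e]
    module
  · rw [tensorAction_X, action_X, action_X, action_X, action_K]
    simp only [LinearMap.comp_apply, LinearMap.add_apply, TensorProduct.map_tmul, X_vec_zero,
      LinearMap.id_apply, K_vec_zero, map_smul, X_vec _ n, X_vec _ (n + 1),
      TensorProduct.tmul_smul, ← TensorProduct.smul_tmul', projMap_vec_zero,
      TensorProduct.tmul_zero, zero_add, smul_smul]
    congr 1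
    obtain _ | k := k
    · simp [qint_zero]
    · have e₁ : (n : ℤ) + 1 - (k + 1 : ℕ) = n - (k + 1 : ℕ) + 1 := by ring
      have e₂ : ((n + 1 : ℕ) : ℤ) - (k + 1 : ℕ) + 1 = n + 1 - (k + 1 - 1 : ℕ) := by
        push_cast [Nat.add_sub_cancel]; ring
      have e₃ : (q : ℂ) ^ ((k + 1 : ℕ) : ℤ) = q * (q : ℂ) ^ ((k + 1 - 1 : ℕ) : ℤ) := by
        rw [← zpow_one_add₀ hq]
        congr 1
        push_cast [Nat.add_sub_cancel]; ring
      rw [e₁, e₂, e₃]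
      ring
  · rw [tensorAction_X, action_X, action_X, action_X, action_K]
    simp only [LinearMap.comp_apply, LinearMap.add_apply, TensorProduct.map_tmul, X_vec_one q hD,
      LinearMap.id_apply, K_vec_one, map_smul, map_add, X_vec _ n, X_vec _ (n + 1),
      TensorProduct.tmul_smul, ← TensorProduct.smul_tmul', projMap_vec_zero, projMap_vec_one,
      smul_smul, Nat.add_sub_cancel]
    have h := qint_add_one' hD k
    have e₁ : ((n + 1 : ℕ) : ℤ) - (k + 1 : ℕ) + 1 = n - k + 1 := by push_cast; ring
    have e₂ : ((k + 1 : ℕ) : ℤ) = k + 1 := by push_cast; rfl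
    have e₃ : (n : ℤ) + 1 - k = n - k + 1 := by ring
    rw [e₁, e₂, e₃, h]
    obtain _ | k := k
    · simp only [Nat.cast_zero, qint_zero, zero_mul, mul_zero, zero_smul, add_zero]
      congr 1
      ring
    · rw [Nat.add_sub_cancel]
      module
  · rw [tensorAction_Y, action_Y, action_Y, action_Y, action_Kinv]
    simp only [LinearMap.comp_apply, LinearMap.add_apply, TensorProduct.map_tmul, Y_vec,
      LinearMap.id_apply, Kinv_vec, map_smul, map_add, ← TensorProduct.smul_tmul',
      projMap_vec_zero, zero_add, projMap_vec_one, smul_smul]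
    rw [← add_smul]
    congr 1
    have h := qint_add_one hD (n - k)
    have e₁ : (n : ℤ) + 1 - k = n - k + 1 := by ring
    have e₂ : (n : ℤ) + 1 - (k + 1 : ℕ) = n - k := by push_cast; ring
    have e₃ : (q : ℂ) ^ (-((n : ℤ) - 2 * k)) = (q : ℂ) ^ (k : ℤ) * (q : ℂ) ^ (-((n : ℤ) - k)) := by
      rw [← zpow_add₀ hq]
      congr 1
      ring
    have e₄ : (q : ℂ) ^ ((k + 1 : ℕ) : ℤ) = q * (q : ℂ) ^ (k : ℤ) := by
      rw [← zpow_one_add₀ hq]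
      congr 1
      push_cast; ring
    rw [e₁, e₂, h, e₃, e₄]
    ring
  · rw [tensorAction_Y, action_Y, action_Y, action_Y, action_Kinv]
    simp only [LinearMap.comp_apply, LinearMap.add_apply, TensorProduct.map_tmul, Y_vec_one,
      Y_vec n, Y_vec (n + 1), LinearMap.id_apply, map_smul, map_add, TensorProduct.tmul_zero,
      zero_add, map_zero, projMap_vec_one]

end SimpleModule

namespace UqMod

open SimpleModule

variable {q : ℂˣ}

/-- The linear map underlying a morphism of modules. -/
def app {M N : UqMod q} (f : M ⟶ N) : M.V →ₗ[ℂ] N.V := f.hom.hom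

/-- The pure tensors in a tensor product of modules. -/
def tm {M N : UqMod q} (x : M.V) (y : N.V) : (M ⊗ N).V := TensorProduct.tmul ℂ x y

/-- The unit of the trivial module. -/
def unit : (𝟙_ (UqMod q)).V := (1 : ℂ)

section

variable {M N P M' N' : UqMod q}

theorem app_injective {f g : M ⟶ N} (h : app f = app g) : f = g := hom_ext (ModuleCat.hom_ext h)

theorem app_comp (f : M ⟶ N) (g : N ⟶ P) (x : M.V) : app (f ≫ g) x = app g (app f x) := rfl
theorem app_id (x : M.V) : app (𝟙 M) x = x := rfl
theorem app_add (f g : M ⟶ N) : app (f + g) = app f + app g := rfl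
theorem app_smul (c : ℂ) (f : M ⟶ N) : app (c • f) = c • app f := rfl
theorem app_zero : app (0 : M ⟶ N) = 0 := rfl
theorem app_whiskerRight (f : M ⟶ N) (x : M.V) (y : P.V) :
    app (f ▷ P) (tm x y) = tm (app f x) y := rfl
theorem app_whiskerLeft (f : M ⟶ N) (x : M.V) (y : P.V) :
    app (P ◁ f) (tm y x) = tm y (app f x) := rfl
theorem app_associator_hom (x : M.V) (y : N.V) (z : P.V) :
    app (α_ M N P).hom (tm (tm x y) z) = tm x (tm y z) := rfl
theorem app_associator_inv (x : M.V) (y : N.V) (z : P.V) :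
    app (α_ M N P).inv (tm x (tm y z)) = tm (tm x y) z := rfl
theorem app_leftUnitor_hom (x : M.V) : app (λ_ M).hom (tm unit x) = x :=
  one_smul ℂ x
theorem app_leftUnitor_inv (x : M.V) : app (λ_ M).inv x = tm unit x := rfl
theorem app_rightUnitor_hom (x : M.V) : app (ρ_ M).hom (tm x unit) = x :=
  one_smul ℂ x
theorem app_rightUnitor_inv (x : M.V) : app (ρ_ M).inv x = tm x unit := rfl

theorem tm_add (x : M.V) (y y' : N.V) : tm x (y + y') = tm x y + tm x y' :=
  TensorProduct.tmul_add x y y'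
theorem add_tm (x x' : M.V) (y : N.V) : tm (x + x') y = tm x y + tm x' y :=
  TensorProduct.add_tmul x x' y
theorem tm_smul (c : ℂ) (x : M.V) (y : N.V) : tm x (c • y) = c • tm x y :=
  TensorProduct.tmul_smul c x y
theorem smul_tm (c : ℂ) (x : M.V) (y : N.V) : tm (c • x) y = c • tm x y :=
  (TensorProduct.smul_tmul' c x y).symm
theorem tm_zero (x : M.V) : tm x (0 : N.V) = 0 := TensorProduct.tmul_zero _ x
theorem zero_tm (y : N.V) : tm (0 : M.V) y = 0 := TensorProduct.zero_tmul _ y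
theorem tm_sum {ι : Type*} (s : Finset ι) (x : M.V) (y : ι → N.V) :
    tm x (∑ i ∈ s, y i) = ∑ i ∈ s, tm x (y i) := TensorProduct.tmul_sum x s y
theorem sum_tm {ι : Type*} (s : Finset ι) (x : ι → M.V) (y : N.V) :
    tm (∑ i ∈ s, x i) y = ∑ i ∈ s, tm (x i) y := TensorProduct.sum_tmul s x y

theorem unit_ext {A : Type*} [AddCommGroup A] [Module ℂ A] {f g : (𝟙_ (UqMod q)).V →ₗ[ℂ] A}
    (h : f unit = g unit) : f = g := LinearMap.ext_ring (f := f) (g := g) h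

/-- The action of `K`. -/
def actK (M : UqMod q) : M.V →ₗ[ℂ] M.V := M.ρ (Uq.K q)

theorem app_actK (f : M ⟶ N) (x : M.V) : app f (actK M x) = actK N (app f x) :=
  LinearMap.congr_fun (f.comm (Uq.K q)) x

theorem actK_tm (x : M.V) (y : N.V) : actK (M ⊗ N) (tm x y) = tm (actK M x) (actK N y) :=
  LinearMap.congr_fun (tensorAction_K (ρ := M.ρ) (ρ' := N.ρ)) (tm x y)

theorem actK_unit (x : (𝟙_ (UqMod q)).V) : actK (𝟙_ (UqMod q)) x = x :=
  LinearMap.congr_fun trivialAction_K x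

end

/-- The weight vectors of `V_n`. -/
def wt (q : ℂˣ) (n k : ℕ) : (simple q n).V := vec n k

theorem wt_eq_zero {n k : ℕ} (h : n < k) : wt q n k = 0 := vec_eq_zero h

theorem simple_ext {n : ℕ} {A : Type*} [AddCommGroup A] [Module ℂ A]
    {f g : (simple q n).V →ₗ[ℂ] A} (h : ∀ k, f (wt q n k) = g (wt q n k)) : f = g :=
  vec_ext h

theorem actK_wt (n k : ℕ) : actK (simple q n) (wt q n k) = (q : ℂ) ^ ((n : ℤ) - 2 * k) • wt q n k :=
  (LinearMap.congr_fun (action_K q n) (vec n k)).trans (K_vec q n k)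

theorem simple_hom_ext {n : ℕ} {M : UqMod q} {f g : simple q n ⟶ M}
    (h : app f (wt q n 0) = app g (wt q n 0)) : f = g :=
  app_injective (eq_of_vec_zero f.comm g.comm h)

theorem simple_hom_ext₂ {n m : ℕ} (hm : IsRegular q m) {M : UqMod q}
    {f g : simple q n ⊗ simple q m ⟶ M}
    (h : app f (tm (wt q n 0) (wt q m m)) = app g (tm (wt q n 0) (wt q m m))) : f = g :=
  app_injective (eq_of_vec₂ hm f.comm g.comm h)

/-- The evaluation of `V_n`. -/
def evS (q : ℂˣ) (n : ℕ) : simple q n ⊗ simple q n ⟶ 𝟙_ (UqMod q) :=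
  ⟨ModuleCat.ofHom (SimpleModule.ev q n), SimpleModule.ev_intertwines q n⟩
/-- The coevaluation of `V_n`. -/
def coevS (q : ℂˣ) (n : ℕ) : 𝟙_ (UqMod q) ⟶ simple q n ⊗ simple q n :=
  ⟨ModuleCat.ofHom (SimpleModule.coev q n), SimpleModule.coev_intertwines q n⟩

theorem app_evS (n i j : ℕ) : app (evS q n) (tm (wt q n i) (wt q n j)) =
    (if i + j = n then (-1) ^ i * (q : ℂ) ^ (-((i : ℤ) * (n - i + 1))) else 0) • unit :=
  (SimpleModule.ev_vec q n i j).trans (mul_one _).symm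

theorem app_coevS (n : ℕ) : app (coevS q n) unit =
    ∑ i ∈ Finset.range (n + 1), coevCoeff q n i • tm (wt q n i) (wt q n (n - i)) :=
  (LinearMap.toSpanSingleton_apply ℂ (TensorProduct ℂ (Fin (n + 1) → ℂ) (Fin (n + 1) → ℂ)) _ _).trans
    (one_smul ℂ _)

theorem coevCoeff_mul (q : ℂˣ) (n : ℕ) {i : ℕ} (hi : i ≤ n) : coevCoeff q n i *
    ((-1) ^ (n - i) * (q : ℂ) ^ (-(((n - i : ℕ) : ℤ) * (n - (n - i : ℕ) + 1)))) = 1 := by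
  have h : -(((n - i : ℕ) : ℤ) * (n - (n - i : ℕ) + 1)) = -(((n : ℤ) - i) * (i + 1)) := by
    rw [Nat.cast_sub hi]; ring
  have h₂ : ((-1 : ℂ) ^ (n - i)) * (-1) ^ (n - i) = 1 := by
    rw [← mul_pow]; simp
  rw [h, coevCoeff, zpow_neg, mul_mul_mul_comm, h₂, one_mul,
    mul_inv_cancel₀ (zpow_ne_zero _ q.ne_zero)]

theorem zigzagS (n : ℕ) : coevS q n ▷ simple q n ≫ (α_ _ _ _).hom ≫ simple q n ◁ evS q n =
    (λ_ (simple q n)).hom ≫ (ρ_ (simple q n)).inv := by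
  refine app_injective ((cancel_epi (λ_ (simple q n)).inv).1 ?_ |> congrArg app)
  refine app_injective (simple_ext fun k => ?_)
  rw [Iso.inv_hom_id_assoc, app_rightUnitor_inv]
  simp only [app_comp]
  rw [app_leftUnitor_inv, app_whiskerRight, app_coevS, sum_tm, map_sum, map_sum]
  by_cases hk : k ≤ n
  · rw [Finset.sum_eq_single_of_mem k (Finset.mem_range.2 (by omega))]
    · rw [smul_tm, map_smul, map_smul, app_associator_hom, app_whiskerLeft, app_evS,
        if_pos (by omega), tm_smul, smul_smul, coevCoeff_mul q n hk, one_smul]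
    · intro i hi hik
      have := Finset.mem_range.1 hi
      rw [smul_tm, map_smul, map_smul, app_associator_hom, app_whiskerLeft, app_evS,
        if_neg (by omega), zero_smul, tm_zero, smul_zero]
  · rw [wt_eq_zero (by omega), zero_tm]
    refine Finset.sum_eq_zero fun i _ => ?_
    rw [tm_zero, map_zero, map_zero]

theorem zigzagS' (n : ℕ) : simple q n ◁ coevS q n ≫ (α_ _ _ _).inv ≫ evS q n ▷ simple q n =
    (ρ_ (simple q n)).hom ≫ (λ_ (simple q n)).inv := by
  refine app_injective ((cancel_epi (ρ_ (simple q n)).inv).1 ?_ |> congrArg app)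
  refine app_injective (simple_ext fun k => ?_)
  rw [Iso.inv_hom_id_assoc, app_leftUnitor_inv]
  simp only [app_comp]
  rw [app_rightUnitor_inv, app_whiskerLeft, app_coevS, tm_sum, map_sum, map_sum]
  by_cases hk : k ≤ n
  · rw [Finset.sum_eq_single_of_mem (n - k) (Finset.mem_range.2 (by omega))]
    · have h := coevCoeff_mul q n (Nat.sub_le n k)
      rw [Nat.sub_sub_self hk] at h
      rw [tm_smul, map_smul, map_smul, app_associator_inv, app_whiskerRight, app_evS,
        if_pos (by omega), smul_tm, smul_smul, Nat.sub_sub_self hk, h, one_smul]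
    · intro i hi hik
      have := Finset.mem_range.1 hi
      rw [tm_smul, map_smul, map_smul, app_associator_inv, app_whiskerRight, app_evS,
        if_neg (by omega), zero_smul, zero_tm, smul_zero]
  · rw [wt_eq_zero (by omega), tm_zero]
    refine Finset.sum_eq_zero fun i _ => ?_
    rw [zero_tm, map_zero, map_zero]

/-- The two-dimensional module `V_1` is self-dual, and its loop is `-(q + q⁻¹)`. -/
def selfDual {a : ℂˣ} (hq : q = a ^ 2) : TL.SelfDual (a : ℂ) (simple q 1) where
  cup := coevS q 1
  cap := evS q 1
  zigzag_left := zigzagS' 1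
  zigzag_right := zigzagS 1
  loop := by
    refine app_injective (unit_ext ?_)
    rw [app_comp, app_coevS, map_sum, Finset.sum_range_succ, Finset.sum_range_one, map_smul,
      map_smul, app_evS, app_evS, if_pos (by omega), if_pos (by omega), app_smul,
      LinearMap.smul_apply, app_id, smul_smul, smul_smul, ← add_smul]
    congr 1
    simp only [coevCoeff, hq]
    simp [add_comm]

end UqMod

/-! ### Vectors in the tensor powers of the two-dimensional module -/

namespace UqMod

open SimpleModule TL TL.Arr

variable {q : ℂˣ}

/-- The tensor powers of `V_1`. -/
abbrev T (q : ℂˣ) (n : ℕ) : UqMod q := TL.pow (simple q 1) n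

/-- The empty word in the vectors of `V_1`. -/
def nil (q : ℂˣ) : (T q 0).V := unit

/-- A vector in a tensor power of `V_1`, followed by a weight vector. -/
def snoc {n : ℕ} (s : (T q n).V) (k : ℕ) : (T q (n + 1)).V := tm s (wt q 1 k)

/-- The vectors in the tensor powers of `V_1`, with the exponent not recorded in the type. Their
tensor product is strictly associative. -/
structure PVec (q : ℂˣ) where
  deg : ℕ
  val : (T q deg).V

namespace PVec

theorem ext' {u v : PVec q} (h : u.deg = v.deg)
    (h' : app (pow.cast (simple q 1) h).hom u.val = v.val) : u = v := by
  obtain ⟨m, s⟩ := u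
  obtain ⟨n, t⟩ := v
  dsimp only at h
  subst h
  have h' : s = t := h'
  rw [h']

instance : Mul (PVec q) := ⟨fun u v =>
  ⟨u.deg + v.deg, app (pow.mul (simple q 1) u.deg v.deg).hom (tm u.val v.val)⟩⟩
instance : One (PVec q) := ⟨⟨0, nil q⟩⟩
instance : SMul ℂ (PVec q) := ⟨fun c u => ⟨u.deg, c • u.val⟩⟩

instance : Monoid (PVec q) where
  mul_assoc u v w := ext' (Nat.add_assoc _ _ _) (LinearMap.congr_fun
    (congrArg app (pow.mul_assoc (simple q 1) u.deg v.deg w.deg)) (tm (tm u.val v.val) w.val))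
  one_mul u := ext' (Nat.zero_add _) ((LinearMap.congr_fun
    (congrArg app (pow.zero_mul (simple q 1) u.deg)) (tm unit u.val)).trans (app_leftUnitor_hom _))
  mul_one u := congrArg (PVec.mk u.deg) (app_rightUnitor_hom u.val)
  npow := npowRec

theorem smul_mul (c : ℂ) (u v : PVec q) : (c • u) * v = c • (u * v) :=
  congrArg (PVec.mk _) ((congrArg _ (smul_tm c _ _)).trans (map_smul _ c _))
theorem mul_smul' (c : ℂ) (u v : PVec q) : u * (c • v) = c • (u * v) :=
  congrArg (PVec.mk _) ((congrArg _ (tm_smul c _ _)).trans (map_smul _ c _))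
theorem smul_smul' (c d : ℂ) (u : PVec q) : c • d • u = (c * d) • u :=
  congrArg (PVec.mk _) (smul_smul c d u.val)
theorem one_smul' (u : PVec q) : (1 : ℂ) • u = u := congrArg (PVec.mk _) (one_smul ℂ u.val)

variable (q) in
/-- The weight vectors of `V_1`, as vectors in the first tensor power. -/
def letter (k : ℕ) : PVec q := ⟨1, snoc (nil q) k⟩

theorem mk_mul_letter {n : ℕ} (s : (T q n).V) (k : ℕ) :
    (⟨n, s⟩ * letter q k : PVec q) = ⟨n + 1, snoc s k⟩ :=
  congrArg (PVec.mk (n + 1)) (congrArg (fun z => tm z (wt q 1 k)) (app_rightUnitor_hom s))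

theorem letter_mul_letter (k l : ℕ) :
    letter q k * letter q l = ⟨2, snoc (snoc (nil q) k) l⟩ := mk_mul_letter _ _

theorem pow_deg (k n : ℕ) : (letter q k ^ n).deg = n := by
  induction n with
  | zero => rfl
  | succ n ih =>
    rw [pow_succ]
    exact congrArg (· + 1) ih

end PVec

section

variable {a : ℂˣ} (hq : q = a ^ 2)

/-- The representation of the Temperley-Lieb category on the tensor powers of `V_1`. -/
abbrev rep : TL (a : ℂ) ⥤ UqMod q := (selfDual hq).functor

/-- The arrow `x` maps the vector `u` to the vector `v`. -/
def Acts (x : Arr (a : ℂ)) (u v : PVec q) : Prop :=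
  ∃ (m n : ℕ) (g : (⟨m⟩ : TL (a : ℂ)) ⟶ ⟨n⟩) (s : (T q m).V), x = of g ∧ u = ⟨m, s⟩ ∧
    v = ⟨n, app ((rep hq).map g) s⟩

namespace Acts

variable {hq} {x y : Arr (a : ℂ)} {u v w u' v' : PVec q}

theorem comp (h : Acts hq x u v) (h' : Acts hq y v w) : Acts hq (x.comp y) u w := by
  obtain ⟨m, n, g, s, rfl, rfl, rfl⟩ := h
  obtain ⟨n', p, g', s', rfl, e, rfl⟩ := h'
  cases e
  refine ⟨m, p, g ≫ g', s, (of_comp g g').symm, rfl, ?_⟩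
  rw [Functor.map_comp]
  rfl

theorem mul (h : Acts hq x u v) (h' : Acts hq y u' v') : Acts hq (x * y) (u * u') (v * v') := by
  obtain ⟨m, n, g, s, rfl, rfl, rfl⟩ := h
  obtain ⟨m', n', g', s', rfl, rfl, rfl⟩ := h'
  refine ⟨m + m', n + n', tensorMap g g', _, rfl, rfl, ?_⟩
  exact congrArg (PVec.mk (n + n')) (LinearMap.congr_fun
    (congrArg app ((selfDual hq).mul_functor_map_tensorMap g g')) (tm s s')).symm

theorem idn (u : PVec q) : Acts hq (idn (a : ℂ) u.deg) u u :=
  ⟨u.deg, u.deg, 𝟙 _, u.val, rfl, rfl, congrArg (PVec.mk u.deg)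
    (LinearMap.congr_fun (congrArg app ((rep hq).map_id ⟨u.deg⟩)) u.val).symm⟩

theorem idn' {n : ℕ} (u : PVec q) (h : u.deg = n) : Acts hq (Arr.idn (a : ℂ) n) u u := h ▸ idn u

theorem smul (c : ℂ) (h : Acts hq x u v) : Acts hq x (c • u) (c • v) := by
  obtain ⟨m, n, g, s, rfl, rfl, rfl⟩ := h
  exact ⟨m, n, g, c • s, rfl, rfl, congrArg (PVec.mk n) (map_smul (app ((rep hq).map g)) c s).symm⟩

theorem smul_right (c : ℂ) (h : Acts hq x u v) : Acts hq (c • x) u (c • v) := by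
  obtain ⟨m, n, g, s, rfl, rfl, rfl⟩ := h
  refine ⟨m, n, c • g, s, rfl, rfl, ?_⟩
  rw [Functor.map_smul]
  rfl

theorem app_eq {m n : ℕ} {g : (⟨m⟩ : TL (a : ℂ)) ⟶ ⟨n⟩} {s : (T q m).V} {t : (T q n).V}
    (h : Acts hq (of g) ⟨m, s⟩ ⟨n, t⟩) : app ((rep hq).map g) s = t := by
  obtain ⟨m', n', g', s', e, e', e''⟩ := h
  cases e'
  cases e
  cases e''
  rfl

end Acts

theorem app_coevS_one : app (coevS q 1) unit =
    tm (wt q 1 1) (wt q 1 0) - (q : ℂ) • tm (wt q 1 0) (wt q 1 1) := by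
  rw [app_coevS, Finset.sum_range_succ, Finset.sum_range_one]
  simp [coevCoeff, sub_eq_add_neg, add_comm]

theorem app_capP (k l : ℕ) : app (selfDual hq).capP (snoc (snoc (nil q) k) l) =
    (app (evS q 1) (tm (wt q 1 k) (wt q 1 l)) : (T q 0).V) :=
  congrArg (fun z => app (evS q 1) (tm z (wt q 1 l))) (app_leftUnitor_hom (wt q 1 k))

theorem app_cupP : app (selfDual hq).cupP (nil q) =
    snoc (snoc (nil q) 1) 0 - (q : ℂ) • snoc (snoc (nil q) 0) 1 :=
  (congrArg (app ((λ_ (simple q 1)).inv ▷ simple q 1)) app_coevS_one).trans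
    ((map_sub (app ((λ_ (simple q 1)).inv ▷ simple q 1)) _ _).trans (congrArg₂ (· - ·) rfl
      (map_smul (app ((λ_ (simple q 1)).inv ▷ simple q 1)) _ _)))

theorem app_evS_zero_one : app (evS q 1) (tm (wt q 1 0) (wt q 1 1)) = unit := by
  rw [app_evS, if_pos (by omega)]
  simp

theorem app_evS_zero_zero : app (evS q 1) (tm (wt q 1 0) (wt q 1 0)) = 0 := by
  rw [app_evS, if_neg (by omega), zero_smul]

theorem app_capP_zero_one : app (selfDual hq).capP (snoc (snoc (nil q) 0) 1) = nil q :=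
  (app_capP hq 0 1).trans app_evS_zero_one

theorem app_capP_zero_zero : app (selfDual hq).capP (snoc (snoc (nil q) 0) 0) = 0 :=
  (app_capP hq 0 0).trans app_evS_zero_zero

theorem acts_cap : Acts hq (capA (a : ℂ)) (.letter q 0 * .letter q 1) 1 := by
  refine ⟨2, 0, cap₂ (a : ℂ), _, rfl, PVec.letter_mul_letter 0 1, congrArg (PVec.mk 0) ?_⟩
  refine Eq.trans ?_ (LinearMap.congr_fun (congrArg app (selfDual hq).functor_map_cap) _).symm
  exact (app_capP_zero_one hq).symm

theorem app_crossing (x : (T q 2).V) :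
    app ((rep hq).map (crossing (a : ℂ))) x = (a : ℂ) • x +
      (a : ℂ)⁻¹ • app (selfDual hq).cupP (app (selfDual hq).capP x) :=
  LinearMap.congr_fun (congrArg app ((selfDual hq).mapL_diagram (m := ⟨2⟩) (n := ⟨2⟩) .pos)) x

theorem acts_cross_zero_zero :
    Acts hq (crossA (a : ℂ)) (.letter q 0 * .letter q 0) ((a : ℂ) • (.letter q 0 * .letter q 0)) := by
  rw [PVec.letter_mul_letter]
  refine ⟨2, 2, crossing (a : ℂ), _, rfl, rfl, congrArg (PVec.mk 2) ?_⟩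
  refine ((app_crossing hq _).trans ?_).symm
  rw [app_capP_zero_zero, map_zero, smul_zero, add_zero]

theorem acts_cross_zero_one :
    Acts hq (crossA (a : ℂ)) (.letter q 0 * .letter q 1) ((a : ℂ)⁻¹ • (.letter q 1 * .letter q 0)) := by
  rw [PVec.letter_mul_letter, PVec.letter_mul_letter]
  refine ⟨2, 2, crossing (a : ℂ), _, rfl, rfl, congrArg (PVec.mk 2) ?_⟩
  refine ((app_crossing hq _).trans ?_).symm
  have : (a : ℂ)⁻¹ * q = a := by
    rw [hq, Units.val_pow_eq_pow_val, pow_two, inv_mul_cancel_left₀ a.ne_zero]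
  rw [app_capP_zero_one, app_cupP, smul_sub, smul_smul, this]
  exact add_sub_cancel _ _

/-- If the crossing exchanges two letters up to a scalar, then the braiding exchanges powers of
these letters up to a power of the scalar. -/
theorem acts_braidA {c : ℂ} {k l : ℕ}
    (h : Acts hq (crossA (a : ℂ)) (.letter q k * .letter q l) (c • (.letter q l * .letter q k)))
    (n m : ℕ) : Acts hq (braidA (a : ℂ) n m) (.letter q k ^ n * .letter q l ^ m)
      (c ^ (n * m) • (.letter q l ^ m * .letter q k ^ n)) := by
  have h₁ : ∀ m, Acts hq (braidA (a : ℂ) 1 m) (.letter q k * .letter q l ^ m)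
      (c ^ m • (.letter q l ^ m * .letter q k)) := by
    intro m
    induction m with
    | zero =>
      rw [braidA_zero_right, pow_zero, pow_zero, PVec.one_smul', mul_one, one_mul]
      exact Acts.idn' _ rfl
    | succ m ih =>
      have h₂ := ((Acts.idn' (hq := hq) (.letter q l ^ m) (PVec.pow_deg l m)).mul h).smul (c ^ m)
      have h₁ := ih.mul (.idn (.letter q l))
      rw [PVec.smul_mul, mul_assoc, mul_assoc] at h₁
      have := h₁.comp h₂
      rw [PVec.mul_smul', PVec.smul_smul', ← mul_assoc (PVec.letter q l ^ m), ← pow_succ,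
        ← pow_succ] at this
      rw [braidA_one_succ]
      exact this
  induction n with
  | zero =>
    rw [braidA_zero_left, Nat.zero_mul, pow_zero, pow_zero, PVec.one_smul', mul_one, one_mul]
    exact Acts.idn' _ (PVec.pow_deg l m)
  | succ n ih =>
    have h₂ := (Acts.idn' (hq := hq) (.letter q k ^ n) (PVec.pow_deg k n)).mul (h₁ m)
    have h₃ := (ih.mul (.idn (.letter q k))).smul (c ^ m)
    rw [← mul_assoc, PVec.mul_smul', ← pow_succ, ← mul_assoc] at h₂
    have := h₂.comp h₃
    rw [PVec.smul_mul, PVec.smul_smul', mul_assoc, ← pow_succ, ← pow_add] at this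
    rw [braidA_succ_left, Nat.succ_mul, add_comm (n * m)]
    exact this

theorem acts_twistA (n : ℕ) : Acts hq (twistA (a : ℂ) n) (.letter q 0 ^ n)
    ((a : ℂ) ^ (n * (n + 2)) • .letter q 0 ^ n) := by
  have ha := a.ne_zero
  induction n with
  | zero =>
    rw [twistA_zero, pow_zero, Nat.zero_mul, pow_zero, PVec.one_smul']
    exact Acts.idn' (n := 0) _ rfl
  | succ n ih =>
    have h₁ : Acts hq (twistA (a : ℂ) 1) (.letter q 0) ((a : ℂ) ^ 3 • .letter q 0) := by
      rw [twistA_one ha]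
      exact Acts.smul_right _ (Acts.idn (hq := hq) (.letter q 0))
    have h₂ := acts_braidA hq (acts_cross_zero_zero hq) n 1
    have h₃ := acts_braidA hq (acts_cross_zero_zero hq) 1 n
    rw [pow_one, mul_one] at h₂
    rw [pow_one, one_mul] at h₃
    have h₄ := ih.mul h₁
    rw [PVec.smul_mul, PVec.mul_smul'] at h₄
    have := h₄.comp (((h₂.comp (h₃.smul _)).smul _).smul _)
    rw [PVec.smul_smul', PVec.smul_smul', PVec.smul_smul', ← pow_succ, ← pow_add, ← pow_add,
      ← pow_add] at this
    rw [twistA_add ha]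
    convert this using 3
    ring

theorem acts_evA (n : ℕ) : Acts hq (evA (a : ℂ) n) (.letter q 0 ^ n * .letter q 1 ^ n) 1 := by
  induction n with
  | zero =>
    rw [evA_zero, pow_zero, pow_zero, mul_one]
    exact Acts.idn' (n := 0) _ rfl
  | succ n ih =>
    have := (((Acts.idn' (hq := hq) (.letter q 0 ^ n) (PVec.pow_deg 0 n)).mul (acts_cap hq)).mul
      (Acts.idn' (hq := hq) (.letter q 1 ^ n) (PVec.pow_deg 1 n)))
    have := this.comp (by rw [mul_one]; exact ih)
    rw [evA_succ, pow_succ, pow_succ']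
    simp only [mul_assoc] at this ⊢
    exact this

end

/-! ### The simple modules as images of the Jones-Wenzl idempotents -/

theorem intertwines_trivial : Intertwines (action q 0) (trivialAction q)
    (LinearEquiv.funUnique (Fin 1) ℂ ℂ).toLinearMap := by
  refine .of_generators ?_ ?_ ?_ <;> refine vec_ext fun k => ?_
  · rw [action_K, trivialAction_K, LinearMap.comp_apply, K_vec, map_smul, LinearMap.comp_apply,
      LinearMap.id_apply]
    obtain _ | k := k
    · simp
    · rw [vec_eq_zero (by omega), map_zero, smul_zero]
  · rw [action_X, trivialAction_X, LinearMap.comp_apply, X_vec, map_smul, LinearMap.comp_apply,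
      LinearMap.zero_apply]
    obtain _ | _ | k := k
    · simp [qint_zero]
    · simp [qint_zero]
    · rw [vec_eq_zero (by omega), map_zero, smul_zero]
  · rw [action_Y, trivialAction_Y, LinearMap.comp_apply, Y_vec, vec_eq_zero (by omega), map_zero,
      LinearMap.comp_apply, LinearMap.zero_apply]

/-- The module `V_0` is trivial. -/
def trivS (q : ℂˣ) : simple q 0 ≅ 𝟙_ (UqMod q) :=
  isoMk (M := simple q 0) (N := 𝟙_ (UqMod q)) (LinearEquiv.funUnique (Fin 1) ℂ ℂ).toModuleIso
    intertwines_trivial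

theorem app_trivS : app (trivS q).hom (wt q 0 0) = unit := by
  change vec 0 0 (default : Fin 1) = (1 : ℂ)
  simp [vec]

section

variable (hD : (q : ℂ) - (q : ℂ)⁻¹ ≠ 0)

/-- The inclusion of `V_{n+1}` in `V_n ⊗ V_1`, as a morphism of modules. -/
def inclS (n : ℕ) : simple q (n + 1) ⟶ simple q n ⊗ simple q 1 :=
  ⟨ModuleCat.ofHom (inclMap q n), inclMap_intertwines n hD⟩
/-- The projection of `V_n ⊗ V_1` to `V_{n+1}`, as a morphism of modules. -/
def projS (n : ℕ) : simple q n ⊗ simple q 1 ⟶ simple q (n + 1) :=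
  ⟨ModuleCat.ofHom (projMap q n), projMap_intertwines n hD⟩

theorem app_inclS (n k : ℕ) : app (inclS hD n) (wt q (n + 1) k) = tm (wt q n k) (wt q 1 0) +
    ((q : ℂ) ^ ((k : ℤ) - 1 - n) * qint q k) • tm (wt q n (k - 1)) (wt q 1 1) := inclMap_vec n k

theorem app_projS_zero (n k : ℕ) : app (projS hD n) (tm (wt q n k) (wt q 1 0)) =
    ((q : ℂ) ^ (k : ℤ) * qint q (n + 1 - k) / qint q (n + 1)) • wt q (n + 1) k :=
  projMap_vec_zero n k

theorem app_projS_one (n k : ℕ) : app (projS hD n) (tm (wt q n k) (wt q 1 1)) =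
    (qint q (n + 1))⁻¹ • wt q (n + 1) (k + 1) := projMap_vec_one n k

theorem app_inclS_zero (n : ℕ) : app (inclS hD n) (wt q (n + 1) 0) = tm (wt q n 0) (wt q 1 0) := by
  rw [app_inclS, Nat.cast_zero, qint_zero, mul_zero, zero_smul, add_zero]

theorem app_inclS_last (n : ℕ) : app (inclS hD n) (wt q (n + 1) (n + 1)) =
    qint q (n + 1) • tm (wt q n n) (wt q 1 1) := by
  have : ((n + 1 : ℕ) : ℤ) - 1 - n = 0 := by push_cast; ring
  rw [app_inclS, wt_eq_zero (n := n) (k := n + 1) (by omega), zero_tm, zero_add, this, zpow_zero,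
    one_mul, Nat.add_sub_cancel]
  push_cast
  rfl

theorem inclS_projS {n : ℕ} (hn : qint q (n + 1) ≠ 0) : inclS hD n ≫ projS hD n = 𝟙 _ := by
  refine simple_hom_ext ?_
  rw [app_comp, app_inclS_zero, app_projS_zero, Nat.cast_zero, zpow_zero, one_mul, sub_zero,
    div_self hn, one_smul]
  rfl

/-- The inclusion of `V_n` in the tensor power of `V_1`. -/
def ιS : (n : ℕ) → (simple q n ⟶ T q n)
  | 0 => (trivS q).hom
  | n + 1 => inclS hD n ≫ ιS n ▷ simple q 1
/-- The projection of the tensor power of `V_1` to `V_n`. -/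
def πS : (n : ℕ) → (T q n ⟶ simple q n)
  | 0 => (trivS q).inv
  | n + 1 => πS n ▷ simple q 1 ≫ projS hD n

theorem ιS_πS {n : ℕ} (hn : IsRegular q n) : ιS hD n ≫ πS hD n = 𝟙 _ := by
  induction n with
  | zero => exact (trivS q).hom_inv_id
  | succ n ih =>
    have ih := ih fun j hj hj' => hn j hj (by omega)
    have h : (inclS hD n ≫ ιS hD n ▷ simple q 1) ≫ πS hD n ▷ simple q 1 ≫ projS hD n = 𝟙 _ := by
      rw [Category.assoc, ← comp_whiskerRight_assoc, ih, id_whiskerRight, Category.id_comp]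
      exact inclS_projS hD (by exact_mod_cast hn (n + 1) (by omega) le_rfl)
    exact h

theorem ιS_zero (n : ℕ) : (⟨n, app (ιS hD n) (wt q n 0)⟩ : PVec q) = .letter q 0 ^ n := by
  induction n with
  | zero => exact congrArg (PVec.mk 0) app_trivS
  | succ n ih =>
    rw [pow_succ, ← ih, PVec.mk_mul_letter]
    exact congrArg (fun z => PVec.mk (n + 1) (app (ιS hD n ▷ simple q 1) z)) (app_inclS_zero hD n)

/-- The quantum factorial. -/
def qfac (q : ℂˣ) : ℕ → ℂ
  | 0 => 1
  | n + 1 => qint q (n + 1) * qfac q n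

/-- The lowest weight vector of `V_n` is a multiple of the tensor power of that of `V_1`. -/
theorem ιS_last (n : ℕ) :
    (⟨n, app (ιS hD n) (wt q n n)⟩ : PVec q) = qfac q n • .letter q 1 ^ n := by
  induction n with
  | zero =>
    rw [qfac, PVec.one_smul']
    exact congrArg (PVec.mk 0) app_trivS
  | succ n ih =>
    rw [pow_succ, qfac, ← PVec.smul_smul', ← PVec.smul_mul, ← ih, PVec.mk_mul_letter]
    refine congrArg (PVec.mk (n + 1)) ?_
    refine (congrArg (app (ιS hD n ▷ simple q 1)) (app_inclS_last hD n)).trans ?_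
    exact map_smul (app (ιS hD n ▷ simple q 1)) _ _

theorem qfac_ne_zero {n : ℕ} (hn : IsRegular q n) : qfac q n ≠ 0 := by
  induction n with
  | zero => exact one_ne_zero
  | succ n ih =>
    exact mul_ne_zero (by exact_mod_cast hn (n + 1) (by omega) le_rfl)
      (ih fun j hj hj' => hn j hj (by omega))

variable {a : ℂˣ} (hq : q = a ^ 2)

theorem app_mul_two {n : ℕ} (s : (T q n).V) (k l : ℕ) :
    app (pow.mul (simple q 1) n 2).hom (tm s (snoc (snoc (nil q) k) l)) = snoc (snoc s k) l :=
  congrArg (fun z => tm (tm z (wt q 1 k)) (wt q 1 l)) (app_rightUnitor_hom s)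

theorem app_cupLast {n : ℕ} (s : (T q n).V) : app ((rep hq).map (cupLast (a : ℂ) n)) s =
    snoc (snoc s 1) 0 - (q : ℂ) • snoc (snoc s 0) 1 := by
  have h := LinearMap.congr_fun (congrArg app ((selfDual hq).mul_functor_map_tensorMap
    (𝟙 (⟨n⟩ : TL (a : ℂ))) (cup₂ (a : ℂ)))) (tm s (nil q))
  have h₁ : app ((rep hq).map (cup₂ (a : ℂ))) (nil q) = snoc (snoc (nil q) 1) 0 -
      (q : ℂ) • snoc (snoc (nil q) 0) 1 :=
    (LinearMap.congr_fun (congrArg app (selfDual hq).functor_map_cup) (nil q)).trans (app_cupP hq)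
  have h₂ : app ((rep hq).map (𝟙 (⟨n⟩ : TL (a : ℂ)))) s = s :=
    LinearMap.congr_fun (congrArg app ((rep hq).map_id ⟨n⟩)) s
  have h₃ : tm s (snoc (snoc (nil q) 1) 0 - (q : ℂ) • snoc (snoc (nil q) 0) 1) =
      tm s (snoc (snoc (nil q) 1) 0) - (q : ℂ) • tm s (snoc (snoc (nil q) 0) 1) :=
    (TensorProduct.tmul_sub (R := ℂ) s _ _).trans (congrArg _ (tm_smul _ _ _))
  refine (congrArg (app ((rep hq).map (cupLast (a : ℂ) n)))
    (app_rightUnitor_hom (M := T q n) s).symm).trans (h.trans ?_)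
  refine (congrArg₂ (fun z w => app (pow.mul (simple q 1) n 2).hom (tm z w)) h₂ h₁).trans ?_
  refine (congrArg _ h₃).trans ((map_sub _ _ _).trans ?_)
  exact congrArg₂ (· - ·) (app_mul_two s 1 0)
    ((map_smul _ _ _).trans (congrArg _ (app_mul_two s 0 1)))

theorem app_capLast {n : ℕ} (s : (T q n).V) :
    app ((rep hq).map (capLast (a : ℂ) n)) (snoc (snoc s 0) 1) = s := by
  have h := LinearMap.congr_fun (congrArg app ((selfDual hq).mul_functor_map_tensorMap
    (𝟙 (⟨n⟩ : TL (a : ℂ))) (cap₂ (a : ℂ)))) (tm s (snoc (snoc (nil q) 0) 1))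
  have h₁ : app ((rep hq).map (cap₂ (a : ℂ))) (snoc (snoc (nil q) 0) 1) = nil q :=
    (LinearMap.congr_fun (congrArg app (selfDual hq).functor_map_cap) _).trans
      (app_capP_zero_one hq)
  have h₂ : app ((rep hq).map (𝟙 (⟨n⟩ : TL (a : ℂ)))) s = s :=
    LinearMap.congr_fun (congrArg app ((rep hq).map_id ⟨n⟩)) s
  refine (congrArg (app ((rep hq).map (capLast (a : ℂ) n))) (app_mul_two s 0 1).symm).trans
    (h.trans ?_)
  refine (congrArg₂ (fun z w => app (pow.mul (simple q 1) n 0).hom (tm z w)) h₂ h₁).trans ?_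
  exact app_rightUnitor_hom (M := T q n) s

theorem isRegular_one (hD : (q : ℂ) - (q : ℂ)⁻¹ ≠ 0) : IsRegular q 1 := fun j hj hj' => by
  obtain rfl : j = 1 := by omega
  rw [Nat.cast_one, qint_one' q hD]
  exact one_ne_zero

/-- Wenzl's recursion on the side of modules: both sides are intertwiners from `V_{n+1} ⊗ V_1`,
hence agree if they do on the generator `v_0 ⊗ v_1`. -/
theorem projS_inclS (n : ℕ) (hn : IsRegular q (n + 2)) :
    projS hD (n + 1) ≫ inclS hD (n + 1) = 𝟙 (simple q (n + 1) ⊗ simple q 1) +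
      (qint q ((n + 1 : ℕ) : ℤ) / qint q ((n + 2 : ℕ) : ℤ)) •
        ((ιS hD (n + 1) ▷ simple q 1 : simple q (n + 1) ⊗ simple q 1 ⟶ T q (n + 2)) ≫
          ((rep hq).map (capLast (a : ℂ) n ≫ cupLast (a : ℂ) n) : T q (n + 2) ⟶ T q (n + 2)) ≫
            (πS hD (n + 1) ▷ simple q 1 : T q (n + 2) ⟶ simple q (n + 1) ⊗ simple q 1)) := by
  refine simple_hom_ext₂ (isRegular_one hD) ?_
  have e₀ : IsRegular q (n + 1) := fun j hj hj' => hn j hj (by omega)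
  -- the image of `v_0` in the tensor power, ending with `v_0`
  have e₁ : app (ιS hD (n + 1)) (wt q (n + 1) 0) = snoc (app (ιS hD n) (wt q n 0)) 0 :=
    congrArg (app (ιS hD n ▷ simple q 1)) (app_inclS_zero hD n)
  have e₂ : app (πS hD (n + 1)) (snoc (app (ιS hD n) (wt q n 0)) 0) = wt q (n + 1) 0 := by
    rw [← e₁]
    exact LinearMap.congr_fun (congrArg app (ιS_πS hD e₀)) _
  have e₃ : app (πS hD (n + 1)) (snoc (app (ιS hD n) (wt q n 0)) 1) =
      (qint q ((n + 1 : ℕ) : ℤ))⁻¹ • wt q (n + 1) 1 := by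
    have : app (πS hD n) (app (ιS hD n) (wt q n 0)) = wt q n 0 :=
      LinearMap.congr_fun (congrArg app (ιS_πS hD fun j hj hj' => hn j hj (by omega))) _
    refine (congrArg (fun z => app (projS hD n) (tm z (wt q 1 1))) this).trans ?_
    rw [app_projS_one]
    push_cast
    rfl
  have hL : app (projS hD (n + 1) ≫ inclS hD (n + 1)) (tm (wt q (n + 1) 0) (wt q 1 1)) =
      (qint q ((n + 2 : ℕ) : ℤ))⁻¹ • (tm (wt q (n + 1) 1) (wt q 1 0) +
        ((q : ℂ) ^ (-((n + 1 : ℕ) : ℤ))) • tm (wt q (n + 1) 0) (wt q 1 1)) := by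
    have e : ((n + 1 : ℕ) : ℤ) + 1 = (n + 2 : ℕ) := by push_cast; ring
    have e' : ((0 + 1 : ℕ) : ℤ) - 1 - (n + 1 : ℕ) = -((n + 1 : ℕ) : ℤ) := by push_cast; ring
    rw [app_comp, app_projS_one, map_smul, app_inclS, e, e']
    simp [qint_one' q hD]
  have hR : app ((ιS hD (n + 1) ▷ simple q 1 : simple q (n + 1) ⊗ simple q 1 ⟶ T q (n + 2)) ≫
      ((rep hq).map (capLast (a : ℂ) n ≫ cupLast (a : ℂ) n) : T q (n + 2) ⟶ T q (n + 2)) ≫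
        (πS hD (n + 1) ▷ simple q 1 : T q (n + 2) ⟶ simple q (n + 1) ⊗ simple q 1))
      (tm (wt q (n + 1) 0) (wt q 1 1)) = (qint q ((n + 1 : ℕ) : ℤ))⁻¹ •
        tm (wt q (n + 1) 1) (wt q 1 0) - (q : ℂ) • tm (wt q (n + 1) 0) (wt q 1 1) := by
    have h₁ : app (ιS hD (n + 1) ▷ simple q 1) (tm (wt q (n + 1) 0) (wt q 1 1)) =
        snoc (snoc (app (ιS hD n) (wt q n 0)) 0) 1 := congrArg (fun z => tm z (wt q 1 1)) e₁
    have h₂ : app ((rep hq).map (capLast (a : ℂ) n ≫ cupLast (a : ℂ) n))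
        (snoc (snoc (app (ιS hD n) (wt q n 0)) 0) 1) =
        snoc (snoc (app (ιS hD n) (wt q n 0)) 1) 0 -
          (q : ℂ) • snoc (snoc (app (ιS hD n) (wt q n 0)) 0) 1 := by
      refine (LinearMap.congr_fun (congrArg app ((rep hq).map_comp _ _)) _).trans ?_
      refine (congrArg (app ((rep hq).map (cupLast (a : ℂ) n))) (app_capLast hq _)).trans ?_
      exact app_cupLast hq _
    refine (congrArg (app (πS hD (n + 1) ▷ simple q 1)) ((congrArg _ h₁).trans h₂)).trans ?_
    refine (map_sub (app (πS hD (n + 1) ▷ simple q 1)) _ _).trans (congrArg₂ (· - ·) ?_ ?_)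
    · exact (congrArg (fun z => tm z (wt q 1 0)) e₃).trans (smul_tm _ _ _)
    · refine (map_smul (app (πS hD (n + 1) ▷ simple q 1)) _ _).trans (congrArg _ ?_)
      exact congrArg (fun z => tm z (wt q 1 1)) e₂
  rw [hL, app_add, app_smul, LinearMap.add_apply, LinearMap.smul_apply, hR, app_id]
  have h := qint_add_one hD (n + 1 : ℕ)
  have e : ((n + 1 : ℕ) : ℤ) + 1 = (n + 2 : ℕ) := by push_cast; ring
  rw [e] at h
  have h₁ := hn (n + 1) (by omega) (by omega)
  have h₂ := hn (n + 2) (by omega) le_rfl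
  generalize qint q ((n + 1 : ℕ) : ℤ) = x at *
  generalize qint q ((n + 2 : ℕ) : ℤ) = y at *
  generalize (q : ℂ) ^ (-((n + 1 : ℕ) : ℤ)) = z at *
  match_scalars
  · field_simp
  · field_simp
    rw [h]
    ring

theorem tens_id_one {C : Type*} [Category C] [MonoidalCategory C] (V : C) {m n : ℕ}
    (f : pow V m ⟶ pow V n) : pow.tens V f (𝟙 (pow V 1)) = f ▷ V := by
  refine (cancel_epi (pow.mul V m 1).hom).1 ((pow.mul_tens f (𝟙 (pow V 1))).trans ?_)
  change (f ⊗ₘ 𝟙 (𝟙_ C ⊗ V)) ≫ (α_ (pow V n) (𝟙_ C) V).inv ≫ (ρ_ (pow V n)).hom ▷ V =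
    ((α_ (pow V m) (𝟙_ C) V).inv ≫ (ρ_ (pow V m)).hom ▷ V) ≫ f ▷ V
  rw [tensorHom_id, associator_inv_naturality_left_assoc, ← comp_whiskerRight,
    rightUnitor_naturality, Category.assoc, comp_whiskerRight]

theorem rep_map_addStrand {m n : ℕ} (f : (⟨m⟩ : TL (a : ℂ)) ⟶ ⟨n⟩) :
    ((rep hq).map (addStrand f) : T q (m + 1) ⟶ T q (n + 1)) =
      ((rep hq).map f : T q m ⟶ T q n) ▷ simple q 1 :=
  ((selfDual hq).functor_map_tensorMap f (𝟙 (⟨1⟩ : TL (a : ℂ)))).trans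
    ((congrArg (pow.tens _ _) ((rep hq).map_id _)).trans (tens_id_one _ _))

theorem comp_add_smul_comp {A B : UqMod q} {i : A ⟶ B} {p : B ⟶ A} {x j : B ⟶ B} {e : A ⟶ A}
    {c : ℂ} (he : e = 𝟙 A + c • (i ≫ x ≫ p)) (hj : p ≫ i = j) :
    p ≫ e ≫ i = j + c • (j ≫ x ≫ j) := by
  rw [he, Preadditive.add_comp, Preadditive.comp_add, Category.id_comp, Linear.smul_comp,
    Linear.comp_smul, ← hj]
  simp only [Category.assoc]

theorem projS_inclS_zero : projS hD 0 ≫ inclS hD 0 = 𝟙 _ := by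
  refine simple_hom_ext₂ (isRegular_one hD) ?_
  rw [app_comp, app_projS_one, map_smul, app_inclS_last]
  simp [qint_one' q hD, app_id]

/-- The projection of the tensor power onto `V_n` is the image of the Jones-Wenzl element, since
both satisfy the same recursion. -/
theorem πS_ιS : ∀ (n : ℕ), IsRegular q n →
    πS hD n ≫ ιS hD n = (rep hq).map (jw (a := (a : ℂ)) q n)
  | 0, _ => (trivS q).inv_hom_id.trans ((rep hq).map_id ⟨0⟩).symm
  | 1, _ => by
    have h : ((trivS q).inv ▷ simple q 1 ≫ projS hD 0) ≫ inclS hD 0 ≫ (trivS q).hom ▷ simple q 1 =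
        𝟙 _ := by
      rw [Category.assoc, reassoc_of% projS_inclS_zero hD, inv_hom_whiskerRight]
    exact h.trans ((rep hq).map_id ⟨1⟩).symm
  | n + 2, hn => by
    have ih := πS_ιS (n + 1) fun j hj hj' => hn j hj (by omega)
    have h₁ : (πS hD (n + 1) ▷ simple q 1 : T q (n + 2) ⟶ simple q (n + 1) ⊗ simple q 1) ≫
        (ιS hD (n + 1) ▷ simple q 1 : simple q (n + 1) ⊗ simple q 1 ⟶ T q (n + 2)) =
        (rep hq).map (addStrand (jw (a := (a : ℂ)) q (n + 1))) :=
      (comp_whiskerRight _ _ _).symm.trans ((congrArg (· ▷ simple q 1) ih).trans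
        (rep_map_addStrand hq _).symm)
    have h₂ := comp_add_smul_comp (projS_inclS hD hq n hn) h₁
    refine (Category.assoc (πS hD (n + 1) ▷ simple q 1) (projS hD (n + 1))
      (inclS hD (n + 1) ≫ ιS hD (n + 1) ▷ simple q 1)).trans ?_
    refine (congrArg (_ ≫ ·) (Category.assoc _ _ _)).symm.trans (h₂.trans ?_)
    rw [jw_add_two]
    refine ((Functor.map_add _).trans (congrArg₂ (· + ·) rfl ?_)).symm
    refine (Functor.map_smul _ _ _).trans (congrArg _ ?_)
    exact (Functor.map_comp _ _ _).trans (congrArg _ (Functor.map_comp _ _ _))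

/-- The module `V_n` is the image of the Jones-Wenzl idempotent on `n` strands. -/
def summand {n : ℕ} (hn : IsRegular q n) : Summand (rep hq) (simple q n) where
  X := ⟨n⟩
  e := jw q n
  idem := (jw_spec (a := (a : ℂ)) (by rw [hq]; simp) hD hn).idem
  ι := ιS hD n
  π := πS hD n
  ι_π := ιS_πS hD hn
  π_ι := πS_ιS hD hq n hn

end

end UqMod

/-! ### Representatives of the structure morphisms of the simple modules -/

namespace TL.Arr

variable {a : ℂ} {E E' : Arr a}

theorem IsMate.coevA_comp_mul (h : IsMate E E') (hE : E.comp E = E) (ht : E.tgt = E.src) :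
    (coevA a E.src).comp (E * E') = (coevA a E.src).comp (E * idn a E.src) := by
  have e := h.eq
  rw [ht] at e
  rw [mul_eq_comp' (x := E) (y := E') (m := E.src) (n := E.src) rfl h.tgt_eq.symm, ← comp_assoc,
    ← e, comp_assoc, mul_idn_comp, hE]

theorem IsMate.mul_comp_evA (h : IsMate E E') (hE : E.comp E = E) (ht : E.tgt = E.src) :
    (E' * E).comp (evA a E.src) = (idn a E.src * E).comp (evA a E.src) := by
  have e := h.ev_eq
  rw [ht] at e
  rw [mul_eq_comp' (x := E') (y := E) (m := E.src) (n := E.src) (by rw [h.src_eq, ht]) ht.symm,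
    comp_assoc, e, ← comp_assoc, idn_mul_comp, hE]

/-- The zigzag identity, with idempotents on all strands. -/
theorem IsMate.zigzag_of_idem (h : IsMate E E') (hE : E.comp E = E) (ht : E.tgt = E.src)
    (hE' : E'.comp E' = E') :
    ((coevA a E.src).comp (E * E') * E).comp ((E * E' * E).comp (E * (E' * E).comp (evA a E.src))) =
      E := by
  have e : ((coevA a E.src).comp (E * E') * E).comp (E * E' * E) =
      (coevA a E.src).comp (E * E') * E := by
    rw [mul_comp_mul (by rw [comp_tgt, mul_tgt, mul_src, h.tgt_eq, h.src_eq, ht]) ht, comp_assoc,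
      mul_comp_mul ht (by rw [h.tgt_eq, h.src_eq, ht]), hE, hE']
  rw [← comp_assoc, e, h.coevA_comp_mul hE ht, h.mul_comp_evA hE ht]
  exact Arr.zigzag_of_idem rfl ht hE

end TL.Arr

namespace UqMod

open SimpleModule TL TL.Arr

variable {q : ℂˣ}

theorem isRegular_of_mem {n : ℕ} (hn : n ∈ SimpleIndex q) : IsRegular q n := fun j hj hj' => by
  obtain ⟨l, rfl⟩ : ∃ l, j = l + 1 := ⟨j - 1, by omega⟩
  exact SimpleIndex.qint_natCast_ne_zero hn (by omega)

/-- On the product of a highest and a lowest weight vector, only the first term of the quasi-R-matrix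
contributes. -/
theorem braiding_vec (a : ℂˣ) (n m : ℕ) : SimpleModule.braiding a q n m (vec n 0 ⊗ₜ[ℂ] vec m m) =
    ((a : ℂ)⁻¹ ^ (n * m)) • (vec m m ⊗ₜ[ℂ] vec n 0) := by
  have h : action₂ q n m (Uq.quasiR q n) (vec n 0 ⊗ₜ[ℂ] vec m m) = vec n 0 ⊗ₜ[ℂ] vec m m := by
    rw [Uq.quasiR, map_sum, LinearMap.sum_apply, Finset.sum_eq_single_of_mem 0 (by simp)]
    · rw [map_smul, action₂_tmul, pow_zero, pow_zero, map_one, map_one, Uq.rCoeff, one_smul]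
      rfl
    · intro l _ hl
      have h := X_pow_vec_of_lt (q := q) n (Nat.pos_of_ne_zero hl)
      rw [map_smul, action₂_tmul, map_pow, action_X, LinearMap.smul_apply, TensorProduct.map_tmul,
        h, TensorProduct.zero_tmul, smul_zero]
  rw [SimpleModule.braiding, LinearMap.comp_apply, LinearMap.comp_apply, h, weightTwist_vec,
    map_smul]
  refine congrArg (· • (vec m m ⊗ₜ[ℂ] vec n 0)) ?_
  rw [inv_pow, ← zpow_natCast, ← zpow_neg]
  congr 1
  push_cast; ring

/-- A coevaluation is determined by the evaluation. -/
theorem coev_unique {V : UqMod q} {c c' : 𝟙_ (UqMod q) ⟶ V ⊗ V} {e : V ⊗ V ⟶ 𝟙_ (UqMod q)}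
    (h : c ▷ V ≫ (α_ V V V).hom ≫ V ◁ e = (λ_ V).hom ≫ (ρ_ V).inv)
    (h' : V ◁ c' ≫ (α_ V V V).inv ≫ e ▷ V = (ρ_ V).hom ≫ (λ_ V).inv) : c = c' := by
  calc c = c ≫ V ◁ ((ρ_ V).inv ≫ (V ◁ c' ≫ (α_ V V V).inv ≫ e ▷ V) ≫ (λ_ V).hom) := by
        rw [h']; simp
    _ = (ρ_ (𝟙_ (UqMod q))).inv ≫ (c ▷ 𝟙_ (UqMod q) ≫ (V ⊗ V) ◁ c') ≫ (α_ V V (V ⊗ V)).hom ≫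
          V ◁ (α_ V V V).inv ≫ V ◁ e ▷ V ≫ V ◁ (λ_ V).hom := by monoidal
    _ = c' ≫ (λ_ V).inv ▷ V ≫ (c ▷ V ≫ (α_ V V V).hom ≫ V ◁ e) ▷ V ≫ (ρ_ V).hom ▷ V := by
        rw [← whisker_exchange]; monoidal
    _ = c' := by rw [h]; simp

variable (hD : (q : ℂ) - (q : ℂ)⁻¹ ≠ 0) {a : ℂˣ} (hq : q = a ^ 2) {n m : ℕ} (hn : IsRegular q n)
  (hm : IsRegular q m)

/-- Both sides are intertwiners from `V_n ⊗ V_m`, and are compared on the generator, where all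
crossings exchange the two letters of `V_1` up to the factor `a⁻¹`. -/
theorem rep_braiding (β : simple q n ⊗ simple q m ⟶ simple q m ⊗ simple q n)
    (hβ : app β (tm (wt q n 0) (wt q m m)) =
      ((a : ℂ)⁻¹ ^ (n * m)) • tm (wt q m m) (wt q n 0)) :
    ((summand hD hq hn).tensor (summand hD hq hm)).Rep ((summand hD hq hm).tensor (summand hD hq hn))
      β ((of (jw q n) * of (jw q m)).comp ((braidA (a : ℂ) n m).comp
        (of (jw q m) * of (jw q n)))) := by
  refine Summand.Rep.of_ι (s := (summand hD hq hn).tensor (summand hD hq hm))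
    (t := (summand hD hq hm).tensor (summand hD hq hn)) (TL.braid (a : ℂ) n m) ?_ rfl
  refine simple_hom_ext₂ (M := T q (m + n)) hm ?_
  have h := acts_braidA hq (acts_cross_zero_one hq) n m
  have h := h.smul (qfac q m)
  rw [← PVec.mul_smul', PVec.smul_smul', mul_comm (qfac q m), ← PVec.smul_smul', ← PVec.smul_mul,
    ← ιS_last hD, ← ιS_zero hD] at h
  refine Eq.trans (Acts.app_eq h) ?_
  refine ((congrArg (app ((summand hD hq hm).tensor (summand hD hq hn)).ι) hβ).trans
    (map_smul (app ((summand hD hq hm).tensor (summand hD hq hn)).ι) _ _)).symm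

theorem rep_twist : (summand hD hq hn).Rep (summand hD hq hn)
    ((a : ℂ) ^ (n * (n + 2)) • 𝟙 (simple q n))
      ((of (jw q n)).comp ((twistA (a : ℂ) n).comp (of (jw q n)))) := by
  refine Summand.Rep.of_ι (s := summand hD hq hn) (t := summand hD hq hn) (TL.twist (a : ℂ) n) ?_ rfl
  refine simple_hom_ext (M := T q n) ?_
  have h := acts_twistA hq n
  rw [← ιS_zero hD] at h
  refine Eq.trans (Acts.app_eq h) ?_
  exact (map_smul (app (ιS hD n)) _ _).symm

theorem app_evS_zero (n : ℕ) : app (evS q n) (tm (wt q n 0) (wt q n n)) = unit := by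
  rw [app_evS, if_pos (by omega)]
  simp

/-- The scalar comes from the lowest weight vector of `V_n`, which is a multiple of a pure tensor by
the quantum factorial. -/
theorem rep_ev : ((summand hD hq hn).tensor (summand hD hq hn)).Rep Summand.unit (evS q n)
    ((qfac q n)⁻¹ • (of (jw q n) * of (jw q n)).comp (evA (a : ℂ) n)) := by
  have : ((summand hD hq hn).tensor (summand hD hq hn)).Rep Summand.unit (qfac q n • evS q n)
      ((of (jw q n) * of (jw q n)).comp ((evA (a : ℂ) n).comp 1)) := by
    refine Summand.Rep.of_ι (s := (summand hD hq hn).tensor (summand hD hq hn)) (t := Summand.unit)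
      (TL.ev (a : ℂ) n) ?_ rfl
    refine simple_hom_ext₂ (M := 𝟙_ (UqMod q)) hn ?_
    have h := (acts_evA hq n).smul (qfac q n)
    rw [← PVec.mul_smul', ← ιS_last hD, ← ιS_zero hD] at h
    refine Eq.trans (Acts.app_eq h) ?_
    exact (congrArg (qfac q n • ·) (app_evS_zero n)).symm
  have h := this.smul (qfac q n)⁻¹
  rw [smul_smul, inv_mul_cancel₀ (qfac_ne_zero hn), one_smul] at h
  have e : (evA (a : ℂ) n).comp 1 = evA (a : ℂ) n := comp_idn (n := 0) rfl
  rwa [e] at h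

theorem rep_coev : Summand.unit.Rep ((summand hD hq hn).tensor (summand hD hq hn)) (coevS q n)
    (qfac q n • (coevA (a : ℂ) n).comp (of (jw q n) * of (jw q n))) := by
  have h₀ := (Summand.rep_hat Summand.unit ((summand hD hq hn).tensor (summand hD hq hn))
    (TL.coev (a : ℂ) n) rfl).smul (qfac q n)
  have e : (1 : Arr (a : ℂ)).comp ((coevA (a : ℂ) n).comp (of (jw q n) * of (jw q n))) =
      (coevA (a : ℂ) n).comp (of (jw q n) * of (jw q n)) :=
    idn_comp (n := 0) (by rw [comp_src]; rfl)
  have h : Summand.unit.Rep ((summand hD hq hn).tensor (summand hD hq hn)) _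
    (qfac q n • (coevA (a : ℂ) n).comp (of (jw q n) * of (jw q n))) := e ▸ h₀
  suffices e : _ = coevS q n from e ▸ h
  refine coev_unique (e := evS q n) ?_ (zigzagS' n)
  have h₁ := (h.whiskerRight (summand hD hq hn)).comp
    ((Summand.rep_associator (summand hD hq hn) (summand hD hq hn) (summand hD hq hn)).comp
      ((rep_ev hD hq hn).whiskerLeft (summand hD hq hn)))
  have h₂ := (Summand.rep_leftUnitor (summand hD hq hn)).comp
    (Summand.rep_rightUnitor_inv (summand hD hq hn))
  have hj := jw_spec (a := (a : ℂ)) (q := q) (by rw [hq]; simp) hD hn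
  have hF : (of (jw (a := (a : ℂ)) q n)).comp (of (jw q n)) = of (jw q n) := by
    rw [← of_comp, hj.idem]
  have e₁ : (qfac q n • (coevA (a : ℂ) n).comp (of (jw q n) * of (jw q n)) * of (jw q n)).comp
      ((of (jw q n) * of (jw q n) * of (jw q n)).comp
        (of (jw q n) * (qfac q n)⁻¹ • (of (jw q n) * of (jw q n)).comp (evA (a : ℂ) n))) =
      of (jw q n) := by
    rw [smul_mul, mul_smul', comp_smul, smul_comp, comp_smul, smul_smul',
      mul_inv_cancel₀ (qfac_ne_zero hn), one_smul']
    exact hj.isMate_self.zigzag_of_idem hF rfl hF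
  have h₁ : (Summand.unit.tensor (summand hD hq hn)).Rep ((summand hD hq hn).tensor Summand.unit) _
      (of (jw q n)) := e₁ ▸ h₁
  have h₂ : (Summand.unit.tensor (summand hD hq hn)).Rep ((summand hD hq hn).tensor Summand.unit) _
      (of (jw q n)) := hF ▸ h₂
  exact h₁.unique h₂

end UqMod

/-! ### The realization of the tensor products of simple modules -/

namespace TL.Arr

variable {a : ℂ} {S S' T T' : Arr a}

theorem coevA_tensor (hS : S.comp S = S) (hS' : S'.comp S' = S') (hT : T.comp T = T)
    (hT' : T'.comp T' = T') (eS : S.tgt = S.src) (eS' : S'.tgt = S'.src) (eT : T.tgt = T.src)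
    (eT' : T'.tgt = T'.src) (e : S'.src = S.src) (e' : T'.src = T.src) :
    ((coevA a S.src).comp (S * S')).comp ((S * (S'.comp (((coevA a T.src).comp (T * T') * S').comp
      (T * T' * S')))).comp (S * T * (T' * S'))) =
      (coevA a (S * T).src).comp (S * T * (T' * S')) := by
  have h₁ : ((coevA a T.src).comp (T * T') * S').comp (T * T' * S') =
      (coevA a T.src).comp (T * T') * S' := by
    rw [mul_comp_mul (by rw [comp_tgt, mul_tgt, mul_src, eT, eT']) eS', comp_assoc,
      mul_comp_mul eT eT', hT, hT', hS']
  have h₂ : S'.comp ((coevA a T.src).comp (T * T') * S') = (coevA a T.src).comp (T * T') * S' := by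
    have h : S' = idn a 0 * S' := by rw [idn_zero, one_mul]
    nth_rewrite 1 [h]
    rw [mul_comp_mul (by rw [comp_src]; rfl) eS', hS', idn_comp (by rw [comp_src]; rfl)]
  have h₃ : (coevA a T.src).comp (T * T') * S' =
      (coevA a T.src * idn a S.src).comp (T * T' * S') := by
    rw [mul_comp_mul (by rw [coevA_tgt, mul_src, e']) e.symm, idn_comp e.symm]
  have h₄ : (S * S').comp (S * ((coevA a T.src).comp (T * T') * S')) =
      S * ((coevA a T.src).comp (T * T') * S') := by
    rw [mul_comp_mul eS (by rw [eS', mul_src, comp_src, coevA_src, zero_add]), hS, h₂]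
  have h₅ : S * ((coevA a T.src * idn a S.src).comp (T * T' * S')) =
      (idn a S.src * (coevA a T.src * idn a S.src)).comp (S * T * (T' * S')) := by
    rw [mul_assoc S, ← mul_assoc T, mul_comp_mul (x := idn a S.src) (x' := S) rfl (by
      simp only [mul_tgt, mul_src, coevA_tgt, e', idn_tgt, e]), idn_comp rfl]
  have h₆ : (S * T * (T' * S')).comp (S * T * (T' * S')) = S * T * (T' * S') := by
    rw [mul_comp_mul (by rw [mul_tgt, mul_src, eS, eT]) (by rw [mul_tgt, mul_src, eS', eT']),
      mul_comp_mul eS eT, mul_comp_mul eT' eS', hS, hT, hS', hT']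
  rw [h₁, h₂, comp_assoc, ← comp_assoc (S * S'), h₄, h₃, h₅, comp_assoc, h₆, ← comp_assoc,
    ← coevA_add, mul_src]

theorem evA_tensor (hS : S.comp S = S) (hS' : S'.comp S' = S') (hT : T.comp T = T)
    (hT' : T'.comp T' = T') (eS : S.tgt = S.src) (eS' : S'.tgt = S'.src) (eT : T.tgt = T.src)
    (eT' : T'.tgt = T'.src) (e : S'.src = S.src) (e' : T'.src = T.src) :
    (T' * S' * (S * T)).comp ((T' * ((S' * S * T).comp (((S' * S).comp (evA a S.src) * T).comp
      T))).comp ((T' * T).comp (evA a T.src))) =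
      (T' * S' * (S * T)).comp (evA a (S * T).src) := by
  have h₁ : ((S' * S).comp (evA a S.src) * T).comp T = (S' * S).comp (evA a S.src) * T := by
    have h : T = idn a 0 * T := by rw [idn_zero, one_mul]
    nth_rewrite 2 [h]
    rw [mul_comp_mul (by rw [comp_tgt]; rfl) eT, hT, comp_idn (by rw [comp_tgt]; rfl)]
  have h₂ : (S' * S * T).comp ((S' * S).comp (evA a S.src) * T) =
      (S' * S).comp (evA a S.src) * T := by
    rw [mul_comp_mul (by rw [comp_src, mul_tgt, mul_src, eS, eS']) eT, ← comp_assoc,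
      mul_comp_mul eS' eS, hS, hS', hT]
  have h₃ : (S' * S).comp (evA a S.src) * T =
      (S' * S * T).comp (evA a S.src * idn a T.src) := by
    rw [mul_comp_mul (x := S' * S) (x' := evA a S.src) (y' := idn a T.src)
      (by rw [evA_src, mul_tgt, eS, eS', e]) eT,
      comp_idn eT.symm]
  have h₄ : (T' * ((S' * S).comp (evA a S.src) * T)).comp (T' * T) =
      T' * ((S' * S).comp (evA a S.src) * T) := by
    rw [mul_comp_mul eT' (by rw [eT.symm, mul_tgt, comp_tgt, evA_tgt, zero_add]), hT', h₁]
  have h₅ : T' * ((S' * S * T).comp (evA a S.src * idn a T.src)) =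
      (T' * S' * (S * T)).comp (idn a T.src * (evA a S.src * idn a T.src)) := by
    rw [mul_assoc T', ← mul_assoc S', mul_comp_mul (x := T') (x' := idn a T.src)
      (by rw [eT', e', idn_src]) (by
        simp only [mul_tgt, mul_src, evA_src, eS, eS', eT, idn_src, e]), comp_idn (by rw [eT', e'])]
  have h₆ : (T' * S' * (S * T)).comp (T' * S' * (S * T)) = T' * S' * (S * T) := by
    rw [mul_comp_mul (by rw [mul_tgt, mul_src, eS', eT']) (by rw [mul_tgt, mul_src, eS, eT]),
      mul_comp_mul eS eT, mul_comp_mul eT' eS', hS, hT, hS', hT']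
  rw [h₁, h₂, ← comp_assoc (T' * _), h₄, h₃, h₅, comp_assoc, ← comp_assoc (T' * S' * (S * T)),
    h₆, ← evA_add, mul_src,
    add_comm]

end TL.Arr

namespace RepCat

open TL TL.Arr UqMod SimpleModule

variable {q a : ℂˣ} (hq : q = a ^ 2)

/-- A tensor product of the modules `V_n` as the image of the tensor product of the Jones-Wenzl
idempotents. -/
def word : (W : RepWord q) → Summand (rep hq) W.toMod
  | .unit => Summand.unit
  | .simple n => summand (sub_ne_zero_of_mem n.2) hq (isRegular_of_mem n.2)
  | .tensor W W' => (word W).tensor (word W')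

/-- The tensor product of Jones-Wenzl idempotents. -/
def wordE (W : RepWord q) : Arr (a : ℂ) := of (word hq W).e

theorem wordE_idem (W : RepWord q) : (wordE hq W).comp (wordE hq W) = wordE hq W :=
  (of_comp _ _).symm.trans (congrArg of (word hq W).idem)

theorem wordE_tgt (W : RepWord q) : (wordE hq W).tgt = (wordE hq W).src := rfl

theorem wordE_tensor (W W' : RepWord q) :
    wordE hq (.tensor W W') = wordE hq W * wordE hq W' := Summand.of_tensor_e _ _

theorem wordE_dual (W : RepWord q) : IsMate (wordE hq W) (wordE hq W.dual) := by
  induction W with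
  | unit => exact isMate_idn 0
  | simple n => exact (jw_spec (a := (a : ℂ)) (q := q) (by rw [hq]; simp) (sub_ne_zero_of_mem n.2)
      (isRegular_of_mem n.2)).isMate_self
  | tensor W W' h h' =>
    rw [RepWord.dual, wordE_tensor, wordE_tensor]
    exact h.mul h'

theorem rep_braidSimple (n : SimpleIndex q) (W : RepWord q) :
    ((word hq (.simple n)).tensor (word hq W)).Rep ((word hq W).tensor (word hq (.simple n)))
      (braidSimple hq n W) ((wordE hq (.simple n) * wordE hq W).comp
        (braidA (a : ℂ) (wordE hq (.simple n)).src (wordE hq W).src)) := by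
  have ha : (a : ℂ) ≠ 0 := a.ne_zero
  induction W with
  | unit =>
    have h := (Summand.rep_rightUnitor (word hq (.simple n))).comp
      (Summand.rep_leftUnitor_inv (word hq (.simple n)))
    have e : (wordE hq (.simple n)).comp (wordE hq (.simple n)) =
        (wordE hq (.simple n) * 1).comp (braidA (a : ℂ) (wordE hq (.simple n)).src 0) := by
      rw [wordE_idem, mul_one, braidA_zero_right]; exact (comp_idn rfl).symm
    exact e ▸ h
  | simple m =>
    have h := rep_braiding (sub_ne_zero_of_mem n.2) hq (isRegular_of_mem n.2)
      (isRegular_of_mem m.2) (braidSimple hq n (.simple m)) (braiding_vec a n m)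
    have h₁ := mul_comp_braidA ha (wordE hq (.simple n)) (wordE hq (.simple m))
    have h₂ := wordE_idem hq (.tensor (.simple n) (.simple m))
    rw [wordE_tensor] at h₂
    have e : (wordE hq (.simple n) * wordE hq (.simple m)).comp ((braidA (a : ℂ)
        (wordE hq (.simple n)).src (wordE hq (.simple m)).src).comp
        (wordE hq (.simple m) * wordE hq (.simple n))) =
        (wordE hq (.simple n) * wordE hq (.simple m)).comp
        (braidA (a : ℂ) (wordE hq (.simple n)).src (wordE hq (.simple m)).src) := by
      rw [wordE_tgt, wordE_tgt] at h₁
      rw [← h₁, ← comp_assoc, h₂]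
    exact e ▸ h
  | tensor W W' h h' =>
    have h₁ := (Summand.rep_associator_inv (word hq (.simple n)) (word hq W) (word hq W')).comp
      ((h.whiskerRight (word hq W')).comp ((Summand.rep_associator (word hq W)
        (word hq (.simple n)) (word hq W')).comp ((h'.whiskerLeft (word hq W)).comp
          (Summand.rep_associator_inv (word hq W) (word hq W') (word hq (.simple n))))))
    have e := hexagon_right ha (wordE_idem hq (.simple n)) (wordE_idem hq W) (wordE_idem hq W')
      rfl rfl rfl
    have h₁ := e.symm ▸ h₁
    rw [wordE_tensor, ← mul_assoc]
    exact h₁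

theorem rep_braid (W W' : RepWord q) :
    ((word hq W).tensor (word hq W')).Rep ((word hq W').tensor (word hq W))
      (braid hq W W') ((wordE hq W * wordE hq W').comp
        (braidA (a : ℂ) (wordE hq W).src (wordE hq W').src)) := by
  have ha : (a : ℂ) ≠ 0 := a.ne_zero
  induction W with
  | unit =>
    have h := (Summand.rep_leftUnitor (word hq W')).comp (Summand.rep_rightUnitor_inv (word hq W'))
    have e : (wordE hq W').comp (wordE hq W') =
        (1 * wordE hq W').comp (braidA (a : ℂ) 0 (wordE hq W').src) := by
      rw [wordE_idem, one_mul, braidA_zero_left]; exact (comp_idn rfl).symm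
    exact e ▸ h
  | simple n => exact rep_braidSimple hq n W'
  | tensor U W h h' =>
    have h₁ := (Summand.rep_associator (word hq U) (word hq W) (word hq W')).comp
      ((h'.whiskerLeft (word hq U)).comp ((Summand.rep_associator_inv (word hq U)
        (word hq W') (word hq W)).comp ((h.whiskerRight (word hq W)).comp
          (Summand.rep_associator (word hq W') (word hq U) (word hq W)))))
    have e := hexagon_left ha (wordE_idem hq U) (wordE_idem hq W) (wordE_idem hq W')
      rfl rfl rfl
    have h₁ := e.symm ▸ h₁
    rw [wordE_tensor]
    exact h₁

theorem wordE_comp_twistA (W : RepWord q) : (wordE hq W).comp (twistA (a : ℂ) (wordE hq W).src) =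
    (twistA (a : ℂ) (wordE hq W).src).comp (wordE hq W) := isTwistNat a.ne_zero (wordE hq W)

theorem rep_twist (W : RepWord q) : (word hq W).Rep (word hq W) (twist hq W)
    ((twistA (a : ℂ) (wordE hq W).src).comp (wordE hq W)) := by
  have ha : (a : ℂ) ≠ 0 := a.ne_zero
  induction W with
  | unit =>
    have e : (1 : Arr (a : ℂ)) = (twistA (a : ℂ) 0).comp 1 := by
      rw [twistA_zero]; exact (comp_idn (n := 0) rfl).symm
    exact e ▸ Summand.rep_id _
  | simple n =>
    have h := UqMod.rep_twist (sub_ne_zero_of_mem n.2) hq (isRegular_of_mem n.2)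
    have e : (wordE hq (.simple n)).comp ((twistA (a : ℂ) (wordE hq (.simple n)).src).comp
        (wordE hq (.simple n))) =
        (twistA (a : ℂ) (wordE hq (.simple n)).src).comp (wordE hq (.simple n)) := by
      rw [← wordE_comp_twistA, ← comp_assoc, wordE_idem]
    exact e ▸ h
  | tensor W W' h h' =>
    have h₁ := (h.tensor h').comp ((rep_braid hq W W').comp (rep_braid hq W' W))
    have e₁ : (wordE hq W * wordE hq W').comp (braidA (a : ℂ) (wordE hq W).src (wordE hq W').src) =
      _ := mul_comp_braidA ha (wordE hq W) (wordE hq W')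
    have e₂ : (wordE hq W' * wordE hq W).comp (braidA (a : ℂ) (wordE hq W').src (wordE hq W).src) =
      _ := mul_comp_braidA ha (wordE hq W') (wordE hq W)
    have hi := wordE_idem hq (.tensor W W')
    rw [wordE_tensor] at hi
    have e : ((twistA (a : ℂ) (wordE hq W).src).comp (wordE hq W) *
        (twistA (a : ℂ) (wordE hq W').src).comp (wordE hq W')).comp
        (((wordE hq W * wordE hq W').comp (braidA (a : ℂ) (wordE hq W).src (wordE hq W').src)).comp
        ((wordE hq W' * wordE hq W).comp (braidA (a : ℂ) (wordE hq W').src (wordE hq W).src))) =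
        (twistA (a : ℂ) (wordE hq (.tensor W W')).src).comp (wordE hq (.tensor W W')) := by
      rw [wordE_tensor, mul_src, twistA_add ha, ← mul_comp_mul (by rfl) (by rfl)]
      simp only [comp_assoc]
      rw [e₂, comp_reassoc e₁, comp_reassoc e₂, hi, comp_reassoc e₁, comp_reassoc e₂, hi]
    exact e ▸ h₁

/-- The scalar by which the coevaluation of a tensor product differs from nested cups. -/
def scalar : RepWord q → ℂ
  | .unit => 1
  | .simple n => qfac q n
  | .tensor W W' => scalar W * scalar W'

theorem scalar_ne_zero (W : RepWord q) : scalar W ≠ 0 := by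
  induction W with
  | unit => exact one_ne_zero
  | simple n => exact qfac_ne_zero (isRegular_of_mem n.2)
  | tensor W W' h h' => exact mul_ne_zero h h'

theorem wordE_dual_src (W : RepWord q) : (wordE hq W.dual).src = (wordE hq W).src :=
  (wordE_dual hq W).src_eq

theorem rep_coev (W : RepWord q) : (Summand.unit).Rep ((word hq W).tensor (word hq W.dual)) (coev W)
    (scalar W • (coevA (a : ℂ) (wordE hq W).src).comp (wordE hq W * wordE hq W.dual)) := by
  induction W with
  | unit =>
    have e : (1 : Arr (a : ℂ)) = (1 : ℂ) • (coevA (a : ℂ) 0).comp (1 * 1) := by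
      rw [one_smul', coevA_zero, one_mul]; exact (comp_idn (n := 0) rfl).symm
    exact e ▸ Summand.rep_leftUnitor_inv (F := rep hq) Summand.unit
  | simple n => exact UqMod.rep_coev (sub_ne_zero_of_mem n.2) hq (isRegular_of_mem n.2)
  | tensor W W' h h' =>
    have h₁ := h.comp ((((Summand.rep_leftUnitor_inv (word hq W.dual)).comp
      ((h'.whiskerRight (word hq W.dual)).comp (Summand.rep_associator (word hq W')
        (word hq W'.dual) (word hq W.dual)))).whiskerLeft (word hq W)).comp
      (Summand.rep_associator_inv (word hq W) (word hq W')
        ((word hq W'.dual).tensor (word hq W.dual))))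
    rw [Summand.of_tensor_e] at h₁
    have e := coevA_tensor (wordE_idem hq W) (wordE_idem hq W.dual) (wordE_idem hq W')
      (wordE_idem hq W'.dual) rfl rfl rfl rfl (wordE_dual_src hq W) (wordE_dual_src hq W')
    rw [← wordE_tensor, ← wordE_tensor] at e
    have h₁ : Summand.unit.Rep ((word hq (.tensor W W')).tensor (word hq (RepWord.tensor W W').dual))
      (coev (.tensor W W')) ((scalar W • (coevA (a : ℂ) (wordE hq W).src).comp
        (wordE hq W * wordE hq W.dual)).comp ((wordE hq W * ((wordE hq W.dual).comp
        (((scalar W' • (coevA (a : ℂ) (wordE hq W').src).comp (wordE hq W' * wordE hq W'.dual)) *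
          wordE hq W.dual).comp (wordE hq W' * wordE hq W'.dual * wordE hq W.dual)))).comp
        (wordE hq W * wordE hq W' * (wordE hq W'.dual * wordE hq W.dual)))) := h₁
    rw [smul_mul, smul_comp, smul_comp, comp_smul, mul_smul', smul_comp, comp_smul,
      smul_smul'] at h₁
    rw [← wordE_tensor, ← wordE_tensor] at h₁
    exact e ▸ h₁

theorem rep_ev (W : RepWord q) : ((word hq W.dual).tensor (word hq W)).Rep Summand.unit (ev W)
    ((scalar W)⁻¹ • (wordE hq W.dual * wordE hq W).comp (evA (a : ℂ) (wordE hq W).src)) := by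
  induction W with
  | unit =>
    have e : (1 : Arr (a : ℂ)) = (1 : ℂ)⁻¹ • ((1 : Arr (a : ℂ)) * 1).comp (evA (a : ℂ) 0) := by
      rw [inv_one, one_smul', evA_zero, one_mul]; exact (comp_idn (n := 0) rfl).symm
    exact e ▸ Summand.rep_leftUnitor (F := rep hq) Summand.unit
  | simple n => exact UqMod.rep_ev (sub_ne_zero_of_mem n.2) hq (isRegular_of_mem n.2)
  | tensor W W' h h' =>
    have h₁ := (Summand.rep_associator (word hq W'.dual) (word hq W.dual)
        ((word hq W).tensor (word hq W'))).comp
      ((((Summand.rep_associator_inv (word hq W.dual) (word hq W) (word hq W')).comp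
      ((h.whiskerRight (word hq W')).comp
        (Summand.rep_leftUnitor (word hq W')))).whiskerLeft (word hq W'.dual)).comp h')
    rw [Summand.of_tensor_e] at h₁
    have e := evA_tensor (wordE_idem hq W) (wordE_idem hq W.dual) (wordE_idem hq W')
      (wordE_idem hq W'.dual) rfl rfl rfl rfl (wordE_dual_src hq W) (wordE_dual_src hq W')
    rw [← wordE_tensor, ← wordE_tensor] at e
    have h₁ : ((word hq (RepWord.tensor W W').dual).tensor (word hq (.tensor W W'))).Rep Summand.unit
      (ev (.tensor W W')) ((wordE hq W'.dual * wordE hq W.dual * (wordE hq W * wordE hq W')).comp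
        ((wordE hq W'.dual * ((wordE hq W.dual * wordE hq W * wordE hq W').comp
        ((((scalar W)⁻¹ • (wordE hq W.dual * wordE hq W).comp (evA (a : ℂ) (wordE hq W).src)) *
          wordE hq W').comp (wordE hq W')))).comp
        ((scalar W')⁻¹ • (wordE hq W'.dual * wordE hq W').comp (evA (a : ℂ) (wordE hq W').src)))) := h₁
    simp only [smul_mul, smul_comp, comp_smul, mul_smul',
      smul_smul'] at h₁
    rw [← mul_inv, mul_comm (scalar W')] at h₁
    rw [← wordE_tensor, ← wordE_tensor] at h₁
    exact e ▸ h₁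

/-- The presentation of the morphisms between tensor products of simple modules by elements of the
Temperley-Lieb category. -/
def realization : Realization (a : ℂ) (ribbonData hq) where
  E := wordE hq
  Rep {X Y} f x := (word hq X).Rep (word hq Y) f.hom x
  κ := scalar
  κ' W := (scalar W)⁻¹
  κ_mul W := mul_inv_cancel₀ (scalar_ne_zero W)
  E_idem := wordE_idem hq
  E_tgt _ := rfl
  E_tensor := wordE_tensor hq
  E_unit := rfl
  E_dual := wordE_dual hq
  src := by rintro X Y f x ⟨g, rfl, -⟩; rfl
  tgt := by rintro X Y f x ⟨g, rfl, -⟩; rfl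
  left := by
    rintro X Y f x ⟨g, rfl, h, -⟩
    exact (of_comp _ _).symm.trans (congrArg of h)
  right := by
    rintro X Y f x ⟨g, rfl, -, h, -⟩
    exact (of_comp _ _).symm.trans (congrArg of h)
  unique h h' := InducedCategory.hom_ext (h.unique h')
  exists_rep X Y x hs ht := by
    obtain ⟨m, n, g⟩ := x
    obtain rfl : m = (word hq X).X.strands := hs
    obtain rfl : n = (word hq Y).X.strands := ht
    exact ⟨InducedCategory.homMk _, Summand.rep_hat (word hq X) (word hq Y) g rfl⟩
  id X := Summand.rep_id _
  comp h h' := h.comp h'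
  tensor h h' := h.tensor h'
  add h h' := h.add h'
  smul c _ _ h := h.smul c
  associator_hom X Y Z := Summand.rep_associator _ _ _
  leftUnitor_hom X := Summand.rep_leftUnitor _
  rightUnitor_hom X := Summand.rep_rightUnitor _
  braiding := rep_braid hq
  twist X := (wordE_comp_twistA hq X).symm ▸ rep_twist hq X
  coev X := by
    have h := rep_coev hq X
    rw [(wordE_dual hq X).coevA_comp_mul (wordE_idem hq X) rfl] at h
    exact h
  ev X := by
    have h := rep_ev hq X
    rw [(wordE_dual hq X).mul_comp_evA (wordE_idem hq X) rfl] at h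
    exact h

end RepCat

/-! ### The quantum trace is the trace twisted by the action of `K` -/

namespace UqMod

open SimpleModule

variable {q : ℂˣ} {M N P V V' : UqMod q}

theorem exists_eq_smul_unit (u : (𝟙_ (UqMod q)).V) : ∃ c : ℂ, u = c • unit :=
  ⟨u, (mul_one (M := ℂ) u).symm⟩

/-- The trace of an endomorphism composed with the action of `K`. -/
def ktrace (f : M ⟶ M) : ℂ := LinearMap.trace ℂ M.V (actK M ∘ₗ app f)

theorem ktrace_comm [Module.Finite ℂ M.V] [Module.Finite ℂ N.V] (f : M ⟶ N) (g : N ⟶ M) :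
    ktrace (f ≫ g) = ktrace (g ≫ f) := by
  have h : actK M ∘ₗ app (f ≫ g) = app g ∘ₗ (actK N ∘ₗ app f) :=
    LinearMap.ext fun x => (app_actK g (app f x)).symm
  have h' : actK N ∘ₗ app (g ≫ f) = (actK N ∘ₗ app f) ∘ₗ app g := rfl
  rw [ktrace, ktrace, h, h', LinearMap.trace_comp_comm']

/-- If `t` is a tensor and `e` a pairing, then contracting the tensor with the pairing composed with `L`
amounts to the trace of the operator which they define. -/
theorem contract_eq_trace [Module.Finite ℂ M.V] (e : N ⊗ M ⟶ 𝟙_ (UqMod q)) (L : M.V →ₗ[ℂ] M.V)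
    (E : (M ⊗ N).V →ₗ[ℂ] (𝟙_ (UqMod q)).V) (hE : ∀ x φ, E (tm x φ) = app e (tm φ (L x)))
    (t : (M ⊗ N).V) :
    E t = LinearMap.trace ℂ M.V ((app ((α_ M N M).hom ≫ M ◁ e ≫ (ρ_ M).hom) ∘ₗ
      TensorProduct.mk ℂ (M ⊗ N).V M.V t) ∘ₗ L) • unit := by
  induction t using TensorProduct.induction_on with
  | zero => rw [map_zero, map_zero, LinearMap.comp_zero, LinearMap.zero_comp, map_zero, zero_smul]
  | add t t' h h' => rw [map_add, map_add, LinearMap.comp_add, LinearMap.add_comp, map_add, add_smul, h, h']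
  | tmul x φ =>
    let l : M.V →ₗ[ℂ] ℂ := (app e ∘ₗ TensorProduct.mk ℂ N.V M.V φ) ∘ₗ L
    -- The operator has rank one.
    have h : (app ((α_ M N M).hom ≫ M ◁ e ≫ (ρ_ M).hom) ∘ₗ
        TensorProduct.mk ℂ (M ⊗ N).V M.V (tm x φ)) ∘ₗ L = dualTensorHom ℂ M.V M.V (l ⊗ₜ x) := rfl
    refine (hE x φ).trans (Eq.trans ?_ (congrArg (fun g => LinearMap.trace ℂ M.V g • unit) h).symm)
    refine Eq.trans ?_ (congrArg (· • unit) (LinearMap.trace_eq_contract_apply ℂ M.V (l ⊗ₜ x))).symm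
    exact (mul_one (l x)).symm

theorem pairing_ext {f : (M ⊗ N) ⊗ (V ⊗ V') ⟶ P} {g : (V ⊗ V') ⊗ (M ⊗ N) ⟶ P}
    (h : ∀ x x' φ' φ, app f (tm (tm x x') (tm φ' φ)) =
      app g (tm (tm φ' φ) (actK (M ⊗ N) (tm x x')))) (x : (M ⊗ N).V) (φ : (V ⊗ V').V) :
    app f (tm x φ) = app g (tm φ (actK _ x)) := by
  induction x using TensorProduct.induction_on with
  | zero => rw [zero_tm, map_zero, map_zero, tm_zero, map_zero]
  | add t t' h h' => rw [add_tm, map_add, map_add, tm_add, map_add, h, h']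
  | tmul x x' =>
    induction φ using TensorProduct.induction_on with
    | zero => rw [tm_zero, zero_tm, map_zero, map_zero]
    | add t t' h h' => rw [tm_add, add_tm, map_add, map_add, h, h']
    | tmul φ' φ => exact h x x' φ' φ

/-- The partial trace over `V`. -/
def ptrace (c : 𝟙_ (UqMod q) ⟶ V ⊗ V') (d : V ⊗ V' ⟶ 𝟙_ (UqMod q)) (h : M ⊗ V ⟶ M ⊗ V) : M ⟶ M :=
  (ρ_ M).inv ≫ M ◁ c ≫ (α_ M V V').inv ≫ h ▷ V' ≫ (α_ M V V').hom ≫ M ◁ d ≫ (ρ_ M).hom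

theorem ptrace_whiskerRight_comp (c : 𝟙_ (UqMod q) ⟶ V ⊗ V') (d : V ⊗ V' ⟶ 𝟙_ (UqMod q))
    (e : M ⟶ M) (h : M ⊗ V ⟶ M ⊗ V) : ptrace c d (e ▷ V ≫ h) = e ≫ ptrace c d h := by
  unfold ptrace
  rw [comp_whiskerRight]
  simp only [Category.assoc]
  rw [rightUnitor_inv_naturality_assoc, ← whisker_exchange_assoc,
    associator_inv_naturality_left_assoc]

/-- The kernel of `X` on `V_m` is spanned by the highest weight vector. -/
theorem simple_hom_vec_zero {n m : ℕ} (hm : IsRegular q m) (f : simple q n ⟶ simple q m) :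
    ∃ c : ℂ, app f (wt q n 0) = c • wt q m 0 := by
  have hX : SimpleModule.X q m (app f (wt q n 0)) = 0 := by
    have h := LinearMap.congr_fun (f.comm (Uq.X q)) (wt q n 0)
    have h₁ : (simple q n).ρ (Uq.X q) (wt q n 0) = 0 :=
      (LinearMap.congr_fun (action_X q n) _).trans (X_vec_zero q n)
    have h₂ := LinearMap.congr_fun (action_X q m) (app f (wt q n 0))
    refine h₂.symm.trans (Eq.trans h.symm ?_)
    exact (congrArg (app f) h₁).trans (map_zero _)
  generalize app f (wt q n 0) = u at hX
  change Fin (m + 1) → ℂ at u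
  have key : ∀ j (hj : j < m), u ⟨j + 1, by omega⟩ = 0 := by
    intro j hj
    have h : (LinearMap.proj (R := ℂ) (φ := fun _ : Fin (m + 1) => ℂ) ⟨j, by omega⟩) ∘ₗ SimpleModule.X q m =
        (qint q (j + 1 : ℕ) * qint q (m - j : ℕ)) •
          (LinearMap.proj (R := ℂ) (φ := fun _ : Fin (m + 1) => ℂ) ⟨j + 1, by omega⟩) := by
      refine vec_ext fun k => ?_
      rw [LinearMap.comp_apply, X_vec, map_smul, LinearMap.smul_apply, LinearMap.proj_apply,
        LinearMap.proj_apply]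
      by_cases hk : k = j + 1
      · subst hk
        rw [Nat.add_sub_cancel, vec, vec, dif_pos (by omega), dif_pos (by omega), Pi.single_eq_same,
          Pi.single_eq_same]
        congr 3
        push_cast [Nat.cast_sub hj.le]; ring
      · have h₀ : vec m k ⟨j + 1, by omega⟩ = 0 := by
          unfold vec
          split_ifs
          · exact Pi.single_eq_of_ne (by simpa [Fin.ext_iff] using Ne.symm hk) _
          · rfl
        rw [h₀, smul_zero]
        obtain _ | k := k
        · rw [Nat.cast_zero, qint_zero, zero_mul, zero_smul]
        · have h₁ : vec m k ⟨j, by omega⟩ = 0 := by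
            unfold vec
            split_ifs
            · exact Pi.single_eq_of_ne (by simp only [ne_eq, Fin.ext_iff]; omega) _
            · rfl
          rw [Nat.add_sub_cancel, h₁, smul_zero]
    have h := LinearMap.congr_fun h u
    rw [LinearMap.comp_apply, hX, map_zero, LinearMap.smul_apply] at h
    refine (smul_eq_zero.1 h.symm).resolve_left (mul_ne_zero (hm _ (by omega) (by omega)) (hm _ (by omega) (by omega)))
  refine ⟨u 0, funext fun i => ?_⟩
  change u i = (u 0 • vec m 0) i
  obtain ⟨_ | i, hi⟩ := i
  · simp [vec]
  · rw [key i (by omega), Pi.smul_apply, vec, dif_pos (by omega),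
      Pi.single_eq_of_ne (by simp [Fin.ext_iff]), smul_zero]

/-- The endomorphisms of `V_n` are scalars. -/
theorem simple_end {n : ℕ} (hn : IsRegular q n) (f : simple q n ⟶ simple q n) :
    ∃ c : ℂ, f = c • 𝟙 _ := by
  obtain ⟨c, h⟩ := simple_hom_vec_zero hn f
  exact ⟨c, simple_hom_ext h⟩

/-- There are no nonzero morphisms between different simple modules: the highest weights `q ^ n` and
`q ^ m` differ for indices in `SimpleIndex q`. -/
theorem simple_hom_eq_zero {n m : ℕ} (hn : n ∈ SimpleIndex q) (hm : m ∈ SimpleIndex q) (hnm : n ≠ m)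
    (f : simple q n ⟶ simple q m) : f = 0 := by
  obtain ⟨c, h⟩ := simple_hom_vec_zero (isRegular_of_mem hm) f
  refine simple_hom_ext (h.trans ?_)
  by_cases hc : c = 0
  · rw [hc, zero_smul]; rfl
  have h₁ := app_actK f (wt q n 0)
  rw [actK_wt, map_smul, h, map_smul, actK_wt, smul_smul, smul_smul, mul_comm c] at h₁
  have h₂ := congrFun (f := (_ : Fin (m + 1) → ℂ)) h₁ 0
  have h₃ : wt q m 0 (0 : Fin (m + 1)) = 1 := by
    change vec m 0 0 = 1
    simp [vec]
  have h₄ : (q : ℂ) ^ ((n : ℤ) - 2 * (0 : ℕ)) * c * wt q m 0 (0 : Fin (m + 1)) =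
    (q : ℂ) ^ ((m : ℤ) - 2 * (0 : ℕ)) * c * wt q m 0 (0 : Fin (m + 1)) := h₂
  rw [h₃, mul_one, mul_one] at h₄
  have h₅ := mul_right_cancel₀ hc h₄
  simp only [Nat.cast_zero, mul_zero, sub_zero, zpow_natCast] at h₅
  exfalso
  have key : ∀ {k l : ℕ}, l ∈ SimpleIndex q → k < l → (q : ℂ) ^ k ≠ (q : ℂ) ^ l := by
    intro k l hl hkl e
    have e' : (q : ℂ) ^ (l - k) = 1 := by
      refine mul_left_cancel₀ (pow_ne_zero k q.ne_zero) ?_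
      rw [← pow_add, Nat.add_sub_cancel' hkl.le, mul_one, e]
    have := hl (l - k) (by omega) (by rw [mul_comm, pow_mul, e', one_pow])
    omega
  rcases lt_or_gt_of_ne hnm with h | h
  · exact key hm h h₅
  · exact key hn h h₅.symm

/-- The quantum dimension of `V_n`. -/
theorem ktrace_id_simple (hD : (q : ℂ) - (q : ℂ)⁻¹ ≠ 0) (n : ℕ) :
    ktrace (𝟙 (simple q n)) = qint q ((n + 1 : ℕ) : ℤ) := by
  have h₁ : ktrace (𝟙 (simple q n)) = ∑ i ∈ Finset.range (n + 1), (q : ℂ) ^ ((n : ℤ) - 2 * i) := by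
    have : ktrace (𝟙 (simple q n)) = LinearMap.trace ℂ (Fin (n + 1) → ℂ) (SimpleModule.K q n) :=
      congrArg (LinearMap.trace ℂ (Fin (n + 1) → ℂ)) (action_K q n)
    rw [this, LinearMap.trace_eq_matrix_trace ℂ (Pi.basisFun ℂ _), Matrix.trace, Finset.sum_range]
    refine Finset.sum_congr rfl fun i _ => ?_
    rw [Matrix.diag_apply, LinearMap.toMatrix_apply, ← vec_fin, K_vec, map_smul, vec_fin]
    simp
  have h₂ : ∀ i : ℕ, (q : ℂ) ^ ((n : ℤ) - 2 * i) * ((q : ℂ) - (q : ℂ)⁻¹) =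
      (q : ℂ) ^ ((n : ℤ) + 1 - 2 * i) - (q : ℂ) ^ ((n : ℤ) + 1 - 2 * (i + 1 : ℕ)) := by
    intro i
    have e₁ : (n : ℤ) + 1 - 2 * i = (n - 2 * i) + 1 := by ring
    have e₂ : (n : ℤ) + 1 - 2 * (i + 1 : ℕ) = (n - 2 * i) - 1 := by push_cast; ring
    rw [e₁, e₂, zpow_add_one₀ q.ne_zero, zpow_sub_one₀ q.ne_zero, mul_sub]
  rw [h₁, qint, eq_div_iff hD, Finset.sum_mul, Finset.sum_congr rfl fun i _ => h₂ i,
    Finset.sum_range_sub']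
  congr 2
  push_cast; ring

end UqMod

namespace RepCat

open TL TL.Arr UqMod SimpleModule

variable {q a : ℂˣ} (hq : q = a ^ 2)

instance finite_toMod (W : RepWord q) : Module.Finite ℂ W.toMod.V := by
  induction W with
  | unit => exact inferInstanceAs (Module.Finite ℂ ℂ)
  | simple n => exact inferInstanceAs (Module.Finite ℂ (Fin (n + 1) → ℂ))
  | tensor W W' h h' => exact inferInstanceAs (Module.Finite ℂ (TensorProduct ℂ W.toMod.V W'.toMod.V))

/-- The right evaluation. -/
def rightEv (W : RepWord q) : W.toMod ⊗ W.dual.toMod ⟶ 𝟙_ (UqMod q) :=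
  twist hq W ▷ W.dual.toMod ≫ braid hq W W.dual ≫ ev W

theorem wordE_dual_dual (W : RepWord q) : wordE hq W.dual.dual = wordE hq W := by
  congr 1
  induction W with
  | unit => rfl
  | simple n => rfl
  | tensor W W' h h' => rw [RepWord.dual, RepWord.dual, h, h']

theorem rep_rightEv (W : RepWord q) : ((word hq W).tensor (word hq W.dual)).Rep Summand.unit
    (rightEv hq W) (((-1) ^ (wordE hq W).src * (scalar W)⁻¹) •
      (wordE hq W * wordE hq W.dual).comp (evA (a : ℂ) (wordE hq W).src)) := by
  have h := (realization hq).rightEv a.ne_zero W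
  have h₁ : ((word hq W).tensor (word hq W.dual)).Rep Summand.unit
    (rightEv hq W) (((-1) ^ (wordE hq W).src * (scalar W)⁻¹) •
      (wordE hq W * idn (a : ℂ) (wordE hq W).src).comp (evA (a : ℂ) (wordE hq W).src)) := h
  have e := (wordE_dual hq W.dual).mul_comp_evA (wordE_idem hq W.dual) rfl
  have e' := (wordE_dual hq W.dual).ev_eq
  rw [wordE_tgt] at e'
  rw [← e', wordE_dual_dual, wordE_dual_src] at e
  rwa [e]

theorem rightEv_tensor (W W' : RepWord q) : rightEv hq (.tensor W W') =
    (α_ W.toMod W'.toMod (W'.dual.toMod ⊗ W.dual.toMod)).hom ≫ W.toMod ◁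
      ((α_ W'.toMod W'.dual.toMod W.dual.toMod).inv ≫ rightEv hq W' ▷ W.dual.toMod ≫
        (λ_ W.dual.toMod).hom) ≫ rightEv hq W := by
  have h₁ := (Summand.rep_associator (word hq W) (word hq W')
        ((word hq W'.dual).tensor (word hq W.dual))).comp
      ((((Summand.rep_associator_inv (word hq W') (word hq W'.dual) (word hq W.dual)).comp
      (((rep_rightEv hq W').whiskerRight (word hq W.dual)).comp
        (Summand.rep_leftUnitor (word hq W.dual)))).whiskerLeft (word hq W)).comp (rep_rightEv hq W))
  rw [Summand.of_tensor_e] at h₁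
  have e := evA_tensor (wordE_idem hq W'.dual) (wordE_idem hq W') (wordE_idem hq W.dual)
      (wordE_idem hq W) rfl rfl rfl rfl (wordE_dual_src hq W').symm (wordE_dual_src hq W).symm
  rw [mul_src, wordE_dual_src, wordE_dual_src, ← wordE_tensor, ← wordE_tensor] at e
  have h₁ : ((word hq (.tensor W W')).tensor (word hq (RepWord.tensor W W').dual)).Rep Summand.unit
      _ ((wordE hq W * wordE hq W' * (wordE hq W'.dual * wordE hq W.dual)).comp
        ((wordE hq W * ((wordE hq W' * wordE hq W'.dual * wordE hq W.dual).comp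
        (((((-1) ^ (wordE hq W').src * (scalar W')⁻¹) • (wordE hq W' * wordE hq W'.dual).comp
          (evA (a : ℂ) (wordE hq W').src)) * wordE hq W.dual).comp (wordE hq W.dual)))).comp
        (((-1) ^ (wordE hq W).src * (scalar W)⁻¹) • (wordE hq W * wordE hq W.dual).comp
          (evA (a : ℂ) (wordE hq W).src)))) := h₁
  simp only [smul_mul, smul_comp, comp_smul, mul_smul', smul_smul'] at h₁
  rw [← wordE_tensor, ← wordE_tensor, e] at h₁
  have h₂ := rep_rightEv hq (.tensor W W')
  have e₂ : (wordE hq (.tensor W W')).src = (wordE hq W').src + (wordE hq W).src := by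
    rw [wordE_tensor, mul_src, add_comm]
  rw [e₂, scalar, mul_inv, pow_add, mul_comm ((-1) ^ (wordE hq W').src), mul_mul_mul_comm] at h₂
  exact h₂.unique h₁

/-- The right evaluation is the left one with the action of `K` inserted: on `V_n` this is a
comparison of coefficients, and both sides are multiplicative. -/
theorem app_rightEv (W : RepWord q) (x : W.toMod.V) (φ : W.dual.toMod.V) :
    app (rightEv hq W) (tm x φ) = app (ev W) (tm φ (actK _ x)) := by
  induction W with
  | unit =>
    have h := rep_rightEv hq (.unit : RepWord q)
    have e : (wordE hq (.unit : RepWord q)).src = 0 := rfl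
    rw [e, pow_zero, one_mul] at h
    rw [h.unique (rep_ev hq .unit)]
    obtain ⟨c, rfl⟩ := exists_eq_smul_unit x
    obtain ⟨d, rfl⟩ := exists_eq_smul_unit φ
    exact (mul_comm (c * 1) (d * 1)).trans (congrArg (fun y => app (ev (.unit : RepWord q))
      (tm (d • unit) y)) (actK_unit (c • unit))).symm
  | simple n =>
    have h := (rep_ev hq (.simple n)).smul ((-1) ^ (n : ℕ))
    rw [smul_smul'] at h
    rw [(rep_rightEv hq (.simple n)).unique h]
    change (-1 : ℂ) ^ (n : ℕ) • app (evS q n) (tm x φ) = app (evS q n) (tm φ (actK _ x))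
    revert φ x
    suffices h : ∀ i j, (-1 : ℂ) ^ (n : ℕ) • app (evS q n) (tm (wt q n i) (wt q n j)) =
        app (evS q n) (tm (wt q n j) (actK _ (wt q n i))) by
      intro x φ
      have h₁ : ∀ i, ((-1 : ℂ) ^ (n : ℕ) • app (evS q n)) ∘ₗ TensorProduct.mk ℂ _ _ (wt q n i) =
          (app (evS q n)) ∘ₗ (TensorProduct.mk ℂ (simple q n).V (simple q n).V).flip
            (actK _ (wt q n i)) := fun i => simple_ext (h i)
      have h₂ : ((-1 : ℂ) ^ (n : ℕ) • app (evS q n)) ∘ₗ (TensorProduct.mk ℂ _ _).flip φ =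
          ((app (evS q n)) ∘ₗ (TensorProduct.mk ℂ (simple q n).V (simple q n).V φ)) ∘ₗ actK _ :=
        simple_ext fun i => LinearMap.congr_fun (h₁ i) φ
      exact LinearMap.congr_fun h₂ x
    intro i j
    rw [actK_wt, tm_smul, map_smul, app_evS, app_evS]
    by_cases hij : i + j = n
    · rw [if_pos hij, if_pos (by omega), smul_smul, smul_smul]
      congr 1
      rw [← hij, mul_left_comm ((q : ℂ) ^ _), ← zpow_add₀ q.ne_zero, ← mul_assoc, ← pow_add]
      congr 1
      · rw [show i + j + i = j + 2 * i by ring, pow_add, pow_mul, neg_one_sq, one_pow, mul_one]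
      · congr 1; push_cast; ring
    · rw [if_neg hij, if_neg (by omega), zero_smul, smul_zero, smul_zero]
  | tensor W W' h h' =>
    rw [rightEv_tensor]
    refine pairing_ext (fun x x' φ' φ => ?_) x φ
    obtain ⟨c, hc⟩ := exists_eq_smul_unit (app (rightEv hq W') (tm x' φ'))
    obtain ⟨d, hd⟩ := exists_eq_smul_unit (app (rightEv hq W) (tm x φ))
    have hL : app (rightEv hq W) (tm x (app (λ_ W.dual.toMod).hom
        (tm (app (rightEv hq W') (tm x' φ')) φ))) = (c * d) • unit := by
      rw [hc, smul_tm, map_smul, app_leftUnitor_hom, tm_smul, map_smul, hd, smul_smul]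
    have hR : app (ev W') (tm φ' (app (λ_ W'.toMod).hom
        (tm (app (ev W) (tm φ (actK _ x))) (actK _ x')))) = (c * d) • unit := by
      rw [← h, hd, smul_tm, map_smul, app_leftUnitor_hom, tm_smul, map_smul, ← h', hc, smul_smul,
        mul_comm]
    refine Eq.trans hL (hR.symm.trans ?_)
    exact (congrArg (fun y => app (ev (.tensor W W')) (tm (M := W'.dual.toMod ⊗ W.dual.toMod)
      (N := W.toMod ⊗ W'.toMod) (tm φ' φ) y)) (actK_tm x x')).symm

theorem trace_hom {W : RepCat q} (f : W ⟶ W) : ((ribbonData hq).trace f).hom =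
    coev W ≫ f.hom ▷ (RepWord.dual W).toMod ≫ rightEv hq W := by
  have h : ((ribbonData hq).trace f).hom = coev W ≫ (f.hom ≫ twist hq W) ▷ (RepWord.dual W).toMod ≫
    braid hq W (RepWord.dual W) ≫ ev W := rfl
  rw [h, comp_whiskerRight, Category.assoc, rightEv]

/-- The quantum trace of `f` is the trace of `K f`. -/
theorem app_coev_comp_rightEv (W : RepWord q) (f : W.toMod ⟶ W.toMod) :
    app (coev W ≫ f ▷ W.dual.toMod ≫ rightEv hq W) unit = ktrace f • unit := by
  have h := contract_eq_trace (ev W) (actK _ ∘ₗ app f) (app (f ▷ W.dual.toMod ≫ rightEv hq W))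
    (fun x φ => app_rightEv hq W (app f x) φ) (app (coev W) unit)
  have z : coev W ▷ W.toMod ≫ (α_ W.toMod W.dual.toMod W.toMod).hom ≫ W.toMod ◁ ev W =
    (λ_ W.toMod).hom ≫ (ρ_ W.toMod).inv :=
    congrArg (fun f => f.hom) ((realization hq).coev_ev W)
  have z' : coev W ▷ W.toMod ≫ ((α_ W.toMod W.dual.toMod W.toMod).hom ≫ W.toMod ◁ ev W ≫
    (ρ_ W.toMod).hom) = (λ_ W.toMod).hom := by
    have := congrArg (· ≫ (ρ_ W.toMod).hom) z
    simpa only [Category.assoc, Iso.inv_hom_id, Category.comp_id] using this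
  have e : (app ((α_ W.toMod W.dual.toMod W.toMod).hom ≫ W.toMod ◁ ev W ≫ (ρ_ W.toMod).hom) ∘ₗ
      TensorProduct.mk ℂ (W.toMod ⊗ W.dual.toMod).V W.toMod.V (app (coev W) unit)) ∘ₗ
      (actK _ ∘ₗ app f) = actK _ ∘ₗ app f := by
    refine LinearMap.ext fun y => ?_
    exact (LinearMap.congr_fun (congrArg app z') (tm unit (actK _ (app f y)))).trans
      (app_leftUnitor_hom _)
  exact h.trans (congrArg (fun g => LinearMap.trace ℂ _ g • unit) e)

/-- The quantum trace can be taken in two steps. -/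
theorem ktrace_tensor (W V : RepWord q) (h : W.toMod ⊗ V.toMod ⟶ W.toMod ⊗ V.toMod) :
    ktrace h = ktrace (ptrace (coev V) (rightEv hq V) h) := by
  have e : coev (.tensor W V) ≫ h ▷ (V.dual.toMod ⊗ W.dual.toMod) ≫ rightEv hq (.tensor W V) =
      coev W ≫ ptrace (coev V) (rightEv hq V) h ▷ W.dual.toMod ≫ rightEv hq W := by
    rw [rightEv_tensor, coev, ptrace]
    monoidal
  have h₁ := app_coev_comp_rightEv hq (.tensor W V) h
  have h₂ := app_coev_comp_rightEv hq W (ptrace (coev V) (rightEv hq V) h)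
  have h₃ := (h₁.symm.trans (LinearMap.congr_fun (congrArg app e) unit)).trans h₂
  have h₄ : ktrace h * 1 = ktrace (ptrace (coev V) (rightEv hq V) h) * 1 := h₃
  rwa [mul_one, mul_one] at h₄

end RepCat

/-! ### The ideal generated by the critical idempotents -/

namespace UqMod

open SimpleModule TL TL.Arr

variable {q a : ℂˣ} {hq : q = a ^ 2} {M N P Q Z : UqMod q}

variable (hq) in
/-- The functor to modules on the morphisms between two objects. -/
def repMap {m n : ℕ} : ((⟨m⟩ : TL (a : ℂ)) ⟶ ⟨n⟩) →ₗ[ℂ] (T q m ⟶ T q n) :=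
  (rep hq).mapLinearMap ℂ

theorem repMap_comp {m n p : ℕ} (x : (⟨m⟩ : TL (a : ℂ)) ⟶ ⟨n⟩) (y : (⟨n⟩ : TL (a : ℂ)) ⟶ ⟨p⟩) :
    repMap hq (x ≫ y) = repMap hq x ≫ repMap hq y := (rep hq).map_comp x y

theorem repMap_id (n : ℕ) : repMap hq (𝟙 (⟨n⟩ : TL (a : ℂ))) = 𝟙 _ := (rep hq).map_id _

theorem repMap_addStrand {m n : ℕ} (f : (⟨m⟩ : TL (a : ℂ)) ⟶ ⟨n⟩) :
    repMap hq (addStrand f) = repMap hq f ▷ simple q 1 := rep_map_addStrand hq f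

theorem repMap_jw (hD : (q : ℂ) - (q : ℂ)⁻¹ ≠ 0) {n : ℕ} (hn : IsRegular q n) :
    repMap hq (jw q n) = πS hD n ≫ ιS hD n := (πS_ιS hD hq n hn).symm

variable (hq) in
/-- The span of the morphisms which factor through the image of a critical Jones-Wenzl idempotent,
possibly tensored with identities. -/
def critSpan (M N : UqMod q) : Submodule ℂ (M ⟶ N) :=
  Submodule.span ℂ {z | ∃ (n : ℕ) (e : (⟨n⟩ : TL (a : ℂ)) ⟶ ⟨n⟩) (x : M ⟶ T q n) (y : T q n ⟶ N),
    IsCrit q e ∧ z = x ≫ repMap hq e ≫ y}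

theorem map_mem_critSpan {n : ℕ} {e : (⟨n⟩ : TL (a : ℂ)) ⟶ ⟨n⟩} (he : IsCrit q e) (x : M ⟶ T q n)
    (y : T q n ⟶ N) : x ≫ repMap hq e ≫ y ∈ critSpan hq M N :=
  Submodule.subset_span ⟨n, e, x, y, he, rfl⟩

theorem comp_mem_critSpan (f : P ⟶ M) {g : M ⟶ N} (h : g ∈ critSpan hq M N) (k : N ⟶ Q) :
    f ≫ g ≫ k ∈ critSpan hq P Q := by
  induction h using Submodule.span_induction with
  | mem z hz =>
    obtain ⟨n, e, x, y, he, rfl⟩ := hz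
    have h := map_mem_critSpan (hq := hq) he (f ≫ x) (y ≫ k)
    simp only [Category.assoc] at h ⊢
    exact h
  | zero => rw [Limits.zero_comp, Limits.comp_zero]; exact zero_mem _
  | add g h _ _ hg hh => rw [Preadditive.add_comp, Preadditive.comp_add]; exact add_mem hg hh
  | smul c g _ hg => rw [Linear.smul_comp, Linear.comp_smul]; exact Submodule.smul_mem _ c hg

theorem whiskerRight_simple_mem_critSpan {f : M ⟶ N} (h : f ∈ critSpan hq M N) :
    f ▷ simple q 1 ∈ critSpan hq (M ⊗ simple q 1) (N ⊗ simple q 1) := by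
  induction h using Submodule.span_induction with
  | mem z hz =>
    obtain ⟨n, e, x, y, he, rfl⟩ := hz
    rw [comp_whiskerRight, comp_whiskerRight]
    rw [← repMap_addStrand]
    exact map_mem_critSpan he.add (x ▷ simple q 1) (y ▷ simple q 1)
  | zero => rw [MonoidalPreadditive.zero_whiskerRight]; exact zero_mem _
  | add g h _ _ hg hh => rw [MonoidalPreadditive.add_whiskerRight]; exact add_mem hg hh
  | smul c g _ hg => rw [MonoidalLinear.smul_whiskerRight]; exact Submodule.smul_mem _ c hg

theorem whiskerRight_pow_mem_critSpan {f : M ⟶ N} (h : f ∈ critSpan hq M N) (n : ℕ) :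
    f ▷ T q n ∈ critSpan hq (M ⊗ T q n) (N ⊗ T q n) := by
  induction n with
  | zero =>
    have e : f ▷ 𝟙_ (UqMod q) = (ρ_ M).hom ≫ f ≫ (ρ_ N).inv := whiskerRight_id f
    exact e ▸ comp_mem_critSpan (ρ_ M).hom h (ρ_ N).inv
  | succ n ih =>
    have e : f ▷ (T q n ⊗ simple q 1) =
      (α_ M (T q n) (simple q 1)).inv ≫ f ▷ T q n ▷ simple q 1 ≫ (α_ N (T q n) (simple q 1)).hom :=
      whiskerRight_tensor f _ _
    exact e ▸ comp_mem_critSpan _ (whiskerRight_simple_mem_critSpan ih) _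

theorem whiskerRight_mem_critSpan (s : Summand (rep hq) Z) {f : M ⟶ N} (h : f ∈ critSpan hq M N) :
    f ▷ Z ∈ critSpan hq (M ⊗ Z) (N ⊗ Z) := by
  have h := comp_mem_critSpan (M ◁ s.ι) (whiskerRight_pow_mem_critSpan h s.X.strands) (N ◁ s.π)
  have e : M ◁ s.ι ≫ f ▷ (rep hq).obj s.X ≫ N ◁ s.π = f ▷ Z := by
    rw [whisker_exchange_assoc, ← MonoidalCategory.whiskerLeft_comp, s.ι_π,
      MonoidalCategory.whiskerLeft_id, Category.comp_id]
  exact e ▸ h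

/-- The braiding of the Temperley-Lieb category moves the strands on the left to the right. -/
theorem whiskerLeft_eq (n : ℕ) {m : ℕ} (e : (⟨m⟩ : TL (a : ℂ)) ⟶ ⟨m⟩) :
    ∃ x y, (⟨n⟩ : TL (a : ℂ)) ◁ e = x ≫ (e ▷ (⟨n⟩ : TL (a : ℂ))) ≫ y := by
  have ha : (a : ℂ) ≠ 0 := a.ne_zero
  have h := mul_comp_braidA ha (idn (a : ℂ) n) (of e)
  obtain ⟨⟨s, t, y⟩, h₁, h₂, h₃, h₄⟩ := isInvertible_braidA ha n m
  obtain rfl : s = m + n := h₁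
  obtain rfl : t = n + m := h₂
  refine ⟨TL.braid (a : ℂ) n m, y, of_injective (m := ⟨n + m⟩) (n := ⟨n + m⟩) ?_⟩
  refine (of_whiskerLeft _ _).trans (Eq.trans ?_ (of_comp _ _).symm)
  refine Eq.trans ?_ (congrArg _ ((of_comp _ _).trans
    (congrArg (Arr.comp · (of y)) (of_whiskerRight _ _))).symm)
  change idn (a : ℂ) n * of e = (braidA (a : ℂ) n m).comp ((of e * idn (a : ℂ) n).comp (of y))
  have h' := congrArg (Arr.comp · (of y)) h
  simp only [comp_assoc] at h'
  refine Eq.trans ?_ h'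
  exact ((congrArg _ h₃).trans (comp_idn rfl)).symm

theorem whiskerLeft_mem_critSpan (s : Summand (rep hq) Z) {f : M ⟶ N} (h : f ∈ critSpan hq M N) :
    Z ◁ f ∈ critSpan hq (Z ⊗ M) (Z ⊗ N) := by
  induction h using Submodule.span_induction with
  | mem z hz =>
    obtain ⟨m, e, x, y, he, rfl⟩ := hz
    obtain ⟨b, b', hb⟩ := whiskerLeft_eq s.X.strands e
    have h₁ := whiskerRight_pow_mem_critSpan (hq := hq) (map_mem_critSpan he (𝟙 _) (𝟙 _)) s.X.strands
    rw [Category.id_comp, Category.comp_id] at h₁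
    have h₂ : (rep hq).obj s.X ◁ repMap hq e ∈
        critSpan hq ((rep hq).obj s.X ⊗ T q m) ((rep hq).obj s.X ⊗ T q m) := by
      have h₃ := comp_mem_critSpan (Functor.LaxMonoidal.μ (rep hq) s.X ⟨m⟩ ≫ (rep hq).map b ≫
        Functor.OplaxMonoidal.δ (rep hq) ⟨m⟩ s.X) h₁ (Functor.LaxMonoidal.μ (rep hq) ⟨m⟩ s.X ≫
        (rep hq).map b' ≫ Functor.OplaxMonoidal.δ (rep hq) s.X ⟨m⟩)
      have e₁ : (rep hq).obj s.X ◁ repMap hq e = Functor.LaxMonoidal.μ (rep hq) s.X ⟨m⟩ ≫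
          (rep hq).map (s.X ◁ e) ≫ Functor.OplaxMonoidal.δ (rep hq) s.X ⟨m⟩ := by
        rw [← Functor.LaxMonoidal.μ_natural_right_assoc, Functor.Monoidal.μ_δ, Category.comp_id]
        rfl
      have e₂ : (rep hq).map (s.X ◁ e) = (rep hq).map b ≫ (Functor.OplaxMonoidal.δ (rep hq) ⟨m⟩ s.X ≫
          (rep hq).map e ▷ (rep hq).obj s.X ≫ Functor.LaxMonoidal.μ (rep hq) ⟨m⟩ s.X) ≫
            (rep hq).map b' := by
        rw [Functor.LaxMonoidal.μ_natural_left, Functor.Monoidal.δ_μ_assoc]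
        refine (congrArg _ hb).trans ?_
        rw [Functor.map_comp, Functor.map_comp]
      rw [e₁, e₂]
      simp only [Category.assoc] at h₃ ⊢
      exact h₃
    have h₄ := comp_mem_critSpan (s.ι ▷ M ≫ (rep hq).obj s.X ◁ x) h₂ ((rep hq).obj s.X ◁ y ≫ s.π ▷ N)
    have e₄ : (s.ι ▷ M ≫ (rep hq).obj s.X ◁ x) ≫ ((rep hq).obj s.X ◁ repMap hq e) ≫
        (rep hq).obj s.X ◁ y ≫ s.π ▷ N = Z ◁ (x ≫ repMap hq e ≫ y) := by
      rw [Category.assoc, ← MonoidalCategory.whiskerLeft_comp_assoc,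
        ← MonoidalCategory.whiskerLeft_comp_assoc, whisker_exchange, ← comp_whiskerRight_assoc,
        s.ι_π, id_whiskerRight, Category.id_comp, Category.assoc]
    exact e₄ ▸ h₄
  | zero => rw [MonoidalPreadditive.whiskerLeft_zero]; exact zero_mem _
  | add g h _ _ hg hh => rw [MonoidalPreadditive.whiskerLeft_add]; exact add_mem hg hh
  | smul c g _ hg => rw [MonoidalLinear.whiskerLeft_smul]; exact Submodule.smul_mem _ c hg

theorem critSpan_eq_bot (h : ∀ c, ¬ IsCritical q c) : critSpan hq M N = ⊥ := by
  refine Submodule.span_eq_bot.2 ?_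
  rintro z ⟨n, e, x, y, he, -⟩
  exfalso
  clear x y
  induction he with
  | base hc => exact h _ hc
  | add _ ih => exact ih

/-! ### Traces of critical morphisms -/

theorem exists_toMod_eq (h1 : 1 ∈ SimpleIndex q) (n : ℕ) : ∃ W : RepWord q, W.toMod = T q n := by
  induction n with
  | zero => exact ⟨.unit, rfl⟩
  | succ n ih =>
    obtain ⟨W, h⟩ := ih
    exact ⟨.tensor W (.simple ⟨1, h1⟩), congrArg (· ⊗ simple q 1) h⟩

theorem ktrace_smul (c : ℂ) (f : M ⟶ M) : ktrace (c • f) = c * ktrace f := by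
  rw [ktrace, app_smul, LinearMap.comp_smul, map_smul, smul_eq_mul]; rfl

theorem ktrace_add (f g : M ⟶ M) : ktrace (f + g) = ktrace f + ktrace g := by
  rw [ktrace, app_add, LinearMap.comp_add, map_add]; rfl

theorem exists_ktrace_whiskerRight (hq : q = a ^ 2) (h1 : 1 ∈ SimpleIndex q)
    (hM : ∃ W : RepWord q, W.toMod = M) (e : M ⟶ M) (G : M ⊗ simple q 1 ⟶ M ⊗ simple q 1) :
    ∃ G' : M ⟶ M, ktrace (e ▷ simple q 1 ≫ G) = ktrace (e ≫ G') := by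
  obtain ⟨W, rfl⟩ := hM
  refine ⟨_, (RepCat.ktrace_tensor hq W (.simple ⟨1, h1⟩) _).trans
    (congrArg _ (ptrace_whiskerRight_comp _ _ e G))⟩

/-- The critical idempotent has quantum dimension zero, and the added strands can be removed by partial
traces. -/
theorem ktrace_isCrit (h1 : 1 ∈ SimpleIndex q) {n : ℕ} {e : (⟨n⟩ : TL (a : ℂ)) ⟶ ⟨n⟩}
    (he : IsCrit q e) (G : T q n ⟶ T q n) : ktrace (repMap hq e ≫ G) = 0 := by
  induction he with
  | @base c hc =>
    have hD := sub_ne_zero_of_mem h1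
    have hr : IsRegular q c := fun j hj hj' => hc.qint_ne_zero hj hj'
    obtain ⟨W, hW⟩ := exists_toMod_eq h1 c
    have : Module.Finite ℂ (T q c).V := hW ▸ RepCat.finite_toMod W
    have : Module.Finite ℂ (simple q c).V := inferInstanceAs (Module.Finite ℂ (Fin (c + 1) → ℂ))
    -- The trace is a multiple of the quantum dimension `[c + 1] = 0` of the simple module `V_c`.
    obtain ⟨t, ht⟩ := simple_end hr ((ιS hD c ≫ G) ≫ πS hD c)
    rw [repMap_jw hD hr, Category.assoc, ktrace_comm, ht, ktrace_smul, ktrace_id_simple hD,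
      hc.qint_eq_zero, mul_zero]
  | @add n f hf ih =>
    obtain ⟨G', h⟩ := exists_ktrace_whiskerRight hq h1 (exists_toMod_eq h1 n) (repMap hq f) G
    rw [repMap_addStrand]
    exact h.trans (ih G')

theorem ktrace_eq_zero (h1 : 1 ∈ SimpleIndex q) [Module.Finite ℂ M.V] {f : M ⟶ M}
    (hf : f ∈ critSpan hq M M) : ktrace f = 0 := by
  induction hf using Submodule.span_induction with
  | mem z hz =>
    obtain ⟨n, e, x, y, he, rfl⟩ := hz
    obtain ⟨W, hW⟩ := exists_toMod_eq h1 n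
    have : Module.Finite ℂ (T q n).V := hW ▸ RepCat.finite_toMod W
    rw [ktrace_comm, Category.assoc]
    exact ktrace_isCrit h1 he (y ≫ x)
  | zero => rw [ktrace, app_zero, LinearMap.comp_zero, map_zero]
  | add g h _ _ hg hh => rw [ktrace_add, hg, hh, add_zero]
  | smul c g _ hg => rw [ktrace_smul, hg, mul_zero]

/-! ### Fullness and faithfulness -/

/-- Schur's lemma for the simple modules and the decomposition of the identities show that the morphisms
between tensor powers of `V_1` come from the Temperley-Lieb category, modulo critical ones. -/
theorem mem_range_sup_critSpan (h1 : 1 ∈ SimpleIndex q) {m n : ℕ} (G : T q m ⟶ T q n) :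
    G ∈ LinearMap.range (repMap hq (m := m) (n := n)) ⊔ critSpan hq (T q m) (T q n) := by
  have hqa : (q : ℂ) = (a : ℂ) ^ 2 := by rw [hq]; simp
  have hD := sub_ne_zero_of_mem h1
  have key : ∀ {z z'}, z ∈ jwSpan (a := (a : ℂ)) q m m → z' ∈ jwSpan (a := (a : ℂ)) q n n →
      repMap hq z ≫ G ≫ repMap hq z' ∈
        LinearMap.range (repMap hq (m := m) (n := n)) ⊔
          critSpan hq (T q m) (T q n) := by
    intro z z' hz hz'
    induction hz using Submodule.span_induction with
    | mem z hz =>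
      obtain ⟨i, hi, x, y, rfl⟩ | ⟨i, e, x, y, he, rfl⟩ := hz
      · induction hz' using Submodule.span_induction with
        | mem z' hz' =>
          obtain ⟨j, hj, x', y', rfl⟩ | ⟨j, e, x', y', he, rfl⟩ := hz'
          · obtain ⟨k, hk⟩ : ∃ k, k = ιS hD i ≫ repMap hq y ≫ G ≫ repMap hq x' ≫ πS hD j := ⟨_, rfl⟩
            have e : repMap hq (x ≫ jw q i ≫ y) ≫ G ≫ repMap hq (x' ≫ jw q j ≫ y') =
                repMap hq x ≫ πS hD i ≫ k ≫ ιS hD j ≫ repMap hq y' := by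
              rw [hk]
              simp only [repMap_comp, repMap_jw hD (isRegular_of_mem hi),
                repMap_jw hD (isRegular_of_mem hj), Category.assoc]
            rw [e]
            -- Schur's lemma for the component between `V_i` and `V_j`.
            by_cases hij : i = j
            · subst hij
              obtain ⟨c, rfl⟩ := simple_end (isRegular_of_mem hi) k
              refine Submodule.mem_sup_left ⟨c • (x ≫ jw q i ≫ y'), ?_⟩
              rw [Linear.smul_comp, Category.id_comp, Linear.comp_smul, Linear.comp_smul, map_smul]
              simp only [repMap_comp, repMap_jw hD (isRegular_of_mem hi), Category.assoc]
            · rw [simple_hom_eq_zero hi hj hij k, Limits.zero_comp, Limits.comp_zero,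
                Limits.comp_zero]
              exact zero_mem _
          · refine Submodule.mem_sup_right ?_
            have h := map_mem_critSpan (hq := hq) he (repMap hq (x ≫ jw q i ≫ y) ≫ G ≫ repMap hq x')
              (repMap hq y')
            rw [repMap_comp x', repMap_comp e]
            simp only [Category.assoc] at h
            exact h
        | zero => rw [map_zero, Limits.comp_zero, Limits.comp_zero]; exact zero_mem _
        | add g h _ _ hg hh =>
          rw [map_add, Preadditive.comp_add, Preadditive.comp_add]; exact add_mem hg hh
        | smul c g _ hg =>
          rw [map_smul, Linear.comp_smul, Linear.comp_smul]; exact Submodule.smul_mem _ c hg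
      · refine Submodule.mem_sup_right ?_
        have h := map_mem_critSpan (hq := hq) he (repMap hq x) (repMap hq y ≫ G ≫ repMap hq z')
        rw [repMap_comp x, repMap_comp e, Category.assoc, Category.assoc]
        exact h
    | zero => rw [map_zero, Limits.zero_comp]; exact zero_mem _
    | add g h _ _ hg hh => rw [map_add, Preadditive.add_comp]; exact add_mem hg hh
    | smul c g _ hg => rw [map_smul, Linear.smul_comp]; exact Submodule.smul_mem _ c hg
  have h := key (id_mem_jwSpan hqa h1 m) (id_mem_jwSpan hqa h1 n)
  rwa [repMap_id, repMap_id, Category.id_comp, Category.comp_id] at h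

/-- If there is no critical index, then the functor to modules is faithful. -/
theorem eq_zero_of_rep_map_eq_zero (h1 : 1 ∈ SimpleIndex q) (hc : ∀ c, ¬ IsCritical q c) {m n : ℕ}
    {w : (⟨m⟩ : TL (a : ℂ)) ⟶ ⟨n⟩} (hw : repMap hq w = 0) : w = 0 := by
  have hqa : (q : ℂ) = (a : ℂ) ^ 2 := by rw [hq]; simp
  have hD := sub_ne_zero_of_mem h1
  have hcrit : ∀ {n : ℕ} {e : (⟨n⟩ : TL (a : ℂ)) ⟶ ⟨n⟩}, ¬ IsCrit q e := by
    intro n e he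
    induction he with
    | base h => exact hc _ h
    | add _ ih => exact ih
  have key : ∀ {z z'}, z ∈ jwSpan (a := (a : ℂ)) q m m → z' ∈ jwSpan (a := (a : ℂ)) q n n →
      z ≫ w ≫ z' = 0 := by
    intro z z' hz hz'
    induction hz using Submodule.span_induction with
    | mem z hz =>
      obtain ⟨i, hi, x, y, rfl⟩ | ⟨i, e, x, y, he, rfl⟩ := hz
      · induction hz' using Submodule.span_induction with
        | mem z' hz' =>
          obtain ⟨j, hj, x', y', rfl⟩ | ⟨j, e, x', y', he, rfl⟩ := hz'
          · have hfi := jw_spec_of_mem (a := (a : ℂ)) hqa hi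
            have hfj := jw_spec_of_mem (a := (a : ℂ)) hqa hj
            suffices h : jw q i ≫ (y ≫ w ≫ x') ≫ jw q j = 0 by
              have h' : (x ≫ jw q i ≫ y) ≫ w ≫ x' ≫ jw q j ≫ y' =
                x ≫ (jw q i ≫ (y ≫ w ≫ x') ≫ jw q j) ≫ y' := by simp only [Category.assoc]
              rw [h', h, Limits.zero_comp, Limits.comp_zero]
            -- The component is a multiple of the idempotent `f_i`, whose image `V_i` is nonzero, or
            -- vanishes already in the Temperley-Lieb category.
            by_cases hij : i = j
            · subst hij
              obtain ⟨t, ht⟩ := sandwich_eq_smul (fun hc => hfi.comp_cap hc)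
                (fun hu => hfi.cup_comp hu) hfi.idem (y ≫ w ≫ x')
              have h := congrArg (repMap hq) ht
              rw [repMap_comp, repMap_comp, repMap_comp, repMap_comp, hw,
                Limits.zero_comp, Limits.comp_zero, Limits.zero_comp, Limits.comp_zero,
                map_smul] at h
              obtain rfl | h₀ := smul_eq_zero.1 h.symm
              · rw [ht, zero_smul]
              · exfalso
                have h₂ : 𝟙 (simple q i) = 0 := by
                  have h₃ : ιS hD i ≫ (πS hD i ≫ ιS hD i) ≫ πS hD i = 𝟙 _ := by
                    rw [Category.assoc, ιS_πS hD (isRegular_of_mem hi), Category.comp_id,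
                      ιS_πS hD (isRegular_of_mem hi)]
                  rw [← h₃, ← repMap_jw (hq := hq) hD (isRegular_of_mem hi), h₀, Limits.zero_comp,
                    Limits.comp_zero]
                have h₃ : wt q i 0 = 0 := LinearMap.congr_fun (congrArg app h₂) (wt q i 0)
                have h₄ := congrFun (show vec i 0 = 0 from h₃) 0
                simp [vec] at h₄
            · exact sandwich_eq_zero hij (fun hc => hfi.comp_cap hc) (fun hu => hfj.cup_comp hu) _
          · exact (hcrit he).elim
        | zero => rw [Limits.comp_zero, Limits.comp_zero]
        | add g h _ _ hg hh => rw [Preadditive.comp_add, Preadditive.comp_add, hg, hh, add_zero]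
        | smul c g _ hg => rw [Linear.comp_smul, Linear.comp_smul, hg, smul_zero]
      · exact (hcrit he).elim
    | zero => rw [Limits.zero_comp]
    | add g h _ _ hg hh => rw [Preadditive.add_comp, hg, hh, add_zero]
    | smul c g _ hg => rw [Linear.smul_comp, hg, smul_zero]
  have h := key (id_mem_jwSpan hqa h1 m) (id_mem_jwSpan hqa h1 n)
  rwa [Category.id_comp, Category.comp_id] at h

end UqMod

namespace RepCat

open TL TL.Arr UqMod SimpleModule

variable {q a : ℂˣ} (hq : q = a ^ 2)

/-- The tensor products of simple modules are realized up to the morphisms which factor through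
critical idempotents. -/
theorem isFullModulo (h1 : 1 ∈ SimpleIndex q) : (realization hq).IsFullModulo
    (fun {X Y} f => f.hom ∈ critSpan hq (RepWord.toMod X) (RepWord.toMod Y)) where
  full {X Y} f := by
    let s := word hq X
    let t := word hq Y
    obtain ⟨_, ⟨x, rfl⟩, y, hy, h⟩ := Submodule.mem_sup.1 (mem_range_sup_critSpan (hq := hq) h1
      (m := s.X.strands) (n := t.X.strands) (s.π ≫ f.hom ≫ t.ι))
    refine ⟨InducedCategory.homMk (s.ι ≫ repMap hq x ≫ t.π), _, Summand.rep_hat s t x rfl, ?_⟩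
    have e : s.ι ≫ y ≫ t.π = f.hom - s.ι ≫ repMap hq x ≫ t.π := by
      have h : (y : (rep hq).obj s.X ⟶ (rep hq).obj t.X) =
        s.π ≫ f.hom ≫ t.ι - (rep hq).map x := eq_sub_of_add_eq' h
      refine (congrArg (fun z => s.ι ≫ z ≫ t.π) h).trans ?_
      change s.ι ≫ (s.π ≫ f.hom ≫ t.ι - (rep hq).map x) ≫ t.π = f.hom - s.ι ≫ (rep hq).map x ≫ t.π
      rw [Preadditive.sub_comp, Preadditive.comp_sub, Category.assoc, Category.assoc, t.ι_π,
        reassoc_of% s.ι_π, Category.comp_id]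
    have h := comp_mem_critSpan s.ι hy t.π
    rw [e] at h
    exact h
  comp_left f g h := by
    have := comp_mem_critSpan f.hom h (𝟙 _)
    rwa [Category.comp_id] at this
  comp_right {X Y Z f} g h := by
    have := comp_mem_critSpan (𝟙 _) h g.hom
    rwa [Category.id_comp] at this
  whiskerLeft Z _ _ _ h := whiskerLeft_mem_critSpan (word hq Z) h
  whiskerRight Z h := whiskerRight_mem_critSpan (word hq Z) h
  trace {X f} h := by
    refine InducedCategory.hom_ext (app_injective (unit_ext ?_))
    rw [trace_hom]
    refine (app_coev_comp_rightEv hq X f.hom).trans ?_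
    rw [ktrace_eq_zero h1 h, zero_smul]
    rfl

/-- In the generic case, the zero morphism is represented by zero only. -/
theorem rep_zero_iff (h1 : 1 ∈ SimpleIndex q) (hc : ∀ c, ¬ IsCritical q c) (X Y : RepCat q)
    {x : Arr (a : ℂ)} (h : (realization hq).Rep (0 : X ⟶ Y) x) :
    ∃ m n, x = of (0 : (⟨m⟩ : TL (a : ℂ)) ⟶ ⟨n⟩) := by
  obtain ⟨g, rfl, h₁, h₂, h₃⟩ := h
  refine ⟨_, _, congrArg of (eq_zero_of_rep_map_eq_zero (hq := hq) h1 hc ?_)⟩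
  change (rep hq).map g = 0
  rw [← h₁, ← h₂, Functor.map_comp, Functor.map_comp, ← (word hq X).π_ι, ← (word hq Y).π_ι]
  have h₃ : (word hq X).ι ≫ (rep hq).map g ≫ (word hq Y).π = 0 := h₃.symm
  have h₄ := congrArg (fun f => (word hq X).π ≫ f ≫ (word hq Y).ι) h₃
  simpa only [Category.assoc, Limits.zero_comp, Limits.comp_zero] using h₄

end RepCat

/-! ### The comparison of the two categories -/

namespace TL.Realization

open TL.Arr

universe v w

variable {a : ℂ} {C : Type w} [Category.{v} C] [MonoidalCategory C] [Preadditive C] [Linear ℂ C]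
  {D : RibbonData C} (R : Realization a D)

theorem trace_id_unit (R : Realization a D) (ha : a ≠ 0) : D.trace (𝟙 (𝟙_ C)) = 𝟙 (𝟙_ C) := by
  have h := R.trace ha (R.id (𝟙_ C))
  have h₁ := R.id (𝟙_ C)
  rw [R.E_unit] at h h₁
  refine R.unique' h h₁ ?_
  have e : (1 : Arr a).src = 0 := rfl
  rw [e, pow_zero, one_smul', coevA_zero, evA_zero, idn_zero, mul_one]
  exact (idn_comp (n := 0) rfl).trans (idn_comp (n := 0) rfl)

theorem finrank_end_unit (full : ∀ f : 𝟙_ C ⟶ 𝟙_ C, ∃ x, R.Rep f x) (h₀ : 𝟙 (𝟙_ C) ≠ 0) :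
    Module.finrank ℂ (𝟙_ C ⟶ 𝟙_ C) = 1 := by
  refine finrank_eq_one (𝟙 _) h₀ fun f => ?_
  obtain ⟨⟨m, n, x⟩, hx⟩ := full f
  have hm := R.src hx
  have hn := R.tgt hx
  have h₁ := R.id (𝟙_ C)
  rw [R.E_unit] at hm hn h₁
  obtain rfl : m = 0 := hm
  obtain rfl : n = 0 := hn
  obtain ⟨t, rfl⟩ := end_unit_eq_smul x
  exact ⟨t, R.unique (R.smul t h₁) hx⟩

theorem purified_id_unit_ne_zero [MonoidalPreadditive C] [MonoidalLinear ℂ C] (R : Realization a D)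
    (ha : a ≠ 0) (h₀ : 𝟙 (𝟙_ C) ≠ 0) (N : NegligibleIdeal D) : 𝟙 (𝟙_ (Purified N)) ≠ 0 := by
  intro h
  have h : D.trace (𝟙 (𝟙_ C) ≫ 𝟙 (𝟙_ C)) = 0 :=
    (N.mem_iff _).1 ((Submodule.Quotient.mk_eq_zero _).1 h) (𝟙 (𝟙_ C))
  rw [Category.id_comp, R.trace_id_unit ha] at h
  exact h₀ h

end TL.Realization

namespace Turaev

open TL TL.Arr

/-- Turaev's category is realized without morphisms being neglected. -/
theorem isFullModulo {a : ℂ} (ha : a ≠ 0) (h : ∀ n ∈ J a, JWSpec (jonesWenzl a n)) :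
    (realization ha h).IsFullModulo (fun f => f = 0) where
  full f := ⟨f, ofHom f, rfl, sub_self f⟩
  comp_left f g hg := by rw [hg, Limits.comp_zero]
  comp_right g hf := by rw [hf, Limits.zero_comp]
  whiskerLeft Z _ _ _ hf := by rw [hf, MonoidalPreadditive.whiskerLeft_zero]
  whiskerRight Z hf := by rw [hf, MonoidalPreadditive.zero_whiskerRight]
  trace hf := by rw [hf, RibbonData.trace_zero]

end Turaev

namespace RepCat

open TL TL.Arr UqMod

variable {q a : ℂˣ} (hq : q = a ^ 2)

theorem mem_J_iff (hq : q = a ^ 2) (n : ℕ) : n ∈ Turaev.J (a : ℂ) ↔ 1 ≤ n ∧ n ∈ SimpleIndex q := by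
  have h : ∀ r : ℕ, (a : ℂ) ^ (4 * r) = (q : ℂ) ^ (2 * r) := fun r => by
    rw [hq, Units.val_pow_eq_pow_val, ← pow_mul]; ring_nf
  simp only [Turaev.J, SimpleIndex, Set.mem_ofPred_eq, h]

theorem jwSpec_of_mem (hq : q = a ^ 2) {n : ℕ} (hn : n ∈ SimpleIndex q) : JWSpec (a := (a : ℂ)) (jw q n) :=
  jw_spec_of_mem (by rw [hq]; simp) hn

theorem jwSpec_jonesWenzl (hq : q = a ^ 2) (n : ℕ) (hn : n ∈ Turaev.J (a : ℂ)) :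
    JWSpec (jonesWenzl (a : ℂ) n) := by
  have h := jwSpec_of_mem hq ((mem_J_iff hq n).1 hn).2
  rwa [h.jonesWenzl_eq]

/-- The tensor product of simple modules given by a finite sequence. -/
def ofSeq : List (Turaev.J (a : ℂ)) → RepWord q
  | [] => .unit
  | n :: s => .tensor (.simple ⟨n, ((mem_J_iff hq n).1 n.2).2⟩) (ofSeq s)

theorem seqA_singleton (n : Turaev.J (a : ℂ)) :
    Turaev.seqA [n] = wordE hq (.simple ⟨n, ((mem_J_iff hq n).1 n.2).2⟩) := by
  rw [Turaev.seqA, List.map_singleton, List.prod_singleton]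
  exact congrArg of (jwSpec_of_mem hq ((mem_J_iff hq n).1 n.2).2).jonesWenzl_eq

theorem wordE_ofSeq (s : List (Turaev.J (a : ℂ))) : wordE hq (ofSeq hq s) = Turaev.seqA s := by
  induction s with
  | nil => rfl
  | cons n s ih =>
    rw [ofSeq, wordE_tensor, ih, ← List.singleton_append, Turaev.seqA_append, seqA_singleton hq]

/-- Every tensor product of simple modules has the idempotent of a sequence; the factors `V_0` are
dropped. -/
theorem exists_seqA_eq (W : RepWord q) : ∃ s : List (Turaev.J (a : ℂ)), Turaev.seqA s = wordE hq W := by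
  induction W with
  | unit => exact ⟨[], rfl⟩
  | simple n =>
    obtain ⟨_ | n, hn⟩ := n
    · exact ⟨[], (congrArg of (jw_zero (a := (a : ℂ)) (q := q))).symm⟩
    · exact ⟨[⟨n + 1, (mem_J_iff hq _).2 ⟨by omega, hn⟩⟩], seqA_singleton hq _⟩
  | tensor W W' h h' =>
    obtain ⟨s, hs⟩ := h
    obtain ⟨s', hs'⟩ := h'
    exact ⟨s ++ s', by rw [Turaev.seqA_append, wordE_tensor, hs, hs']⟩

theorem id_unit_ne_zero : 𝟙 (𝟙_ (RepCat q)) ≠ 0 := fun h =>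
  one_ne_zero (α := ℂ) (LinearMap.congr_fun (congrArg (fun f => app f.hom) h) unit)

/-- The empty diagram is nonzero, since it acts on the trivial module as the identity. -/
theorem turaev_id_unit_ne_zero (hq : q = a ^ 2) : 𝟙 (𝟙_ (TuraevCat (a : ℂ))) ≠ 0 := by
  intro h
  have h₁ : of (𝟙 (⟨0⟩ : TL (a : ℂ))) = of (0 : (⟨0⟩ : TL (a : ℂ)) ⟶ ⟨0⟩) :=
    (Turaev.ofHom_id _).symm.trans (congrArg Turaev.ofHom h)
  have h₂ := congrArg (repMap hq) (of_injective h₁)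
  rw [repMap_id, map_zero] at h₂
  exact one_ne_zero (α := ℂ) (LinearMap.congr_fun (congrArg app h₂) unit)

/-- If `q` is generic, then all indices belong to simple modules. -/
theorem not_isCritical (hg : IsGeneric q) (c : ℕ) : ¬ IsCritical q c := by
  rintro ⟨k, -, -, hc⟩
  exact hc fun r hr h => absurd (Units.ext h) (hg (2 * r) (by omega))

theorem isFullModulo_generic (h1 : 1 ∈ SimpleIndex q) (hc : ∀ c, ¬ IsCritical q c) {X Y : RepCat q}
    (f : X ⟶ Y) : ∃ x, (realization hq).Rep f x := by
  obtain ⟨g, x, hx, h⟩ := (isFullModulo hq h1).full f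
  rw [critSpan_eq_bot hc, Submodule.mem_bot] at h
  have h : f = g := sub_eq_zero.1 (InducedCategory.hom_ext h)
  exact ⟨x, h ▸ hx⟩

/-- In the generic case, the sequences correspond to the tensor products of simple modules. -/
def comparison (h1 : 1 ∈ SimpleIndex q) (hc : ∀ c, ¬ IsCritical q c) :
    Realization.Comparison (Turaev.realization a.ne_zero (jwSpec_jonesWenzl hq))
      (realization hq) where
  obj := ofSeq hq
  E_obj := wordE_ofSeq hq
  exists_E_eq := exists_seqA_eq hq
  full f := ⟨Turaev.ofHom f, rfl⟩
  full' := isFullModulo_generic hq h1 hc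
  rep_zero_iff X Y x := by
    have hz := (Turaev.realization a.ne_zero (jwSpec_jonesWenzl hq)).zero X Y
    have hz' := (realization hq).zero (ofSeq hq X) (ofSeq hq Y)
    have eX : (realization hq).E (ofSeq hq X) = Turaev.seqA X := wordE_ofSeq hq X
    have eY : (realization hq).E (ofSeq hq Y) = Turaev.seqA Y := wordE_ofSeq hq Y
    constructor
    · intro h
      rw [eX, eY] at hz'
      exact hz.symm.trans h ▸ hz'
    · intro h
      have hs := (realization hq).src h
      have ht := (realization hq).tgt h
      obtain ⟨m, n, rfl⟩ := rep_zero_iff hq h1 hc _ _ h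
      rw [eX] at hs
      rw [eY] at ht
      obtain rfl : m = (Turaev.seqA X).src := hs
      obtain rfl : n = (Turaev.seqA Y).src := ht
      exact hz

/-- After purification, the zero morphisms on both sides are represented by the elements which are null for
the trace form of the Temperley-Lieb category. -/
def purifiedComparison (h1 : 1 ∈ SimpleIndex q)
    (N : NegligibleIdeal (Turaev.ribbonData (a : ℂ))) (N' : NegligibleIdeal (ribbonData hq)) :
    Realization.Comparison ((Turaev.realization a.ne_zero (jwSpec_jonesWenzl hq)).purified N)
      ((realization hq).purified N') where
  obj X := ⟨ofSeq hq X.of⟩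
  E_obj X := wordE_ofSeq hq X.of
  exists_E_eq Y := by
    obtain ⟨s, hs⟩ := exists_seqA_eq hq Y.of
    exact ⟨⟨s⟩, hs⟩
  full := (Turaev.isFullModulo a.ne_zero (jwSpec_jonesWenzl hq)).purified_full N
  full' := (isFullModulo hq h1).purified_full N'
  rep_zero_iff X Y x := by
    have eX : (realization hq).E (ofSeq hq X.of) = Turaev.seqA X.of := wordE_ofSeq hq X.of
    have eY : (realization hq).E (ofSeq hq Y.of) = Turaev.seqA Y.of := wordE_ofSeq hq Y.of
    have h := (Turaev.isFullModulo a.ne_zero (jwSpec_jonesWenzl hq)).purified_rep_zero a.ne_zero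
      (turaev_id_unit_ne_zero hq) N (X := X) (Y := Y) x
    have h' := (isFullModulo hq h1).purified_rep_zero a.ne_zero id_unit_ne_zero N'
      (X := ⟨ofSeq hq X.of⟩) (Y := ⟨ofSeq hq Y.of⟩) x
    rw [eX, eY] at h'
    exact h.trans h'.symm

end RepCat

end

theorem mainTheorem1 (a q : ℂˣ) (hq : q = a ^ 2) :
    (IsGeneric a → IsGeneric q →
      (Turaev.ribbonData (a : ℂ)).IsRibbon ∧ (RepCat.ribbonData hq).IsRibbon ∧
      ∃ (F : TuraevCat (a : ℂ) ⥤ RepCat q) (_ : F.Monoidal) (_ : F.Additive),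
        F.Linear ℂ ∧ F.IsEquivalence ∧
        (Turaev.ribbonData (a : ℂ)).IsPreservedBy (RepCat.ribbonData hq) F) ∧
    (∀ r : ℕ, 3 ≤ r → IsPrimitiveRoot a (4 * r) → IsPrimitiveRoot q (2 * r) →
      ∃ (NV : NegligibleIdeal (Turaev.ribbonData (a : ℂ)))
        (NR : NegligibleIdeal (RepCat.ribbonData hq)),
        (Purified.ribbonData NV).IsRibbon ∧ (Purified.ribbonData NR).IsRibbon ∧
        ∃ (F : Purified NV ⥤ Purified NR) (_ : F.Monoidal) (_ : F.Additive),
          F.Linear ℂ ∧ F.IsEquivalence ∧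
          (Purified.ribbonData NV).IsPreservedBy (Purified.ribbonData NR) F) := by
  have ha : (a : ℂ) ≠ 0 := a.ne_zero
  let R := Turaev.realization ha (RepCat.jwSpec_jonesWenzl hq)
  let R' := RepCat.realization hq
  have hR := Turaev.isFullModulo ha (RepCat.jwSpec_jonesWenzl hq)
  have h₀ := RepCat.turaev_id_unit_ne_zero hq
  have h₀' := RepCat.id_unit_ne_zero (q := q)
  refine ⟨fun _ hg => ?_, fun r hr _ hqr => ?_⟩
  · have h1 : 1 ∈ SimpleIndex q := fun r hr h => absurd (Units.ext h) (hg (2 * r) (by omega))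
    let F := RepCat.comparison hq h1 (RepCat.not_isCritical hg)
    exact ⟨R.isRibbon ha F.full (R.finrank_end_unit F.full h₀),
      R'.isRibbon ha F.full' (R'.finrank_end_unit F.full' h₀'),
      F.functor, inferInstance, inferInstance, inferInstance, inferInstance, F.isPreservedBy⟩
  · have h1 : 1 ∈ SimpleIndex q := fun s hs h => by
      have h₁ : q ^ (2 * s) = 1 := Units.ext h
      have h₂ := Nat.le_of_dvd (by omega) (hqr.dvd_of_pow_eq_one _ h₁)
      omega
    have hR' := RepCat.isFullModulo hq h1
    let N := hR.negligibleIdeal ha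
    let N' := hR'.negligibleIdeal ha
    let F := RepCat.purifiedComparison hq h1 N N'
    exact ⟨N, N',
      (R.purified N).isRibbon ha F.full
        ((R.purified N).finrank_end_unit F.full (R.purified_id_unit_ne_zero ha h₀ N)),
      (R'.purified N').isRibbon ha F.full'
        ((R'.purified N').finrank_end_unit F.full' (R'.purified_id_unit_ne_zero ha h₀' N')),
      F.functor, inferInstance, inferInstance, inferInstance, inferInstance, F.isPreservedBy⟩
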